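/- **Setting.** Let $d\ge 1$, $T>0$, let $\Omega\subset\mathbb R^d$ be a bounded (polyhedral) Lipschitz domain and $Q=(0,T)\times\Omega$. Let $\mathcal T$ be a finite partition of $\overline Q$ into non-overlapping prisms $K=K_t\times K_x$ with a compact time interval $K_t$ of length $h_t(K)>0$ and a $d$-simplex $K_x$ of diameter $h_x(K)$; hanging nodes are allowed, but of two overlapping facets one contains the other. The mesh is shape regular in space with constant $\gamma$: each $K_x$ contains a ball of radius $r>0$ with $h_x(K)\le\gamma r$. $\mathcal F_c^x$ is the set of facets parallel to the time axis that are not properly contained in another facet, and $\mathcal T_0$ is the set of the $K_x$ with $K\in\mathcal T$, $\min K_t=0$. For $\mathbf v=(v,\tau)$ with values in $\mathbb R\times\mathbb R^d$ put $\operatorname{div}\mathbf v=\partial_t v+\operatorname{div}_x\tau$, $A\mathbf v=(\operatorname{div}\mathbf v,\nabla_xv+\tau)$, $A^*\mathbf v=(-\operatorname{div}\mathbf v,-\nabla_xv+\tau)$ (weak derivatives). Let $H(A^*,\mathcal T)$ be the space of $\mathbf w\in L^2(Q)\times L^2(Q;\mathbb R^d)$ whose restriction to each $K$ has $A^*\mathbf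 w\in L^2(K)$, let $A_h^*$ be $A^*$ applied cell by cell, and $Y=H(A^*,\mathcal T)\times L^2(\Omega)$ with $\|(\mathbf w,\xi)\|_Y^2=\|\mathbf w\|^2_{L^2(Q)}+\|A_h^*\mathbf w\|^2_{L^2(Q)}+\|\xi\|^2_{L^2(\Omega)}$. Let $U_0$ be the space of $\mathbf v=(v,\tau)\in L^2(Q)\times L^2(Q;\mathbb R^d)$ with $\nabla_xv,\operatorname{div}\mathbf v\in L^2(Q)$ and $v=0$ on $(0,T)\times\partial\Omega$, the latter in the sense $\langle\nabla_x v,\chi\rangle=-\langle v,\operatorname{div}_x\chi\rangle$ for all $\chi\in C^\infty(\overline Q;\mathbb R^d)$; $\gamma_0\mathbf v=v(0,\cdot)\in L^2(\Omega)$ is the value at time $0$ of the continuous representative $v\in C([0,T];L^2(\Omega))$. Let $\gamma_A:U_0\to Y^*$, $\langle\gamma_A\mathbf v,(\mathbf w,\xi)\rangle=\langle A\mathbf v,\mathbf w\rangle_{L^2(Q)}-\langle\mathbf v,A_h^*\mathbf w\rangle_{L^2(Q)}+\langle\gamma_0\mathbf v,\xi\rangle_{L^2(\Omega)}$, $X=(L^2(Q)\times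 L^2(Q;\mathbb R^d))\times\gamma_AU_0$ with norm $\|(\mathbf v,\mathbf t)\|_X^2=\|\mathbf v\|^2_{L^2(Q)}+\|\mathbf t\|_{Y^*}^2$, and $b(\mathbf v,\mathbf t;\mathbf w,\xi)=\langle\mathbf v,A_h^*\mathbf w\rangle_{L^2(Q)}+\mathbf t(\mathbf w,\xi)$ on $X\times Y$. With $\mathbb P_k$ the polynomials of total degree at most $k$ and $\mathbb T_k(K)=\mathbb P_k(K_t)\otimes\mathbb P_k(K_x)$, and $\mathbb T_k(\mathcal T)$, $\mathbb P_k(\mathcal T_0)$ the corresponding piecewise polynomials, let $Y_h=(\mathbb T_k(\mathcal T)\times\mathbb T_1(\mathcal T;\mathbb R^d))\times\mathbb P_1(\mathcal T_0)$ with $k=3$ for $d=1$ and $k=2$ for $d\ge2$, and $X_h=(\mathbb T_0(\mathcal T)\times\mathbb T_0(\mathcal T;\mathbb R^d))\times\Gamma_h$, where $\Gamma_h$ is the sum of $\{\gamma_A(v,0): v\in\mathbb T_1(\mathcal T),\ (v,0)\in U_0\}$ and $\{\gamma_A(0,\tau):\tau\in L^2(Q;\mathbb R^d),\ \operatorname{div}_x\tau\in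 L^2(Q),\ \tau\cdot\nu_x \text{ constant on each } f\in\mathcal F_c^x\}$. **Theorem (Fortin operator).** There is a constant $C<\infty$, depending only on $Q$ and $\gamma$, such that for every such mesh $\mathcal T$ there is a bounded linear operator $\Pi:Y\to Y_h$ with the following properties. 1. $b(x_h;y-\Pi y)=0$ for all $x_h\in X_h$ and $y\in Y$. 2. $\|\Pi\|\le C\max_{K\in\mathcal T}\{1,h_t(K),h_x(K),h_t(K)/h_x(K)\}$, with the operator norm with respect to $\|\cdot\|_Y$. 3. $\Pi(\mathbf w,\xi)=(\Pi_0\mathbf w,\Pi_1\xi)$ with linear operators $\Pi_0$ on $H(A^*,\mathcal T)$ and $\Pi_1$ on $L^2(\Omega)$, and for all $(\mathbf w,\xi)\in Y$, $K\in\mathcal T$ and $K_0\in\mathcal T_0$, $$\langle\mathbf v_0,\mathbf w-\Pi_0\mathbf w\rangle_{L^2(K)}=0\ \ (\mathbf v_0\in\mathbb R^{d+1}),\qquad \langle\vartheta_h,\xi-\Pi_1\xi\rangle_{L^2(K_0)}=0\ \ (\vartheta_h\in\mathbb P_1(K_0)).$$ 4. $\Pi$ acts elementwise: $\mathbf w|_K=0$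 implies $(\Pi_0\mathbf w)|_K=0$ for $K\in\mathcal T$, and $\xi|_{K_0}=0$ implies $(\Pi_1\xi)|_{K_0}=0$ for $K_0\in\mathcal T_0$. 5. (Quasi-optimality of the practical DPG scheme.) Let $F\in Y^*$, let $x\in X$ satisfy $b(x;\cdot)=F$ on $Y$, and let $x_h\in X_h$ minimize $\|b(x_h;\cdot)-F\|_{Y_h^*}$ over $X_h$. Then for all $z_h\in X_h$ $$\|b(x-x_h;\cdot)\|_{Y^*}\le\|\Pi\|\,\|b(x-z_h;\cdot)\|_{Y^*}\quad\text{and}\quad \beta\,\|x-x_h\|_X\le\|b\|\,\|\Pi\|\,\|x-z_h\|_X,$$ where $\beta$ and $\|b\|$ are the infimum and the supremum of $\|b(x;\cdot)\|_{Y^*}/\|x\|_X$ over $x\in X\setminus\{0\}$. -/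

import Mathlib

open MeasureTheory Set
open scoped ContDiff RealInnerProductSpace

noncomputable section

namespace HeatDPG

/-! ### Points, fields and elementary differential operators -/

/-- The space `ℝ^d`. -/
abbrev Sp (d : ℕ) := EuclideanSpace ℝ (Fin d)

/-- Time-space points `z = (t, x)`. -/
abbrev TS (d : ℕ) := ℝ × Sp d

/-- Values `(v, τ) ∈ ℝ × ℝ^d` of time-space fields, with the Euclidean norm of `ℝ^{1+d}`. -/
abbrev Val (d : ℕ) := WithLp 2 (ℝ × Sp d)

/-- Time derivative. -/
def dt {d : ℕ} (φ : TS d → ℝ) (z : TS d) : ℝ := fderiv ℝ φ z (1, 0)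

/-- Gradient in the space directions. -/
def gradX {d : ℕ} (φ : TS d → ℝ) (z : TS d) : Sp d :=
  WithLp.toLp 2 fun i => fderiv ℝ φ z (0, EuclideanSpace.single i 1)

/-- Divergence in the space directions. -/
def divX {d : ℕ} (χ : TS d → Sp d) (z : TS d) : ℝ :=
  ∑ i, (fderiv ℝ χ z (0, EuclideanSpace.single i 1)) i

/-- `f` is the weak time-space divergence `∂_t w + div_x χ` of `𝐰 = (w, χ)` on the open set
`U ⊆ S`; the integrals are written over `S`, the test functions live in `U`. -/
def HasWeakDiv {d : ℕ} (S U : Set (TS d)) (w : TS d → Val d) (f : TS d → ℝ) : Prop :=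
  ∀ φ : TS d → ℝ, ContDiff ℝ ∞ φ → HasCompactSupport φ → tsupport φ ⊆ U →
    ∫ z in S, ((w z).fst * dt φ z + ⟪(w z).snd, gradX φ z⟫) = - ∫ z in S, f z * φ z

/-- `g` is the weak spatial gradient `∇_x v` of `v` on the open set `U ⊆ S`. -/
def HasWeakGradX {d : ℕ} (S U : Set (TS d)) (v : TS d → ℝ) (g : TS d → Sp d) : Prop :=
  ∀ φ : TS d → ℝ, ContDiff ℝ ∞ φ → HasCompactSupport φ → tsupport φ ⊆ U →
    ∫ z in S, v z • gradX φ z = - ∫ z in S, φ z • g z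

/-! ### The domain -/

/-- Bounded Lipschitz domains in `ℝ^d`: bounded, open, connected, and near every boundary point
the set lies on one side of the graph of a Lipschitz function. Here `n` is the (unit) direction
of the graph and `ψ` does not depend on the coordinate in direction `n`. -/
structure IsLipschitzDomain {d : ℕ} (Ω : Set (Sp d)) : Prop where
  isOpen : IsOpen Ω
  isConnected : IsConnected Ω
  isBounded : Bornology.IsBounded Ω
  graph : ∀ p ∈ frontier Ω, ∃ (n : Sp d) (r : ℝ) (L : NNReal) (ψ : Sp d → ℝ),
    ‖n‖ = 1 ∧ 0 < r ∧ LipschitzWith L ψ ∧ (∀ x (s : ℝ), ψ (x + s • n) = ψ x) ∧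
      ∀ x ∈ Metric.ball p r, x ∈ Ω ↔ ψ x < ⟪x, n⟫

/-- The time-space cylinder `Q = (0, T) × Ω`. -/
def cyl {d : ℕ} (T : ℝ) (Ω : Set (Sp d)) : Set (TS d) := Ioo 0 T ×ˢ Ω

/-- `L²(Q) × L²(Q; ℝ^d)`. -/
abbrev L2Q {d : ℕ} (T : ℝ) (Ω : Set (Sp d)) := Lp (Val d) 2 (volume.restrict (cyl T Ω))

/-- `L²(Ω)`. -/
abbrev L2Om {d : ℕ} (Ω : Set (Sp d)) := Lp ℝ 2 (volume.restrict Ω)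

/-! ### Meshes of time-space prisms -/

/-- A prism `K = K_t × K_x` with time interval `K_t = [a, b]` and `d`-simplex `K_x`. -/
structure Cell (d : ℕ) where
  a : ℝ
  b : ℝ
  hab : a < b
  simplex : Affine.Simplex ℝ (Sp d) d

namespace Cell

variable {d : ℕ} (K : Cell d)

/-- The closed simplex `K_x`. -/
def space : Set (Sp d) := convexHull ℝ (range K.simplex.points)

/-- The closed prism `K = K_t × K_x`. -/
def carrier : Set (TS d) := Icc K.a K.b ×ˢ K.space

/-- The interior of the prism. -/
def openCell : Set (TS d) := Ioo K.a K.b ×ˢ interior K.space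

/-- `h_t(K) = |K_t|`. -/
def ht : ℝ := K.b - K.a

/-- `h_x(K) = diam K_x`. -/
def hx : ℝ := Metric.diam K.space

/-- The facet of `K_x` opposite to the `i`-th vertex. -/
def spaceFacet (i : Fin (d + 1)) : Set (Sp d) := convexHull ℝ (K.simplex.points '' {i}ᶜ)

/-- The facets of `K` that are parallel to the time axis. -/
def lateralFacet (i : Fin (d + 1)) : Set (TS d) := Icc K.a K.b ×ˢ K.spaceFacet i

/-- All facets of `K`. -/
def facets : Set (Set (TS d)) :=
  range K.lateralFacet ∪ {{K.a} ×ˢ K.space, {K.b} ×ˢ K.space}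

/-- `ν` is the outer unit normal vector of `K_x` on its `i`-th facet. -/
def IsOuterNormal (i : Fin (d + 1)) (ν : Sp d) : Prop :=
  ‖ν‖ = 1 ∧
  (∀ j k, j ≠ i → k ≠ i → ⟪ν, K.simplex.points j - K.simplex.points k⟫ = (0 : ℝ)) ∧
  ∀ j, j ≠ i → ⟪ν, K.simplex.points i - K.simplex.points j⟫ < (0 : ℝ)

end Cell

/-- The set `ℱ` of all facets. -/
def allFacets {d : ℕ} (𝒯 : Finset (Cell d)) : Set (Set (TS d)) := {f | ∃ K ∈ 𝒯, f ∈ K.facets}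

/-- The set of all coarse facets that are parallel to the time axis. -/
def coarseLateral {d : ℕ} (𝒯 : Finset (Cell d)) : Set (Set (TS d)) :=
  {f | (∃ K ∈ 𝒯, f ∈ range K.lateralFacet) ∧ ∀ g ∈ allFacets 𝒯, f ⊆ g → f = g}

/-- Partitions of the closure of `Q` into non-overlapping prisms with matching facets (hanging
nodes are allowed). Two facets overlap if their relative interiors intersect. -/
structure IsMesh {d : ℕ} (T : ℝ) (Ω : Set (Sp d)) (𝒯 : Finset (Cell d)) : Prop where
  cover : ⋃ K ∈ 𝒯, K.carrier = closure (cyl T Ω)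
  nonoverlap : ∀ K ∈ 𝒯, ∀ K' ∈ 𝒯, K ≠ K' → Disjoint K.openCell K'.openCell
  matching : ∀ f ∈ allFacets 𝒯, ∀ g ∈ allFacets 𝒯,
    (intrinsicInterior ℝ f ∩ intrinsicInterior ℝ g).Nonempty → f ⊆ g ∨ g ⊆ f

/-- Shape regularity in space with constant `γ`: every `K_x` contains a ball of radius at
least `diam K_x / γ`. -/
def ShapeRegular {d : ℕ} (γ : ℝ) (𝒯 : Finset (Cell d)) : Prop :=
  ∀ K ∈ 𝒯, ∃ (c : Sp d) (r : ℝ), 0 < r ∧ Metric.closedBall c r ⊆ K.space ∧ K.hx ≤ γ * r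

/-- `max_K {1, h_t(K), h_x(K), h_t(K) / h_x(K)}`. -/
def meshFactor {d : ℕ} (𝒯 : Finset (Cell d)) : ℝ :=
  ⨆ K : 𝒯, max (max 1 K.1.ht) (max K.1.hx (K.1.ht / K.1.hx))

/-! ### Piecewise polynomials -/

/-- Polynomials of total degree at most `k` on `ℝ^d`. -/
def polySpace (d k : ℕ) : Submodule ℝ (Sp d → ℝ) where
  carrier := {f | ∃ p : MvPolynomial (Fin d) ℝ, p.totalDegree ≤ k ∧
    f = fun x => MvPolynomial.eval (fun i => x i) p}
  zero_mem' := ⟨0, by simp, by ext; simp⟩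
  add_mem' := by
    rintro _ _ ⟨p, hp, rfl⟩ ⟨q, hq, rfl⟩
    exact ⟨p + q, (MvPolynomial.totalDegree_add p q).trans (max_le hp hq), by ext; simp⟩
  smul_mem' := by
    rintro c _ ⟨p, hp, rfl⟩
    exact ⟨c • p, (MvPolynomial.totalDegree_smul_le c p).trans hp, by ext; simp⟩

/-- The tensor space `𝕋_k = ℙ_k(time) ⊗ ℙ_k(space)`. -/
def tensorSpace (d k : ℕ) : Submodule ℝ (TS d → ℝ) :=
  Submodule.span ℝ {f | ∃ (p : Polynomial ℝ) (q : Sp d → ℝ),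
    p.natDegree ≤ k ∧ q ∈ polySpace d k ∧ f = fun z => p.eval z.1 * q z.2}

/-- `v ∈ 𝕋_k(𝒯)`. -/
def IsPwTensor {d : ℕ} (T : ℝ) (Ω : Set (Sp d)) (𝒯 : Finset (Cell d)) (k : ℕ)
    (v : TS d → ℝ) : Prop :=
  ∀ K ∈ 𝒯, ∃ f ∈ tensorSpace d k, ∀ᵐ z ∂volume.restrict (cyl T Ω), z ∈ K.carrier → v z = f z

/-- `ξ ∈ ℙ_k(𝒯₀)`, where `𝒯₀` is the partition of `Ω` formed by the facets of the mesh on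
`{0} × Ω`, that is, by the simplices `K_x` of the cells `K` whose time interval starts at `0`. -/
def IsPwPoly0 {d : ℕ} (Ω : Set (Sp d)) (𝒯 : Finset (Cell d)) (k : ℕ) (ξ : Sp d → ℝ) : Prop :=
  ∀ K ∈ 𝒯, K.a = 0 → ∃ f ∈ polySpace d k,
    ∀ᵐ x ∂volume.restrict Ω, x ∈ K.space → ξ x = f x

theorem IsPwTensor.of_comb {d : ℕ} {T : ℝ} {Ω : Set (Sp d)} {𝒯 : Finset (Cell d)} {k : ℕ}
    {u v w : TS d → ℝ} (c : ℝ) (hu : IsPwTensor T Ω 𝒯 k u) (hv : IsPwTensor T Ω 𝒯 k v)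
    (h : ∀ᵐ z ∂volume.restrict (cyl T Ω), w z = c * u z + v z) : IsPwTensor T Ω 𝒯 k w := by
  intro K hK
  obtain ⟨f, hf, hf'⟩ := hu K hK
  obtain ⟨g, hg, hg'⟩ := hv K hK
  refine ⟨c • f + g, Submodule.add_mem _ (Submodule.smul_mem _ c hf) hg, ?_⟩
  filter_upwards [hf', hg', h] with z h1 h2 h3 hz
  simp [h3, h1 hz, h2 hz]

theorem IsPwPoly0.of_comb {d : ℕ} {Ω : Set (Sp d)} {𝒯 : Finset (Cell d)} {k : ℕ}
    {u v w : Sp d → ℝ} (c : ℝ) (hu : IsPwPoly0 Ω 𝒯 k u) (hv : IsPwPoly0 Ω 𝒯 k v)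
    (h : ∀ᵐ x ∂volume.restrict Ω, w x = c * u x + v x) : IsPwPoly0 Ω 𝒯 k w := by
  intro K hK h0
  obtain ⟨f, hf, hf'⟩ := hu K hK h0
  obtain ⟨g, hg, hg'⟩ := hv K hK h0
  refine ⟨c • f + g, Submodule.add_mem _ (Submodule.smul_mem _ c hf) hg, ?_⟩
  filter_upwards [hf', hg', h] with z h1 h2 h3 hz
  simp [h3, h1 hz, h2 hz]

/-! ### The broken test space -/

section Broken

variable {d : ℕ}

theorem continuous_dt {φ : TS d → ℝ} (h : ContDiff ℝ ∞ φ) : Continuous (dt φ) :=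
  (h.continuous_fderiv (by simp)).clm_apply continuous_const

theorem continuous_gradX {φ : TS d → ℝ} (h : ContDiff ℝ ∞ φ) : Continuous (gradX φ) :=
  (PiLp.continuous_toLp 2 _).comp
    (continuous_pi fun _ => (h.continuous_fderiv (by simp)).clm_apply continuous_const)

theorem hasCompactSupport_dt {φ : TS d → ℝ} (h : HasCompactSupport φ) :
    HasCompactSupport (dt φ) :=
  (h.fderiv ℝ).comp_left (g := fun A : TS d →L[ℝ] ℝ => A (1, 0)) rfl

theorem hasCompactSupport_gradX {φ : TS d → ℝ} (h : HasCompactSupport φ) :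
    HasCompactSupport (gradX φ) :=
  (h.fderiv ℝ).comp_left (g := fun A : TS d →L[ℝ] ℝ =>
    (WithLp.toLp 2 fun i => A (0, EuclideanSpace.single i 1) : Sp d)) (by ext; simp)

theorem memLp_fst {μ : Measure (TS d)} {w : TS d → Val d} (h : MemLp w 2 μ) :
    MemLp (fun z => (w z).fst) 2 μ := (WithLp.fstL 2 ℝ ℝ (Sp d)).comp_memLp' h

theorem memLp_snd {μ : Measure (TS d)} {w : TS d → Val d} (h : MemLp w 2 μ) :
    MemLp (fun z => (w z).snd) 2 μ := (WithLp.sndL 2 ℝ ℝ (Sp d)).comp_memLp' h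

theorem HasWeakDiv.of_comb {S U : Set (TS d)} {u v w : TS d → Val d} {f g h : TS d → ℝ} (c : ℝ)
    (hu : HasWeakDiv S U u f) (hv : HasWeakDiv S U v g)
    (mu : MemLp u 2 (volume.restrict S)) (mv : MemLp v 2 (volume.restrict S))
    (mf : MemLp f 2 (volume.restrict S)) (mg : MemLp g 2 (volume.restrict S))
    (hw : ∀ᵐ z ∂volume.restrict S, w z = c • u z + v z)
    (hh : ∀ᵐ z ∂volume.restrict S, h z = c * f z + g z) : HasWeakDiv S U w h := by
  intro φ h1 h2 h3
  have ct : MemLp (dt φ) 2 (volume.restrict S) :=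
    (continuous_dt h1).memLp_of_hasCompactSupport (hasCompactSupport_dt h2)
  have cx : MemLp (gradX φ) 2 (volume.restrict S) :=
    (continuous_gradX h1).memLp_of_hasCompactSupport (hasCompactSupport_gradX h2)
  have c0 : MemLp φ 2 (volume.restrict S) := h1.continuous.memLp_of_hasCompactSupport h2
  have key : ∀ {y : TS d → Val d}, MemLp y 2 (volume.restrict S) →
      Integrable (fun z => (y z).fst * dt φ z + ⟪(y z).snd, gradX φ z⟫) (volume.restrict S) :=
    fun my => ((memLp_fst my).integrable_mul ct).add
      (((memLp_snd my).norm.integrable_mul cx.norm).mono'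
        ((memLp_snd my).1.inner cx.1) (ae_of_all _ fun _ => norm_inner_le_norm _ _))
  have e1 : ∫ z in S, ((w z).fst * dt φ z + ⟪(w z).snd, gradX φ z⟫) =
      ∫ z in S, (c * ((u z).fst * dt φ z + ⟪(u z).snd, gradX φ z⟫) +
        ((v z).fst * dt φ z + ⟪(v z).snd, gradX φ z⟫)) := by
    refine integral_congr_ae ?_
    filter_upwards [hw] with z hz
    simp only [hz, WithLp.add_fst, WithLp.add_snd, WithLp.smul_fst, WithLp.smul_snd,
      inner_add_left, real_inner_smul_left, smul_eq_mul]
    ring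
  have e2 : ∫ z in S, h z * φ z = ∫ z in S, (c * (f z * φ z) + g z * φ z) := by
    refine integral_congr_ae ?_
    filter_upwards [hh] with z hz
    rw [hz]
    ring
  have i1 : Integrable (fun z => f z * φ z) (volume.restrict S) := mf.integrable_mul c0
  have i2 : Integrable (fun z => g z * φ z) (volume.restrict S) := mg.integrable_mul c0
  rw [e1, e2, integral_add ((key mu).const_mul c) (key mv), integral_add (i1.const_mul c) i2,
    integral_const_mul, integral_const_mul, hu φ h1 h2 h3, hv φ h1 h2 h3]
  ring

theorem HasWeakGradX.of_comb {S U : Set (TS d)} {u v w : TS d → ℝ} {f g h : TS d → Sp d} (c : ℝ)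
    (hu : HasWeakGradX S U u f) (hv : HasWeakGradX S U v g)
    (mu : MemLp u 2 (volume.restrict S)) (mv : MemLp v 2 (volume.restrict S))
    (mf : MemLp f 2 (volume.restrict S)) (mg : MemLp g 2 (volume.restrict S))
    (hw : ∀ᵐ z ∂volume.restrict S, w z = c * u z + v z)
    (hh : ∀ᵐ z ∂volume.restrict S, h z = c • f z + g z) : HasWeakGradX S U w h := by
  intro φ h1 h2 h3
  have cx : MemLp (gradX φ) 2 (volume.restrict S) :=
    (continuous_gradX h1).memLp_of_hasCompactSupport (hasCompactSupport_gradX h2)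
  have c0 : MemLp φ 2 (volume.restrict S) := h1.continuous.memLp_of_hasCompactSupport h2
  have k1 : ∀ {y : TS d → ℝ}, MemLp y 2 (volume.restrict S) →
      Integrable (fun z => y z • gradX φ z) (volume.restrict S) :=
    fun my => memLp_one_iff_integrable.1 (cx.smul my)
  have k2 : ∀ {y : TS d → Sp d}, MemLp y 2 (volume.restrict S) →
      Integrable (fun z => φ z • y z) (volume.restrict S) :=
    fun my => memLp_one_iff_integrable.1 (my.smul c0)
  have e1 : ∫ z in S, w z • gradX φ z =
      ∫ z in S, (c • (u z • gradX φ z) + v z • gradX φ z) := by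
    refine integral_congr_ae ?_
    filter_upwards [hw] with z hz
    rw [hz, add_smul, mul_smul]
  have e2 : ∫ z in S, φ z • h z = ∫ z in S, (c • (φ z • f z) + φ z • g z) := by
    refine integral_congr_ae ?_
    filter_upwards [hh] with z hz
    rw [hz, smul_add, smul_comm]
  have i1 : Integrable (fun z => c • (u z • gradX φ z)) (volume.restrict S) := (k1 mu).smul c
  have i2 : Integrable (fun z => c • (φ z • f z)) (volume.restrict S) := (k2 mf).smul c
  rw [e1, e2, integral_add i1 (k1 mv), integral_add i2 (k2 mg),
    integral_smul, integral_smul, hu φ h1 h2 h3, hv φ h1 h2 h3]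
  simp [add_comm]

end Broken

/-- `𝐚 = A_h^* 𝐰`, that is, for all cells `K` the restriction of `𝐰 = (w, χ)` to `K` has a weak
divergence and a weak spatial gradient on `K`, and
`𝐚 = (- div 𝐰, - ∇_x w + χ)` on `K`. -/
def IsBrokenAstar {d : ℕ} (T : ℝ) (Ω : Set (Sp d)) (𝒯 : Finset (Cell d))
    (w a : TS d → Val d) : Prop :=
  ∀ K ∈ 𝒯,
    HasWeakDiv (cyl T Ω) K.openCell w (fun z => -(a z).fst) ∧
    HasWeakGradX (cyl T Ω) K.openCell (fun z => (w z).fst) (fun z => (w z).snd - (a z).snd)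

theorem coeFn_comb {α E : Type*} [MeasurableSpace α] [NormedAddCommGroup E] [NormedSpace ℝ E]
    {μ : Measure α} (c : ℝ) (f g : Lp E 2 μ) : ∀ᵐ z ∂μ, (c • f + g) z = c • f z + g z := by
  filter_upwards [Lp.coeFn_add (c • f) g, Lp.coeFn_smul c f] with z h1 h2
  rw [h1, Pi.add_apply, h2, Pi.smul_apply]

theorem HasWeakDiv.zero {d : ℕ} {S U : Set (TS d)} {w : TS d → Val d} {f : TS d → ℝ}
    (hw : ∀ᵐ z ∂volume.restrict S, w z = 0) (hf : ∀ᵐ z ∂volume.restrict S, f z = 0) :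
    HasWeakDiv S U w f := by
  intro φ _ _ _
  rw [integral_eq_zero_of_ae (by filter_upwards [hw] with z hz; rw [hz]; simp),
    integral_eq_zero_of_ae (by filter_upwards [hf] with z hz; rw [hz]; simp), neg_zero]

theorem HasWeakGradX.zero {d : ℕ} {S U : Set (TS d)} {v : TS d → ℝ} {g : TS d → Sp d}
    (hv : ∀ᵐ z ∂volume.restrict S, v z = 0) (hg : ∀ᵐ z ∂volume.restrict S, g z = 0) :
    HasWeakGradX S U v g := by
  intro φ _ _ _
  rw [integral_eq_zero_of_ae (by filter_upwards [hv] with z hz; rw [hz]; simp),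
    integral_eq_zero_of_ae (by filter_upwards [hg] with z hz; rw [hz]; simp), neg_zero]

theorem IsBrokenAstar.zero {d : ℕ} {T : ℝ} {Ω : Set (Sp d)} {𝒯 : Finset (Cell d)} :
    IsBrokenAstar T Ω 𝒯 (0 : L2Q T Ω) (0 : L2Q T Ω) := by
  have h0 := Lp.coeFn_zero (E := Val d) (p := 2) (μ := volume.restrict (cyl T Ω))
  refine fun K _ => ⟨HasWeakDiv.zero h0 ?_, HasWeakGradX.zero ?_ ?_⟩ <;>
  · filter_upwards [h0] with z hz
    rw [hz]
    simp

theorem IsBrokenAstar.comb {d : ℕ} {T : ℝ} {Ω : Set (Sp d)} {𝒯 : Finset (Cell d)} (c : ℝ)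
    {w a w' a' : L2Q T Ω} (h : IsBrokenAstar T Ω 𝒯 w a) (h' : IsBrokenAstar T Ω 𝒯 w' a') :
    IsBrokenAstar T Ω 𝒯 (c • w + w' : L2Q T Ω) (c • a + a' : L2Q T Ω) := by
  have h1 := coeFn_comb c w w'
  have h2 := coeFn_comb c a a'
  have m1 := Lp.memLp w
  have m2 := Lp.memLp a
  have m3 := Lp.memLp w'
  have m4 := Lp.memLp a'
  refine fun K hK => ⟨?_, ?_⟩
  · refine HasWeakDiv.of_comb c (h K hK).1 (h' K hK).1 m1 m3 (memLp_fst m2).neg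
      (memLp_fst m4).neg h1 ?_
    filter_upwards [h2] with z hz
    rw [hz, WithLp.add_fst, WithLp.smul_fst, smul_eq_mul]
    ring
  · refine HasWeakGradX.of_comb c (h K hK).2 (h' K hK).2 (memLp_fst m1) (memLp_fst m3)
      ((memLp_snd m1).sub (memLp_snd m2)) ((memLp_snd m3).sub (memLp_snd m4)) ?_ ?_
    · filter_upwards [h1] with z hz
      rw [hz, WithLp.add_fst, WithLp.smul_fst, smul_eq_mul]
    · filter_upwards [h1, h2] with z hz hz'
      rw [hz, hz', WithLp.add_snd, WithLp.smul_snd, WithLp.add_snd, WithLp.smul_snd]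
      module

/-- The space `H(A^*, 𝒯)` of broken functions with the graph norm
`(‖𝐰‖² + ‖A_h^* 𝐰‖²)^{1/2}`, realised isometrically as the graph of `A_h^*`: its elements are
the pairs `(𝐰, A_h^* 𝐰)`. -/
def HA {d : ℕ} (T : ℝ) (Ω : Set (Sp d)) (𝒯 : Finset (Cell d)) :
    Submodule ℝ (WithLp 2 (L2Q T Ω × L2Q T Ω)) where
  carrier := {p | IsBrokenAstar T Ω 𝒯 p.fst p.snd}
  zero_mem' := IsBrokenAstar.zero
  add_mem' := by
    intro p q hp hq
    have h := IsBrokenAstar.comb 1 hp hq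
    rw [one_smul, one_smul] at h
    exact h
  smul_mem' := by
    intro c p hp
    have h := IsBrokenAstar.comb c hp IsBrokenAstar.zero
    rw [add_zero, add_zero] at h
    exact h

section Spaces

variable {d : ℕ} (T : ℝ) (Ω : Set (Sp d)) (𝒯 : Finset (Cell d))

/-- The broken function `𝐰` itself. -/
def HA.field : HA T Ω 𝒯 →L[ℝ] L2Q T Ω :=
  (WithLp.fstL 2 ℝ (L2Q T Ω) (L2Q T Ω)).comp (HA T Ω 𝒯).subtypeL

/-- The operator `A_h^*`. -/
def HA.astar : HA T Ω 𝒯 →L[ℝ] L2Q T Ω :=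
  (WithLp.sndL 2 ℝ (L2Q T Ω) (L2Q T Ω)).comp (HA T Ω 𝒯).subtypeL

/-- The test space `Y = H(A^*, 𝒯) × L²(Ω)` with norm
`(‖𝐰‖² + ‖A_h^* 𝐰‖² + ‖ξ‖²)^{1/2}`. -/
abbrev Y := WithLp 2 (HA T Ω 𝒯 × L2Om Ω)

/-- The component `𝐰` of `(𝐰, ξ) ∈ Y`. -/
def Y.field : Y T Ω 𝒯 →L[ℝ] L2Q T Ω :=
  (HA.field T Ω 𝒯).comp (WithLp.fstL 2 ℝ (HA T Ω 𝒯) (L2Om Ω))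

/-- `A_h^* 𝐰` for `(𝐰, ξ) ∈ Y`. -/
def Y.astar : Y T Ω 𝒯 →L[ℝ] L2Q T Ω :=
  (HA.astar T Ω 𝒯).comp (WithLp.fstL 2 ℝ (HA T Ω 𝒯) (L2Om Ω))

/-- The component `ξ` of `(𝐰, ξ) ∈ Y`. -/
def Y.init : Y T Ω 𝒯 →L[ℝ] L2Om Ω := WithLp.sndL 2 ℝ (HA T Ω 𝒯) (L2Om Ω)

/-! ### The trial space and the bilinear form -/

/-- `𝐯 = (v, τ) ∈ U₀` and `𝐟 = A 𝐯 = (div 𝐯, ∇_x v + τ)`. The second condition says that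
`∇_x v = 𝐟_x - τ` in the weak sense with homogeneous lateral boundary conditions; the test
functions are smooth up to the boundary. -/
def IsU0 (v f : L2Q T Ω) : Prop :=
  HasWeakDiv (cyl T Ω) (cyl T Ω) v (fun z => (f z).fst) ∧
  ∀ χ : TS d → Sp d, ContDiff ℝ ∞ χ →
    ∫ z in cyl T Ω, ⟪(f z).snd - (v z).snd, χ z⟫ = - ∫ z in cyl T Ω, (v z).fst * divX χ z

/-- `g = γ₀ 𝐯 = v(0, ·)`: the first component of `𝐯` has a representative in
`C([0, T]; L²(Ω))` with value `g` at time `0`. -/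
def IsInitialTrace (v : L2Q T Ω) (g : L2Om Ω) : Prop :=
  ∃ u : ℝ → L2Om Ω, ContinuousOn u (Icc 0 T) ∧ u 0 = g ∧
    ∀ᵐ t ∂volume.restrict (Ioo 0 T), ∀ᵐ x ∂volume.restrict Ω, u t x = (v (t, x)).fst

/-- The functional `γ_A 𝐯 ∈ Y^*`,
`(𝐰, ξ) ↦ ⟨A 𝐯, 𝐰⟩ - ⟨𝐯, A_h^* 𝐰⟩ + ⟨γ₀ 𝐯, ξ⟩`, where `f = A 𝐯` and `g = γ₀ 𝐯`. -/
def traceFunctional (v f : L2Q T Ω) (g : L2Om Ω) : StrongDual ℝ (Y T Ω 𝒯) :=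
  (innerSL ℝ f).comp (Y.field T Ω 𝒯) - (innerSL ℝ v).comp (Y.astar T Ω 𝒯) +
    (innerSL ℝ g).comp (Y.init T Ω 𝒯)

/-- The trace space `Γ(∂𝒯) = γ_A U₀ ⊆ Y^*`. -/
def Gam : Set (StrongDual ℝ (Y T Ω 𝒯)) :=
  {t | ∃ v f g, IsU0 T Ω v f ∧ IsInitialTrace T Ω v g ∧ t = traceFunctional T Ω 𝒯 v f g}

/-- The ambient Hilbert space of `X`, with the product norm `(‖𝐯‖² + ‖𝐭‖²_{Y^*})^{1/2}`. -/
abbrev XAmb := WithLp 2 (L2Q T Ω × StrongDual ℝ (Y T Ω 𝒯))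

/-- The trial space `X = (L²(Q) × L²(Q; ℝ^d)) × Γ(∂𝒯)`. -/
def X : Set (XAmb T Ω 𝒯) := {x | x.snd ∈ Gam T Ω 𝒯}

/-- The bilinear form `b(𝐯, 𝐭; 𝐰, ξ) = ⟨𝐯, A_h^* 𝐰⟩ + 𝐭(𝐰, ξ)`. -/
def bform (x : XAmb T Ω 𝒯) : StrongDual ℝ (Y T Ω 𝒯) :=
  (innerSL ℝ x.fst).comp (Y.astar T Ω 𝒯) + x.snd

/-! ### The discrete spaces -/

/-- The polynomial degree of the first component of the discrete test functions. -/
def testDeg (d : ℕ) : ℕ := if d = 1 then 3 else 2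

/-- The pair `(𝐰, ξ)` lies in `(𝕋_k(𝒯) × 𝕋_1(𝒯; ℝ^d)) × ℙ_1(𝒯₀)` with `k = testDeg d`. -/
def IsDiscreteTest (w : L2Q T Ω) (ξ : L2Om Ω) : Prop :=
  IsPwTensor T Ω 𝒯 (testDeg d) (fun z => (w z).fst) ∧
  (∀ i, IsPwTensor T Ω 𝒯 1 (fun z => (w z).snd i)) ∧ IsPwPoly0 Ω 𝒯 1 ξ

theorem IsDiscreteTest.zero : IsDiscreteTest T Ω 𝒯 0 0 := by
  have h0 := Lp.coeFn_zero (E := Val d) (p := 2) (μ := volume.restrict (cyl T Ω))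
  have h1 := Lp.coeFn_zero (E := ℝ) (p := 2) (μ := volume.restrict Ω)
  refine ⟨fun K _ => ⟨0, Submodule.zero_mem _, ?_⟩,
    fun i K _ => ⟨0, Submodule.zero_mem _, ?_⟩, fun K _ _ => ⟨0, Submodule.zero_mem _, ?_⟩⟩
  · filter_upwards [h0] with z hz _
    rw [hz]
    simp
  · filter_upwards [h0] with z hz _
    rw [hz]
    simp
  · filter_upwards [h1] with z hz _
    rw [hz]

variable {T Ω 𝒯} in
theorem IsDiscreteTest.comb (c : ℝ) {w w' : L2Q T Ω} {ξ ξ' : L2Om Ω}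
    (h : IsDiscreteTest T Ω 𝒯 w ξ) (h' : IsDiscreteTest T Ω 𝒯 w' ξ') :
    IsDiscreteTest T Ω 𝒯 (c • w + w') (c • ξ + ξ') := by
  have h1 := coeFn_comb c w w'
  refine ⟨h.1.of_comb c h'.1 ?_, fun i => (h.2.1 i).of_comb c (h'.2.1 i) ?_,
    h.2.2.of_comb c h'.2.2 (coeFn_comb c ξ ξ')⟩
  · filter_upwards [h1] with z hz
    rw [hz]
    simp
  · filter_upwards [h1] with z hz
    rw [hz]
    simp

/-- The space `(𝕋_k(𝒯) × 𝕋_1(𝒯; ℝ^d)) × ℙ_1(𝒯₀)` of piecewise polynomials, where `k = 3` for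
`d = 1` and `k = 2` for `d ≥ 2`. -/
def discreteTest : Submodule ℝ (L2Q T Ω × L2Om Ω) where
  carrier := {y | IsDiscreteTest T Ω 𝒯 y.1 y.2}
  zero_mem' := IsDiscreteTest.zero T Ω 𝒯
  add_mem' := by
    intro p q hp hq
    have h := IsDiscreteTest.comb 1 hp hq
    rw [one_smul, one_smul] at h
    exact h
  smul_mem' := by
    intro c p hp
    have h := IsDiscreteTest.comb c hp (IsDiscreteTest.zero T Ω 𝒯)
    rw [add_zero, add_zero] at h
    exact h

/-- The discrete test space `Y_h`: all `(𝐰, ξ) ∈ Y` in the space of piecewise polynomials. -/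
def Yh : Submodule ℝ (Y T Ω 𝒯) :=
  (discreteTest T Ω 𝒯).comap ((Y.field T Ω 𝒯).prod (Y.init T Ω 𝒯)).toLinearMap

/-- `X_{0,h} = 𝕋_0(𝒯) × 𝕋_0(𝒯; ℝ^d)`. -/
def X0h : Set (L2Q T Ω) :=
  {v | IsPwTensor T Ω 𝒯 0 (fun z => (v z).fst) ∧ ∀ i, IsPwTensor T Ω 𝒯 0 (fun z => (v z).snd i)}

/-- The traces `γ_A (v, 0)` of functions `v ∈ V_h = 𝕋_1(𝒯) ∩ H^1_D(Q)`. Note that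
`(v, 0) ∈ U₀` says precisely that the weak derivatives `∂_t v = div (v, 0)` and `∇_x v` are in
`L²(Q)` and that `v` vanishes on the lateral boundary, that is, `v ∈ H^1_D(Q)`. -/
def GamH1 : Set (StrongDual ℝ (Y T Ω 𝒯)) :=
  {t | ∃ v f g, IsU0 T Ω v f ∧ IsInitialTrace T Ω v g ∧
    (∀ᵐ z ∂volume.restrict (cyl T Ω), (v z).snd = 0) ∧
    IsPwTensor T Ω 𝒯 1 (fun z => (v z).fst) ∧ t = traceFunctional T Ω 𝒯 v f g}

/-- For `τ` with `q = div_x τ`: the normal trace of `τ` is constant on each coarse facet that is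
parallel to the time axis. The vector `P f` is the constant normal trace on `f` times the
corresponding unit normal vector, so that the normal trace with respect to the outer normal
vector `ν i` of a cell `K` with `i`-th lateral facet contained in `f i` equals `⟪P (f i), ν i⟫`;
the normal trace on the boundary of `K` is understood by integration by parts. -/
def HasConstNormalTraces {d : ℕ} (𝒯 : Finset (Cell d)) (τ : TS d → Sp d) (q : TS d → ℝ) : Prop :=
  ∃ P : Set (TS d) → Sp d, ∀ K ∈ 𝒯, ∀ (f : Fin (d + 1) → Set (TS d)) (ν : Fin (d + 1) → Sp d),
    (∀ i, f i ∈ coarseLateral 𝒯 ∧ K.lateralFacet i ⊆ f i ∧ K.IsOuterNormal i (ν i)) →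
    ∀ φ : TS d → ℝ, ContDiff ℝ ∞ φ →
      ∫ z in K.carrier, (q z * φ z + ⟪τ z, gradX φ z⟫) =
        ∑ i, ⟪P (f i), ν i⟫ * ∫ t in K.a..K.b, ∫ x in K.spaceFacet i, φ (t, x) ∂μHE[d - 1]

/-- The traces `γ_A (0, τ)` of functions `τ ∈ H(div_x, Q)` with constant normal traces on the
coarse facets parallel to the time axis; for `(0, τ) ∈ U₀` one has `A (0, τ) = (div_x τ, τ)`. -/
def GamDiv : Set (StrongDual ℝ (Y T Ω 𝒯)) :=
  {t | ∃ v f g, IsU0 T Ω v f ∧ IsInitialTrace T Ω v g ∧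
    (∀ᵐ z ∂volume.restrict (cyl T Ω), (v z).fst = 0) ∧
    HasConstNormalTraces 𝒯 (fun z => (v z).snd) (fun z => (f z).fst) ∧
    t = traceFunctional T Ω 𝒯 v f g}

/-- The low-order trial space `X_h = X_{0,h} × Γ_h(∂𝒯)`, where `Γ_h(∂𝒯)` is the sum of the two
discrete trace spaces. -/
def Xh : Set (XAmb T Ω 𝒯) :=
  {x | x.fst ∈ X0h T Ω 𝒯 ∧ ∃ t₁ ∈ GamH1 T Ω 𝒯, ∃ t₂ ∈ GamDiv T Ω 𝒯, x.snd = t₁ + t₂}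

/-! ### The practical scheme -/

/-- The quotients `‖b(x; ·)‖_{Y^*} / ‖x‖_X` for `x ∈ X` with `x ≠ 0`. -/
def stabQuotients : Set ℝ := {r | ∃ x ∈ X T Ω 𝒯, x ≠ 0 ∧ r = ‖bform T Ω 𝒯 x‖ / ‖x‖}

/-- The inf-sup constant `β` of `b`. -/
def infSupConst : ℝ := sInf (stabQuotients T Ω 𝒯)

/-- The continuity constant `‖b‖` of `b`. -/
def contConst : ℝ := sSup (stabQuotients T Ω 𝒯)

/-- `x_h ∈ X_h` minimizes the discrete residual `‖b(x_h; ·) - F‖_{Y_h^*}`. -/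
def IsPracticalDPG (F : StrongDual ℝ (Y T Ω 𝒯)) (xh : XAmb T Ω 𝒯) : Prop :=
  xh ∈ Xh T Ω 𝒯 ∧ ∀ z ∈ Xh T Ω 𝒯,
    ‖(bform T Ω 𝒯 xh - F).comp (Yh T Ω 𝒯).subtypeL‖ ≤
      ‖(bform T Ω 𝒯 z - F).comp (Yh T Ω 𝒯).subtypeL‖

end Spaces

end HeatDPG

end

noncomputable section

namespace HeatDPG

/-! Everything reduces to finitely many means over a single prism `K`. Write `𝐰 = (e, χ)`, let `λ_i`
be the barycentric coordinates of `K_x` with vertices `p_i`, and let `t` be the time relative to the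
midpoint of `K_t`. On `K`, testing a constant field against `A^* 𝐰` needs only the means of `χ`,
`div 𝐰` and `∇_x e`. The trace of a function in `𝕋_1` needs, for `v = λ_i` and `v = t λ_i`, the
means of `(∂_t v) e + ∇_x v · χ + v div 𝐰`. The trace of a `τ` with constant normal components needs
the integrals of `e` over the lateral facets. These facet integrals become volume integrals: `x -
p_i` is tangential to the facets through `p_i` and has constant normal component on the opposite
facet, so `∫_{F_i} e` is a multiple of `∫ (d e + (x - p_i) · ∇_x e)`
(`Cell.exists_integral_facet_eq`). Hence it suffices that the operator preserves the means with the
weights `wE`, `wX`, `wD`, `wT` and `wG`.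

The function `e` has only a weak spatial gradient and no trace theorem is invoked. Identities that
express a vanishing normal trace are proved for functions smooth up to the boundary and then pass to
the limit: contracting the convex cell towards an interior point and mollifying approximates `e` and
`∇_x e` simultaneously (`Cell.exists_contDiff_approx`, `Cell.integral_eq_zero_of_contDiff`).

The local field `Cell.poly` has first component `∑ (A_i + B_i t) λ_i` plus corrections with
coefficients `β_j`, and its second component is `m + t c + (s + s' t)(x - center)`. The `j`-th
correction is orthogonal to affine functions and its integrals over all facets of `K_x` but the
`j`-th vanish. With these two properties the linear system for the preserved means is solved
explicitly by `Cell.coeffs`. Quadratic corrections exist for `d ≥ 2`; on an interval there are four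
conditions and only three quadratic monomials, which explains the degree `3`.

For the norm, `λ_j λ_k (p_j - p_k)` has divergence `λ_k - λ_j` and no normal trace, so the means of
`λ_j e` and `λ_k e` differ by a mean of `∇_x e` with a weight of size `h_x` (`Cell.wmean_wLam_sub`).
This takes the place of a Poincaré inequality: up to a common constant the `A_i` are of size `h_x`,
as are the `β_j`, which compensates `|∇λ_i| ≤ γ / h_x`. Only the term `t B_i ∇λ_i` is not
compensated, and it produces the ratio `h_t / h_x`. The remaining powers of `h_t` and `h_x` are
bounded in terms of `Q`.

The initial values are projected onto `ℙ_1(𝒯₀)` in `L²`. For small positive times a function in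
`𝕋_1(𝒯)` is affine on each initial simplex, so its pairing with the projection error vanishes there,
and at time `0` by continuity.

Quasi-optimality with constant `‖Π‖`, rather than `1 + ‖Π‖`, is a Hilbert space fact
(`norm_le_of_minimal_of_fortin`): minimality in `Y_h^*` is an orthogonality that bounds the
component in the discrete space by `‖Π‖` times the total residual, and the bound carries over to the
complementary component as for the norms of complementary projections. -/

instance isAddHaarMeasure_volume {d : ℕ} : (volume : Measure (TS d)).IsAddHaarMeasure :=
  Measure.prod.instIsAddHaarMeasure volume volume

namespace Cell

/-! ### Barycentric coordinates and the geometry of cells -/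

variable {d : ℕ} (K : Cell d)

/-- The vertices of `K_x` as an affine basis of `ℝ^d`. -/
def basis : AffineBasis (Fin (d + 1)) ℝ (Sp d) :=
  ⟨K.simplex.points, K.simplex.independent, by
    rw [K.simplex.independent.affineSpan_eq_top_iff_card_eq_finrank_add_one]
    simp⟩

/-- The vertices of `K_x`. -/
def vert (i : Fin (d + 1)) : Sp d := K.simplex.points i

/-- The barycentric coordinates of `K_x`. -/
def lam (i : Fin (d + 1)) (x : Sp d) : ℝ := K.basis.coord i x

/-- The gradients of the barycentric coordinates of `K_x`. -/
def grad (i : Fin (d + 1)) : Sp d :=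
  (InnerProductSpace.toDual ℝ (Sp d)).symm (LinearMap.toContinuousLinearMap (K.basis.coord i).linear)

theorem inner_grad (i : Fin (d + 1)) (v : Sp d) : ⟪K.grad i, v⟫ = (K.basis.coord i).linear v := by
  simp [grad]

theorem lam_sub (i : Fin (d + 1)) (x y : Sp d) : K.lam i x - K.lam i y = ⟪K.grad i, x - y⟫ := by
  rw [inner_grad, lam, lam, ← vsub_eq_sub x y, AffineMap.linearMap_vsub, vsub_eq_sub]

theorem lam_add (i : Fin (d + 1)) (x v : Sp d) : K.lam i (x + v) = K.lam i x + ⟪K.grad i, v⟫ := by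
  have := K.lam_sub i (x + v) x
  rw [add_sub_cancel_left] at this
  linarith

theorem lam_vert (i j : Fin (d + 1)) : K.lam i (K.vert j) = if i = j then 1 else 0 :=
  K.basis.coord_apply i j

theorem sum_lam (x : Sp d) : ∑ i, K.lam i x = 1 := K.basis.sum_coord_apply_eq_one x

theorem sum_lam_smul_vert (x : Sp d) : ∑ i, K.lam i x • K.vert i = x :=
  K.basis.linear_combination_coord_eq_self x

theorem sum_lam_smul_sub (x y : Sp d) : ∑ i, K.lam i x • (K.vert i - y) = x - y := by
  simp_rw [smul_sub, Finset.sum_sub_distrib, sum_lam_smul_vert, ← Finset.sum_smul, sum_lam,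
    one_smul]

theorem inner_grad_sub_vert (i j : Fin (d + 1)) (x : Sp d) :
    ⟪K.grad i, x - K.vert j⟫ = K.lam i x - if i = j then 1 else 0 := by
  rw [← lam_sub, lam_vert]

theorem sum_grad : ∑ i, K.grad i = 0 := by
  refine ext_inner_right ℝ fun v => ?_
  have h : ∀ i, ⟪K.grad i, v⟫ = K.lam i (0 + v) - K.lam i 0 := fun i => by
    rw [lam_add]; ring
  simp_rw [sum_inner, h, Finset.sum_sub_distrib, sum_lam]
  simp

theorem continuous_lam (i : Fin (d + 1)) : Continuous (K.lam i) :=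
  continuous_barycentric_coord K.basis i

theorem mem_space {x : Sp d} : x ∈ K.space ↔ ∀ i, 0 ≤ K.lam i x := by
  have := K.basis.convexHull_eq_nonneg_coord
  exact (Set.ext_iff.1 this x)

theorem mem_interior_space {x : Sp d} : x ∈ interior K.space ↔ ∀ i, 0 < K.lam i x := by
  have := K.basis.interior_convexHull
  exact (Set.ext_iff.1 this x)

theorem lam_nonneg {x : Sp d} (hx : x ∈ K.space) (i : Fin (d + 1)) : 0 ≤ K.lam i x :=
  K.mem_space.1 hx i

theorem lam_le_one {x : Sp d} (hx : x ∈ K.space) (i : Fin (d + 1)) : K.lam i x ≤ 1 := by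
  rw [← K.sum_lam x]
  exact Finset.single_le_sum (fun j _ => K.lam_nonneg hx j) (Finset.mem_univ i)

theorem abs_lam_le_one {x : Sp d} (hx : x ∈ K.space) (i : Fin (d + 1)) : |K.lam i x| ≤ 1 :=
  abs_le.2 ⟨by linarith [K.lam_nonneg hx i], K.lam_le_one hx i⟩

theorem vert_mem (i : Fin (d + 1)) : K.vert i ∈ K.space :=
  subset_convexHull ℝ _ (mem_range_self i)

theorem convex_space : Convex ℝ K.space := convex_convexHull ℝ _

theorem isCompact_space : IsCompact K.space := (finite_range _).isCompact_convexHull ℝ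

theorem measurableSet_space : MeasurableSet K.space := K.isCompact_space.measurableSet

/-- The barycenter of `K_x`. -/
def center : Sp d := ∑ i, ((d : ℝ) + 1)⁻¹ • K.vert i

theorem inner_grad_sub_center (i : Fin (d + 1)) (x : Sp d) :
    ⟪K.grad i, x - K.center⟫ = K.lam i x - ((d : ℝ) + 1)⁻¹ := by
  have h : x - K.center = ∑ j, ((d : ℝ) + 1)⁻¹ • (x - K.vert j) := by
    rw [center, ← Finset.smul_sum, ← Finset.smul_sum, Finset.sum_sub_distrib, smul_sub]
    congr 1
    rw [Finset.sum_const, Finset.card_univ, Fintype.card_fin, ← Nat.cast_smul_eq_nsmul ℝ,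
      smul_smul]
    push_cast
    rw [inv_mul_cancel₀ (by positivity), one_smul]
  rw [h, inner_sum]
  simp_rw [inner_smul_right, inner_grad_sub_vert]
  rw [← Finset.mul_sum, Finset.sum_sub_distrib]
  simp only [Finset.sum_const, Finset.card_univ, Fintype.card_fin, nsmul_eq_mul,
    Finset.sum_ite_eq, Finset.mem_univ, if_true]
  push_cast
  field_simp

theorem lam_center (i : Fin (d + 1)) : K.lam i K.center = ((d : ℝ) + 1)⁻¹ := by
  have := K.inner_grad_sub_center i K.center
  rw [sub_self, inner_zero_right] at this
  linarith

theorem center_mem_interior : K.center ∈ interior K.space :=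
  K.mem_interior_space.2 fun i => by rw [lam_center]; positivity

theorem center_mem : K.center ∈ K.space := interior_subset K.center_mem_interior

theorem ht_pos : 0 < K.ht := sub_pos.2 K.hab

theorem norm_sub_le_hx {x y : Sp d} (hx : x ∈ K.space) (hy : y ∈ K.space) : ‖x - y‖ ≤ K.hx := by
  rw [← dist_eq_norm]
  exact Metric.dist_le_diam_of_mem K.isCompact_space.isBounded hx hy

theorem hx_nonneg : 0 ≤ K.hx := Metric.diam_nonneg

theorem isCompact_carrier : IsCompact K.carrier := isCompact_Icc.prod K.isCompact_space

theorem convex_carrier : Convex ℝ K.carrier := (convex_Icc _ _).prod K.convex_space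

theorem openCell_eq : K.openCell = interior K.carrier := by
  rw [openCell, carrier, interior_prod_eq, interior_Icc]

theorem isOpen_openCell : IsOpen K.openCell := by rw [openCell_eq]; exact isOpen_interior

theorem openCell_subset : K.openCell ⊆ K.carrier := by rw [openCell_eq]; exact interior_subset

theorem openCell_nonempty : K.openCell.Nonempty :=
  ⟨((K.a + K.b) / 2, K.center), ⟨by linarith [K.hab], by linarith [K.hab]⟩, K.center_mem_interior⟩

theorem volume_carrier_diff : volume (K.carrier \ K.openCell) = 0 := by
  rw [openCell_eq]
  refine measure_mono_null (sdiff_subset_sdiff_left subset_closure) ?_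
  exact K.convex_carrier.addHaar_frontier volume

theorem openCell_ae_eq : K.openCell =ᵐ[volume] K.carrier := by
  rw [openCell_eq]
  exact interior_ae_eq_of_null_frontier (K.convex_carrier.addHaar_frontier volume)

theorem interior_space_ae_eq : (interior K.space : Set (Sp d)) =ᵐ[volume] K.space :=
  interior_ae_eq_of_null_frontier (K.convex_space.addHaar_frontier volume)

theorem volume_space_ne_top : volume K.space ≠ ⊤ := K.isCompact_space.measure_lt_top.ne

theorem volume_space_pos : 0 < volume.real K.space :=
  ENNReal.toReal_pos ((isOpen_interior.measure_pos volume ⟨_, K.center_mem_interior⟩).trans_le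
    (measure_mono interior_subset)).ne' K.volume_space_ne_top

theorem volume_real_carrier : volume.real K.carrier = K.ht * volume.real K.space := by
  rw [carrier, Measure.volume_eq_prod, measureReal_prod_prod, Real.volume_real_Icc_of_le K.hab.le, ht]

theorem volume_carrier_pos : 0 < volume.real K.carrier := by
  rw [volume_real_carrier]; exact mul_pos K.ht_pos K.volume_space_pos

/-- A step of length `r` from the centre of the ball in the direction of the gradient stays in the
simplex and raises the coordinate by `r ‖∇λ_i‖`, while coordinates stay between `0` and `1` there.
-/
theorem norm_grad_le {c : Sp d} {r : ℝ} (hr : 0 < r) (h : Metric.closedBall c r ⊆ K.space)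
    (i : Fin (d + 1)) : ‖K.grad i‖ ≤ r⁻¹ := by
  by_cases h0 : K.grad i = 0
  · rw [h0, norm_zero]; positivity
  have hn : 0 < ‖K.grad i‖ := norm_pos_iff.2 h0
  set x := c + (r / ‖K.grad i‖) • K.grad i with hx
  have hxm : x ∈ K.space := h (by
    rw [mem_closedBall_iff_norm, hx, add_sub_cancel_left, norm_smul, Real.norm_eq_abs, abs_div,
      abs_norm, abs_of_pos hr, div_mul_cancel₀ _ hn.ne'])
  have h1 := K.lam_add i c ((r / ‖K.grad i‖) • K.grad i)
  rw [← hx, inner_smul_right, real_inner_self_eq_norm_sq] at h1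
  have h2 := K.lam_le_one hxm i
  have h3 := K.lam_nonneg (h (Metric.mem_closedBall_self hr.le)) i
  have h4 : r / ‖K.grad i‖ * ‖K.grad i‖ ^ 2 = r * ‖K.grad i‖ := by field_simp
  rw [le_inv_comm₀ hn hr, ← one_div, le_div_iff₀ hn]
  linarith

theorem mem_spaceFacet {i : Fin (d + 1)} {x : Sp d} :
    x ∈ K.spaceFacet i ↔ x ∈ K.space ∧ K.lam i x = 0 := by
  constructor
  · intro hx
    have hs : K.simplex.points '' {i}ᶜ ⊆ {x | x ∈ K.space ∧ K.lam i x = 0} := by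
      rintro _ ⟨j, hj, rfl⟩
      refine ⟨K.vert_mem j, ?_⟩
      have := K.lam_vert i j
      rwa [if_neg (Ne.symm hj)] at this
    refine convexHull_min hs ?_ hx
    have hc : Convex ℝ {x | K.lam i x = 0} := by
      intro x hx y hy a b ha hb hab
      change K.lam i x = 0 at hx
      change K.lam i y = 0 at hy
      change K.lam i (a • x + b • y) = 0
      have h1 := K.lam_sub i (a • x + b • y) y
      have h2 : a • x + b • y - y = a • (x - y) := by
        rw [smul_sub, eq_sub_of_add_eq' hab]; module
      rw [h2, inner_smul_right, ← lam_sub, hx, hy] at h1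
      simpa using h1
    exact K.convex_space.inter hc
  · rintro ⟨hx, h0⟩
    rw [← K.sum_lam_smul_vert x, ← Finset.sum_erase (a := i) _ (by rw [h0, zero_smul])]
    refine (convex_convexHull ℝ _).sum_mem (fun j _ => K.lam_nonneg hx j) ?_ ?_
    · exact (Finset.sum_erase (f := fun i => K.lam i x) Finset.univ h0).trans (K.sum_lam x)
    · intro j hj
      exact subset_convexHull ℝ _ ⟨j, by simpa using hj, rfl⟩

theorem grad_ne_zero (hd : 1 ≤ d) (i : Fin (d + 1)) : K.grad i ≠ 0 := by
  intro h
  obtain ⟨j, hj⟩ : ∃ j : Fin (d + 1), j ≠ i := by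
    have : Nontrivial (Fin (d + 1)) := Fin.nontrivial_iff_two_le.2 (by omega)
    exact exists_ne i
  have h1 := K.inner_grad_sub_vert i j (K.vert i)
  rw [h, inner_zero_left, lam_vert, if_pos rfl, if_neg hj.symm] at h1
  norm_num at h1

/-- The normal is `-∇λ_i / ‖∇λ_i‖`. Existence is what makes the condition in `HasConstNormalTraces`
applicable to a cell, since that condition is quantified over given normals. -/
theorem exists_isOuterNormal (hd : 1 ≤ d) (i : Fin (d + 1)) : ∃ ν, K.IsOuterNormal i ν := by
  have hn : 0 < ‖K.grad i‖ := norm_pos_iff.2 (K.grad_ne_zero hd i)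
  have key : ∀ j k, ⟪-(‖K.grad i‖⁻¹ • K.grad i), K.simplex.points j - K.simplex.points k⟫ =
      -(‖K.grad i‖⁻¹ * ((if i = j then 1 else 0) - if i = k then 1 else 0)) := fun j k => by
    rw [inner_neg_left, real_inner_smul_left]
    have := K.inner_grad_sub_vert i k (K.vert j)
    rw [lam_vert] at this
    rw [← this]; rfl
  refine ⟨-(‖K.grad i‖⁻¹ • K.grad i), ?_, fun j k hj hk => ?_, fun j hj => ?_⟩
  · rw [norm_neg, norm_smul, norm_inv, norm_norm, inv_mul_cancel₀ hn.ne']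
  · rw [key, if_neg hj.symm, if_neg hk.symm]; simp
  · rw [key, if_pos rfl, if_neg hj.symm]
    simp [hn]

end Cell

end HeatDPG

end

/-! ### Facet integrals as volume integrals: the cone formula -/

noncomputable section

namespace HeatDPG

open Module in
/-- Coordinates `x = s e + v` adapted to a hyperplane that does not contain `e`. -/
def hyperplaneCoords {E : Type*} [NormedAddCommGroup E] [InnerProductSpace ℝ E]
    (g e : E) (h : ⟪g, e⟫ = (-1 : ℝ)) : (ℝ × (ℝ ∙ g)ᗮ) ≃ₗ[ℝ] E where
  toFun q := q.1 • e + (q.2 : E)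
  map_add' p q := by simp only [Prod.fst_add, Prod.snd_add, Submodule.coe_add]; module
  map_smul' c q := by
    simp only [Prod.smul_fst, Prod.smul_snd, Submodule.coe_smul, RingHom.id_apply, smul_eq_mul]
    module
  invFun x := (-⟪g, x⟫, ⟨x + ⟪g, x⟫ • e, by
    rw [Submodule.mem_orthogonal_singleton_iff_inner_right, inner_add_right, inner_smul_right, h]
    ring⟩)
  left_inv q := by
    have hq : ⟪g, (q.2 : E)⟫ = 0 := Submodule.mem_orthogonal_singleton_iff_inner_right.1 q.2.2
    ext
    · simp only [inner_add_right, inner_smul_right, h, hq]; ring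
    · simp only [inner_add_right, inner_smul_right, h, hq]; module
  right_inv x := by simp only; module

/-- Integration in the coordinates `x = p + s e + v`, up to a nonzero constant. -/
theorem exists_integral_hyperplaneCoords {E : Type*} [NormedAddCommGroup E]
    [InnerProductSpace ℝ E] [FiniteDimensional ℝ E] [MeasurableSpace E] [BorelSpace E]
    (g e : E) (h : ⟪g, e⟫ = (-1 : ℝ)) (p : E) :
    ∃ c : ℝ, c ≠ 0 ∧ ∀ F : E → ℝ, Integrable F →
      ∫ x, F x = c * ∫ s : ℝ, ∫ v : (ℝ ∙ g)ᗮ, F (p + (s • e + (v : E))) := by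
  let L : (ℝ × (ℝ ∙ g)ᗮ) ≃L[ℝ] E := (hyperplaneCoords g e h).toContinuousLinearEquiv
  have hL : ∀ q, L q = q.1 • e + (q.2 : E) := fun q => rfl
  have : ((volume : Measure (ℝ × (ℝ ∙ g)ᗮ))).IsAddHaarMeasure :=
    Measure.prod.instIsAddHaarMeasure volume volume
  have hH : ((volume : Measure (ℝ × (ℝ ∙ g)ᗮ)).map L).IsAddHaarMeasure :=
    L.isAddHaarMeasure_map _
  -- Both measures are Haar measures and therefore proportional. The factor is never computed:
  -- normal traces are arbitrary constants, so only its being nonzero and finite matters.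
  obtain ⟨c, c0, ct, hc⟩ : ∃ c : ENNReal, c ≠ 0 ∧ c ≠ ⊤ ∧
      (volume : Measure E) = c • (volume : Measure (ℝ × (ℝ ∙ g)ᗮ)).map L :=
    ⟨_, ENNReal.coe_ne_zero.2 (Measure.addHaarScalarFactor_pos_of_isAddHaarMeasure _ _).ne',
      ENNReal.coe_ne_top, Measure.isAddLeftInvariant_eq_smul (volume : Measure E)
        ((volume : Measure (ℝ × (ℝ ∙ g)ᗮ)).map L)⟩
  have hemb : MeasurableEmbedding L := L.toHomeomorph.measurableEmbedding
  refine ⟨c.toReal, ENNReal.toReal_ne_zero.2 ⟨c0, ct⟩, fun F hF => ?_⟩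
  have hF' : Integrable (fun x => F (p + x)) := hF.comp_add_left p
  have hi : Integrable (fun q : ℝ × (ℝ ∙ g)ᗮ => F (p + L q)) (volume.prod volume) := by
    rw [hc] at hF'
    have := (integrable_smul_measure c0 ct).1 hF'
    exact (hemb.integrable_map_iff).1 this
  calc ∫ x, F x = ∫ x, F (p + x) := (integral_add_left_eq_self F p).symm
    _ = c.toReal * ∫ q, F (p + L q) := by
      rw [hc, integral_smul_measure, hemb.integral_map, smul_eq_mul]
    _ = _ := by
      rw [Measure.volume_eq_prod, integral_prod _ hi]
      simp only [hL]

/-- The derivative of `s ↦ s^{m+1} φ(p + s u)` integrates to `φ(p + u)`. -/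
theorem integral_cone_ray {E : Type*} [NormedAddCommGroup E] [NormedSpace ℝ E]
    {φ : E → ℝ} (hφ : ContDiff ℝ 1 φ) (m : ℕ) (p u : E) :
    ∫ s in (0 : ℝ)..1, s ^ m * (((m + 1 : ℕ) : ℝ) * φ (p + s • u) +
      fderiv ℝ φ (p + s • u) (s • u)) = φ (p + u) := by
  have hd : ∀ s : ℝ, HasDerivAt (fun s : ℝ => s ^ (m + 1) * φ (p + s • u))
      (s ^ m * (((m + 1 : ℕ) : ℝ) * φ (p + s • u) + fderiv ℝ φ (p + s • u) (s • u))) s := by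
    intro s
    have h1 : HasDerivAt (fun s : ℝ => p + s • u) u s := by
      simpa using ((hasDerivAt_id s).smul_const u).const_add p
    have h2 := ((hφ.differentiable (by simp)) (p + s • u)).hasFDerivAt.comp_hasDerivAt s h1
    have h3 := (hasDerivAt_pow (m + 1) s).mul h2
    refine h3.congr_deriv ?_
    simp only [Nat.add_sub_cancel, Function.comp, map_smul, smul_eq_mul]
    ring
  have hc : Continuous (fun s : ℝ => s ^ m * (((m + 1 : ℕ) : ℝ) * φ (p + s • u) +
      fderiv ℝ φ (p + s • u) (s • u))) := by
    have h1 : Continuous fun s : ℝ => p + s • u := by fun_prop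
    have h2 : Continuous fun s : ℝ => fderiv ℝ φ (p + s • u) (s • u) :=
      ((hφ.continuous_fderiv (by simp)).comp h1).clm_apply (by fun_prop)
    have h3 : Continuous fun s : ℝ => φ (p + s • u) := hφ.continuous.comp h1
    fun_prop
  rw [intervalIntegral.integral_eq_sub_of_hasDerivAt (fun s _ => hd s) (hc.intervalIntegrable _ _)]
  simp

theorem _root_.Continuous.integrableOn_of_isCompact {X E : Type*} [TopologicalSpace X]
    [MeasurableSpace X] [OpensMeasurableSpace X] [T2Space X] [NormedAddCommGroup E]
    [SecondCountableTopologyEither X E] {μ : Measure X} [IsFiniteMeasureOnCompacts μ] {f : X → E}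
    {s : Set X} (hf : Continuous f) (hs : IsCompact s) : IntegrableOn f s μ :=
  hf.continuousOn.integrableOn_compact hs

namespace Cell

variable {d : ℕ} (K : Cell d)

theorem lam_eq (i : Fin (d + 1)) (x : Sp d) : K.lam i x = K.lam i 0 + ⟪K.grad i, x⟫ := by
  rw [← lam_add, zero_add]

theorem contDiff_lam {n : WithTop ℕ∞} (i : Fin (d + 1)) : ContDiff ℝ n (K.lam i) := by
  rw [funext (K.lam_eq i)]
  exact contDiff_const.add (innerSL ℝ (K.grad i)).contDiff

theorem hasFDerivAt_lam (i : Fin (d + 1)) (x : Sp d) :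
    HasFDerivAt (K.lam i) (innerSL ℝ (K.grad i)) x := by
  rw [funext (K.lam_eq i)]
  exact (innerSL ℝ (K.grad i)).hasFDerivAt.const_add _

open Module in
-- The hyperplane carrying the facet is an isometric copy of the orthogonal complement of `∇λ_i`.
-- This has dimension `m`, so its Euclidean Hausdorff measure is the Lebesgue measure.
theorem integral_spaceFacet {m : ℕ} (K : Cell (m + 1)) (i : Fin (m + 1 + 1)) (y₀ : Sp (m + 1))
    (hy : K.lam i y₀ = 0) (φ : Sp (m + 1) → ℝ) :
    ∫ x in K.spaceFacet i, φ x ∂μHE[m] =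
      ∫ v : (ℝ ∙ K.grad i)ᗮ, K.space.indicator φ (y₀ + v) := by
  have hf : finrank ℝ (ℝ ∙ K.grad i)ᗮ = m := by
    have : Fact (finrank ℝ (Sp (m + 1)) = m + 1) := ⟨by simp⟩
    exact Submodule.finrank_orthogonal_span_singleton (K.grad_ne_zero (by omega) i)
  set j : (ℝ ∙ K.grad i)ᗮ → Sp (m + 1) := fun v => y₀ + v with hj
  have hiso : Isometry j := (IsometryEquiv.addLeft y₀).isometry.comp isometry_subtype_coe
  have hjc : MeasurableEmbedding j := hiso.isClosedEmbedding.measurableEmbedding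
  have hr : K.spaceFacet i = K.space ∩ range j := by
    ext x
    rw [mem_spaceFacet, mem_inter_iff]
    refine and_congr_right fun _ => ⟨fun h => ⟨⟨x - y₀, ?_⟩, by simp [hj]⟩, ?_⟩
    · rw [Submodule.mem_orthogonal_singleton_iff_inner_right, ← lam_sub, h, hy, sub_zero]
    · rintro ⟨v, rfl⟩
      rw [hj, lam_add, hy, Submodule.mem_orthogonal_singleton_iff_inner_right.1 v.2, zero_add]
  have hmap : (volume : Measure (ℝ ∙ K.grad i)ᗮ).map j = μHE[m].restrict (range j) := by
    rw [← InnerProductSpace.euclideanHausdorffMeasure_eq_volume, hf,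
      hiso.map_euclideanHausdorffMeasure]
  rw [hr, ← Measure.restrict_restrict K.measurableSet_space, ← hmap,
    ← integral_indicator K.measurableSet_space, hjc.integral_map]

/-- The cone formula: the integral over a facet as an integral over the simplex. -/
theorem exists_integral_facet_eq (hd : 1 ≤ d) (i : Fin (d + 1)) :
    ∃ κ : ℝ, κ ≠ 0 ∧ ∀ φ : Sp d → ℝ, ContDiff ℝ 1 φ →
      ∫ x in K.spaceFacet i, φ x ∂μHE[d - 1] =
        κ * ∫ x in K.space, ((d : ℝ) * φ x + fderiv ℝ φ x (x - K.vert i)) := by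
  obtain ⟨m, rfl⟩ : ∃ m, d = m + 1 := ⟨d - 1, by omega⟩
  obtain ⟨j, hj⟩ : ∃ j : Fin (m + 1 + 1), j ≠ i := exists_ne i
  set p := K.vert i
  set y₀ := K.vert j
  set e := y₀ - p with he
  have hg : ⟪K.grad i, e⟫ = (-1 : ℝ) := by
    rw [he, inner_grad_sub_vert, lam_vert, if_neg hj.symm, if_pos rfl]; norm_num
  obtain ⟨c, c0, hc⟩ := exists_integral_hyperplaneCoords (K.grad i) e hg p
  refine ⟨c⁻¹, inv_ne_zero c0, fun φ hφ => ?_⟩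
  rw [eq_inv_mul_iff_mul_eq₀ c0]
  have hy0 : K.lam i y₀ = 0 := by rw [lam_vert, if_neg hj.symm]
  have hf : Module.finrank ℝ (ℝ ∙ K.grad i)ᗮ = m := by
    have : Fact (Module.finrank ℝ (Sp (m + 1)) = m + 1) := ⟨by simp⟩
    exact Submodule.finrank_orthogonal_span_singleton (K.grad_ne_zero (by omega) i)
  have hpy : ∀ v : Sp (m + 1), p + (e + v) = y₀ + v := fun v => by rw [he]; abel
  set F : Sp (m + 1) → ℝ := fun x => ((m + 1 : ℕ) : ℝ) * φ x + fderiv ℝ φ x (x - p) with hF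
  have hFc : Continuous F := by
    have h1 := hφ.continuous
    have h2 : Continuous fun x => fderiv ℝ φ x (x - p) :=
      (hφ.continuous_fderiv (by simp)).clm_apply (by fun_prop)
    fun_prop
  have hint : Integrable (K.space.indicator F) :=
    (hFc.continuousOn.integrableOn_compact K.isCompact_space).integrable_indicator
      K.measurableSet_space
  rw [Nat.add_sub_cancel, K.integral_spaceFacet i y₀ hy0, ← integral_indicator K.measurableSet_space,
    hc _ hint]
  congr 1
  -- the section of the simplex with a hyperplane parallel to the facet
  set F' : Set (ℝ ∙ K.grad i)ᗮ := {v | y₀ + (v : Sp (m + 1)) ∈ K.space} with hF'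
  have hlamv : ∀ v : (ℝ ∙ K.grad i)ᗮ, ⟪K.grad i, (v : Sp (m + 1))⟫ = 0 := fun v =>
    Submodule.mem_orthogonal_singleton_iff_inner_right.1 v.2
  -- The point `p + s (e + v)` is the convex combination of the apex `p` and `y₀ + v`: the slice at
  -- height `s` is the facet scaled by `s`. The bound `s ≤ 1` enters only through the `i`-th
  -- coordinate, which equals `1 - s`.
  have hmem : ∀ s : ℝ, 0 < s → s ≤ 1 → ∀ v : (ℝ ∙ K.grad i)ᗮ,
      (p + (s • e + ((s • v : (ℝ ∙ K.grad i)ᗮ) : Sp (m + 1))) ∈ K.space ↔ v ∈ F') := by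
    intro s hs hs1 v
    have hk : ∀ k, K.lam k (p + (s • e + ((s • v : (ℝ ∙ K.grad i)ᗮ) : Sp (m + 1)))) =
        (1 - s) * K.lam k p + s * K.lam k (y₀ + v) := by
      intro k
      rw [Submodule.coe_smul, ← smul_add, lam_add, inner_smul_right, ← hpy, lam_add]
      ring
    rw [hF', mem_ofPred_eq, mem_space, mem_space]
    refine forall_congr' fun k => ?_
    rw [hk, lam_vert]
    by_cases hki : k = i
    · rw [if_pos hki, hki, lam_add, hy0, hlamv]
      constructor <;> intro <;> linarith
    · rw [if_neg hki, mul_zero, zero_add]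
      exact mul_nonneg_iff_of_pos_left hs
  have hiso : Isometry fun v : (ℝ ∙ K.grad i)ᗮ => y₀ + (v : Sp (m + 1)) :=
    (IsometryEquiv.addLeft y₀).isometry.comp isometry_subtype_coe
  have hF'c : IsCompact F' :=
    (Topology.IsClosedEmbedding.isCompact_preimage
      (f := fun v : (ℝ ∙ K.grad i)ᗮ => y₀ + (v : Sp (m + 1)))
      hiso.isClosedEmbedding K.isCompact_space)
  have hF'm : MeasurableSet F' := hF'c.measurableSet
  set Gs : ℝ → (ℝ ∙ K.grad i)ᗮ → ℝ := fun s v => s ^ m * (((m + 1 : ℕ) : ℝ) *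
    φ (p + s • (e + v)) + fderiv ℝ φ (p + s • (e + v)) (s • (e + v))) with hGs
  have hslice : ∀ s : ℝ, 0 < s → s ≤ 1 →
      ∫ v : (ℝ ∙ K.grad i)ᗮ, K.space.indicator F (p + (s • e + (v : Sp (m + 1)))) =
        ∫ v in F', Gs s v := by
    intro s hs hs1
    -- Rescaling the slice to the facet costs a factor `s ^ m`, because the hyperplane has dimension
    -- `m`; this is the power in `Gs` and in `integral_cone_ray`.
    have h1 := Measure.integral_comp_smul (volume : Measure (ℝ ∙ K.grad i)ᗮ)
      (fun v : (ℝ ∙ K.grad i)ᗮ => K.space.indicator F (p + (s • e + (v : Sp (m + 1))))) s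
    rw [hf, abs_of_pos (by positivity), smul_eq_mul, eq_inv_mul_iff_mul_eq₀ (by positivity)] at h1
    rw [← h1, ← integral_const_mul, ← integral_indicator hF'm]
    refine integral_congr_ae (ae_of_all _ fun v => ?_)
    by_cases hv : v ∈ F'
    · simp only [indicator_of_mem hv, indicator_of_mem ((hmem s hs hs1 v).2 hv), hF, hGs]
      rw [Submodule.coe_smul, ← smul_add, add_sub_cancel_left]
    · simp only [indicator_of_notMem hv,
        indicator_of_notMem (mt (hmem s hs hs1 v).1 hv), mul_zero]
  -- Outside the unit interval the hyperplane misses the simplex, because `λ_i = 1 - s` on it.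
  have hzero : ∀ s : ℝ, s ∉ Icc (0 : ℝ) 1 →
      ∫ v : (ℝ ∙ K.grad i)ᗮ, K.space.indicator F (p + (s • e + (v : Sp (m + 1)))) = 0 := by
    intro s hs
    refine integral_eq_zero_of_ae (ae_of_all _ fun v => indicator_of_notMem (fun hk => hs ?_) _)
    have h1 : K.lam i (p + (s • e + (v : Sp (m + 1)))) = 1 - s := by
      rw [lam_add, inner_add_right, inner_smul_right, hg, hlamv, lam_vert, if_pos rfl]; ring
    have h2 := K.lam_nonneg hk i
    have h3 := K.lam_le_one hk i
    constructor <;> linarith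
  have hGc : Continuous (fun q : ℝ × (ℝ ∙ K.grad i)ᗮ => Gs q.1 q.2) := by
    have h1 : Continuous fun q : ℝ × (ℝ ∙ K.grad i)ᗮ => p + q.1 • (e + (q.2 : Sp (m + 1))) := by
      fun_prop
    have h2 : Continuous fun q : ℝ × (ℝ ∙ K.grad i)ᗮ =>
        fderiv ℝ φ (p + q.1 • (e + (q.2 : Sp (m + 1)))) (q.1 • (e + (q.2 : Sp (m + 1)))) :=
      ((hφ.continuous_fderiv (by simp)).comp h1).clm_apply (by fun_prop)
    have h3 := hφ.continuous.comp h1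
    simp only [Function.comp_def] at h3
    simp only [hGs]
    fun_prop
  calc ∫ v : (ℝ ∙ K.grad i)ᗮ, K.space.indicator φ (y₀ + v)
      = ∫ v in F', φ (y₀ + v) := by
        rw [← integral_indicator hF'm]
        rfl
    -- Each value on the facet is the integral of a derivative along the ray from the apex.
    -- Exchanging the integrals then reassembles the simplex from its slices.
    _ = ∫ v in F', ∫ s in Ioc (0 : ℝ) 1, Gs s v := by
        refine integral_congr_ae (ae_of_all _ fun v => ?_)
        have := integral_cone_ray hφ m p (e + (v : Sp (m + 1)))
        rw [intervalIntegral.integral_of_le zero_le_one, hpy] at this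
        exact this.symm
    _ = ∫ s in Ioc (0 : ℝ) 1, ∫ v in F', Gs s v := by
        refine integral_integral_swap (f := fun v s => Gs s v) ?_
        rw [Measure.prod_restrict]
        refine IntegrableOn.mono_set ?_ (prod_mono_right Ioc_subset_Icc_self)
        exact (hGc.comp continuous_swap).continuousOn.integrableOn_compact
          (hF'c.prod isCompact_Icc)
    _ = ∫ s in Ioc (0 : ℝ) 1, ∫ v : (ℝ ∙ K.grad i)ᗮ,
          K.space.indicator F (p + (s • e + (v : Sp (m + 1)))) :=
        setIntegral_congr_fun measurableSet_Ioc fun s hs => (hslice s hs.1 hs.2).symm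
    _ = _ := by
        rw [← integral_Icc_eq_integral_Ioc]
        exact setIntegral_eq_integral_of_forall_compl_eq_zero fun s hs => hzero s hs

/-- The fields `λ_j λ_k (p_j - p_k)` have no normal trace on the boundary of the simplex. -/
theorem integral_lam_sub_lam_mul (hd : 1 ≤ d) (j k : Fin (d + 1)) {φ : Sp d → ℝ}
    (hφ : ContDiff ℝ 1 φ) :
    ∫ x in K.space, (K.lam j x - K.lam k x) * φ x =
      ∫ x in K.space, K.lam j x * K.lam k x * fderiv ℝ φ x (K.vert j - K.vert k) := by
  rcases eq_or_ne j k with rfl | hjk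
  · simp
  set ψ : Sp d → ℝ := fun x => K.lam j x * K.lam k x * φ x with hψ
  have hl : ∀ i x, HasFDerivAt (K.lam i) (innerSL ℝ (K.grad i)) x := K.hasFDerivAt_lam
  have hψd : ∀ x, HasFDerivAt ψ ((K.lam j x * K.lam k x) • fderiv ℝ φ x +
      φ x • (K.lam j x • innerSL ℝ (K.grad k) + K.lam k x • innerSL ℝ (K.grad j))) x := fun x =>
    ((hl j x).mul (hl k x)).mul (hφ.differentiable (by simp) x).hasFDerivAt
  have hψc : ContDiff ℝ 1 ψ := ((K.contDiff_lam j).mul (K.contDiff_lam k)).mul hφ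
  -- The product `ψ` vanishes on the facets opposite to `p_j` and `p_k`, so the cone formula at
  -- these two vertices has left side zero; its factor `κ` is nonzero and can be cancelled.
  have hz : ∀ i, i = j ∨ i = k →
      ∫ x in K.space, ((d : ℝ) * ψ x + fderiv ℝ ψ x (x - K.vert i)) = 0 := by
    intro i hi
    obtain ⟨κ, κ0, hκ⟩ := K.exists_integral_facet_eq hd i
    have h1 := hκ ψ hψc
    rw [setIntegral_eq_zero_of_forall_eq_zero] at h1
    · exact (mul_eq_zero.1 h1.symm).resolve_left κ0
    · intro x hx
      have := (K.mem_spaceFacet.1 hx).2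
      rcases hi with rfl | rfl <;> simp [hψ, this]
  have hint : ∀ v : Sp d → Sp d, Continuous v →
      IntegrableOn (fun x => (d : ℝ) * ψ x + fderiv ℝ ψ x (v x)) K.space := fun v hv => by
    refine Continuous.integrableOn_of_isCompact ?_ K.isCompact_space
    have h1 := hψc.continuous
    have h2 : Continuous fun x => fderiv ℝ ψ x (v x) :=
      (hψc.continuous_fderiv (by simp)).clm_apply hv
    fun_prop
  -- In the difference of the two cone formulas the terms `d ψ` cancel, and what remains is the
  -- derivative of `ψ` in the fixed direction `p_j - p_k`, along which `λ_j` and `λ_k` have slopes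
  -- `1` and `-1`.
  have h0 : ∫ x in K.space, (((d : ℝ) * ψ x + fderiv ℝ ψ x (x - K.vert k)) -
      ((d : ℝ) * ψ x + fderiv ℝ ψ x (x - K.vert j))) = 0 := by
    rw [integral_sub (hint _ (by fun_prop)) (hint _ (by fun_prop)), hz k (Or.inr rfl),
      hz j (Or.inl rfl), sub_zero]
  rw [← sub_eq_zero, ← integral_sub, ← neg_eq_zero, ← integral_neg, ← h0]
  · refine integral_congr_ae (ae_of_all _ fun x => ?_)
    have hv : x - K.vert k = (x - K.vert j) + (K.vert j - K.vert k) := by abel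
    have hgj : ⟪K.grad j, K.vert j - K.vert k⟫ = (1 : ℝ) := by
      rw [inner_grad_sub_vert, lam_vert, if_pos rfl, if_neg hjk]; norm_num
    have hgk : ⟪K.grad k, K.vert j - K.vert k⟫ = (-1 : ℝ) := by
      rw [inner_grad_sub_vert, lam_vert, if_pos rfl, if_neg hjk.symm]; norm_num
    simp only [hv, map_add, (hψd x).fderiv, add_apply,
      smul_apply, innerSL_apply_apply, hgj, hgk, smul_eq_mul]
    ring
  · refine Continuous.integrableOn_of_isCompact ?_ K.isCompact_space
    have h1 := hφ.continuous
    have h2 := K.continuous_lam j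
    have h3 := K.continuous_lam k
    fun_prop
  · refine Continuous.integrableOn_of_isCompact ?_ K.isCompact_space
    have h1 : Continuous fun x => fderiv ℝ φ x (K.vert j - K.vert k) :=
      (hφ.continuous_fderiv (by simp)).clm_apply continuous_const
    have h2 := K.continuous_lam j
    have h3 := K.continuous_lam k
    fun_prop

end Cell

end HeatDPG

end

noncomputable section

namespace HeatDPG

/-! ### Density of smooth functions -/

section Mollify

open Filter Topology
open scoped ENNReal Convolution

variable {V E : Type*} [NormedAddCommGroup V] [NormedSpace ℝ V] [FiniteDimensional ℝ V]
  [MeasurableSpace V] [BorelSpace V] {μ : Measure V} [μ.IsAddHaarMeasure]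
  [NormedAddCommGroup E]

theorem map_affine {r : ℝ} (hr : r ≠ 0) (b : V) :
    μ.map (fun z => r • z + b) = ENNReal.ofReal |(r ^ Module.finrank ℝ V)⁻¹| • μ := by
  have h1 : (fun z : V => r • z + b) = (fun z => z + b) ∘ (fun z => r • z) := rfl
  rw [h1, ← Measure.map_map (measurable_add_const b) (measurable_const_smul r),
    Measure.map_addHaar_smul μ hr, Measure.map_smul, map_add_right_eq_self]

theorem quasiMeasurePreserving_affine {r : ℝ} (hr : r ≠ 0) (b : V) :
    Measure.QuasiMeasurePreserving (fun z : V => r • z + b) μ μ :=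
  ⟨by fun_prop, by rw [map_affine hr]; exact Measure.smul_absolutelyContinuous⟩

theorem eLpNorm_comp_affine {u : V → E} (hu : AEStronglyMeasurable u μ) {r : ℝ} (hr : r ≠ 0)
    (b : V) : eLpNorm (fun z => u (r • z + b)) 2 μ =
      ENNReal.ofReal |(r ^ Module.finrank ℝ V)⁻¹| ^ (1 / 2 : ℝ) * eLpNorm u 2 μ := by
  have h2 : (fun z => u (r • z + b)) = u ∘ (fun z => r • z + b) := rfl
  rw [h2, ← eLpNorm_map_measure (μ := μ) (by
    rw [map_affine hr]; exact hu.mono_ac Measure.smul_absolutelyContinuous)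
    (by fun_prop), map_affine hr, eLpNorm_smul_measure_of_ne_top (by simp)]
  simp

theorem sq_eLpNorm_two {α : Type*} [MeasurableSpace α] (ν : Measure α) (f : α → E) :
    eLpNorm f 2 ν ^ 2 = ∫⁻ x, ‖f x‖ₑ ^ 2 ∂ν := by
  have := eLpNorm_nnreal_pow_eq_lintegral (μ := ν) (f := f) (p := 2) (by norm_num)
  simpa using this

variable [NormedSpace ℝ E]

/-- Composition with affine maps close to the identity is continuous in `L²`. -/
theorem exists_eLpNorm_comp_affine_sub_le {u : V → E} (hu : MemLp u 2 μ) (z₀ : V) {η : ℝ≥0∞}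
    (hη : η ≠ 0) : ∃ δ > 0, ∀ ε : ℝ, 0 ≤ ε → ε < δ → ∀ w : V, ‖w‖ ≤ δ →
      eLpNorm (fun z => u ((1 - ε) • z + (ε • z₀ - w)) - u z) 2 μ ≤ η := by
  rcases eq_or_ne η ⊤ with rfl | hηt
  · exact ⟨1, one_pos, fun _ _ _ _ _ => le_top⟩
  set n := Module.finrank ℝ V
  -- This bounds the Jacobian factor `(1 - ε)^{-n/2}` for `ε ≤ 1/2`. The error splits into `(C + 1)
  -- κ` from replacing `u` by a continuous `v` with compact support and `η / 2` from the uniform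
  -- continuity of `v`.
  set C : ℝ≥0∞ := ENNReal.ofReal (2 ^ n) ^ (1 / 2 : ℝ) with hC
  have hCt : C + 1 ≠ ⊤ := by simp [hC]
  obtain ⟨κ, κ0, hκ⟩ := ENNReal.exists_nnreal_pos_mul_lt hCt (ENNReal.half_pos hη).ne'
  obtain ⟨v, hvs, huv, hvc, hvm⟩ := hu.exists_hasCompactSupport_eLpNorm_sub_le (by simp)
    (ENNReal.coe_ne_zero.2 κ0.ne')
  obtain ⟨R, hR⟩ := hvs.isCompact.isBounded.subset_closedBall (0 : V)
  have hv0 : ∀ z, R < ‖z‖ → v z = 0 := fun z hz => by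
    by_contra h0
    have := hR (subset_tsupport _ h0)
    rw [mem_closedBall_zero_iff] at this
    linarith
  -- For `‖z‖ > R'` both `z` and its image under the affine map lie outside the support of `v`,
  -- because the map shrinks by at most `1/2` and shifts by at most `(‖z₀‖ + 1) / 2`.
  set R' := 2 * (|R| + ‖z₀‖ + 1) with hR'
  set B := Metric.closedBall (0 : V) R' with hB
  have hμB : μ B ^ (1 / 2 : ℝ) ≠ ⊤ := by
    simp [(isCompact_closedBall (0 : V) R').measure_lt_top.ne, hB]
  -- The pointwise tolerance on `B` is chosen such that its `L²` norm over `B` is below `η / 2`.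
  obtain ⟨c, c0, hc⟩ := ENNReal.exists_nnreal_pos_mul_lt hμB (ENNReal.half_pos hη).ne'
  obtain ⟨δ₁, δ₁0, hδ₁⟩ := Metric.uniformContinuous_iff.1
    (hvs.uniformContinuous_of_continuous hvc) c (by exact_mod_cast c0)
  have hz0 := norm_nonneg z₀
  have hRa := abs_nonneg R
  have hden : 0 < R' + ‖z₀‖ + 1 := by positivity
  refine ⟨min (1 / 2) (δ₁ / (2 * (R' + ‖z₀‖ + 1))), by positivity, fun ε ε0 hε w hw => ?_⟩
  have hε1 : ε < 1 / 2 := hε.trans_le (min_le_left _ _)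
  have hw1 : ‖w‖ ≤ 1 / 2 := hw.trans (min_le_left _ _)
  have hε2 : ε * (2 * (R' + ‖z₀‖ + 1)) < δ₁ :=
    (lt_div_iff₀ (by positivity)).1 (hε.trans_le (min_le_right _ _))
  have hw2 : ‖w‖ * (2 * (R' + ‖z₀‖ + 1)) ≤ δ₁ :=
    (le_div_iff₀ (by positivity)).1 (hw.trans (min_le_right _ _))
  have hpt : ∀ z, ‖v ((1 - ε) • z + (ε • z₀ - w)) - v z‖ ≤ ‖B.indicator (fun _ => (c : ℝ)) z‖ := by
    intro z
    by_cases hz : z ∈ B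
    · rw [indicator_of_mem hz, Real.norm_of_nonneg c.coe_nonneg, ← dist_eq_norm]
      refine (hδ₁ ?_).le
      rw [dist_eq_norm, show (1 - ε) • z + (ε • z₀ - w) - z = ε • (z₀ - z) - w by module]
      have hz' : ‖z‖ ≤ R' := mem_closedBall_zero_iff.1 hz
      have h1 : ‖ε • (z₀ - z) - w‖ ≤ ε * (‖z₀‖ + R') + ‖w‖ := by
        refine (norm_sub_le _ _).trans ?_
        rw [norm_smul, Real.norm_of_nonneg ε0]
        gcongr
        exact (norm_sub_le _ _).trans (by gcongr)
      have h2 : 0 ≤ ‖w‖ * (R' + ‖z₀‖) := by positivity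
      nlinarith
    · rw [indicator_of_notMem hz, norm_zero]
      have hz' : R' < ‖z‖ := by simpa [hB] using hz
      have h1 : R < ‖z‖ := by linarith [le_abs_self R]
      have h2 : R < ‖(1 - ε) • z + (ε • z₀ - w)‖ := by
        have h3 : (1 - ε) * ‖z‖ ≤ ‖(1 - ε) • z + (ε • z₀ - w)‖ + (ε * ‖z₀‖ + ‖w‖) := by
          calc (1 - ε) * ‖z‖ = ‖(1 - ε) • z‖ := by
                rw [norm_smul, Real.norm_of_nonneg (by linarith)]
            _ = ‖((1 - ε) • z + (ε • z₀ - w)) - (ε • z₀ - w)‖ := by congr 1; abel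
            _ ≤ _ := (norm_sub_le _ _).trans (by
                gcongr
                refine (norm_sub_le _ _).trans ?_
                rw [norm_smul, Real.norm_of_nonneg ε0])
        nlinarith [le_abs_self R]
      rw [hv0 _ h1, hv0 _ h2, sub_zero, norm_zero]
  have h3 : eLpNorm (fun z => v ((1 - ε) • z + (ε • z₀ - w)) - v z) 2 μ ≤ η / 2 := by
    refine (eLpNorm_mono hpt).trans ((eLpNorm_indicator_const_le _ _).trans ?_)
    refine le_trans (le_of_eq ?_) hc.le
    rw [Real.enorm_eq_ofReal c.coe_nonneg, ENNReal.ofReal_coe_nnreal]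
    simp
  have hum := hu.1.sub hvm.1
  have h2 : eLpNorm (fun z => (u - v) ((1 - ε) • z + (ε • z₀ - w))) 2 μ ≤ C * κ := by
    have h1ε : 0 < 1 - ε := by linarith
    rw [eLpNorm_comp_affine hum h1ε.ne', abs_of_pos (by positivity), ← inv_pow, hC]
    gcongr
    rw [inv_le_comm₀ h1ε (by norm_num)]
    linarith
  have hcomp : AEStronglyMeasurable (fun z => (u - v) ((1 - ε) • z + (ε • z₀ - w))) μ :=
    hum.comp_quasiMeasurePreserving (quasiMeasurePreserving_affine (by linarith) _)
  calc eLpNorm (fun z => u ((1 - ε) • z + (ε • z₀ - w)) - u z) 2 μ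
      = eLpNorm ((fun z => (u - v) ((1 - ε) • z + (ε • z₀ - w))) +
        ((fun z => v ((1 - ε) • z + (ε • z₀ - w)) - v z) - (u - v))) 2 μ := by
        congr 1
        funext z
        simp only [Pi.add_apply, Pi.sub_apply]
        abel
    _ ≤ C * κ + (η / 2 + κ) := by
        refine (eLpNorm_add_le hcomp ((Continuous.aestronglyMeasurable (by fun_prop)).sub hum)
          one_le_two).trans ?_
        gcongr
        refine (eLpNorm_sub_le (Continuous.aestronglyMeasurable (by fun_prop)) hum
          one_le_two).trans ?_
        gcongr
    _ = κ * (C + 1) + η / 2 := by ring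
    _ ≤ η / 2 + η / 2 := by gcongr
    _ = η := ENNReal.add_halves η

/-- Jensen's inequality, obtained from the inclusion of `L²` in `L¹` over a probability space. -/
theorem enorm_integral_sq_le {α : Type*} [MeasurableSpace α] (ν : Measure α)
    [IsProbabilityMeasure ν] (f : α → E) (hf : AEStronglyMeasurable f ν) :
    ‖∫ x, f x ∂ν‖ₑ ^ 2 ≤ ∫⁻ x, ‖f x‖ₑ ^ 2 ∂ν := by
  rw [← sq_eLpNorm_two]
  gcongr
  refine (enorm_integral_le_lintegral_enorm f).trans ?_
  rw [← eLpNorm_one_eq_lintegral_enorm]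
  exact eLpNorm_le_eLpNorm_of_exponent_le (by norm_num) hf

variable [CompleteSpace E]

/-- Averages of compositions with affine maps close to the identity. -/
theorem eLpNorm_average_comp_affine_sub_le {u : V → E} (hu : StronglyMeasurable u)
    (hli : LocallyIntegrable u μ) {ε : ℝ} (z₀ : V) (φ : ContDiffBump (0 : V)) {η : ℝ≥0∞}
    (h : ∀ w : V, ‖w‖ ≤ φ.rOut →
      eLpNorm (fun z => u ((1 - ε) • z + (ε • z₀ - w)) - u z) 2 μ ≤ η) :
    eLpNorm (fun z => (φ.normed μ ⋆[ContinuousLinearMap.lsmul ℝ ℝ, μ] u)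
      ((1 - ε) • z + ε • z₀) - u z) 2 μ ≤ η := by
  set k : V → ℝ := φ.normed μ with hk
  have hk0 : ∀ w, 0 ≤ k w := φ.nonneg_normed
  have hkc : Continuous k := φ.continuous_normed
  -- Mollification is the expectation of translates with respect to this probability measure.
  -- Jensen's inequality and Tonelli's theorem then bound the error of the average by the worst
  -- error of a single translate.
  set ν : Measure V := μ.withDensity fun w => ENNReal.ofReal (k w) with hν
  have hν1 : IsProbabilityMeasure ν := ⟨by
    rw [hν, withDensity_apply _ MeasurableSet.univ, Measure.restrict_univ,
      ← ofReal_integral_eq_lintegral_ofReal φ.integrable_normed (ae_of_all _ hk0),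
      φ.integral_normed, ENNReal.ofReal_one]⟩
  have hint : ∀ z : V, Integrable (fun w => u ((1 - ε) • z + (ε • z₀ - w))) ν := by
    intro z
    rw [hν, integrable_withDensity_iff_integrable_smul' (by fun_prop) (by simp)]
    have h1 := (φ.hasCompactSupport_normed (μ := μ)).convolutionExists_left
      (ContinuousLinearMap.lsmul ℝ ℝ) hkc hli ((1 - ε) • z + ε • z₀)
    refine h1.congr (ae_of_all _ fun w => ?_)
    simp [ENNReal.toReal_ofReal (hk0 w), add_sub_assoc, ← hk]
  have hconv : ∀ z : V, (k ⋆[ContinuousLinearMap.lsmul ℝ ℝ, μ] u) ((1 - ε) • z + ε • z₀) - u z =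
      ∫ w, (u ((1 - ε) • z + (ε • z₀ - w)) - u z) ∂ν := by
    intro z
    rw [integral_sub (hint z) (integrable_const _), integral_const, probReal_univ, one_smul, hν,
      integral_withDensity_eq_integral_toReal_smul (by fun_prop) (by simp)]
    congr 1
    refine integral_congr_ae (ae_of_all _ fun w => ?_)
    simp [ENNReal.toReal_ofReal (hk0 w), add_sub_assoc]
  have hmeas : StronglyMeasurable (fun q : V × V =>
      u ((1 - ε) • q.1 + (ε • z₀ - q.2)) - u q.1) :=
    (hu.comp_measurable (by fun_prop)).sub (hu.comp_measurable measurable_fst)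
  rw [← ENNReal.pow_le_pow_left_iff two_ne_zero, sq_eLpNorm_two]
  calc ∫⁻ z, ‖(k ⋆[ContinuousLinearMap.lsmul ℝ ℝ, μ] u) ((1 - ε) • z + ε • z₀) - u z‖ₑ ^ 2 ∂μ
      ≤ ∫⁻ z, ∫⁻ w, ‖u ((1 - ε) • z + (ε • z₀ - w)) - u z‖ₑ ^ 2 ∂ν ∂μ := by
        refine lintegral_mono fun z => ?_
        rw [hconv z]
        exact enorm_integral_sq_le ν _ (hmeas.comp_measurable measurable_prodMk_left).aestronglyMeasurable
    _ = ∫⁻ w, ∫⁻ z, ‖u ((1 - ε) • z + (ε • z₀ - w)) - u z‖ₑ ^ 2 ∂μ ∂ν :=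
        lintegral_lintegral_swap ((hmeas.enorm.pow_const 2).aemeasurable)
    _ ≤ ∫⁻ w, η ^ 2 ∂ν := by
        refine lintegral_mono_ae ?_
        have hs : ∀ᵐ w ∂ν, ‖w‖ ≤ φ.rOut := by
          rw [hν, ae_withDensity_iff (by fun_prop)]
          refine ae_of_all _ fun w hw => ?_
          have : w ∈ Function.support k := fun h0 => hw (by rw [h0, ENNReal.ofReal_zero])
          rw [hk, φ.support_normed_eq, mem_ball_zero_iff] at this
          exact this.le
        filter_upwards [hs] with w hw
        rw [← sq_eLpNorm_two]
        gcongr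
        exact h w hw
    _ = η ^ 2 := by rw [lintegral_const, measure_univ, mul_one]

end Mollify

end HeatDPG

end

/-! ### Smooth approximation up to the boundary of a cell -/

noncomputable section

namespace HeatDPG

open scoped Convolution in
/-- Functions with a spatial gradient on a cell are approximated by smooth functions, up to the
boundary of the cell. -/
theorem Cell.exists_contDiff_approx {d : ℕ} (K : Cell d) {S : Set (TS d)}
    (hS : K.openCell ⊆ S) {u : TS d → ℝ} {g : TS d → Sp d}
    (hu : MemLp u 2 (volume.restrict K.openCell)) (hg : MemLp g 2 (volume.restrict K.openCell))
    (h : HasWeakGradX S K.openCell u g) {η : ENNReal} (hη : η ≠ 0) :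
    ∃ φ : TS d → ℝ, ContDiff ℝ ∞ φ ∧
      eLpNorm (fun z => φ z - u z) 2 (volume.restrict K.openCell) ≤ η ∧
      eLpNorm (fun z => gradX φ z - g z) 2 (volume.restrict K.openCell) ≤ η := by
  set U := K.openCell with hU
  have hUm : MeasurableSet U := K.isOpen_openCell.measurableSet
  -- strongly measurable extensions by zero
  set u' : TS d → ℝ := U.indicator (hu.1.mk u) with hu'
  set g' : TS d → Sp d := U.indicator (hg.1.mk g) with hg'
  have hus : StronglyMeasurable u' := hu.1.stronglyMeasurable_mk.indicator hUm
  have hgs : StronglyMeasurable g' := hg.1.stronglyMeasurable_mk.indicator hUm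
  have huu : ∀ᵐ z, z ∈ U → u z = u' z := by
    rw [← ae_restrict_iff' hUm]
    filter_upwards [hu.1.ae_eq_mk, ae_restrict_mem hUm] with z hz hzU
    rw [hz, hu', indicator_of_mem hzU]
  have hgg : ∀ᵐ z, z ∈ U → g z = g' z := by
    rw [← ae_restrict_iff' hUm]
    filter_upwards [hg.1.ae_eq_mk, ae_restrict_mem hUm] with z hz hzU
    rw [hz, hg', indicator_of_mem hzU]
  have hum : MemLp u' 2 := (memLp_indicator_iff_restrict hUm).2 (hu.ae_eq hu.1.ae_eq_mk)
  have hgm : MemLp g' 2 := (memLp_indicator_iff_restrict hUm).2 (hg.ae_eq hg.1.ae_eq_mk)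
  have huli : LocallyIntegrable u' := hum.locallyIntegrable one_le_two
  have hgli : LocallyIntegrable g' := hgm.locallyIntegrable one_le_two
  have hweak : ∀ ψ : TS d → ℝ, ContDiff ℝ ∞ ψ → HasCompactSupport ψ → tsupport ψ ⊆ U →
      ∫ z, u' z • gradX ψ z = - ∫ z, ψ z • g' z := by
    intro ψ h1 h2 h3
    have hz : ∀ z ∉ U, gradX ψ z = 0 := fun z hz => by
      have : fderiv ℝ ψ z = 0 := by
        by_contra h0
        exact hz (h3 (support_fderiv_subset ℝ h0))
      ext i
      simp [gradX, this]
    have hz' : ∀ z ∉ U, ψ z = 0 := fun z hz => image_eq_zero_of_notMem_tsupport fun h0 => hz (h3 h0)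
    have e1 : ∫ z, u' z • gradX ψ z = ∫ z in S, u z • gradX ψ z := by
      rw [setIntegral_eq_integral_of_forall_compl_eq_zero fun z hz0 => by
        rw [hz z fun h0 => hz0 (hS h0), smul_zero]]
      refine integral_congr_ae ?_
      filter_upwards [huu] with z hzu
      by_cases hzU : z ∈ U
      · rw [hzu hzU]
      · rw [hz z hzU, smul_zero, smul_zero]
    have e2 : ∫ z, ψ z • g' z = ∫ z in S, ψ z • g z := by
      rw [setIntegral_eq_integral_of_forall_compl_eq_zero fun z hz0 => by
        rw [hz' z fun h0 => hz0 (hS h0), zero_smul]]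
      refine integral_congr_ae ?_
      filter_upwards [hgg] with z hzu
      by_cases hzU : z ∈ U
      · rw [hzu hzU]
      · rw [hz' z hzU, zero_smul, zero_smul]
    rw [e1, e2, h ψ h1 h2 h3]
  obtain ⟨z₀, hz₀⟩ := K.openCell_nonempty
  obtain ⟨ρ, ρ0, hρ⟩ := Metric.isOpen_iff.1 K.isOpen_openCell z₀ hz₀
  obtain ⟨δ₁, δ₁0, hδ₁⟩ := exists_eLpNorm_comp_affine_sub_le (μ := volume) hum z₀ hη
  obtain ⟨δ₂, δ₂0, hδ₂⟩ := exists_eLpNorm_comp_affine_sub_le (μ := volume) hgm z₀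
    (ENNReal.half_pos hη).ne'
  -- The gradient of the contracted function carries the factor `1 - ε`. The resulting extra error
  -- `ε ‖g'‖` stays below `η / 2` once `ε < κ`.
  obtain ⟨κ, κ0, hκ⟩ := ENNReal.exists_nnreal_pos_mul_lt hgm.2.ne (ENNReal.half_pos hη).ne'
  obtain ⟨ε, ε0, hε⟩ : ∃ ε : ℝ, 0 < ε ∧ ε < 1 ∧ ε < δ₁ ∧ ε < δ₂ ∧ ε < κ := by
    obtain ⟨ε, h1, h2⟩ := exists_between
      (show (0 : ℝ) < min (min 1 δ₁) (min δ₂ κ) from by positivity)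
    simp only [lt_min_iff] at h2
    exact ⟨ε, h1, h2.1.1, h2.1.2, h2.2.1, h2.2.2⟩
  obtain ⟨δ, δ0, hδ⟩ : ∃ δ : ℝ, 0 < δ ∧ δ < ε * ρ ∧ δ < δ₁ ∧ δ < δ₂ := by
    obtain ⟨δ, h1, h2⟩ := exists_between
      (show (0 : ℝ) < min (ε * ρ) (min δ₁ δ₂) from by positivity)
    simp only [lt_min_iff] at h2
    exact ⟨δ, h1, h2.1, h2.2.1, h2.2.2⟩
  let B : ContDiffBump (0 : TS d) := ⟨δ / 2, δ, by positivity, by linarith⟩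
  set k : TS d → ℝ := B.normed volume with hk
  have hkd : ContDiff ℝ ∞ k := B.contDiff_normed
  have hkc : HasCompactSupport k := B.hasCompactSupport_normed
  set A : TS d → TS d := fun z => (1 - ε) • z + ε • z₀ with hA
  -- By convexity `U` contains `(1 - ε) z + ε B(z₀, ρ)`, a ball of radius `ε ρ > δ` about `A z`.
  -- Mollification at `A z` therefore sees only values inside the cell, and the extension by zero
  -- does no harm.
  have hAU : ∀ z ∈ U, Metric.closedBall (A z) δ ⊆ U := by
    intro z hz y hy
    have hy' : z₀ + ε⁻¹ • (y - A z) ∈ U := hρ (by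
      rw [mem_ball_iff_norm, add_sub_cancel_left, norm_smul, norm_inv, Real.norm_of_nonneg ε0.le,
        inv_mul_lt_iff₀ ε0]
      exact (mem_closedBall_iff_norm.1 hy).trans_lt hδ.1)
    have hconv : Convex ℝ U := (convex_Ioo _ _).prod K.convex_space.interior
    have := hconv hz hy' (show 0 ≤ 1 - ε by linarith) ε0.le (by ring)
    convert this using 1
    rw [smul_add, smul_inv_smul₀ ε0.ne']
    simp only [hA]
    abel
  set cu := k ⋆[ContinuousLinearMap.lsmul ℝ ℝ, volume] u' with hcu
  set cg := k ⋆[ContinuousLinearMap.lsmul ℝ ℝ, volume] g' with hcg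
  have hcud : ContDiff ℝ ∞ cu := hkc.contDiff_convolution_left _ hkd huli
  have hAd : ContDiff ℝ ∞ A := by
    simp only [hA]
    fun_prop
  -- The reflected kernel centred at `A z` has its support in `U` and is an admissible test function
  -- in the weak formulation; this identifies the derivative of the convolution with the convolution
  -- of the weak gradient.
  have hgrad : ∀ z ∈ U, gradX (fun z => cu (A z)) z = (1 - ε) • cg (A z) := by
    intro z hz
    set x := A z with hx
    set ψ : TS d → ℝ := fun y => k (x - y) with hψ
    have hψd : ContDiff ℝ ∞ ψ := hkd.comp (contDiff_const.sub contDiff_id)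
    have hψs : tsupport ψ ⊆ Metric.closedBall x δ := by
      refine closure_minimal (fun y hy => ?_) Metric.isClosed_closedBall
      have h1 : x - y ∈ Function.support k := hy
      rw [hk, B.support_normed_eq, mem_ball_zero_iff] at h1
      rw [mem_closedBall_iff_norm, norm_sub_rev]
      exact h1.le
    have hψc : HasCompactSupport ψ :=
      HasCompactSupport.of_support_subset_isCompact (isCompact_closedBall x δ)
        (subset_closure.trans hψs)
    have hw := hweak ψ hψd hψc (hψs.trans (hAU z hz))
    have hψg : ∀ y v, fderiv ℝ ψ y v = - fderiv ℝ k (x - y) v := by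
      intro y v
      have h1 : HasFDerivAt (fun y : TS d => x - y) (-ContinuousLinearMap.id ℝ (TS d)) y :=
        (hasFDerivAt_id y).const_sub x
      have h2 := ((hkd.differentiable (by simp)) (x - y)).hasFDerivAt.comp y h1
      rw [show ψ = k ∘ fun y => x - y from rfl, h2.fderiv]
      simp
    have hcgx : cg x = ∫ y, ψ y • g' y := by
      rw [hcg, convolution_eq_swap]
      rfl
    have hflip : cu = u' ⋆[(ContinuousLinearMap.lsmul ℝ ℝ).flip, volume] k := by
      rw [hcu, convolution_flip]
    have hcux : ∀ v, fderiv ℝ cu x v = ∫ y, fderiv ℝ k (x - y) v * u' y := by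
      intro v
      have h1 := hkc.hasFDerivAt_convolution_right
        ((ContinuousLinearMap.lsmul ℝ ℝ).flip : ℝ →L[ℝ] ℝ →L[ℝ] ℝ) huli (hkd.of_le (by simp)) x
      rw [← hflip] at h1
      rw [h1.fderiv, convolution_precompR_apply _ huli (hkc.fderiv ℝ)
        (hkd.continuous_fderiv (by simp))]
      rfl
    have i1 : Integrable fun y => u' y • gradX ψ y :=
      huli.integrable_smul_right_of_hasCompactSupport (continuous_gradX hψd) (hasCompactSupport_gradX hψc)
    have i2 : Integrable fun y => ψ y • g' y :=
      hgli.integrable_smul_left_of_hasCompactSupport hψd.continuous hψc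
    ext i
    have hi := congrArg (fun v : Sp d => EuclideanSpace.proj (𝕜 := ℝ) i v) hw
    simp only [map_neg] at hi
    rw [← ContinuousLinearMap.integral_comp_comm _ i1] at hi
    have hch : fderiv ℝ (fun z => cu (A z)) z (0, EuclideanSpace.single i 1) =
        (1 - ε) * fderiv ℝ cu x (0, EuclideanSpace.single i 1) := by
      have h1 : HasFDerivAt A ((1 - ε) • ContinuousLinearMap.id ℝ (TS d)) z :=
        ((hasFDerivAt_id z).const_smul (1 - ε)).add_const _
      have h2 := ((hcud.differentiable (by simp)) x).hasFDerivAt.comp z h1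
      rw [show (fun z => cu (A z)) = cu ∘ A from rfl, h2.fderiv]
      simp
    have h3 : gradX (fun z => cu (A z)) z i =
        fderiv ℝ (fun z => cu (A z)) z (0, EuclideanSpace.single i 1) := rfl
    have h4 : EuclideanSpace.proj (𝕜 := ℝ) i (∫ y, ψ y • g' y) = (cg x) i := by
      rw [hcgx]; rfl
    rw [h3, hch, hcux, PiLp.smul_apply, ← h4, smul_eq_mul, ← neg_eq_iff_eq_neg.2 hi,
      ← integral_neg]
    congr 1
    refine integral_congr_ae (ae_of_all _ fun y => ?_)
    have h5 : EuclideanSpace.proj (𝕜 := ℝ) i (u' y • gradX ψ y) =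
        u' y * fderiv ℝ ψ y (0, EuclideanSpace.single i 1) := rfl
    beta_reduce
    rw [h5, hψg]
    ring
  refine ⟨fun z => cu (A z), hcud.comp hAd, ?_, ?_⟩
  · calc _ = eLpNorm (fun z => cu (A z) - u' z) 2 (volume.restrict U) := by
          refine eLpNorm_congr_ae ?_
          filter_upwards [(ae_restrict_iff' hUm).2 huu] with z hz
          rw [hz]
      _ ≤ eLpNorm (fun z => cu (A z) - u' z) 2 volume := eLpNorm_restrict_le _ _ _ _
      _ ≤ η := eLpNorm_average_comp_affine_sub_le hus huli z₀ B fun w hw =>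
          hδ₁ ε ε0.le hε.2.1 w (hw.trans hδ.2.1.le)
  · have hcgm : StronglyMeasurable (fun z => cg (A z)) := by
      have h1 : Continuous cg := (hkc.contDiff_convolution_left (n := 0) _ (hkd.of_le (by simp))
        hgli).continuous
      exact (h1.comp hAd.continuous).stronglyMeasurable
    calc _ = eLpNorm ((1 - ε) • (fun z => cg (A z) - g' z) - ε • g') 2 (volume.restrict U) := by
          refine eLpNorm_congr_ae ?_
          filter_upwards [(ae_restrict_iff' hUm).2 hgg, ae_restrict_mem hUm] with z hz hzU
          rw [hz, hgrad z hzU]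
          simp only [Pi.sub_apply, Pi.smul_apply]
          module
      _ ≤ eLpNorm ((1 - ε) • (fun z => cg (A z) - g' z) - ε • g') 2 volume :=
          eLpNorm_restrict_le _ _ _ _
      _ ≤ eLpNorm ((1 - ε) • (fun z => cg (A z) - g' z)) 2 volume + eLpNorm (ε • g') 2 volume :=
          eLpNorm_sub_le ((hcgm.sub hgs).const_smul _).aestronglyMeasurable
            (hgs.const_smul ε).aestronglyMeasurable one_le_two
      _ ≤ 1 * (η / 2) + κ * eLpNorm g' 2 volume := by
          rw [eLpNorm_const_smul, eLpNorm_const_smul]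
          gcongr
          · rw [Real.enorm_eq_ofReal (by linarith), ENNReal.ofReal_le_one]
            linarith
          · exact eLpNorm_average_comp_affine_sub_le hgs hgli z₀ B fun w hw =>
              hδ₂ ε ε0.le hε.2.2.1 w (hw.trans hδ.2.2.le)
          · rw [Real.enorm_eq_ofReal ε0.le]
            exact ENNReal.ofReal_le_of_le_toReal (by simpa using hε.2.2.2.le)
      _ ≤ η / 2 + η / 2 := by rw [one_mul]; gcongr
      _ = η := ENNReal.add_halves η

theorem lintegral_enorm_inner_le {α E : Type*} [MeasurableSpace α] [NormedAddCommGroup E]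
    [InnerProductSpace ℝ E] {μ : Measure α} {f g : α → E} (hf : MemLp f 2 μ) (hg : MemLp g 2 μ) :
    ∫⁻ x, ‖(⟪f x, g x⟫ : ℝ)‖ₑ ∂μ ≤ eLpNorm f 2 μ * eLpNorm g 2 μ := by
  have := eLpNorm_le_eLpNorm_mul_eLpNorm'_of_norm (p := 2) (q := 2) (r := 1) hf.1 hg.1 (fun x y => (⟪x, y⟫ : ℝ)) 1
    (ae_of_all _ fun x => by simpa using norm_inner_le_norm (𝕜 := ℝ) (f x) (g x))
  rw [eLpNorm_one_eq_lintegral_enorm] at this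
  simpa using this

theorem integrable_inner_of_memLp {α E : Type*} [MeasurableSpace α] [NormedAddCommGroup E]
    [InnerProductSpace ℝ E] {μ : Measure α} {f g : α → E} (hf : MemLp f 2 μ) (hg : MemLp g 2 μ) :
    Integrable (fun x => (⟪f x, g x⟫ : ℝ)) μ :=
  ⟨hf.1.inner hg.1, (lintegral_enorm_inner_le hf hg).trans_lt (ENNReal.mul_lt_top hf.2 hg.2)⟩

theorem _root_.Continuous.memLp_restrict {X E : Type*} [TopologicalSpace X] [MeasurableSpace X]
    [OpensMeasurableSpace X] [T2Space X] [NormedAddCommGroup E] [SecondCountableTopologyEither X E]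
    {μ : Measure X} [IsFiniteMeasureOnCompacts μ] {f : X → E} {s K : Set X} (hf : Continuous f)
    (hK : IsCompact K) (hs : s ⊆ K) {p : ENNReal} : MemLp f p (μ.restrict s) := by
  refine MemLp.mono_measure (Measure.restrict_mono_set μ hs) ?_
  obtain ⟨C, hC⟩ := hK.exists_bound_of_continuousOn hf.continuousOn
  have : IsFiniteMeasure (μ.restrict K) := ⟨by simpa using hK.measure_lt_top⟩
  exact MemLp.of_bound hf.aestronglyMeasurable C
    (ae_restrict_of_forall_mem hK.measurableSet hC)

/-- An identity for smooth functions extends to all functions with a spatial gradient. -/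
theorem Cell.integral_eq_zero_of_contDiff {d : ℕ} (K : Cell d) {S : Set (TS d)}
    (hS : K.openCell ⊆ S) {u : TS d → ℝ} {g : TS d → Sp d}
    (hu : MemLp u 2 (volume.restrict K.openCell)) (hg : MemLp g 2 (volume.restrict K.openCell))
    (h : HasWeakGradX S K.openCell u g) {q : TS d → ℝ} {τ : TS d → Sp d}
    (hq : MemLp q 2 (volume.restrict K.openCell)) (hτ : MemLp τ 2 (volume.restrict K.openCell))
    (H : ∀ φ : TS d → ℝ, ContDiff ℝ ∞ φ →
      ∫ z in K.openCell, (q z * φ z + ⟪τ z, gradX φ z⟫) = 0) :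
    ∫ z in K.openCell, (q z * u z + ⟪τ z, g z⟫) = 0 := by
  set M := eLpNorm q 2 (volume.restrict K.openCell) + eLpNorm τ 2 (volume.restrict K.openCell)
  have hM : M ≠ ⊤ := ENNReal.add_ne_top.2 ⟨hq.2.ne, hτ.2.ne⟩
  by_contra hne
  -- The integral depends continuously on `(u, g)` with constant `M` and vanishes for smooth
  -- functions. An approximation with `η M` below the assumed nonzero value gives the contradiction.
  obtain ⟨η, η0, hη⟩ := ENNReal.exists_nnreal_pos_mul_lt hM (enorm_ne_zero.2 hne)
  obtain ⟨φ, hφ, h1, h2⟩ := K.exists_contDiff_approx hS hu hg h (ENNReal.coe_ne_zero.2 η0.ne')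
  have m1 : MemLp φ 2 (volume.restrict K.openCell) :=
    hφ.continuous.memLp_restrict K.isCompact_carrier K.openCell_subset
  have m2 : MemLp (gradX φ) 2 (volume.restrict K.openCell) :=
    (continuous_gradX hφ).memLp_restrict K.isCompact_carrier K.openCell_subset
  have key : ∀ {v : TS d → ℝ} {w : TS d → Sp d}, MemLp v 2 (volume.restrict K.openCell) →
      MemLp w 2 (volume.restrict K.openCell) →
      Integrable (fun z => q z * v z + ⟪τ z, w z⟫) (volume.restrict K.openCell) :=
    fun hv hw => (hq.integrable_mul hv).add (integrable_inner_of_memLp hτ hw)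
  have e1 : ∫ z in K.openCell, (q z * u z + ⟪τ z, g z⟫) =
      -∫ z in K.openCell, (⟪q z, φ z - u z⟫ + ⟪τ z, gradX φ z - g z⟫) := by
    have : ∫ z in K.openCell, (⟪q z, φ z - u z⟫ + ⟪τ z, gradX φ z - g z⟫) =
        ∫ z in K.openCell, ((q z * φ z + ⟪τ z, gradX φ z⟫) - (q z * u z + ⟪τ z, g z⟫)) := by
      refine integral_congr_ae (ae_of_all _ fun z => ?_)
      simp only [inner_sub_right, RCLike.inner_apply, conj_trivial]
      ring
    rw [this, integral_sub (key m1 m2) (key hu hg), H φ hφ, zero_sub, neg_neg]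
  have e2 : ‖∫ z in K.openCell, (q z * u z + ⟪τ z, g z⟫)‖ₑ ≤ η * M := by
    rw [e1, enorm_neg]
    refine (enorm_integral_le_lintegral_enorm _).trans ?_
    refine (lintegral_mono fun z => enorm_add_le _ _).trans ?_
    rw [lintegral_add_left' (f := fun z => ‖(⟪q z, φ z - u z⟫ : ℝ)‖ₑ)
      (hq.1.inner (m1.sub hu).1).enorm, mul_add]
    refine add_le_add ((lintegral_enorm_inner_le hq (m1.sub hu)).trans ?_)
      ((lintegral_enorm_inner_le hτ (m2.sub hg)).trans ?_)
    · rw [mul_comm]; gcongr; exact h1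
    · rw [mul_comm]; gcongr; exact h2
  exact absurd hη (not_lt.2 e2)

end HeatDPG

end

noncomputable section

namespace HeatDPG

/-! ### Meshes cover the cylinder up to null sets -/

/-- A Lipschitz domain has no slits: below the graph no points of `Ω` accumulate, so a boundary
point cannot be interior to the closure. The mesh covers only the closure of `Q`, and this puts the
open cells into `Q` itself. -/
theorem IsLipschitzDomain.interior_closure {d : ℕ} {Ω : Set (Sp d)} (h : IsLipschitzDomain Ω) :
    interior (closure Ω) = Ω := by
  refine subset_antisymm (fun p hp => ?_) (h.isOpen.subset_interior_iff.2 subset_closure)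
  by_contra hpΩ
  have hpf : p ∈ frontier Ω := ⟨interior_subset hp, by rwa [h.isOpen.interior_eq]⟩
  obtain ⟨n, r, L, ψ, hn, hr, hL, hψ, hg⟩ := h.graph p hpf
  have h1 : ⟪p, n⟫ ≤ ψ p := not_lt.1 fun h0 => hpΩ ((hg p (Metric.mem_ball_self hr)).2 h0)
  obtain ⟨ε, ε0, hε⟩ := Metric.isOpen_iff.1 isOpen_interior p hp
  obtain ⟨s, s0, hs⟩ := exists_between (show 0 < min ε r from lt_min ε0 hr)
  -- Since `ψ` is constant in the direction `n`, moving down by `s` lands strictly below the graph.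
  -- A neighbourhood of `y` is then free of points of `Ω`, although `y` still lies in its closure.
  set y := p + (-s) • n with hy
  have hyp : dist y p = s := by
    rw [dist_eq_norm, hy, add_sub_cancel_left, norm_smul, hn, mul_one, norm_neg,
      Real.norm_of_nonneg s0.le]
  have hyc : y ∈ closure Ω := interior_subset (hε (by
    rw [Metric.mem_ball, hyp]; exact hs.trans_le (min_le_left _ _)))
  have hyr : y ∈ Metric.ball p r := by
    rw [Metric.mem_ball, hyp]; exact hs.trans_le (min_le_right _ _)
  have hyψ : ⟪y, n⟫ < ψ y := by
    rw [hy, hψ, inner_add_left, real_inner_smul_left, real_inner_self_eq_norm_sq, hn]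
    linarith
  have hop : IsOpen {x | ⟪x, n⟫ < ψ x} := isOpen_lt (by fun_prop) hL.continuous
  obtain ⟨x, ⟨hx1, hx2⟩, hxΩ⟩ := mem_closure_iff.1 hyc _ (hop.inter Metric.isOpen_ball) ⟨hyψ, hyr⟩
  exact absurd ((hg x hx2).1 hxΩ) (not_lt.2 (le_of_lt hx1))

theorem isOpen_cyl {d : ℕ} {T : ℝ} {Ω : Set (Sp d)} (hΩ : IsLipschitzDomain Ω) :
    IsOpen (cyl T Ω) := isOpen_Ioo.prod hΩ.isOpen

namespace IsMesh

variable {d : ℕ} {T : ℝ} {Ω : Set (Sp d)} {𝒯 : Finset (Cell d)}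

theorem closure_cyl (hT : 0 < T) : closure (cyl T Ω) = Icc 0 T ×ˢ closure Ω := by
  rw [cyl, closure_prod_eq, closure_Ioo hT.ne]

theorem carrier_subset (h : IsMesh T Ω 𝒯) {K : Cell d} (hK : K ∈ 𝒯) :
    K.carrier ⊆ closure (cyl T Ω) := by
  rw [← h.cover]
  exact subset_biUnion_of_mem (u := fun K : Cell d => K.carrier) hK

theorem openCell_subset (h : IsMesh T Ω 𝒯) (hT : 0 < T) (hΩ : IsLipschitzDomain Ω) {K : Cell d}
    (hK : K ∈ 𝒯) : K.openCell ⊆ cyl T Ω := by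
  have h1 := interior_mono (h.carrier_subset hK)
  rwa [← Cell.openCell_eq, closure_cyl hT, interior_prod_eq, interior_Icc,
    hΩ.interior_closure] at h1

theorem space_subset (h : IsMesh T Ω 𝒯) (hT : 0 < T) {K : Cell d} (hK : K ∈ 𝒯) :
    K.space ⊆ closure Ω := fun x hx => by
  have h1 : (K.a, x) ∈ closure (cyl T Ω) :=
    h.carrier_subset hK ⟨left_mem_Icc.2 K.hab.le, hx⟩
  rw [closure_cyl hT] at h1
  exact h1.2

theorem Icc_subset (h : IsMesh T Ω 𝒯) (hT : 0 < T) {K : Cell d} (hK : K ∈ 𝒯) :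
    Icc K.a K.b ⊆ Icc 0 T := fun t ht => by
  have h1 : (t, K.center) ∈ closure (cyl T Ω) := h.carrier_subset hK ⟨ht, K.center_mem⟩
  rw [closure_cyl hT] at h1
  exact h1.1

theorem ht_le (h : IsMesh T Ω 𝒯) (hT : 0 < T) {K : Cell d} (hK : K ∈ 𝒯) : K.ht ≤ T := by
  have h1 := h.Icc_subset hT hK (left_mem_Icc.2 K.hab.le)
  have h2 := h.Icc_subset hT hK (right_mem_Icc.2 K.hab.le)
  rw [Cell.ht]
  linarith [h1.1, h2.2]

theorem hx_le (h : IsMesh T Ω 𝒯) (hT : 0 < T) (hΩ : IsLipschitzDomain Ω) {K : Cell d}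
    (hK : K ∈ 𝒯) : K.hx ≤ Metric.diam (closure Ω) :=
  Metric.diam_mono (h.space_subset hT hK) hΩ.isBounded.closure

theorem interior_space_subset (h : IsMesh T Ω 𝒯) (hT : 0 < T) (hΩ : IsLipschitzDomain Ω)
    {K : Cell d} (hK : K ∈ 𝒯) : interior K.space ⊆ Ω := by
  rw [← hΩ.interior_closure]
  exact interior_mono (h.space_subset hT hK)

theorem pairwiseDisjoint (h : IsMesh T Ω 𝒯) :
    (𝒯 : Set (Cell d)).PairwiseDisjoint fun K => K.openCell :=
  fun _ hK _ hK' hne => h.nonoverlap _ hK _ hK' hne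

theorem ae_mem_openCell (h : IsMesh T Ω 𝒯) :
    ∀ᵐ z, z ∈ cyl T Ω → ∃ K ∈ 𝒯, z ∈ K.openCell := by
  have h1 : ∀ᵐ z, ∀ K ∈ 𝒯, z ∉ K.carrier \ K.openCell :=
    (ae_ball_iff 𝒯.countable_toSet).2 fun K _ => measure_eq_zero_iff_ae_notMem.1 K.volume_carrier_diff
  filter_upwards [h1] with z hz hzQ
  have h2 := subset_closure hzQ
  rw [← h.cover, mem_iUnion₂] at h2
  obtain ⟨K, hK, hzK⟩ := h2
  exact ⟨K, hK, by_contra fun h0 => hz K hK ⟨hzK, h0⟩⟩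

theorem cyl_ae_eq (h : IsMesh T Ω 𝒯) (hT : 0 < T) (hΩ : IsLipschitzDomain Ω) :
    (cyl T Ω : Set (TS d)) =ᵐ[volume] ⋃ K ∈ 𝒯, K.openCell := by
  filter_upwards [h.ae_mem_openCell] with z hz
  refine propext ⟨fun hzQ => ?_, fun hz' => ?_⟩
  · obtain ⟨K, hK, hzK⟩ := hz hzQ
    exact mem_biUnion hK hzK
  · obtain ⟨K, hK, hzK⟩ := mem_iUnion₂.1 hz'
    exact h.openCell_subset hT hΩ hK hzK

theorem integral_cyl {E : Type*} [NormedAddCommGroup E] [NormedSpace ℝ E] (h : IsMesh T Ω 𝒯)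
    (hT : 0 < T) (hΩ : IsLipschitzDomain Ω) {F : TS d → E} (hF : IntegrableOn F (cyl T Ω)) :
    ∫ z in cyl T Ω, F z = ∑ K ∈ 𝒯, ∫ z in K.openCell, F z := by
  rw [setIntegral_congr_set (h.cyl_ae_eq hT hΩ),
    integral_biUnion_finset _ (fun K _ => K.isOpen_openCell.measurableSet) h.pairwiseDisjoint
      (fun K hK => hF.mono_set (h.openCell_subset hT hΩ hK))]

theorem exists_initial (h : IsMesh T Ω 𝒯) (hT : 0 < T) {x : Sp d} (hx : x ∈ Ω) :
    ∃ K ∈ 𝒯, K.a = 0 ∧ x ∈ K.space := by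
  have h1 : ((0 : ℝ), x) ∈ closure (cyl T Ω) := by
    rw [closure_cyl hT]
    exact ⟨left_mem_Icc.2 hT.le, subset_closure hx⟩
  rw [← h.cover, mem_iUnion₂] at h1
  obtain ⟨K, hK, hzK⟩ := h1
  exact ⟨K, hK, le_antisymm hzK.1.1 (h.Icc_subset hT hK (left_mem_Icc.2 K.hab.le)).1, hzK.2⟩

open Classical in
/-- The cells whose time interval starts at `0`. -/
def initialCells (𝒯 : Finset (Cell d)) : Finset (Cell d) := 𝒯.filter fun K => K.a = 0

theorem mem_initialCells {K : Cell d} : K ∈ initialCells 𝒯 ↔ K ∈ 𝒯 ∧ K.a = 0 :=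
  Finset.mem_filter

theorem disjoint_initial (h : IsMesh T Ω 𝒯) {K K' : Cell d} (hK : K ∈ 𝒯) (hK' : K' ∈ 𝒯)
    (h0 : K.a = 0) (h0' : K'.a = 0) (hne : K ≠ K') :
    Disjoint (interior K.space) (interior K'.space) := by
  refine disjoint_left.2 fun x hx hx' => ?_
  have hb := K.hab
  have hb' := K'.hab
  rw [h0] at hb
  rw [h0'] at hb'
  -- Overlapping initial simplices would make the two prisms overlap at any time before the earlier
  -- of their end times.
  obtain ⟨t, t0, ht⟩ := exists_between (lt_min hb hb')
  have h1 : ((t, x) : TS d) ∈ K.openCell := ⟨⟨?_, ?_⟩, hx⟩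
  have h2 : ((t, x) : TS d) ∈ K'.openCell := ⟨⟨?_, ?_⟩, hx'⟩
  · exact disjoint_left.1 (h.nonoverlap K hK K' hK' hne) h1 h2
  · rw [h0']; exact t0
  · exact ht.trans_le (min_le_right _ _)
  · rw [h0]; exact t0
  · exact ht.trans_le (min_le_left _ _)

theorem ae_mem_interior_space (h : IsMesh T Ω 𝒯) (hT : 0 < T) :
    ∀ᵐ x, x ∈ Ω → ∃ K ∈ initialCells 𝒯, x ∈ interior K.space := by
  have h1 : ∀ᵐ x, ∀ K ∈ 𝒯, (x ∈ interior K.space ↔ x ∈ K.space) :=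
    (ae_ball_iff 𝒯.countable_toSet).2 fun K _ => K.interior_space_ae_eq.mem_iff
  filter_upwards [h1] with x hx hxΩ
  obtain ⟨K, hK, h0, hxK⟩ := h.exists_initial hT hxΩ
  exact ⟨K, mem_initialCells.2 ⟨hK, h0⟩, (hx K hK).2 hxK⟩

theorem integral_initial (h : IsMesh T Ω 𝒯) (hT : 0 < T) (hΩ : IsLipschitzDomain Ω)
    {F : Sp d → ℝ} (hF : IntegrableOn F Ω) :
    ∫ x in Ω, F x = ∑ K ∈ initialCells 𝒯, ∫ x in interior K.space, F x := by
  have h1 : (Ω : Set (Sp d)) =ᵐ[volume] ⋃ K ∈ initialCells 𝒯, interior K.space := by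
    filter_upwards [h.ae_mem_interior_space hT] with z hz
    refine propext ⟨fun hzQ => ?_, fun hz' => ?_⟩
    · obtain ⟨K, hK, hzK⟩ := hz hzQ
      exact mem_biUnion hK hzK
    · obtain ⟨K, hK, hzK⟩ := mem_iUnion₂.1 hz'
      exact h.interior_space_subset hT hΩ (mem_initialCells.1 hK).1 hzK
  rw [setIntegral_congr_set h1, integral_biUnion_finset _ (fun K _ => measurableSet_interior)
      (fun K hK K' hK' hne => h.disjoint_initial (mem_initialCells.1 hK).1
        (mem_initialCells.1 hK').1 (mem_initialCells.1 hK).2 (mem_initialCells.1 hK').2 hne)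
      (fun K hK => hF.mono_set (h.interior_space_subset hT hΩ (mem_initialCells.1 hK).1))]

theorem nonempty (h : IsMesh T Ω 𝒯) (hT : 0 < T) (hΩ : IsLipschitzDomain Ω) : 𝒯.Nonempty := by
  obtain ⟨x, hx⟩ := hΩ.isConnected.nonempty
  obtain ⟨K, hK, -⟩ := h.exists_initial hT hx
  exact ⟨K, hK⟩

end IsMesh

/-! ### Smooth fields as broken test functions -/

theorem HasWeakDiv.congr {d : ℕ} {S U : Set (TS d)} {w w' : TS d → Val d} {f f' : TS d → ℝ}
    (h : HasWeakDiv S U w f) (hw : w =ᵐ[volume.restrict S] w') (hf : f =ᵐ[volume.restrict S] f') :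
    HasWeakDiv S U w' f' := by
  intro φ h1 h2 h3
  have e1 : ∫ z in S, ((w z).fst * dt φ z + ⟪(w z).snd, gradX φ z⟫) =
      ∫ z in S, ((w' z).fst * dt φ z + ⟪(w' z).snd, gradX φ z⟫) :=
    integral_congr_ae (hw.mono fun z hz => by simp only [hz])
  have e2 : ∫ z in S, f z * φ z = ∫ z in S, f' z * φ z :=
    integral_congr_ae (hf.mono fun z hz => by simp only [hz])
  rw [← e1, ← e2, h φ h1 h2 h3]

theorem HasWeakGradX.congr {d : ℕ} {S U : Set (TS d)} {w w' : TS d → ℝ} {f f' : TS d → Sp d}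
    (h : HasWeakGradX S U w f) (hw : w =ᵐ[volume.restrict S] w') (hf : f =ᵐ[volume.restrict S] f') :
    HasWeakGradX S U w' f' := by
  intro φ h1 h2 h3
  have e1 : ∫ z in S, w z • gradX φ z = ∫ z in S, w' z • gradX φ z :=
    integral_congr_ae (hw.mono fun z hz => by simp only [hz])
  have e2 : ∫ z in S, φ z • f z = ∫ z in S, φ z • f' z :=
    integral_congr_ae (hf.mono fun z hz => by simp only [hz])
  rw [← e1, ← e2, h φ h1 h2 h3]

theorem fderiv_eq_zero_of_notMem {d : ℕ} {U : Set (TS d)} {φ : TS d → ℝ} (h : tsupport φ ⊆ U)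
    {z : TS d} (hz : z ∉ U) : φ z = 0 ∧ dt φ z = 0 ∧ gradX φ z = 0 := by
  have h1 : fderiv ℝ φ z = 0 := by
    by_contra h0
    exact hz (h (support_fderiv_subset ℝ h0))
  refine ⟨image_eq_zero_of_notMem_tsupport fun h0 => hz (h h0), by simp [dt, h1], ?_⟩
  ext i
  simp [gradX, h1]

theorem HasWeakDiv.congr_of_eqOn {d : ℕ} {S U : Set (TS d)} {w w' : TS d → Val d}
    {f f' : TS d → ℝ} (h : HasWeakDiv S U w f) (hw : EqOn w w' U) (hf : EqOn f f' U) :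
    HasWeakDiv S U w' f' := by
  intro φ h1 h2 h3
  have e1 : ∀ z, (w' z).fst * dt φ z + ⟪(w' z).snd, gradX φ z⟫ =
      (w z).fst * dt φ z + ⟪(w z).snd, gradX φ z⟫ := fun z => by
    by_cases hz : z ∈ U
    · rw [hw hz]
    · rw [(fderiv_eq_zero_of_notMem h3 hz).2.1, (fderiv_eq_zero_of_notMem h3 hz).2.2]
      simp
  have e2 : ∀ z, f' z * φ z = f z * φ z := fun z => by
    by_cases hz : z ∈ U
    · rw [hf hz]
    · rw [(fderiv_eq_zero_of_notMem h3 hz).1, mul_zero, mul_zero]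
  simp_rw [e1, e2]
  exact h φ h1 h2 h3

theorem HasWeakGradX.congr_of_eqOn {d : ℕ} {S U : Set (TS d)} {w w' : TS d → ℝ}
    {f f' : TS d → Sp d} (h : HasWeakGradX S U w f) (hw : EqOn w w' U) (hf : EqOn f f' U) :
    HasWeakGradX S U w' f' := by
  intro φ h1 h2 h3
  have e1 : ∀ z, w' z • gradX φ z = w z • gradX φ z := fun z => by
    by_cases hz : z ∈ U
    · rw [hw hz]
    · rw [(fderiv_eq_zero_of_notMem h3 hz).2.2, smul_zero, smul_zero]
  have e2 : ∀ z, φ z • f' z = φ z • f z := fun z => by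
    by_cases hz : z ∈ U
    · rw [hf hz]
    · rw [(fderiv_eq_zero_of_notMem h3 hz).1, zero_smul, zero_smul]
  simp_rw [e1, e2]
  exact h φ h1 h2 h3

theorem integral_mul_fderiv_eq {d : ℕ} {S U : Set (TS d)} (hUS : U ⊆ S) {u φ : TS d → ℝ}
    (hu : ContDiff ℝ ∞ u) (hφ : ContDiff ℝ ∞ φ) (hc : HasCompactSupport φ) (hs : tsupport φ ⊆ U)
    (v : TS d) :
    ∫ z in S, u z * fderiv ℝ φ z v = - ∫ z in S, fderiv ℝ u z v * φ z := by
  have hz : ∀ z ∉ S, fderiv ℝ φ z = 0 := fun z hz => by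
    by_contra h0
    exact hz (hUS (hs (support_fderiv_subset ℝ h0)))
  have hz' : ∀ z ∉ S, φ z = 0 := fun z hz =>
    image_eq_zero_of_notMem_tsupport fun h0 => hz (hUS (hs h0))
  have c1 := hu.continuous
  have c2 : Continuous fun z => fderiv ℝ u z v :=
    (hu.continuous_fderiv (by simp)).clm_apply continuous_const
  have c3 : Continuous fun z => fderiv ℝ φ z v :=
    (hφ.continuous_fderiv (by simp)).clm_apply continuous_const
  have s3 : HasCompactSupport fun z => fderiv ℝ φ z v :=
    (hc.fderiv ℝ).comp_left (g := fun A : TS d →L[ℝ] ℝ => A v) rfl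
  rw [setIntegral_eq_integral_of_forall_compl_eq_zero fun z h0 => by rw [hz z h0]; simp,
    setIntegral_eq_integral_of_forall_compl_eq_zero fun z h0 => by rw [hz' z h0, mul_zero]]
  refine integral_mul_fderiv_eq_neg_fderiv_mul_of_integrable ?_ ?_ ?_
    (fun z _ => hu.differentiable (by simp) z) (fun z _ => hφ.differentiable (by simp) z)
  · exact (c2.mul hφ.continuous).integrable_of_hasCompactSupport hc.mul_left
  · exact (c1.mul c3).integrable_of_hasCompactSupport s3.mul_left
  · exact (c1.mul hφ.continuous).integrable_of_hasCompactSupport hc.mul_left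

/-- Smooth time-space fields. -/
def SmoothField (d : ℕ) : Submodule ℝ (TS d → Val d) where
  carrier := {u | ContDiff ℝ ∞ u}
  zero_mem' := show ContDiff ℝ ∞ fun _ => (0 : Val d) from contDiff_const
  add_mem' := fun {u v} (h : ContDiff ℝ ∞ u) (h' : ContDiff ℝ ∞ v) =>
    show ContDiff ℝ ∞ (u + v) from h.add h'
  smul_mem' := fun c u (h : ContDiff ℝ ∞ u) => show ContDiff ℝ ∞ (c • u) from contDiff_const.smul h

theorem SmoothField.contDiff {d : ℕ} (u : SmoothField d) : ContDiff ℝ ∞ u.1 := u.2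

theorem ContDiff.fst_val {d : ℕ} {u : TS d → Val d} (h : ContDiff ℝ ∞ u) :
    ContDiff ℝ ∞ fun z => (u z).fst := (WithLp.fstL 2 ℝ ℝ (Sp d)).contDiff.comp h

theorem ContDiff.snd_val {d : ℕ} {u : TS d → Val d} (h : ContDiff ℝ ∞ u) :
    ContDiff ℝ ∞ fun z => (u z).snd := (WithLp.sndL 2 ℝ ℝ (Sp d)).contDiff.comp h

/-- `A^*` for smooth fields. -/
def astarOp {d : ℕ} (u : TS d → Val d) (z : TS d) : Val d :=
  WithLp.toLp 2 (-(dt (fun z => (u z).fst) z + divX (fun z => (u z).snd) z),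
    (u z).snd - gradX (fun z => (u z).fst) z)

theorem continuous_divX {d : ℕ} {χ : TS d → Sp d} (h : ContDiff ℝ ∞ χ) : Continuous (divX χ) :=
  continuous_finsetSum _ fun i _ => (EuclideanSpace.proj (𝕜 := ℝ) i).continuous.comp
    ((h.continuous_fderiv (by simp)).clm_apply continuous_const)

theorem continuous_astarOp {d : ℕ} {u : TS d → Val d} (h : ContDiff ℝ ∞ u) :
    Continuous (astarOp u) :=
  (WithLp.prod_continuous_toLp 2 ℝ (Sp d)).comp
    ((((continuous_dt (ContDiff.fst_val h)).add (continuous_divX (ContDiff.snd_val h))).neg).prodMk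
      ((ContDiff.snd_val h).continuous.sub (continuous_gradX (ContDiff.fst_val h))))

theorem fderiv_val_fst {d : ℕ} {u : TS d → Val d} (h : ContDiff ℝ ∞ u) (z v : TS d) :
    fderiv ℝ (fun z => (u z).fst) z v = (fderiv ℝ u z v).fst := by
  have h1 := (WithLp.fstL 2 ℝ ℝ (Sp d)).hasFDerivAt.comp z
    (h.differentiable (by simp) z).hasFDerivAt
  rw [show (fun z => (u z).fst) = (WithLp.fstL 2 ℝ ℝ (Sp d)) ∘ u from rfl, h1.fderiv]
  rfl

theorem fderiv_val_snd {d : ℕ} {u : TS d → Val d} (h : ContDiff ℝ ∞ u) (z v : TS d) :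
    fderiv ℝ (fun z => (u z).snd) z v = (fderiv ℝ u z v).snd := by
  have h1 := (WithLp.sndL 2 ℝ ℝ (Sp d)).hasFDerivAt.comp z
    (h.differentiable (by simp) z).hasFDerivAt
  rw [show (fun z => (u z).snd) = (WithLp.sndL 2 ℝ ℝ (Sp d)) ∘ u from rfl, h1.fderiv]
  rfl

/-- Expressing all components through the one derivative of `u` makes the linearity of `astarOp`
apparent. -/
theorem astarOp_eq {d : ℕ} {u : TS d → Val d} (h : ContDiff ℝ ∞ u) (z : TS d) :
    astarOp u z = WithLp.toLp 2 (-((fderiv ℝ u z (1, 0)).fst +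
      ∑ i, ((fderiv ℝ u z (0, EuclideanSpace.single i 1)).snd) i),
      (u z).snd - WithLp.toLp 2 fun i => (fderiv ℝ u z (0, EuclideanSpace.single i 1)).fst) := by
  simp only [astarOp, dt, divX, gradX, fderiv_val_fst h, fderiv_val_snd h]

theorem astarOp_add {d : ℕ} {u v : TS d → Val d} (hu : ContDiff ℝ ∞ u) (hv : ContDiff ℝ ∞ v)
    (z : TS d) : astarOp (u + v) z = astarOp u z + astarOp v z := by
  have huv : ContDiff ℝ ∞ (u + v) := hu.add hv
  rw [astarOp_eq hu, astarOp_eq hv, astarOp_eq huv,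
    fderiv_add (hu.differentiable (by simp) z) (hv.differentiable (by simp) z), ← WithLp.toLp_add]
  congr 1
  ext i
  · simp [Finset.sum_add_distrib]; ring
  · simp; ring

theorem astarOp_smul {d : ℕ} (c : ℝ) {u : TS d → Val d} (hu : ContDiff ℝ ∞ u) (z : TS d) :
    astarOp (c • u) z = c • astarOp u z := by
  have hcu : ContDiff ℝ ∞ (c • u) := contDiff_const.smul hu
  rw [astarOp_eq hu, astarOp_eq hcu,
    fderiv_const_smul (hu.differentiable (by simp) z), ← WithLp.toLp_smul]
  congr 1
  ext i
  · simp [← Finset.mul_sum]; ring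
  · simp; ring

theorem integral_coord {α : Type*} [MeasurableSpace α] {μ : Measure α} {d : ℕ} {f : α → Sp d}
    (hf : Integrable f μ) (i : Fin d) : (∫ x, f x ∂μ) i = ∫ x, f x i ∂μ :=
  ((EuclideanSpace.proj (𝕜 := ℝ) i).integral_comp_comm hf).symm

theorem hasWeakGradX_of_contDiff {d : ℕ} {S U : Set (TS d)} (hUS : U ⊆ S) {u : TS d → ℝ}
    (hu : ContDiff ℝ ∞ u) : HasWeakGradX S U u (gradX u) := by
  intro φ h1 h2 h3
  have i1 : Integrable (fun z => u z • gradX φ z) (volume.restrict S) :=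
    ((hu.continuous.smul (continuous_gradX h1)).integrable_of_hasCompactSupport
      (hasCompactSupport_gradX h2).smul_left).integrableOn
  have i2 : Integrable (fun z => φ z • gradX u z) (volume.restrict S) :=
    ((h1.continuous.smul (continuous_gradX hu)).integrable_of_hasCompactSupport
      h2.smul_right).integrableOn
  ext i
  rw [PiLp.neg_apply, integral_coord i1, integral_coord i2]
  refine (integral_mul_fderiv_eq hUS hu h1 h2 h3 (0, EuclideanSpace.single i 1)).trans ?_
  congr 1
  exact integral_congr_ae (ae_of_all _ fun z => mul_comm _ _)

theorem hasWeakDiv_of_contDiff {d : ℕ} {S U : Set (TS d)} (hUS : U ⊆ S) {u : TS d → Val d}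
    (hu : ContDiff ℝ ∞ u) :
    HasWeakDiv S U u fun z => dt (fun z => (u z).fst) z + divX (fun z => (u z).snd) z := by
  intro φ h1 h2 h3
  have hu1 := ContDiff.fst_val hu
  have hu2 : ∀ i, ContDiff ℝ ∞ fun z => (u z).snd i := fun i =>
    (EuclideanSpace.proj (𝕜 := ℝ) i).contDiff.comp (ContDiff.snd_val hu)
  have hdiv : ∀ z, divX (fun z => (u z).snd) z =
      ∑ i, fderiv ℝ (fun z => (u z).snd i) z (0, EuclideanSpace.single i 1) := by
    intro z
    refine Finset.sum_congr rfl fun i _ => ?_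
    have h4 := (EuclideanSpace.proj (𝕜 := ℝ) i).hasFDerivAt.comp z
      ((ContDiff.snd_val hu).differentiable (by simp) z).hasFDerivAt
    rw [show (fun z => (u z).snd i) = (EuclideanSpace.proj (𝕜 := ℝ) i) ∘ fun z => (u z).snd from rfl,
      h4.fderiv]
    rfl
  have j1 : ∀ {f : TS d → ℝ}, ContDiff ℝ ∞ f → ∀ v,
      Integrable (fun z => f z * fderiv ℝ φ z v) (volume.restrict S) := fun {f} hf v => by
    have c3 : Continuous fun z => fderiv ℝ φ z v :=
      (h1.continuous_fderiv (by simp)).clm_apply continuous_const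
    have s3 : HasCompactSupport fun z => fderiv ℝ φ z v :=
      (h2.fderiv ℝ).comp_left (g := fun A : TS d →L[ℝ] ℝ => A v) rfl
    exact ((hf.continuous.mul c3).integrable_of_hasCompactSupport s3.mul_left).integrableOn
  have j2 : ∀ {f : TS d → ℝ}, ContDiff ℝ ∞ f → ∀ v,
      Integrable (fun z => fderiv ℝ f z v * φ z) (volume.restrict S) := fun {f} hf v => by
    have c3 : Continuous fun z => fderiv ℝ f z v :=
      (hf.continuous_fderiv (by simp)).clm_apply continuous_const
    exact ((c3.mul h1.continuous).integrable_of_hasCompactSupport h2.mul_left).integrableOn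
  have e1 : ∀ z, (u z).fst * dt φ z + ⟪(u z).snd, gradX φ z⟫ =
      (u z).fst * fderiv ℝ φ z (1, 0) +
        ∑ i, (u z).snd i * fderiv ℝ φ z (0, EuclideanSpace.single i 1) := fun z => by
    rw [PiLp.inner_apply]
    congr 1
    exact Finset.sum_congr rfl fun i _ => by simp [gradX, mul_comm]
  have e2 : ∀ z, (dt (fun z => (u z).fst) z + divX (fun z => (u z).snd) z) * φ z =
      fderiv ℝ (fun z => (u z).fst) z (1, 0) * φ z +
        ∑ i, fderiv ℝ (fun z => (u z).snd i) z (0, EuclideanSpace.single i 1) * φ z := fun z => by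
    rw [hdiv, add_mul, Finset.sum_mul]
    rfl
  simp_rw [e1, e2]
  rw [integral_add (j1 hu1 _) (integrable_finsetSum _ fun i _ => j1 (hu2 i) _),
    integral_add (j2 hu1 _) (integrable_finsetSum _ fun i _ => j2 (hu2 i) _),
    integral_finsetSum _ fun i _ => j1 (hu2 i) _, integral_finsetSum _ fun i _ => j2 (hu2 i) _,
    integral_mul_fderiv_eq hUS hu1 h1 h2 h3, neg_add, ← Finset.sum_neg_distrib]
  congr 1
  exact Finset.sum_congr rfl fun i _ => integral_mul_fderiv_eq hUS (hu2 i) h1 h2 h3 _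

/-- A smooth field on one cell, extended by zero, as a broken test function. -/
theorem IsMesh.exists_cellField {d : ℕ} {T : ℝ} {Ω : Set (Sp d)} {𝒯 : Finset (Cell d)}
    (h : IsMesh T Ω 𝒯) (hT : 0 < T) (hΩ : IsLipschitzDomain Ω) {K : Cell d} (hK : K ∈ 𝒯) :
    ∃ E : SmoothField d →ₗ[ℝ] HA T Ω 𝒯, ∀ u,
      HA.field T Ω 𝒯 (E u) =ᵐ[volume.restrict (cyl T Ω)] K.openCell.indicator u.1 ∧
      HA.astar T Ω 𝒯 (E u) =ᵐ[volume.restrict (cyl T Ω)] K.openCell.indicator (astarOp u.1) := by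
  have hm : MeasurableSet K.openCell := K.isOpen_openCell.measurableSet
  have hmem : ∀ {f : TS d → Val d}, Continuous f →
      MemLp (K.openCell.indicator f) 2 (volume.restrict (cyl T Ω)) := fun hf =>
    ((memLp_indicator_iff_restrict hm).2
      (hf.memLp_restrict K.isCompact_carrier K.openCell_subset)).restrict _
  have m1 : ∀ u : SmoothField d, MemLp (K.openCell.indicator u.1) 2 (volume.restrict (cyl T Ω)) :=
    fun u => hmem (SmoothField.contDiff u).continuous
  have m2 : ∀ u : SmoothField d,
      MemLp (K.openCell.indicator (astarOp u.1)) 2 (volume.restrict (cyl T Ω)) :=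
    fun u => hmem (continuous_astarOp u.2)
  have hb : ∀ u : SmoothField d, WithLp.toLp 2 ((m1 u).toLp, (m2 u).toLp) ∈ HA T Ω 𝒯 := by
    intro u K' hK'
    have hd : HasWeakDiv (cyl T Ω) K'.openCell (K.openCell.indicator u.1)
        (fun z => -(K.openCell.indicator (astarOp u.1) z).fst) ∧
        HasWeakGradX (cyl T Ω) K'.openCell (fun z => (K.openCell.indicator u.1 z).fst)
        (fun z => (K.openCell.indicator u.1 z).snd - (K.openCell.indicator (astarOp u.1) z).snd) := by
      by_cases hKK : K' = K
      · subst hKK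
        have a1 := hasWeakDiv_of_contDiff (h.openCell_subset hT hΩ hK) u.2
        have a2 := hasWeakGradX_of_contDiff (h.openCell_subset hT hΩ hK) (ContDiff.fst_val u.2)
        refine ⟨a1.congr_of_eqOn (eqOn_indicator.symm) fun z hz => ?_,
          a2.congr_of_eqOn (fun z hz => ?_) fun z hz => ?_⟩
        · simp [indicator_of_mem hz, astarOp]
        · simp [indicator_of_mem hz]
        · simp [indicator_of_mem hz, astarOp]
      -- Weak derivatives are required cell by cell only, so the jump of the extension by zero is
      -- invisible: on every other cell the field is zero.
      · have h0 : ∀ z ∈ K'.openCell, z ∉ K.openCell :=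
          fun z hz => disjoint_left.1 (h.nonoverlap K' hK' K hK hKK) hz
        have z1 : HasWeakDiv (cyl T Ω) K'.openCell (fun _ => 0) (fun _ => 0) :=
          HasWeakDiv.zero (ae_of_all _ fun _ => rfl) (ae_of_all _ fun _ => rfl)
        have z2 : HasWeakGradX (cyl T Ω) K'.openCell (fun _ => 0) (fun _ => 0) :=
          HasWeakGradX.zero (ae_of_all _ fun _ => rfl) (ae_of_all _ fun _ => rfl)
        refine ⟨z1.congr_of_eqOn (fun z hz => ?_) fun z hz => ?_,
          z2.congr_of_eqOn (fun z hz => ?_) fun z hz => ?_⟩ <;>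
        simp [indicator_of_notMem (h0 z hz)]
    exact ⟨hd.1.congr (m1 u).coeFn_toLp.symm ((m2 u).coeFn_toLp.symm.fun_comp fun v => -v.fst),
      hd.2.congr ((m1 u).coeFn_toLp.symm.fun_comp fun v => v.fst)
        (((m1 u).coeFn_toLp.symm.fun_comp fun v => v.snd).sub
          ((m2 u).coeFn_toLp.symm.fun_comp fun v => v.snd))⟩
  refine ⟨{ toFun := fun u => ⟨_, hb u⟩, map_add' := fun u v => ?_, map_smul' := fun c u => ?_ },
    fun u => ⟨(m1 u).coeFn_toLp, (m2 u).coeFn_toLp⟩⟩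
  · have e : astarOp (u + v).1 = astarOp u.1 + astarOp v.1 := funext (astarOp_add u.2 v.2)
    refine Subtype.ext (WithLp.ofLp_injective 2 (Prod.ext ?_ ?_))
    · change (m1 (u + v)).toLp = (m1 u).toLp + (m1 v).toLp
      rw [← MemLp.toLp_add]
      exact MemLp.toLp_congr _ _ (by rw [← indicator_add']; rfl)
    · change (m2 (u + v)).toLp = (m2 u).toLp + (m2 v).toLp
      rw [← MemLp.toLp_add]
      exact MemLp.toLp_congr _ _ (by rw [← indicator_add', e])
  · have e : astarOp (c • u).1 = c • astarOp u.1 := funext (astarOp_smul c u.2)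
    refine Subtype.ext (WithLp.ofLp_injective 2 (Prod.ext ?_ ?_))
    · change (m1 (c • u)).toLp = c • (m1 u).toLp
      rw [← MemLp.toLp_const_smul]
      exact MemLp.toLp_congr _ _ (Filter.EventuallyEq.of_eq (indicator_const_smul _ c _))
    · change (m2 (c • u)).toLp = c • (m2 u).toLp
      rw [← MemLp.toLp_const_smul]
      exact MemLp.toLp_congr _ _ (Filter.EventuallyEq.of_eq (e ▸ indicator_const_smul _ c _))

end HeatDPG

end

noncomputable section

namespace HeatDPG

namespace Cell

/-! ### Means of polynomials -/

variable {d : ℕ} (K : Cell d)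

/-- The mean value over the simplex `K_x`. -/
def smean (f : Sp d → ℝ) : ℝ := (volume.real K.space)⁻¹ * ∫ x in K.space, f x

/-- The mean value over the prism `K`. -/
def mean (f : TS d → ℝ) : ℝ := (volume.real K.carrier)⁻¹ * ∫ z in K.openCell, f z

/-- The time coordinate relative to the midpoint of `K_t`. -/
def tc (t : ℝ) : ℝ := t - (K.a + K.b) / 2

variable {K}

theorem smean_add {f g : Sp d → ℝ} (hf : Continuous f) (hg : Continuous g) :
    K.smean (fun x => f x + g x) = K.smean f + K.smean g := by
  rw [smean, integral_add (hf.integrableOn_of_isCompact K.isCompact_space)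
    (hg.integrableOn_of_isCompact K.isCompact_space), mul_add]
  rfl

theorem smean_const_mul (c : ℝ) (f : Sp d → ℝ) :
    K.smean (fun x => c * f x) = c * K.smean f := by
  rw [smean, integral_const_mul, smean]
  ring

theorem smean_sub {f g : Sp d → ℝ} (hf : Continuous f) (hg : Continuous g) :
    K.smean (fun x => f x - g x) = K.smean f - K.smean g := by
  rw [smean, integral_sub (hf.integrableOn_of_isCompact K.isCompact_space)
    (hg.integrableOn_of_isCompact K.isCompact_space), mul_sub]
  rfl

theorem smean_sum {ι : Type*} (s : Finset ι) {f : ι → Sp d → ℝ} (hf : ∀ i ∈ s, Continuous (f i)) :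
    K.smean (fun x => ∑ i ∈ s, f i x) = ∑ i ∈ s, K.smean (f i) := by
  rw [smean, integral_finsetSum _ fun i hi =>
    (hf i hi).integrableOn_of_isCompact K.isCompact_space, Finset.mul_sum]
  rfl

theorem smean_const (c : ℝ) : K.smean (fun _ => c) = c := by
  have h := K.volume_space_pos
  rw [smean, setIntegral_const, smul_eq_mul, inv_mul_cancel_left₀ h.ne']

variable (K) in
/-- The mean of `λ^n` for a barycentric coordinate `λ` of a `d`-simplex. -/
theorem smean_lam_pow_mul (hd : 1 ≤ d) (n : ℕ) {j k : Fin (d + 1)} (hjk : k ≠ j) :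
    K.smean (fun x => K.lam j x ^ (n + 1)) =
      (n + 1) * K.smean (fun x => K.lam j x ^ n * K.lam k x) := by
  have cl := K.continuous_lam
  -- In the direction `p_j - p_k` the coordinate `λ_j` has slope `1`, so the right side becomes `n`
  -- times the mean of `λ_j ^ n λ_k`.
  have h1 := K.integral_lam_sub_lam_mul hd j k (φ := fun x => K.lam j x ^ n)
    ((K.contDiff_lam j).pow n)
  have h2 : ∀ x, fderiv ℝ (fun x => K.lam j x ^ n) x (K.vert j - K.vert k) =
      n * K.lam j x ^ (n - 1) := fun x => by
    rw [((K.hasFDerivAt_lam j x).pow n).fderiv]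
    simp only [smul_apply, innerSL_apply_apply, smul_eq_mul, nsmul_eq_mul]
    rw [← lam_sub, lam_vert, lam_vert, if_pos rfl, if_neg hjk.symm]
    ring
  have h3 : K.smean (fun x => K.lam j x ^ (n + 1) - K.lam j x ^ n * K.lam k x) =
      K.smean (fun x => n * (K.lam j x ^ n * K.lam k x)) := by
    simp only [smean]
    congr 1
    refine (integral_congr_ae (ae_of_all _ fun x => ?_)).trans (h1.trans
      (integral_congr_ae (ae_of_all _ fun x => ?_)))
    · ring
    · simp only [h2]
      rcases n with _ | n
      · simp
      · rw [Nat.add_sub_cancel]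
        ring
  rw [smean_sub (by fun_prop) (by fun_prop), smean_const_mul] at h3
  linarith

variable (K) in
-- Multiply `λ_j ^ n` by `∑ λ_k = 1`: the `d` terms with `k ≠ j` all equal the mean of `λ_j ^ (n +
-- 1)` divided by `n + 1`. Iteration from `n = 0` yields every moment needed below without
-- evaluating an integral.
theorem smean_lam_pow_succ (hd : 1 ≤ d) (n : ℕ) (j : Fin (d + 1)) :
    K.smean (fun x => K.lam j x ^ (n + 1)) =
      (n + 1) / (n + 1 + d) * K.smean (fun x => K.lam j x ^ n) := by
  have cl := K.continuous_lam
  have h1 : K.smean (fun x => K.lam j x ^ n) =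
      ∑ k, K.smean (fun x => K.lam j x ^ n * K.lam k x) := by
    rw [← smean_sum _ fun k _ => by fun_prop]
    congr 1
    ext x
    rw [← Finset.mul_sum, sum_lam, mul_one]
  rw [← Finset.add_sum_erase _ _ (Finset.mem_univ j)] at h1
  have h2 : ∀ k ∈ Finset.univ.erase j, K.smean (fun x => K.lam j x ^ n * K.lam k x) =
      K.smean (fun x => K.lam j x ^ (n + 1)) / (n + 1) := fun k hk => by
    rw [K.smean_lam_pow_mul hd n (Finset.ne_of_mem_erase hk)]
    field_simp
  rw [Finset.sum_congr rfl h2, Finset.sum_const, Finset.card_erase_of_mem (Finset.mem_univ _)] at h1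
  simp only [Finset.card_univ, Fintype.card_fin, Nat.add_sub_cancel, nsmul_eq_mul, ← pow_succ] at h1
  rw [h1]
  field_simp

variable (K) in
theorem smean_lam (hd : 1 ≤ d) (j : Fin (d + 1)) : K.smean (K.lam j) = ((d : ℝ) + 1)⁻¹ := by
  have h := K.smean_lam_pow_succ hd 0 j
  simp only [zero_add, pow_one, pow_zero, smean_const, Nat.cast_zero] at h
  rw [h]
  field_simp
  ring

variable (K) in
theorem smean_lam_sq (hd : 1 ≤ d) (j : Fin (d + 1)) :
    K.smean (fun x => K.lam j x ^ 2) = 2 / (((d : ℝ) + 1) * (d + 2)) := by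
  have h := K.smean_lam_pow_succ hd 1 j
  simp only [pow_one, Nat.cast_one, show K.smean (fun x => K.lam j x) = _ from K.smean_lam hd j] at h
  rw [h]
  field_simp
  ring

variable (K) in
theorem smean_lam_cube (hd : 1 ≤ d) (j : Fin (d + 1)) :
    K.smean (fun x => K.lam j x ^ 3) = 6 / (((d : ℝ) + 1) * (d + 2) * (d + 3)) := by
  have h := K.smean_lam_pow_succ hd 2 j
  simp only [Nat.cast_ofNat, K.smean_lam_sq hd j] at h
  rw [h]
  field_simp
  ring

variable (K) in
theorem smean_lam_pow_four (hd : 1 ≤ d) (j : Fin (d + 1)) :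
    K.smean (fun x => K.lam j x ^ 4) = 24 / (((d : ℝ) + 1) * (d + 2) * (d + 3) * (d + 4)) := by
  have h := K.smean_lam_pow_succ hd 3 j
  simp only [Nat.cast_ofNat, K.smean_lam_cube hd j] at h
  rw [h]
  field_simp
  ring

variable (K) in
theorem smean_lam_mul_lam (hd : 1 ≤ d) (j k : Fin (d + 1)) :
    K.smean (fun x => K.lam j x * K.lam k x) =
      (1 + if k = j then 1 else 0) / (((d : ℝ) + 1) * (d + 2)) := by
  split_ifs with h
  · subst h
    simp only [← pow_two, K.smean_lam_sq hd]
    norm_num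
  · have h1 := K.smean_lam_pow_mul hd 1 h
    rw [K.smean_lam_sq hd] at h1
    simp only [pow_one, Nat.cast_one] at h1
    field_simp at h1 ⊢
    linarith

variable (K) in
theorem smean_lam_sq_mul_lam (hd : 1 ≤ d) (j k : Fin (d + 1)) :
    K.smean (fun x => K.lam j x ^ 2 * K.lam k x) =
      (2 + if k = j then 4 else 0) / (((d : ℝ) + 1) * (d + 2) * (d + 3)) := by
  split_ifs with h
  · subst h
    simp only [← pow_succ, K.smean_lam_cube hd]
    norm_num
  · have h1 := K.smean_lam_pow_mul hd 2 h
    rw [K.smean_lam_cube hd] at h1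
    simp only [Nat.cast_ofNat] at h1
    field_simp at h1 ⊢
    linarith

variable (K) in
theorem smean_lam_cube_mul_lam (hd : 1 ≤ d) (j k : Fin (d + 1)) :
    K.smean (fun x => K.lam j x ^ 3 * K.lam k x) =
      (6 + if k = j then 18 else 0) / (((d : ℝ) + 1) * (d + 2) * (d + 3) * (d + 4)) := by
  split_ifs with h
  · subst h
    simp only [← pow_succ, K.smean_lam_pow_four hd]
    norm_num
  · have h1 := K.smean_lam_pow_mul hd 3 h
    rw [K.smean_lam_pow_four hd] at h1
    simp only [Nat.cast_ofNat] at h1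
    field_simp at h1 ⊢
    linarith

theorem mean_add {f g : TS d → ℝ} (hf : IntegrableOn f K.openCell) (hg : IntegrableOn g K.openCell) :
    K.mean (fun x => f x + g x) = K.mean f + K.mean g := by
  rw [mean, integral_add hf hg, mul_add]
  rfl

theorem mean_const_mul (c : ℝ) (f : TS d → ℝ) :
    K.mean (fun x => c * f x) = c * K.mean f := by
  rw [mean, integral_const_mul, mean]
  ring

theorem mean_mul_prod (α : ℝ → ℝ) (f : Sp d → ℝ) :
    K.mean (fun z => α z.1 * f z.2) = (K.ht⁻¹ * ∫ t in K.a..K.b, α t) * K.smean f := by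
  rw [mean, setIntegral_congr_set K.openCell_ae_eq, carrier, Measure.volume_eq_prod,
    setIntegral_prod_mul, smean, intervalIntegral.integral_of_le K.hab.le, ← integral_Icc_eq_integral_Ioc,
    ← Measure.volume_eq_prod, ← carrier, volume_real_carrier, mul_inv]
  ring

theorem integral_tc : ∫ t in K.a..K.b, K.tc t = 0 := by
  simp only [tc]
  rw [intervalIntegral.integral_sub (by simp) (by simp), integral_id, intervalIntegral.integral_const,
    smul_eq_mul]
  ring

theorem integral_tc_sq : ∫ t in K.a..K.b, K.tc t ^ 2 = K.ht ^ 3 / 12 := by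
  simp only [tc]
  rw [intervalIntegral.integral_comp_sub_right (fun t => t ^ 2), integral_pow, ht]
  ring

variable (K) in
theorem continuous_tc : Continuous K.tc := continuous_id.sub continuous_const

/-- Time is centred at the midpoint, so the linear term has mean zero, and the quadratic one
contributes the variance `h_t ^ 2 / 12` of the uniform distribution on `K_t`. -/
theorem mean_quadratic {f g h : Sp d → ℝ} (hf : Continuous f) (hg : Continuous g)
    (hh : Continuous h) :
    K.mean (fun z => f z.2 + K.tc z.1 * g z.2 + K.tc z.1 ^ 2 * h z.2) =
      K.smean f + K.ht ^ 2 / 12 * K.smean h := by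
  have ct := K.continuous_tc
  have hi : ∀ {F : TS d → ℝ}, Continuous F → IntegrableOn F K.openCell := fun hF =>
    (hF.integrableOn_of_isCompact K.isCompact_carrier).mono_set K.openCell_subset
  have h0 := K.mean_mul_prod (fun _ => 1) f
  have h1 := K.mean_mul_prod K.tc g
  have h2 := K.mean_mul_prod (fun t => K.tc t ^ 2) h
  have hp := K.ht_pos
  rw [mean_add (hi (by fun_prop)) (hi (by fun_prop)), mean_add (hi (by fun_prop)) (hi (by fun_prop)),
    h1, h2, integral_tc, integral_tc_sq]
  simp only [one_mul] at h0
  rw [h0]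
  simp only [intervalIntegral.integral_const, smul_eq_mul]
  rw [ht] at *
  field_simp
  ring

end Cell

/-! ### The correction polynomials -/

/-- Coefficients of the correction polynomials. -/
theorem exists_correction_coeffs {d : ℕ} (hd : 1 ≤ d) : ∃ c₀ c₁ c₂ c₃ κ : ℝ, (d ≠ 1 → c₃ = 0) ∧
    24 * c₃ + 6 * (d + 4) * c₂ + 2 * ((d + 3) * (d + 4)) * c₁ + (d + 2) * ((d + 3) * (d + 4)) * c₀ +
      κ * (2 * (d + 3) * (d + 4)) = 0 ∧
    6 * c₃ + 2 * (d + 4) * c₂ + (d + 3) * (d + 4) * c₁ + (d + 2) * ((d + 3) * (d + 4)) * c₀ +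
      κ * (2 * (d + 3) * (d + 4)) = 0 ∧
    18 * c₃ + 4 * (d + 3) * c₂ + (d + 2) * (d + 3) * c₁ + κ * (2 * d * (d + 3)) = 0 ∧
    6 * c₃ + 2 * (d + 2) * c₂ + (d + 2) * (d + 1) * c₁ = - (d * ((d + 1) * (d + 2) : ℝ)) := by
  rcases eq_or_ne d 1 with rfl | h1
  -- On an interval, orthogonality to affine functions and prescribed values at both end points are
  -- four conditions, one more than quadratics can satisfy.
  · refine ⟨1, -9, 18, -10, 0, ?_, ?_, ?_, ?_, ?_⟩ <;> norm_num
  · have h2 : (1 : ℝ) < d := by exact_mod_cast lt_of_le_of_ne hd (Ne.symm h1)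
    have h3 : (d : ℝ) - 1 ≠ 0 := by linarith
    -- With `c₃ = 0` the difference of the two orthogonality equations gives `c₁ = -4 c₂ / (d + 3)`,
    -- the third equation gives `κ`, and the last one fixes `c₂ = N`; the denominator `d - 1` is the
    -- obstruction for `d = 1`.
    set N : ℝ := d * (d + 1) * (d + 3) / (2 * (d - 1)) with hN
    refine ⟨N * (2 / ((d + 2) * (d + 3)) + 4 / (d * (d + 3) * (d + 2))), -4 * N / (d + 3), N, 0,
      -2 * N / (d * (d + 3)), fun _ => rfl, ?_, ?_, ?_, ?_⟩ <;>
    · rw [hN]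
      field_simp
      ring

end HeatDPG

end

noncomputable section

namespace HeatDPG

/-! ### Gradients of functions of time and space -/

/-- `φ` is differentiable at `z` with time derivative `a` and spatial gradient `g`. -/
def HasGradAt {d : ℕ} (φ : TS d → ℝ) (a : ℝ) (g : Sp d) (z : TS d) : Prop :=
  HasFDerivAt φ (a • ContinuousLinearMap.fst ℝ ℝ (Sp d) +
    (innerSL ℝ g).comp (ContinuousLinearMap.snd ℝ ℝ (Sp d))) z

namespace HasGradAt

variable {d : ℕ} {φ ψ : TS d → ℝ} {a b : ℝ} {g k : Sp d} {z : TS d}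

theorem dt_eq (h : HasGradAt φ a g z) : dt φ z = a := by
  rw [dt, HasFDerivAt.fderiv h]
  simp

theorem fderiv_apply (h : HasGradAt φ a g z) (v : TS d) : fderiv ℝ φ z v = a * v.1 + ⟪g, v.2⟫ := by
  rw [HasFDerivAt.fderiv h]
  simp

theorem gradX_eq (h : HasGradAt φ a g z) : gradX φ z = g := by
  ext i
  rw [gradX]
  simp only [h.fderiv_apply]
  simp [EuclideanSpace.inner_single_right]

theorem congr (h : HasGradAt φ a g z) (ha : a = b) (hg : g = k) : HasGradAt φ b k z := ha ▸ hg ▸ h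

theorem const (c : ℝ) : HasGradAt (fun _ => c) 0 0 z := by
  refine (hasFDerivAt_const c z).congr_fderiv ?_
  ext v <;> simp

theorem add (h : HasGradAt φ a g z) (h' : HasGradAt ψ b k z) :
    HasGradAt (fun z => φ z + ψ z) (a + b) (g + k) z := by
  refine (HasFDerivAt.add h h').congr_fderiv ?_
  ext v <;> simp

theorem mul (h : HasGradAt φ a g z) (h' : HasGradAt ψ b k z) :
    HasGradAt (fun z => φ z * ψ z) (φ z * b + ψ z * a) (φ z • k + ψ z • g) z := by
  refine (HasFDerivAt.mul h h').congr_fderiv ?_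
  ext v <;> simp

theorem const_mul (c : ℝ) (h : HasGradAt φ a g z) :
    HasGradAt (fun z => c * φ z) (c * a) (c • g) z := by
  have h1 := (const c).mul h
  simpa using h1

theorem pow (h : HasGradAt φ a g z) (n : ℕ) :
    HasGradAt (fun z => φ z ^ n) ((n * φ z ^ (n - 1)) * a) ((n * φ z ^ (n - 1)) • g) z := by
  refine (HasFDerivAt.pow h n).congr_fderiv ?_
  ext v <;> simp

theorem sum {ι : Type*} (s : Finset ι) {φ : ι → TS d → ℝ} {a : ι → ℝ} {g : ι → Sp d}
    (h : ∀ i ∈ s, HasGradAt (φ i) (a i) (g i) z) :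
    HasGradAt (fun z => ∑ i ∈ s, φ i z) (∑ i ∈ s, a i) (∑ i ∈ s, g i) z := by
  refine (HasFDerivAt.fun_sum h).congr_fderiv ?_
  ext v <;> simp [Finset.sum_add_distrib]

theorem tc (K : Cell d) (z : TS d) : HasGradAt (fun z => K.tc z.1) 1 0 z := by
  refine ((hasFDerivAt_fst (𝕜 := ℝ) (p := z)).sub_const ((K.a + K.b) / 2)).congr_fderiv ?_
  ext v <;> simp

theorem lam (K : Cell d) (i : Fin (d + 1)) (z : TS d) :
    HasGradAt (fun z => K.lam i z.2) 0 (K.grad i) z := by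
  refine ((K.hasFDerivAt_lam i z.2).comp z hasFDerivAt_snd).congr_fderiv ?_
  ext v <;> simp

end HasGradAt

/-! ### The local polynomial fields -/

/-- Coefficients defining the correction polynomials. -/
structure Correction (d : ℕ) where
  c₀ : ℝ
  c₁ : ℝ
  c₂ : ℝ
  c₃ : ℝ
  κ : ℝ
  cubic : d ≠ 1 → c₃ = 0
  -- The next two equations say that the mean of `λ_i` times the `j`-th correction vanishes for `i =
  -- j` and for `i ≠ j`. The equation `facet` says that the mean of `(x - p_i) · ∇` of the `j`-th
  -- correction vanishes for `i ≠ j`, and together with `facet_self` it gives the value `d` for `i =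
  -- j`.
  orth_self : 24 * c₃ + 6 * (d + 4) * c₂ + 2 * ((d + 3) * (d + 4)) * c₁ +
    (d + 2) * ((d + 3) * (d + 4)) * c₀ + κ * (2 * (d + 3) * (d + 4)) = 0
  orth : 6 * c₃ + 2 * (d + 4) * c₂ + (d + 3) * (d + 4) * c₁ + (d + 2) * ((d + 3) * (d + 4)) * c₀ +
    κ * (2 * (d + 3) * (d + 4)) = 0
  facet : 18 * c₃ + 4 * (d + 3) * c₂ + (d + 2) * (d + 3) * c₁ + κ * (2 * d * (d + 3)) = 0
  facet_self : 6 * c₃ + 2 * (d + 2) * c₂ + (d + 2) * (d + 1) * c₁ =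
    - (d * ((d + 1) * (d + 2) : ℝ))

theorem exists_correction {d : ℕ} (hd : 1 ≤ d) : Nonempty (Correction d) := by
  obtain ⟨c₀, c₁, c₂, c₃, κ, h1, h2, h3, h4, h5⟩ := exists_correction_coeffs hd
  exact ⟨⟨c₀, c₁, c₂, c₃, κ, h1, h2, h3, h4, h5⟩⟩

/-- The coefficients of a local polynomial field. -/
structure Coeffs (d : ℕ) where
  A : Fin (d + 1) → ℝ
  B : Fin (d + 1) → ℝ
  β : Fin (d + 1) → ℝ
  m : Sp d
  c : Sp d
  s : ℝ
  s' : ℝ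

/-- A linear map given by its values on linear combinations. -/
def linearOfComb {M N : Type*} [AddCommGroup M] [Module ℝ M] [AddCommGroup N] [Module ℝ N]
    (f : M → N) (h : ∀ (c : ℝ) x y, f (c • x + y) = c • f x + f y) : M →ₗ[ℝ] N where
  toFun := f
  map_add' x y := by simpa using h 1 x y
  map_smul' c x := by
    have h0 : f 0 = 0 := by simpa using h 1 0 0
    simpa [h0] using h c x 0

namespace Cell

variable {d : ℕ} (K : Cell d) (C : Correction d)

/-- The correction polynomial belonging to the `j`-th facet. -/
def corr (j : Fin (d + 1)) (x : Sp d) : ℝ :=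
  C.c₀ + C.c₁ * K.lam j x + C.c₂ * K.lam j x ^ 2 + C.c₃ * K.lam j x ^ 3 +
    C.κ * ∑ k, K.lam k x ^ 2

/-- The gradient of the correction polynomial. -/
def gradCorr (j : Fin (d + 1)) (x : Sp d) : Sp d :=
  (C.c₁ + 2 * C.c₂ * K.lam j x + 3 * C.c₃ * K.lam j x ^ 2) • K.grad j +
    (2 * C.κ) • ∑ k, K.lam k x • K.grad k

/-- The local polynomial field with given coefficients. -/
def poly (q : Coeffs d) (z : TS d) : Val d :=
  WithLp.toLp 2 (∑ i, (q.A i + q.B i * K.tc z.1) * K.lam i z.2 + ∑ j, q.β j * K.corr C j z.2,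
    q.m + K.tc z.1 • q.c + (q.s + q.s' * K.tc z.1) • (z.2 - K.center))

theorem poly_fst (q : Coeffs d) (z : TS d) : (K.poly C q z).fst =
    ∑ i, (q.A i + q.B i * K.tc z.1) * K.lam i z.2 + ∑ j, q.β j * K.corr C j z.2 := rfl

theorem poly_snd (q : Coeffs d) (z : TS d) : (K.poly C q z).snd =
    q.m + K.tc z.1 • q.c + (q.s + q.s' * K.tc z.1) • (z.2 - K.center) := rfl

theorem continuous_corr (j : Fin (d + 1)) : Continuous (K.corr C j) := by
  have cl := K.continuous_lam
  unfold corr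
  fun_prop

theorem hasGradAt_corr (j : Fin (d + 1)) (z : TS d) :
    HasGradAt (fun z => K.corr C j z.2) 0 (K.gradCorr C j z.2) z := by
  have h := (((((HasGradAt.const C.c₀).add ((HasGradAt.lam K j z).const_mul C.c₁)).add
    (((HasGradAt.lam K j z).pow 2).const_mul C.c₂)).add
    (((HasGradAt.lam K j z).pow 3).const_mul C.c₃)).add
    ((HasGradAt.sum Finset.univ fun k _ => (HasGradAt.lam K k z).pow 2).const_mul C.κ))
  refine HasGradAt.congr h (by simp) ?_
  have e : ∑ k, (((2 : ℕ) : ℝ) * K.lam k z.2 ^ (2 - 1)) • K.grad k =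
      (2 : ℝ) • ∑ k, K.lam k z.2 • K.grad k := by
    rw [Finset.smul_sum]
    exact Finset.sum_congr rfl fun k _ => by rw [smul_smul]; norm_num
  rw [gradCorr, e]
  norm_num
  module

theorem hasGradAt_poly (q : Coeffs d) (z : TS d) :
    HasGradAt (fun z => (K.poly C q z).fst) (∑ i, q.B i * K.lam i z.2)
      (∑ i, (q.A i + q.B i * K.tc z.1) • K.grad i + ∑ j, q.β j • K.gradCorr C j z.2) z := by
  have h := (HasGradAt.sum Finset.univ fun i _ =>
    ((HasGradAt.const (q.A i)).add ((HasGradAt.tc K z).const_mul (q.B i))).mul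
      (HasGradAt.lam K i z)).add
    (HasGradAt.sum Finset.univ fun j _ => (K.hasGradAt_corr C j z).const_mul (q.β j))
  refine HasGradAt.congr h ?_ ?_
  · simp [mul_comm]
  · simp

theorem divX_poly (q : Coeffs d) (z : TS d) :
    divX (fun z => (K.poly C q z).snd) z = d * (q.s + q.s' * K.tc z.1) := by
  have h1 : HasFDerivAt (fun z : TS d => K.tc z.1) (ContinuousLinearMap.fst ℝ ℝ (Sp d)) z :=
    (hasFDerivAt_fst (𝕜 := ℝ) (p := z)).sub_const _
  have h2 : HasFDerivAt (fun z : TS d => (K.poly C q z).snd) _ z :=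
    ((h1.smul_const q.c).const_add q.m).add
    (((h1.const_mul q.s').const_add q.s).smul ((hasFDerivAt_snd (𝕜 := ℝ) (p := z)).sub_const K.center))
  rw [divX, h2.fderiv]
  simp
  ring

theorem contDiff_tc : ContDiff ℝ ∞ fun z : TS d => K.tc z.1 := contDiff_fst.sub contDiff_const

theorem contDiff_lam_snd (i : Fin (d + 1)) : ContDiff ℝ ∞ fun z : TS d => K.lam i z.2 :=
  (K.contDiff_lam i).comp contDiff_snd

theorem contDiff_toLp {f : TS d → ℝ} {g : TS d → Sp d} (hf : ContDiff ℝ ∞ f) (hg : ContDiff ℝ ∞ g) :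
    ContDiff ℝ ∞ fun z => (WithLp.toLp 2 (f z, g z) : Val d) :=
  (WithLp.prodContinuousLinearEquiv 2 ℝ ℝ (Sp d)).symm.contDiff.comp (hf.prodMk hg)

theorem contDiff_poly (q : Coeffs d) : ContDiff ℝ ∞ (K.poly C q) := by
  have c1 := K.contDiff_tc
  have c2 := K.contDiff_lam_snd
  refine contDiff_toLp ?_ ?_
  · unfold corr
    fun_prop
  · fun_prop

/-! ### Weighted means of broken test functions -/

/-- Weights for `e`, `χ`, `div 𝐰` and `∇_x e` where `𝐰 = (e, χ)`. -/
abbrev _root_.HeatDPG.Weight (d : ℕ) : Type :=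
  C(TS d, ℝ) × C(TS d, Sp d) × C(TS d, ℝ) × C(TS d, Sp d)

/-- The density of a weighted mean in terms of `𝐰` and `A^* 𝐰`. -/
def dens (W : Weight d) (w a : TS d → Val d) (z : TS d) : ℝ :=
  W.1 z * (w z).fst + ⟪W.2.1 z, (w z).snd⟫ - W.2.2.1 z * (a z).fst +
    ⟪W.2.2.2 z, (w z).snd - (a z).snd⟫

variable {K}

theorem integrableOn_dens (W : Weight d) {w a : TS d → Val d}
    (hw : MemLp w 2 (volume.restrict K.openCell)) (ha : MemLp a 2 (volume.restrict K.openCell)) :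
    IntegrableOn (dens W w a) K.openCell := by
  have hc : ∀ {E : Type} [NormedAddCommGroup E] [SecondCountableTopology E] (f : C(TS d, E)),
      MemLp f 2 (volume.restrict K.openCell) := fun f =>
    f.continuous.memLp_restrict K.isCompact_carrier K.openCell_subset
  exact ((((hc W.1).integrable_mul (memLp_fst hw)).add
    (integrable_inner_of_memLp (hc W.2.1) (memLp_snd hw))).sub
    ((hc W.2.2.1).integrable_mul (memLp_fst ha))).add
    (integrable_inner_of_memLp (hc W.2.2.2) ((memLp_snd hw).sub (memLp_snd ha)))

theorem memLp_openCell {T : ℝ} {Ω : Set (Sp d)} (hK : K.openCell ⊆ cyl T Ω) (w : L2Q T Ω) :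
    MemLp w 2 (volume.restrict K.openCell) :=
  (Lp.memLp w).mono_measure (Measure.restrict_mono_set _ hK)

theorem ae_openCell {T : ℝ} {Ω : Set (Sp d)} (hK : K.openCell ⊆ cyl T Ω) {p : TS d → Prop}
    (h : ∀ᵐ z ∂volume.restrict (cyl T Ω), p z) : ∀ᵐ z ∂volume.restrict K.openCell, p z :=
  ae_mono (Measure.restrict_mono_set _ hK) h

theorem mean_congr {f g : TS d → ℝ} (h : ∀ᵐ z ∂volume.restrict K.openCell, f z = g z) :
    K.mean f = K.mean g := by rw [mean, integral_congr_ae h, mean]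

theorem mean_dens_comb (W : Weight d) (c : ℝ) {w a w' a' u b : TS d → Val d}
    (hw : MemLp w 2 (volume.restrict K.openCell)) (ha : MemLp a 2 (volume.restrict K.openCell))
    (hw' : MemLp w' 2 (volume.restrict K.openCell)) (ha' : MemLp a' 2 (volume.restrict K.openCell))
    (h1 : ∀ᵐ z ∂volume.restrict K.openCell, u z = c • w z + w' z)
    (h2 : ∀ᵐ z ∂volume.restrict K.openCell, b z = c • a z + a' z) :
    K.mean (dens W u b) = c * K.mean (dens W w a) + K.mean (dens W w' a') := by
  rw [← mean_const_mul, ← mean_add ((integrableOn_dens W hw ha).const_mul c)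
    (integrableOn_dens W hw' ha')]
  refine mean_congr ?_
  filter_upwards [h1, h2] with z h1 h2
  simp only [dens, h1, h2, WithLp.add_fst, WithLp.add_snd, WithLp.smul_fst, WithLp.smul_snd,
    inner_add_right, inner_sub_right, real_inner_smul_right, smul_eq_mul]
  ring

theorem _root_.HeatDPG.HA.field_comb {T : ℝ} {Ω : Set (Sp d)} {𝒯 : Finset (Cell d)} (c : ℝ)
    (w w' : HA T Ω 𝒯) :
    HA.field T Ω 𝒯 (c • w + w') = c • HA.field T Ω 𝒯 w + HA.field T Ω 𝒯 w' := rfl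

theorem _root_.HeatDPG.HA.astar_comb {T : ℝ} {Ω : Set (Sp d)} {𝒯 : Finset (Cell d)} (c : ℝ)
    (w w' : HA T Ω 𝒯) :
    HA.astar T Ω 𝒯 (c • w + w') = c • HA.astar T Ω 𝒯 w + HA.astar T Ω 𝒯 w' := rfl

theorem mean_dens_comb_HA {T : ℝ} {Ω : Set (Sp d)} {𝒯 : Finset (Cell d)}
    (hK : K.openCell ⊆ cyl T Ω) (W : Weight d) (c : ℝ) (w w' : HA T Ω 𝒯) :
    K.mean (dens W (HA.field T Ω 𝒯 (c • w + w')) (HA.astar T Ω 𝒯 (c • w + w'))) =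
      c * K.mean (dens W (HA.field T Ω 𝒯 w) (HA.astar T Ω 𝒯 w)) +
        K.mean (dens W (HA.field T Ω 𝒯 w') (HA.astar T Ω 𝒯 w')) := by
  refine mean_dens_comb W c (memLp_openCell hK _) (memLp_openCell hK _) (memLp_openCell hK _)
    (memLp_openCell hK _) (ae_openCell hK ?_) (ae_openCell hK ?_)
  · rw [HA.field_comb]
    exact coeFn_comb c _ _
  · rw [HA.astar_comb]
    exact coeFn_comb c _ _

/-- Weighted means as linear functionals. -/
def wmean {T : ℝ} {Ω : Set (Sp d)} {𝒯 : Finset (Cell d)} (hK : K.openCell ⊆ cyl T Ω) :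
    Weight d →ₗ[ℝ] HA T Ω 𝒯 →ₗ[ℝ] ℝ where
  toFun W := linearOfComb (fun w => K.mean (dens W (HA.field T Ω 𝒯 w) (HA.astar T Ω 𝒯 w)))
    (fun c w w' => mean_dens_comb_HA hK W c w w')
  map_add' W W' := LinearMap.ext fun w => by
    have h := fun W => integrableOn_dens (K := K) W (memLp_openCell hK (HA.field T Ω 𝒯 w))
      (memLp_openCell hK (HA.astar T Ω 𝒯 w))
    refine Eq.trans ?_ (mean_add (h W) (h W'))
    refine congrArg K.mean (funext fun z => ?_)
    simp only [dens, Prod.fst_add, Prod.snd_add, ContinuousMap.add_apply, inner_add_left]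
    ring
  map_smul' c W := LinearMap.ext fun w => by
    refine Eq.trans ?_ (mean_const_mul c _)
    refine congrArg K.mean (funext fun z => ?_)
    simp only [dens, Prod.smul_fst, Prod.smul_snd, ContinuousMap.smul_apply, smul_eq_mul,
      real_inner_smul_left]
    ring

theorem wmean_apply {T : ℝ} {Ω : Set (Sp d)} {𝒯 : Finset (Cell d)} (hK : K.openCell ⊆ cyl T Ω)
    (W : Weight d) (w : HA T Ω 𝒯) :
    wmean hK W w = K.mean (dens W (HA.field T Ω 𝒯 w) (HA.astar T Ω 𝒯 w)) := rfl

variable (K)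

/-! ### Moments of local polynomial fields -/

/-- The weight of the mean of `e`. -/
def wE : Weight d := (1, 0, 0, 0)

/-- The weight of the mean of `v · χ`. -/
def wX (v : Sp d) : Weight d := (0, ContinuousMap.const _ v, 0, 0)

/-- The weight of the mean of `λ_i div 𝐰`. -/
def wD (i : Fin (d + 1)) : Weight d :=
  (0, 0, ⟨fun z => K.lam i z.2, (K.continuous_lam i).comp continuous_snd⟩, 0)

/-- The weight of the mean of `λ_i e + t (∇λ_i · χ + λ_i div 𝐰)`. -/
def wT (i : Fin (d + 1)) : Weight d :=
  (⟨fun z => K.lam i z.2, (K.continuous_lam i).comp continuous_snd⟩,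
    ⟨fun z => K.tc z.1 • K.grad i, by have := K.continuous_tc; fun_prop⟩,
    ⟨fun z => K.tc z.1 * K.lam i z.2, by
      have := K.continuous_tc; have := K.continuous_lam i; fun_prop⟩, 0)

/-- The weight of the mean of `(x - p_i) · ∇_x e`. -/
def wG (i : Fin (d + 1)) : Weight d := (0, 0, 0, ⟨fun z => z.2 - K.vert i, by fun_prop⟩)

/-- The four groups of terms are the contributions of `e`, `χ`, `div 𝐰` and `∇_x e` of the
polynomial field, which makes each moment a quadratic polynomial in time. -/
theorem dens_poly (W : Weight d) (q : Coeffs d) (z : TS d) :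
    dens W (K.poly C q) (astarOp (K.poly C q)) z =
      W.1 z * (∑ i, (q.A i + q.B i * K.tc z.1) * K.lam i z.2 + ∑ j, q.β j * K.corr C j z.2) +
      (⟪W.2.1 z, q.m⟫ + K.tc z.1 * ⟪W.2.1 z, q.c⟫ +
        (q.s + q.s' * K.tc z.1) * ⟪W.2.1 z, z.2 - K.center⟫) +
      W.2.2.1 z * (∑ i, q.B i * K.lam i z.2 + d * (q.s + q.s' * K.tc z.1)) +
      (∑ i, (q.A i + q.B i * K.tc z.1) * ⟪W.2.2.2 z, K.grad i⟫ +
        ∑ j, q.β j * ⟪W.2.2.2 z, K.gradCorr C j z.2⟫) := by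
  have h1 : (K.poly C q z).snd - (astarOp (K.poly C q) z).snd =
      ∑ i, (q.A i + q.B i * K.tc z.1) • K.grad i + ∑ j, q.β j • K.gradCorr C j z.2 := by
    simp [astarOp, (K.hasGradAt_poly C q z).gradX_eq]
  have h2 : (astarOp (K.poly C q) z).fst =
      -(∑ i, q.B i * K.lam i z.2 + d * (q.s + q.s' * K.tc z.1)) := by
    simp [astarOp, (K.hasGradAt_poly C q z).dt_eq, divX_poly]
  rw [dens, h1, h2]
  simp only [poly_fst, poly_snd, inner_add_right, real_inner_smul_right, inner_sum]
  ring

end Cell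

end HeatDPG

end

/-! ### Evaluation of the moments of local polynomial fields -/

noncomputable section

namespace HeatDPG

namespace Cell

variable {d : ℕ} {K : Cell d}

variable (K) (C : Correction d)

/-- Orthogonality to affine functions keeps the corrections out of the means of `e` and `λ_i e`, so
these are controlled by the affine part alone. -/
theorem smean_lam_mul_corr (hd : 1 ≤ d) (i j : Fin (d + 1)) :
    K.smean (fun x => K.lam i x * K.corr C j x) = 0 := by
  have cl := K.continuous_lam
  have e : (fun x => K.lam i x * K.corr C j x) = fun x =>
      C.c₀ * K.lam i x + C.c₁ * (K.lam j x * K.lam i x) + C.c₂ * (K.lam j x ^ 2 * K.lam i x) +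
        C.c₃ * (K.lam j x ^ 3 * K.lam i x) + C.κ * ∑ k, K.lam k x ^ 2 * K.lam i x := by
    ext x
    rw [corr, ← Finset.sum_mul]
    ring
  rw [e, smean_add (by fun_prop) (by fun_prop), smean_add (by fun_prop) (by fun_prop),
    smean_add (by fun_prop) (by fun_prop), smean_add (by fun_prop) (by fun_prop)]
  simp only [smean_const_mul]
  rw [smean_sum _ fun k _ => by fun_prop]
  rw [show K.smean (fun x => K.lam i x) = _ from K.smean_lam hd i]
  simp only [K.smean_lam_mul_lam hd, K.smean_lam_sq_mul_lam hd, K.smean_lam_cube_mul_lam hd]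
  rw [← Finset.sum_div, Finset.sum_add_distrib]
  simp only [Finset.sum_const, Finset.card_univ, Fintype.card_fin, nsmul_eq_mul, Finset.sum_ite_eq,
    Finset.mem_univ, if_true]
  push_cast
  have h1 := C.orth_self
  have h2 := C.orth
  have h3 : (0 : ℝ) ≤ d := Nat.cast_nonneg d
  by_cases hij : i = j
  · simp only [if_pos hij]
    field_simp
    linear_combination h1
  · simp only [if_neg hij]
    field_simp
    linear_combination h2

theorem smean_corr (hd : 1 ≤ d) (j : Fin (d + 1)) : K.smean (K.corr C j) = 0 := by
  have cl := K.continuous_lam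
  have cc := K.continuous_corr C
  have e : K.corr C j = fun x => ∑ i, K.lam i x * K.corr C j x := by
    ext x
    rw [← Finset.sum_mul, sum_lam, one_mul]
  rw [e, smean_sum _ fun k _ => by fun_prop]
  simp only [K.smean_lam_mul_corr C hd, Finset.sum_const_zero]

theorem inner_sub_vert_grad (i j : Fin (d + 1)) (x : Sp d) :
    ⟪x - K.vert i, K.grad j⟫ = K.lam j x - if j = i then 1 else 0 := by
  rw [real_inner_comm, inner_grad_sub_vert]

theorem mean_eq_of_quadratic {F : TS d → ℝ} {f g h : Sp d → ℝ} (hf : Continuous f)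
    (hg : Continuous g) (hh : Continuous h)
    (hF : ∀ z, F z = f z.2 + K.tc z.1 * g z.2 + K.tc z.1 ^ 2 * h z.2) :
    K.mean F = K.smean f + K.ht ^ 2 / 12 * K.smean h := by
  rw [funext hF, mean_quadratic hf hg hh]

theorem inner_sub_vert_gradCorr (i j : Fin (d + 1)) (x : Sp d) :
    ⟪x - K.vert i, K.gradCorr C j x⟫ =
      (C.c₁ + 2 * C.c₂ * K.lam j x + 3 * C.c₃ * K.lam j x ^ 2) *
        (K.lam j x - if j = i then 1 else 0) + 2 * C.κ * (∑ k, K.lam k x ^ 2 - K.lam i x) := by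
  rw [gradCorr, inner_add_right, real_inner_smul_right, real_inner_smul_right, inner_sum]
  simp only [real_inner_smul_right, inner_sub_vert_grad]
  congr 2
  simp only [mul_sub, mul_ite, mul_one, mul_zero, Finset.sum_sub_distrib, Finset.sum_ite_eq',
    Finset.mem_univ, if_true, pow_two]

/-- Since the corrections have mean zero, the cone formula turns this into a statement on facets:
the `j`-th correction has zero integral over every facet except the `j`-th one. -/
theorem smean_inner_gradCorr (hd : 1 ≤ d) (i j : Fin (d + 1)) :
    K.smean (fun x => ⟪x - K.vert i, K.gradCorr C j x⟫) = if j = i then (d : ℝ) else 0 := by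
  have cl := K.continuous_lam
  set δ : ℝ := if j = i then 1 else 0 with hδ
  have e : (fun x => ⟪x - K.vert i, K.gradCorr C j x⟫) = fun x =>
      3 * C.c₃ * K.lam j x ^ 3 + (2 * C.c₂ - 3 * C.c₃ * δ) * K.lam j x ^ 2 +
        (C.c₁ - 2 * C.c₂ * δ) * K.lam j x + (- C.c₁ * δ) * 1 + (2 * C.κ) * ∑ k, K.lam k x ^ 2 +
        (-2 * C.κ) * K.lam i x := by
    ext x
    rw [inner_sub_vert_gradCorr]
    ring
  rw [e, smean_add (by fun_prop) (by fun_prop), smean_add (by fun_prop) (by fun_prop),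
    smean_add (by fun_prop) (by fun_prop), smean_add (by fun_prop) (by fun_prop),
    smean_add (by fun_prop) (by fun_prop)]
  simp only [smean_const_mul]
  rw [smean_sum _ fun k _ => by fun_prop]
  rw [show K.smean (fun x => K.lam i x) = _ from K.smean_lam hd i,
    show K.smean (fun x => K.lam j x) = _ from K.smean_lam hd j]
  simp only [K.smean_lam_sq hd, K.smean_lam_cube hd, smean_const, Finset.sum_const,
    Finset.card_univ, Fintype.card_fin, nsmul_eq_mul]
  push_cast
  have h1 := C.facet
  have h2 := C.facet_self
  by_cases hij : j = i
  · rw [if_pos hij, show δ = 1 from if_pos hij]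
    field_simp
    linear_combination h1 - (d + 3) * h2
  · rw [if_neg hij, show δ = 0 from if_neg hij]
    field_simp
    linear_combination h1

theorem sub_center_eq (x : Sp d) : x - K.center = ∑ i, K.lam i x • (K.vert i - K.center) :=
  (K.sum_lam_smul_sub x K.center).symm

/-- The average of the vertices is the centre of mass. Centring there decouples the constant part
`m` from the part with nonzero divergence. -/
theorem smean_inner_sub_center (hd : 1 ≤ d) (v : Sp d) :
    K.smean (fun x => ⟪v, x - K.center⟫) = 0 := by
  have cl := K.continuous_lam
  have e : (fun x => ⟪v, x - K.center⟫) = fun x => ∑ i, ⟪v, K.vert i - K.center⟫ * K.lam i x := by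
    ext x
    rw [sub_center_eq, inner_sum]
    simp only [real_inner_smul_right, mul_comm]
  rw [e, smean_sum _ fun k _ => by fun_prop]
  simp only [smean_const_mul]
  have h1 : ∀ i, K.smean (fun x => K.lam i x) = K.lam i K.center := fun i =>
    (K.smean_lam hd i).trans (K.lam_center i).symm
  simp only [h1, mul_comm _ (K.lam _ _), ← real_inner_smul_right]
  rw [← inner_sum, ← sub_center_eq, sub_self, inner_zero_right]

/-- The mean of the density of a local polynomial field. -/
def pmean (W : Weight d) (q : Coeffs d) : ℝ :=
  K.mean (dens W (K.poly C q) (astarOp (K.poly C q)))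

/-- This and the following formulas form a triangular system for the coefficients: the means of `e`
and `λ_i e` determine `A`, that of `χ` determines `m`, those of `λ_i div 𝐰` determine `B` and `s`,
the time-weighted ones `c` and `s'`, and finally `wG` determines `β`. -/
theorem pmean_wE (hd : 1 ≤ d) (q : Coeffs d) :
    K.pmean C wE q = ((d : ℝ) + 1)⁻¹ * ∑ i, q.A i := by
  have cl := K.continuous_lam
  have cc := K.continuous_corr C
  refine (K.mean_eq_of_quadratic (f := (fun x => ∑ i, q.A i * K.lam i x + ∑ j, q.β j * K.corr C j x))
    (g := (fun x => ∑ i, q.B i * K.lam i x))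
    (h := (fun _ => 0)) (by fun_prop) (by fun_prop) (by fun_prop)
    fun z => ?_).trans ?_
  · rw [dens_poly]
    simp only [wE, ContinuousMap.one_apply, ContinuousMap.zero_apply, inner_zero_left, Finset.mul_sum,
      add_mul, Finset.sum_add_distrib]
    simp only [mul_zero, zero_mul, Finset.sum_const_zero, one_mul, add_zero]
    rw [add_right_comm]
    congr 1
    congr 1
    exact funext fun i => by ring
  rw [smean_add (by fun_prop) (by fun_prop), smean_sum _ fun k _ => by fun_prop,
    smean_sum _ fun k _ => by fun_prop]
  simp only [smean_const_mul, smean_const, show ∀ j, K.smean (fun x => K.corr C j x) = 0 from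
    K.smean_corr C hd, show ∀ j, K.smean (fun x => K.lam j x) = _ from K.smean_lam hd]
  rw [← Finset.sum_mul]
  simp [mul_comm]

theorem pmean_wX (hd : 1 ≤ d) (v : Sp d) (q : Coeffs d) : K.pmean C (wX v) q = ⟪v, q.m⟫ := by
  refine (K.mean_eq_of_quadratic (f := (fun x => ⟪v, q.m⟫ + q.s * ⟪v, x - K.center⟫))
    (g := (fun x => ⟪v, q.c⟫ + q.s' * ⟪v, x - K.center⟫))
    (h := (fun _ => 0)) (by fun_prop) (by fun_prop) (by fun_prop)
    fun z => ?_).trans ?_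
  · rw [dens_poly]
    simp only [wX, ContinuousMap.const_apply, ContinuousMap.zero_apply, inner_zero_left,
      mul_zero, zero_mul, Finset.sum_const_zero, add_zero, zero_add]
    ring
  rw [smean_add (by fun_prop) (by fun_prop)]
  simp only [smean_const_mul, smean_const, K.smean_inner_sub_center hd]
  ring

theorem pmean_wD (hd : 1 ≤ d) (i : Fin (d + 1)) (q : Coeffs d) :
    K.pmean C (K.wD i) q = (∑ j, q.B j + q.B i) / ((d + 1) * (d + 2)) + d * q.s / (d + 1) := by
  have cl := K.continuous_lam
  refine (K.mean_eq_of_quadratic (f := (fun x => ∑ j, q.B j * (K.lam j x * K.lam i x) + d * q.s * K.lam i x))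
    (g := (fun x => d * q.s' * K.lam i x))
    (h := (fun _ => 0)) (by fun_prop) (by fun_prop) (by fun_prop)
    fun z => ?_).trans ?_
  · rw [dens_poly]
    simp only [wD, ContinuousMap.coe_mk, ContinuousMap.zero_apply, inner_zero_left,
      mul_zero, zero_mul, Finset.sum_const_zero, add_zero, zero_add, ← mul_assoc, ← Finset.sum_mul]
    ring
  rw [smean_add (by fun_prop) (by fun_prop), smean_sum _ fun k _ => by fun_prop]
  simp only [smean_const_mul, smean_const, K.smean_lam_mul_lam hd,
    show ∀ j, K.smean (fun x => K.lam j x) = _ from K.smean_lam hd]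
  simp only [← mul_div_assoc, mul_add, mul_one, mul_ite, mul_zero]
  rw [← Finset.sum_div, Finset.sum_add_distrib, Finset.sum_ite_eq]
  simp [div_eq_mul_inv]

/-- The coefficients `B`, `m` and `s` enter only with odd powers of the centred time and drop out;
`β` drops out by orthogonality of the corrections. -/
theorem pmean_wT (hd : 1 ≤ d) (i : Fin (d + 1)) (q : Coeffs d) :
    K.pmean C (K.wT i) q = (∑ j, q.A j + q.A i) / ((d + 1) * (d + 2)) +
      K.ht ^ 2 / 12 * (⟪K.grad i, q.c⟫ + d * q.s' / (d + 1)) := by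
  have cl := K.continuous_lam
  have cc := K.continuous_corr C
  refine (K.mean_eq_of_quadratic (f := (fun x => ∑ j, q.A j * (K.lam j x * K.lam i x) + ∑ j, q.β j * (K.lam i x * K.corr C j x)))
    (g := (fun x => (∑ j, q.B j * K.lam j x) * K.lam i x + (⟪K.grad i, q.m⟫ +
        q.s * ⟪K.grad i, x - K.center⟫) + K.lam i x * (∑ j, q.B j * K.lam j x + d * q.s)))
    (h := (fun x => ⟪K.grad i, q.c⟫ + q.s' * ⟪K.grad i, x - K.center⟫ +
          d * q.s' * K.lam i x)) (by fun_prop) (by fun_prop) (by fun_prop)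
    fun z => ?_).trans ?_
  · rw [dens_poly]
    have h1 : ∀ a b : ℝ, ∑ j, (q.A j + q.B j * a) * K.lam j z.2 =
      ∑ j, q.A j * K.lam j z.2 + a * ∑ j, q.B j * K.lam j z.2 := fun a b => by
        rw [Finset.mul_sum, ← Finset.sum_add_distrib]
        exact Finset.sum_congr rfl fun j _ => by ring
    have h2 : ∑ j, q.β j * (K.lam i z.2 * K.corr C j z.2) =
        K.lam i z.2 * ∑ j, q.β j * K.corr C j z.2 := by
      rw [Finset.mul_sum]
      exact Finset.sum_congr rfl fun j _ => by ring
    simp only [wT, ContinuousMap.coe_mk, ContinuousMap.zero_apply, inner_zero_left,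
      mul_zero, Finset.sum_const_zero, add_zero, ← mul_assoc, ← Finset.sum_mul,
      real_inner_smul_left]
    simp only [mul_assoc, h2, h1 _ 0]
    simp only [← mul_assoc]
    ring
  rw [smean_add (by fun_prop) (by fun_prop), smean_sum _ fun k _ => by fun_prop,
    smean_sum _ fun k _ => by fun_prop, smean_add (by fun_prop) (by fun_prop),
    smean_add (by fun_prop) (by fun_prop)]
  simp only [smean_const_mul, smean_const, K.smean_lam_mul_lam hd, K.smean_lam_mul_corr C hd,
    K.smean_inner_sub_center hd,
    show ∀ j, K.smean (fun x => K.lam j x) = _ from K.smean_lam hd]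
  simp only [← mul_div_assoc, mul_add, mul_one, mul_ite, mul_zero]
  rw [← Finset.sum_div, Finset.sum_add_distrib, Finset.sum_ite_eq]
  simp [div_eq_mul_inv]
  ring

/-- The `i`-th facet condition sees only the `i`-th correction, with factor `d`, so `β` can be read
off once `A` is known. -/
theorem pmean_wG (hd : 1 ≤ d) (i : Fin (d + 1)) (q : Coeffs d) :
    K.pmean C (K.wG i) q = ((d : ℝ) + 1)⁻¹ * ∑ j, q.A j - q.A i + d * q.β i := by
  have cl := K.continuous_lam
  have h0 : ∀ j, (fun x => ⟪x - K.vert i, K.gradCorr C j x⟫) = fun x =>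
    (C.c₁ + 2 * C.c₂ * K.lam j x + 3 * C.c₃ * K.lam j x ^ 2) *
        (K.lam j x - if j = i then 1 else 0) + 2 * C.κ * (∑ k, K.lam k x ^ 2 - K.lam i x) :=
    fun j => funext (K.inner_sub_vert_gradCorr C i j)
  have cg : ∀ j, Continuous fun x => ⟪x - K.vert i, K.gradCorr C j x⟫ := fun j => by
    rw [h0]
    fun_prop
  refine (K.mean_eq_of_quadratic (f := (fun x => ∑ j, q.A j * (K.lam j x - if j = i then 1 else 0) +
        ∑ j, q.β j * ⟪x - K.vert i, K.gradCorr C j x⟫))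
    (g := (fun x => ∑ j, q.B j * (K.lam j x - if j = i then 1 else 0)))
    (h := (fun _ => 0)) (by fun_prop) (by fun_prop) (by fun_prop)
    fun z => ?_).trans ?_
  · rw [dens_poly]
    simp only [wG, ContinuousMap.coe_mk, ContinuousMap.zero_apply, inner_zero_left,
      mul_zero, zero_mul, add_zero, zero_add,
      inner_sub_vert_grad, add_mul,
      Finset.sum_add_distrib, Finset.mul_sum]
    rw [add_right_comm]
    congr 1
    congr 1
    exact funext fun j => by ring
  rw [smean_add (by fun_prop) (by fun_prop), smean_sum _ fun k _ => by fun_prop,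
    smean_sum _ fun k _ => by fun_prop]
  have h1 : ∀ j, K.smean (fun x => K.lam j x - if j = i then 1 else 0) =
      ((d : ℝ) + 1)⁻¹ - if j = i then 1 else 0 := fun j => by
    rw [smean_sub (by fun_prop) (by fun_prop), smean_const,
      show K.smean (fun x => K.lam j x) = _ from K.smean_lam hd j]
  simp only [smean_const_mul, smean_const, K.smean_inner_gradCorr C hd, h1]
  simp only [mul_sub, mul_ite, mul_one, mul_zero, Finset.sum_sub_distrib, Finset.sum_ite_eq',
    Finset.mem_univ, if_true, ← Finset.sum_mul]
  ring

end Cell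

end HeatDPG

end

noncomputable section

namespace HeatDPG

namespace Cell

variable {d : ℕ} (K : Cell d) (C : Correction d)

/-! ### The local operator -/

/-- The weight of the mean of `λ_i e`. -/
def wLam (i : Fin (d + 1)) : Weight d :=
  (⟨fun z => K.lam i z.2, (K.continuous_lam i).comp continuous_snd⟩, 0, 0, 0)

/-- The weight of the mean of `div 𝐰`. -/
def wOne : Weight d := (0, 0, 1, 0)

/-- The weight of the mean of `t div 𝐰`. -/
def wTime : Weight d := (0, 0, ⟨fun z => K.tc z.1, K.continuous_tc.comp continuous_fst⟩, 0)

/-- The weight of the mean of `t (v · χ + v · (x - c) div 𝐰)` with the barycenter `c`. -/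
def wXT (v : Sp d) : Weight d :=
  (0, ⟨fun z => K.tc z.1 • v, by have := K.continuous_tc; fun_prop⟩,
    ⟨fun z => K.tc z.1 * ⟪v, z.2 - K.center⟫, by have := K.continuous_tc; fun_prop⟩, 0)

theorem sum_wLam : ∑ i, K.wLam i = wE := by
  refine Prod.ext ?_ (Prod.ext ?_ (Prod.ext ?_ ?_)) <;> ext z <;>
  simp [wLam, wE, Prod.fst_sum, Prod.snd_sum, sum_lam]

theorem sum_wD : ∑ i, K.wD i = wOne := by
  refine Prod.ext ?_ (Prod.ext ?_ (Prod.ext ?_ ?_)) <;> ext z <;>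
  simp [wD, wOne, Prod.fst_sum, Prod.snd_sum, sum_lam]

theorem eq_sum_single (v : Sp d) : v = ∑ k, v k • EuclideanSpace.single k (1 : ℝ) := by
  ext i
  simp [Finset.sum_apply, Pi.single_apply]

theorem wX_eq_sum (v : Sp d) : wX v = ∑ k, v k • wX (EuclideanSpace.single k (1 : ℝ)) := by
  refine Prod.ext ?_ (Prod.ext ?_ (Prod.ext ?_ ?_)) <;> ext z <;>
  simp [wX, Prod.fst_sum, Prod.snd_sum, Pi.single_apply]

theorem wXT_eq_sum (v : Sp d) : K.wXT v = ∑ k, v k • K.wXT (EuclideanSpace.single k (1 : ℝ)) := by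
  refine Prod.ext ?_ (Prod.ext ?_ (Prod.ext ?_ ?_))
  · ext z; simp [wXT, Prod.fst_sum]
  · ext z; simp [wXT, Prod.fst_sum, Prod.snd_sum, Pi.single_apply, mul_comm]
  · ext z
    simp only [wXT, Prod.snd_sum, Prod.fst_sum, Prod.smul_snd, Prod.smul_fst, ContinuousMap.coe_mk,
      ContinuousMap.sum_apply, ContinuousMap.smul_apply, smul_eq_mul]
    conv_lhs => rw [eq_sum_single v, sum_inner, Finset.mul_sum]
    exact Finset.sum_congr rfl fun k _ => by rw [real_inner_smul_left]; ring
  · ext z; simp [wXT, Prod.snd_sum]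

/-- By `λ_i = 1 / (d + 1) + ∇λ_i · (x - center)` the time-weighted part splits into one that is
linear in a vector, matched by `c`, and a scalar one, matched by `s'`. The `d + 1` conditions thus
become conditions on `c` and `s'` separately. -/
theorem wT_eq (i : Fin (d + 1)) :
    K.wT i = K.wLam i + K.wXT (K.grad i) + ((d : ℝ) + 1)⁻¹ • K.wTime := by
  refine Prod.ext ?_ (Prod.ext ?_ (Prod.ext ?_ ?_))
  · ext z; simp [wT, wLam, wXT, wTime]
  · ext z; simp [wT, wLam, wXT, wTime]
  · ext z
    simp [wT, wLam, wXT, wTime, inner_grad_sub_center]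
    ring
  · ext z; simp [wT, wLam, wXT, wTime]

/-- The coefficients of the local operator. -/
def coeffs (μ : Weight d →ₗ[ℝ] ℝ) : Coeffs d where
  -- The inverse of the Gram matrix of the barycentric coordinates, with entries `(1 + δ_ij) / ((d +
  -- 1)(d + 2))`, applied to the means of `λ_i e`. The affine part is thus the affine projection of
  -- `e`, which preserves more than the means required.
  A i := (d + 1) * ((d + 2) * μ (K.wLam i) - μ wE)
  -- The same inverse applied to the means of `λ_i div 𝐰`. The constant part `μ wOne` is subtracted
  -- because it is produced by `s` through the divergence of `x - center`.
  B i := (d + 1) * ((d + 2) * μ (K.wD i) - μ wOne) - μ wOne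
  -- Here `μ wE` is the average of the `A j`, so this solves the equation `pmean_wG` for `β i`.
  β i := (μ (K.wG i) - μ wE + (d + 1) * ((d + 2) * μ (K.wLam i) - μ wE)) / d
  m := WithLp.toLp 2 fun k => μ (wX (EuclideanSpace.single k (1 : ℝ)))
  -- The factor is the inverse of the variance `h_t ^ 2 / 12` of the time coordinate.
  c := WithLp.toLp 2 fun k => 12 / K.ht ^ 2 * μ (K.wXT (EuclideanSpace.single k (1 : ℝ)))
  s := μ wOne / d
  s' := 12 / K.ht ^ 2 * μ K.wTime / d

variable (μ : Weight d →ₗ[ℝ] ℝ)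

theorem inner_coeffs_m (v : Sp d) : ⟪v, (K.coeffs μ).m⟫ = μ (wX v) := by
  rw [wX_eq_sum v, map_sum, PiLp.inner_apply]
  exact Finset.sum_congr rfl fun k _ => by simp [coeffs, mul_comm]

theorem inner_coeffs_c (v : Sp d) : ⟪v, (K.coeffs μ).c⟫ = 12 / K.ht ^ 2 * μ (K.wXT v) := by
  rw [wXT_eq_sum K v, map_sum, PiLp.inner_apply, Finset.mul_sum]
  exact Finset.sum_congr rfl fun k _ => by simp [coeffs]; ring

theorem sum_coeffs_A : ∑ i, (K.coeffs μ).A i = (d + 1) * μ wE := by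
  simp only [coeffs]
  rw [← Finset.mul_sum, Finset.sum_sub_distrib, ← Finset.mul_sum, ← map_sum, sum_wLam]
  simp only [Finset.sum_const, Finset.card_univ, Fintype.card_fin, nsmul_eq_mul]
  push_cast
  ring

theorem sum_coeffs_B : ∑ i, (K.coeffs μ).B i = 0 := by
  simp only [coeffs]
  rw [Finset.sum_sub_distrib, ← Finset.mul_sum, Finset.sum_sub_distrib, ← Finset.mul_sum, ← map_sum,
    sum_wD]
  simp
  ring

theorem pmean_coeffs_wE (hd : 1 ≤ d) : K.pmean C wE (K.coeffs μ) = μ wE := by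
  rw [pmean_wE K C hd, sum_coeffs_A]
  field_simp

theorem pmean_coeffs_wX (hd : 1 ≤ d) (v : Sp d) : K.pmean C (wX v) (K.coeffs μ) = μ (wX v) := by
  rw [pmean_wX K C hd, inner_coeffs_m]

theorem pmean_coeffs_wD (hd : 1 ≤ d) (i : Fin (d + 1)) :
    K.pmean C (K.wD i) (K.coeffs μ) = μ (K.wD i) := by
  have h : (0 : ℝ) < d := by exact_mod_cast hd
  rw [pmean_wD K C hd, sum_coeffs_B]
  simp only [coeffs]
  field_simp
  ring

theorem pmean_coeffs_wT (hd : 1 ≤ d) (i : Fin (d + 1)) :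
    K.pmean C (K.wT i) (K.coeffs μ) = μ (K.wT i) := by
  have h : (0 : ℝ) < d := by exact_mod_cast hd
  have ht := K.ht_pos
  rw [pmean_wT K C hd, sum_coeffs_A, inner_coeffs_c, wT_eq, map_add, map_add, map_smul]
  simp only [coeffs, smul_eq_mul]
  field_simp
  ring

theorem pmean_coeffs_wG (hd : 1 ≤ d) (i : Fin (d + 1)) :
    K.pmean C (K.wG i) (K.coeffs μ) = μ (K.wG i) := by
  have h : (0 : ℝ) < d := by exact_mod_cast hd
  rw [pmean_wG K C hd, sum_coeffs_A]
  simp only [coeffs]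
  field_simp
  ring

theorem poly_coeffs_comb (c : ℝ) (μ ν : Weight d →ₗ[ℝ] ℝ) :
    K.poly C (K.coeffs (c • μ + ν)) = c • K.poly C (K.coeffs μ) + K.poly C (K.coeffs ν) := by
  have hA : ∀ i, (K.coeffs (c • μ + ν)).A i = c * (K.coeffs μ).A i + (K.coeffs ν).A i := fun i => by
    simp [coeffs]; ring
  have hB : ∀ i, (K.coeffs (c • μ + ν)).B i = c * (K.coeffs μ).B i + (K.coeffs ν).B i := fun i => by
    simp [coeffs]; ring
  have hβ : ∀ i, (K.coeffs (c • μ + ν)).β i = c * (K.coeffs μ).β i + (K.coeffs ν).β i := fun i => by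
    simp [coeffs]; ring
  have hm : (K.coeffs (c • μ + ν)).m = c • (K.coeffs μ).m + (K.coeffs ν).m := by
    ext i
    simp [coeffs]
  have hc : (K.coeffs (c • μ + ν)).c = c • (K.coeffs μ).c + (K.coeffs ν).c := by
    ext i
    simp [coeffs]; ring
  have hs : (K.coeffs (c • μ + ν)).s = c * (K.coeffs μ).s + (K.coeffs ν).s := by
    simp [coeffs]; ring
  have hs' : (K.coeffs (c • μ + ν)).s' = c * (K.coeffs μ).s' + (K.coeffs ν).s' := by
    simp [coeffs]; ring
  funext z
  refine WithLp.ofLp_injective 2 (Prod.ext ?_ ?_)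
  · change (K.poly C _ z).fst = c * (K.poly C _ z).fst + (K.poly C _ z).fst
    simp only [poly_fst, hA, hB, hβ]
    simp only [mul_add, Finset.mul_sum, ← Finset.sum_add_distrib]
    exact Finset.sum_congr rfl fun i _ => by ring
  · change (K.poly C _ z).snd = c • (K.poly C _ z).snd + (K.poly C _ z).snd
    simp only [poly_snd, hm, hc, hs, hs']
    module

variable {K} in
theorem wmean_flip_comb {T : ℝ} {Ω : Set (Sp d)} {𝒯 : Finset (Cell d)} (hK : K.openCell ⊆ cyl T Ω)
    (c : ℝ) (w w' : HA T Ω 𝒯) :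
    (wmean hK).flip (c • w + w') = c • (wmean hK).flip w + (wmean hK).flip w' :=
  LinearMap.ext fun W => mean_dens_comb_HA hK W c w w'

variable {K} in
/-- The local operator: a smooth field on `K` for every broken test function. -/
def localField {T : ℝ} {Ω : Set (Sp d)} {𝒯 : Finset (Cell d)} (hK : K.openCell ⊆ cyl T Ω) :
    HA T Ω 𝒯 →ₗ[ℝ] SmoothField d :=
  linearOfComb (fun w => ⟨K.poly C (K.coeffs ((wmean hK).flip w)), K.contDiff_poly C _⟩)
    (fun c w w' => Subtype.ext (by
      rw [wmean_flip_comb]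
      exact K.poly_coeffs_comb C c _ _))

end Cell

end HeatDPG

end

noncomputable section

namespace HeatDPG

namespace Cell

variable {d : ℕ} {K : Cell d}

/-! ### Bounds for the local operator -/

theorem integral_openCell_eq_zero {F : TS d → ℝ} (hF : Continuous F)
    (h : ∀ t, ∫ x in K.space, F (t, x) = 0) : ∫ z in K.openCell, F z = 0 := by
  rw [setIntegral_congr_set K.openCell_ae_eq, carrier, Measure.volume_eq_prod, setIntegral_prod]
  · simp only [h, integral_zero]
  · rw [← Measure.volume_eq_prod]
    exact hF.integrableOn_of_isCompact K.isCompact_carrier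

theorem inner_gradX {φ : TS d → ℝ} (z : TS d) (v : Sp d) :
    ⟪v, gradX φ z⟫ = fderiv ℝ φ z (0, v) := by
  have e : ((0 : ℝ), v) = ∑ i, v i • ((0 : ℝ), EuclideanSpace.single i (1 : ℝ)) := by
    refine Prod.ext ?_ ?_
    · simp [Prod.fst_sum]
    · simpa [Prod.snd_sum] using eq_sum_single v
  rw [PiLp.inner_apply]
  conv_rhs => rw [e, map_sum]
  exact Finset.sum_congr rfl fun i _ => by
    rw [map_smul, smul_eq_mul]; simp [gradX, mul_comm]

theorem fderiv_section {φ : TS d → ℝ} (hφ : ContDiff ℝ ∞ φ) (t : ℝ) (x v : Sp d) :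
    fderiv ℝ (fun x => φ (t, x)) x v = fderiv ℝ φ (t, x) (0, v) := by
  have h1 := ((hφ.differentiable (by simp)) (t, x)).hasFDerivAt.comp x (hasFDerivAt_prodMk_right t x)
  rw [show (fun x => φ (t, x)) = φ ∘ fun x => (t, x) from rfl, h1.fderiv]
  simp

variable (K) in
/-- The weight `λ_i λ_k (p_i - p_k)` for `∇_x e`. -/
def wEdge (i k : Fin (d + 1)) : Weight d :=
  (0, 0, 0, ⟨fun z => (K.lam i z.2 * K.lam k z.2) • (K.vert i - K.vert k), by
    have := K.continuous_lam; fun_prop⟩)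

variable (K) in
/-- The means of `λ_i e` and `λ_k e` differ by a weighted mean of `∇_x e`. -/
theorem wmean_wLam_sub (hd : 1 ≤ d) {T : ℝ} {Ω : Set (Sp d)} {𝒯 : Finset (Cell d)} (hm : K ∈ 𝒯)
    (hK : K.openCell ⊆ cyl T Ω) (w : HA T Ω 𝒯) (i k : Fin (d + 1)) :
    (wmean hK).flip w (K.wLam i) - (wmean hK).flip w (K.wLam k) =
      (wmean hK).flip w (K.wEdge i k) := by
  have cl := K.continuous_lam
  have hw := (w.2 K hm).2
  -- For smooth functions the identity holds on every time slice; density then carries it over to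
  -- `e`.
  have hz := K.integral_eq_zero_of_contDiff hK (memLp_fst (memLp_openCell hK (HA.field T Ω 𝒯 w)))
    ((memLp_snd (memLp_openCell hK (HA.field T Ω 𝒯 w))).sub
      (memLp_snd (memLp_openCell hK (HA.astar T Ω 𝒯 w)))) hw
    (q := fun z => K.lam i z.2 - K.lam k z.2)
    (τ := fun z => -((K.lam i z.2 * K.lam k z.2) • (K.vert i - K.vert k)))
    (Continuous.memLp_restrict (by fun_prop) K.isCompact_carrier K.openCell_subset)
    (Continuous.memLp_restrict (by fun_prop) K.isCompact_carrier K.openCell_subset) ?_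
  · rw [← map_sub, ← sub_eq_zero, ← map_sub, LinearMap.flip_apply, wmean_apply, mean]
    refine mul_eq_zero_of_right _ ((setIntegral_congr_fun K.isOpen_openCell.measurableSet
      fun z _ => ?_).trans hz)
    simp [dens, wLam, wEdge]
  · intro φ hφ
    have cg := continuous_gradX hφ
    have c0 := hφ.continuous
    refine integral_openCell_eq_zero (by fun_prop) fun t => ?_
    have h2 : ContDiff ℝ 1 fun x => φ (t, x) :=
      (hφ.of_le (by exact_mod_cast le_top)).comp (contDiff_prodMk_right t)
    have h1 := K.integral_lam_sub_lam_mul hd i k h2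
    simp only [inner_neg_left, real_inner_smul_left, inner_gradX, ← fderiv_section hφ]
    have cf : Continuous fun x => fderiv ℝ (fun x => φ (t, x)) x (K.vert i - K.vert k) :=
      (h2.continuous_fderiv (by simp)).clm_apply continuous_const
    have c2 := h2.continuous
    rw [integral_add, h1, integral_neg, add_neg_cancel]
    · exact Continuous.integrableOn_of_isCompact (by fun_prop) K.isCompact_space
    · exact Continuous.integrableOn_of_isCompact (by fun_prop) K.isCompact_space

/-- The root mean square of a broken test function and its image under `A^*`. -/
def rms (K : Cell d) (w a : TS d → Val d) : ℝ := √(K.mean fun z => ‖w z‖ ^ 2 + ‖a z‖ ^ 2)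

theorem mean_mono {f g : TS d → ℝ} (hf : IntegrableOn f K.openCell) (hg : IntegrableOn g K.openCell)
    (h : ∀ᵐ z ∂volume.restrict K.openCell, f z ≤ g z) : K.mean f ≤ K.mean g :=
  mul_le_mul_of_nonneg_left (integral_mono_ae hf hg h) (inv_nonneg.2 measureReal_nonneg)

theorem mean_const (c : ℝ) : K.mean (fun _ => c) = c := by
  have h := K.volume_carrier_pos
  rw [mean, setIntegral_const, smul_eq_mul, measureReal_congr K.openCell_ae_eq,
    inv_mul_cancel_left₀ h.ne']

theorem mean_sq_le {f : TS d → ℝ} (hf : MemLp f 2 (volume.restrict K.openCell)) :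
    K.mean f ^ 2 ≤ K.mean fun z => f z ^ 2 := by
  have : IsFiniteMeasure (volume.restrict K.openCell) :=
    ⟨by simpa using (measure_mono K.openCell_subset).trans_lt K.isCompact_carrier.measure_lt_top⟩
  have i1 : IntegrableOn f K.openCell := hf.integrable (by norm_num)
  have i2 : IntegrableOn (fun z => f z ^ 2) K.openCell := hf.integrable_sq
  -- Expanding the square of `f` minus its mean shows that the variance is nonnegative.
  have h1 := mean_mono (K := K) (i1.const_mul (2 * K.mean f)) (i2.add
    (integrable_const (K.mean f ^ 2))) (ae_of_all _ fun z => by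
      simp only [Pi.add_apply]
      nlinarith [sq_nonneg (f z - K.mean f)])
  rw [mean_const_mul] at h1
  have h2 := mean_add (K := K) i2 (integrable_const (K.mean f ^ 2))
  rw [mean_const] at h2
  have h3 := h1.trans_eq h2
  nlinarith

/-- All components of a weight are bounded by `M` on the cell. -/
def _root_.HeatDPG.Weight.BoundedBy (W : Weight d) (K : Cell d) (M : ℝ) : Prop :=
  ∀ z ∈ K.carrier, |W.1 z| ≤ M ∧ ‖W.2.1 z‖ ≤ M ∧ |W.2.2.1 z| ≤ M ∧ ‖W.2.2.2 z‖ ≤ M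

theorem abs_mean_dens_le {W : Weight d} {M : ℝ} (hM : 0 ≤ M) (hW : W.BoundedBy K M)
    {w a : TS d → Val d} (hw : MemLp w 2 (volume.restrict K.openCell))
    (ha : MemLp a 2 (volume.restrict K.openCell)) :
    |K.mean (dens W w a)| ≤ 5 * M * K.rms w a := by
  -- Of the four terms three involve `𝐰` and two involve `A^* 𝐰`, since the weak gradient is `χ`
  -- minus the second component of `A^* 𝐰`. Squaring the bound gives the factor `18`, and `18 ≤ 5 ^
  -- 2` explains the `5` in the result.
  have h0 : ∀ z ∈ K.openCell, |dens W w a z| ≤ 3 * M * (‖w z‖ + ‖a z‖) := fun z hz => by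
    obtain ⟨h1, h2, h3, h4⟩ := hW z (K.openCell_subset hz)
    have n1 := WithLp.prod_norm_sq_eq_of_L2 (w z)
    have n2 := WithLp.prod_norm_sq_eq_of_L2 (a z)
    have e1 : |(w z).fst| ≤ ‖w z‖ := by
      rw [← Real.norm_eq_abs]
      exact abs_le_of_sq_le_sq' (by nlinarith [norm_nonneg (w z).snd]) (norm_nonneg _) |>.2
    have e2 : ‖(w z).snd‖ ≤ ‖w z‖ :=
      abs_le_of_sq_le_sq' (by nlinarith [norm_nonneg (w z).fst]) (norm_nonneg _) |>.2
    have e3 : |(a z).fst| ≤ ‖a z‖ := by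
      rw [← Real.norm_eq_abs]
      exact abs_le_of_sq_le_sq' (by nlinarith [norm_nonneg (a z).snd]) (norm_nonneg _) |>.2
    have e4 : ‖(a z).snd‖ ≤ ‖a z‖ :=
      abs_le_of_sq_le_sq' (by nlinarith [norm_nonneg (a z).fst]) (norm_nonneg _) |>.2
    have f1 : |W.1 z * (w z).fst| ≤ M * ‖w z‖ := by
      rw [abs_mul]
      exact mul_le_mul h1 e1 (abs_nonneg _) hM
    have f2 : |(⟪W.2.1 z, (w z).snd⟫ : ℝ)| ≤ M * ‖w z‖ :=
      (abs_real_inner_le_norm _ _).trans (mul_le_mul h2 e2 (norm_nonneg _) hM)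
    have f3 : |W.2.2.1 z * (a z).fst| ≤ M * ‖a z‖ := by
      rw [abs_mul]
      exact mul_le_mul h3 e3 (abs_nonneg _) hM
    have f4 : |(⟪W.2.2.2 z, (w z).snd - (a z).snd⟫ : ℝ)| ≤ M * (‖w z‖ + ‖a z‖) :=
      (abs_real_inner_le_norm _ _).trans (mul_le_mul h4
        ((norm_sub_le _ _).trans (add_le_add e2 e4)) (norm_nonneg _) hM)
    have g1 : 0 ≤ M * ‖a z‖ := mul_nonneg hM (norm_nonneg _)
    rw [dens]
    rw [abs_le] at *
    constructor <;> nlinarith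
  have hi := integrableOn_dens (K := K) W hw ha
  have hml : MemLp (dens W w a) 2 (volume.restrict K.openCell) :=
    (hw.norm.add ha.norm).of_le_mul hi.1 (c := 3 * M) (by
      filter_upwards [ae_restrict_mem K.isOpen_openCell.measurableSet] with z hz
      rw [Real.norm_eq_abs, Real.norm_of_nonneg (by simp only [Pi.add_apply]; positivity)]
      exact h0 z hz)
  have i1 : IntegrableOn (fun z => ‖w z‖ ^ 2 + ‖a z‖ ^ 2) K.openCell :=
    hw.norm.integrable_sq.add ha.norm.integrable_sq
  have h2 : K.mean (fun z => dens W w a z ^ 2) ≤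
      K.mean fun z => 18 * M ^ 2 * (‖w z‖ ^ 2 + ‖a z‖ ^ 2) := by
    refine mean_mono hml.integrable_sq (i1.const_mul _) ?_
    filter_upwards [ae_restrict_mem K.isOpen_openCell.measurableSet] with z hz
    have h3 := pow_le_pow_left₀ (abs_nonneg _) (h0 z hz) 2
    rw [sq_abs] at h3
    nlinarith [mul_nonneg (sq_nonneg M) (sq_nonneg (‖w z‖ - ‖a z‖))]
  rw [mean_const_mul] at h2
  have h3 : 0 ≤ K.mean fun z => ‖w z‖ ^ 2 + ‖a z‖ ^ 2 :=
    mul_nonneg (inv_nonneg.2 measureReal_nonneg) (integral_nonneg fun z => by positivity)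
  refine abs_le_of_sq_le_sq ?_ (by rw [rms]; positivity)
  rw [mul_pow, rms, Real.sq_sqrt h3]
  nlinarith [mean_sq_le hml, mul_nonneg (sq_nonneg M) h3]

end Cell

end HeatDPG

end

/-! ### Coefficient bounds and pointwise bounds -/

noncomputable section

namespace HeatDPG

namespace Cell

variable {d : ℕ} {K : Cell d}

theorem abs_sum_mul_le {n : ℕ} {a b : Fin n → ℝ} {α β : ℝ} (ha : ∀ i, |a i| ≤ α)
    (hb : ∀ i, |b i| ≤ β) (hα : 0 ≤ α) : |∑ i, a i * b i| ≤ n * (α * β) := by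
  refine (Finset.abs_sum_le_sum_abs _ _).trans ((Finset.sum_le_card_nsmul _ _ (α * β)
    fun i _ => ?_).trans_eq (by simp))
  rw [abs_mul]
  exact mul_le_mul (ha i) (hb i) (abs_nonneg _) hα

theorem norm_sum_smul_le {n : ℕ} {a : Fin n → ℝ} {g : Fin n → Sp d} {α β : ℝ} (ha : ∀ i, |a i| ≤ α)
    (hg : ∀ i, ‖g i‖ ≤ β) (hα : 0 ≤ α) : ‖∑ i, a i • g i‖ ≤ n * (α * β) := by
  refine (norm_sum_le _ _).trans ((Finset.sum_le_card_nsmul _ _ (α * β)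
    fun i _ => ?_).trans_eq (by simp))
  rw [norm_smul]
  exact mul_le_mul (ha i) (hg i) (norm_nonneg _) hα

theorem norm_val_le (v : Val d) : ‖v‖ ≤ |v.fst| + ‖v.snd‖ := by
  have h := WithLp.prod_norm_sq_eq_of_L2 v
  rw [Real.norm_eq_abs] at h
  nlinarith [abs_nonneg v.fst, norm_nonneg v.snd, norm_nonneg v, mul_nonneg (abs_nonneg v.fst) (norm_nonneg v.snd)]

variable (K) in
/-- A functional on weights that is bounded by `R` and comes from a function with a weak spatial
gradient. -/
structure IsBoundedMean (μ : Weight d →ₗ[ℝ] ℝ) (R : ℝ) : Prop where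
  nonneg : 0 ≤ R
  le : ∀ W M, 0 ≤ M → Weight.BoundedBy W K M → |μ W| ≤ 5 * M * R
  edge : ∀ i k, μ (K.wLam i) - μ (K.wLam k) = μ (K.wEdge i k)

theorem abs_tc_le {t : ℝ} (ht : t ∈ Icc K.a K.b) : |K.tc t| ≤ K.ht := by
  have := K.hab
  rw [tc, Cell.ht, abs_le]
  constructor <;> linarith [ht.1, ht.2]

theorem norm_le_of_inner_self_le {v : Sp d} {c : ℝ} (hc : 0 ≤ c) (h : (⟪v, v⟫ : ℝ) ≤ c * ‖v‖) :
    ‖v‖ ≤ c := by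
  rw [real_inner_self_eq_norm_sq] at h
  rcases (norm_nonneg v).eq_or_lt with h0 | h0
  · rw [← h0]
    exact hc
  · nlinarith

namespace IsBoundedMean

variable {μ : Weight d →ₗ[ℝ] ℝ} {R : ℝ} (h : K.IsBoundedMean μ R)
include h

theorem abs_wE : |μ wE| ≤ 5 * R := by
  have := h.le wE 1 zero_le_one fun z _ => by simp [wE]
  linarith

theorem abs_wLam (i : Fin (d + 1)) : |μ (K.wLam i)| ≤ 5 * R := by
  have := h.le (K.wLam i) 1 zero_le_one fun z hz => by simpa [wLam] using K.abs_lam_le_one hz.2 i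
  linarith

theorem abs_wOne : |μ wOne| ≤ 5 * R := by
  have := h.le wOne 1 zero_le_one fun z _ => by simp [wOne]
  linarith

theorem abs_wD (i : Fin (d + 1)) : |μ (K.wD i)| ≤ 5 * R := by
  have := h.le (K.wD i) 1 zero_le_one fun z hz => by simpa [wD] using K.abs_lam_le_one hz.2 i
  linarith

theorem abs_wG (i : Fin (d + 1)) : |μ (K.wG i)| ≤ 5 * K.hx * R :=
  h.le (K.wG i) K.hx K.hx_nonneg fun z hz => by
    simpa [wG, K.hx_nonneg] using K.norm_sub_le_hx hz.2 (K.vert_mem i)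

theorem abs_wEdge (i k : Fin (d + 1)) : |μ (K.wEdge i k)| ≤ 5 * K.hx * R :=
  h.le (K.wEdge i k) K.hx K.hx_nonneg fun z hz => by
    have h1 := K.norm_sub_le_hx (K.vert_mem i) (K.vert_mem k)
    have h2 := K.abs_lam_le_one hz.2 i
    have h3 := K.abs_lam_le_one hz.2 k
    have h4 : |K.lam i z.2| * |K.lam k z.2| ≤ 1 := mul_le_one₀ h2 (abs_nonneg _) h3
    simp only [wEdge, ContinuousMap.zero_apply, ContinuousMap.coe_mk, abs_zero, norm_zero, norm_smul,
      norm_mul, Real.norm_eq_abs, K.hx_nonneg, true_and]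
    nlinarith [norm_nonneg (K.vert i - K.vert k)]

theorem abs_wTime : |μ K.wTime| ≤ 5 * K.ht * R :=
  h.le K.wTime K.ht K.ht_pos.le fun z hz => by
    simpa [wTime, K.ht_pos.le] using abs_tc_le hz.1

theorem abs_wX (v : Sp d) : |μ (wX v)| ≤ 5 * ‖v‖ * R :=
  h.le (wX v) ‖v‖ (norm_nonneg v) fun z _ => by simp [wX]

theorem abs_wXT (v : Sp d) : |μ (K.wXT v)| ≤ 5 * (K.ht * (1 + K.hx) * ‖v‖) * R :=
  h.le (K.wXT v) _ (by have := K.hx_nonneg; have := K.ht_pos; positivity) fun z hz => by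
    have h1 := abs_tc_le (K := K) hz.1
    have h2 := K.norm_sub_le_hx hz.2 K.center_mem
    have h3 := K.hx_nonneg
    have h4 := K.ht_pos
    have h5 : 0 ≤ K.ht * (1 + K.hx) * ‖v‖ := by positivity
    have h6 := abs_real_inner_le_norm v (z.2 - K.center)
    simp only [wXT, ContinuousMap.zero_apply, ContinuousMap.coe_mk, abs_zero, norm_zero, norm_smul,
      abs_mul, Real.norm_eq_abs, h5, true_and, and_true]
    constructor
    · nlinarith [norm_nonneg v, mul_le_mul_of_nonneg_right h1 (norm_nonneg v),
        mul_nonneg (mul_nonneg h4.le h3) (norm_nonneg v)]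
    · calc |K.tc z.1| * |(⟪v, z.2 - K.center⟫ : ℝ)| ≤ K.ht * (‖v‖ * K.hx) :=
          mul_le_mul h1 (h6.trans (mul_le_mul_of_nonneg_left h2 (norm_nonneg v))) (abs_nonneg _) h4.le
        _ ≤ _ := by nlinarith [mul_nonneg h4.le (norm_nonneg v)]

/-- The difference is `d + 2` times the sum over `k` of the means of `(λ_i - λ_k) e`, and each of
these is an edge-weighted mean of `∇_x e`. This gain of a factor `h_x` replaces a Poincaré
inequality. -/
theorem abs_A_sub (i : Fin (d + 1)) :
    |(K.coeffs μ).A i - μ wE| ≤ (d + 1) * (d + 2) * (5 * K.hx * R) := by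
  have h1 : (K.coeffs μ).A i - μ wE = (d + 2) * ∑ k, μ (K.wEdge i k) := by
    simp only [← h.edge]
    rw [Finset.sum_sub_distrib, ← map_sum μ K.wLam, sum_wLam]
    simp only [Finset.sum_const, Finset.card_univ, Fintype.card_fin, nsmul_eq_mul, coeffs]
    push_cast
    ring
  have h2 : |∑ k, μ (K.wEdge i k)| ≤ (d + 1) * (5 * K.hx * R) :=
    (Finset.abs_sum_le_sum_abs _ _).trans ((Finset.sum_le_card_nsmul _ _ _
      fun k _ => h.abs_wEdge i k).trans_eq (by simp))
  rw [h1, abs_mul, abs_of_nonneg (by positivity : (0 : ℝ) ≤ d + 2)]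
  nlinarith [(by positivity : (0 : ℝ) ≤ d + 2)]

theorem abs_A (i : Fin (d + 1)) : |(K.coeffs μ).A i| ≤ 5 * ((d + 1) * (d + 3)) * R := by
  have h1 := h.abs_wLam i
  have h2 := h.abs_wE
  simp only [coeffs]
  have h3 : (0 : ℝ) ≤ d := Nat.cast_nonneg d
  have h4 : |(d + 2) * μ (K.wLam i) - μ wE| ≤ (d + 2) * (5 * R) + 5 * R := by
    refine (abs_sub _ _).trans (add_le_add ?_ h2)
    rw [abs_mul, abs_of_nonneg (by positivity : (0 : ℝ) ≤ d + 2)]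
    exact mul_le_mul_of_nonneg_left h1 (by positivity)
  rw [abs_mul, abs_of_nonneg (by positivity : (0 : ℝ) ≤ d + 1)]
  nlinarith

theorem abs_B (i : Fin (d + 1)) : |(K.coeffs μ).B i| ≤ 5 * ((d + 1) * (d + 3) + 1) * R := by
  have h1 := h.abs_wD i
  have h2 := h.abs_wOne
  simp only [coeffs]
  have h3 : (0 : ℝ) ≤ d := Nat.cast_nonneg d
  have h4 : |(d + 2) * μ (K.wD i) - μ wOne| ≤ (d + 2) * (5 * R) + 5 * R := by
    refine (abs_sub _ _).trans (add_le_add ?_ h2)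
    rw [abs_mul, abs_of_nonneg (by positivity : (0 : ℝ) ≤ d + 2)]
    exact mul_le_mul_of_nonneg_left h1 (by positivity)
  refine (abs_sub _ _).trans ?_
  rw [abs_mul, abs_of_nonneg (by positivity : (0 : ℝ) ≤ d + 1)]
  nlinarith

/-- Taken separately, the terms of the numerator are not small. Grouped as `μ (wG i)` and `A_i - μ
wE`, both parts are of order `h_x`. -/
theorem abs_β (hd : 1 ≤ d) (i : Fin (d + 1)) :
    |(K.coeffs μ).β i| ≤ 5 * (1 + (d + 1) * (d + 2)) * (K.hx * R) := by
  have h1 := h.abs_wG i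
  have h2 := h.abs_A_sub i
  have h3 : (1 : ℝ) ≤ d := by exact_mod_cast hd
  have e : (K.coeffs μ).β i = (μ (K.wG i) + ((K.coeffs μ).A i - μ wE)) / d := by
    simp only [coeffs]
    ring
  rw [e, abs_div, abs_of_nonneg (by positivity : (0 : ℝ) ≤ d)]
  refine (div_le_self (abs_nonneg _) h3).trans ((abs_add_le _ _).trans ?_)
  nlinarith

/-- Testing with the vector `m` itself gives a bound of its norm that does not sum over components.
-/
theorem norm_m : ‖(K.coeffs μ).m‖ ≤ 5 * R := by
  have h0 := h.nonneg
  refine norm_le_of_inner_self_le (by positivity) ?_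
  rw [inner_coeffs_m]
  have := (le_abs_self _).trans (h.abs_wX (K.coeffs μ).m)
  linarith

/-- The factor `12 / h_t ^ 2` meets a weight of size `h_t`, which leaves `1 / h_t`. It is harmless,
as `c` occurs only multiplied by the time coordinate; the same holds for `s'`. -/
theorem ht_mul_norm_c : K.ht * ‖(K.coeffs μ).c‖ ≤ 60 * (1 + K.hx) * R := by
  have h0 := h.nonneg
  have h1 := K.ht_pos
  have h2 := K.hx_nonneg
  have h3 : ‖(K.coeffs μ).c‖ ≤ 60 * (1 + K.hx) * R / K.ht := by
    refine norm_le_of_inner_self_le (by positivity) ?_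
    rw [inner_coeffs_c]
    have h4 := (le_abs_self _).trans (h.abs_wXT (K.coeffs μ).c)
    refine (mul_le_mul_of_nonneg_left h4 (by positivity)).trans_eq ?_
    field_simp
    ring
  rw [le_div_iff₀ h1] at h3
  linarith

theorem abs_s (hd : 1 ≤ d) : |(K.coeffs μ).s| ≤ 5 * R := by
  have h3 : (1 : ℝ) ≤ d := by exact_mod_cast hd
  simp only [coeffs]
  rw [abs_div, abs_of_nonneg (by positivity : (0 : ℝ) ≤ d)]
  exact (div_le_self (abs_nonneg _) h3).trans h.abs_wOne

theorem ht_mul_abs_s' (hd : 1 ≤ d) : K.ht * |(K.coeffs μ).s'| ≤ 60 * R := by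
  have h3 : (1 : ℝ) ≤ d := by exact_mod_cast hd
  have h1 := K.ht_pos
  simp only [coeffs]
  rw [abs_div, abs_of_nonneg (by positivity : (0 : ℝ) ≤ d), abs_mul,
    abs_of_nonneg (by positivity : 0 ≤ 12 / K.ht ^ 2)]
  have h4 := h.abs_wTime
  calc K.ht * (12 / K.ht ^ 2 * |μ K.wTime| / d)
      ≤ K.ht * (12 / K.ht ^ 2 * |μ K.wTime|) :=
        mul_le_mul_of_nonneg_left (div_le_self (by positivity) h3) h1.le
    _ ≤ K.ht * (12 / K.ht ^ 2 * (5 * K.ht * R)) := by gcongr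
    _ = 60 * R := by field_simp; ring

end IsBoundedMean

variable (C : Correction d)

/-- A bound for the correction polynomials. -/
def _root_.HeatDPG.Correction.bound : ℝ := |C.c₀| + |C.c₁| + |C.c₂| + |C.c₃| + |C.κ| * (d + 1)

/-- A bound for the gradients of the correction polynomials. -/
def _root_.HeatDPG.Correction.gradBound : ℝ :=
  |C.c₁| + 2 * |C.c₂| + 3 * |C.c₃| + 2 * |C.κ| * (d + 1)

theorem abs_corr_le {x : Sp d} (hx : x ∈ K.space) (j : Fin (d + 1)) : |K.corr C j x| ≤ C.bound := by
  have h1 : ∀ (i : Fin (d + 1)) n, |K.lam i x ^ n| ≤ 1 := fun i n => by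
    rw [abs_pow]
    exact pow_le_one₀ (abs_nonneg _) (K.abs_lam_le_one hx i)
  have h2 : |∑ k, K.lam k x ^ 2| ≤ d + 1 :=
    (Finset.abs_sum_le_sum_abs _ _).trans ((Finset.sum_le_card_nsmul _ _ 1
      fun k _ => h1 k 2).trans_eq (by simp))
  have h3 : ∀ a b M : ℝ, |b| ≤ M → |a * b| ≤ |a| * M := fun a b M hb => by
    rw [abs_mul]
    exact mul_le_mul_of_nonneg_left hb (abs_nonneg _)
  have h4 := h3 C.c₁ _ _ (h1 j 1)
  have h5 := h3 C.c₂ _ _ (h1 j 2)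
  have h6 := h3 C.c₃ _ _ (h1 j 3)
  have h7 := h3 C.κ _ _ h2
  rw [pow_one] at h4
  rw [corr, Correction.bound]
  refine (abs_add_le _ _).trans (add_le_add ((abs_add_le _ _).trans (add_le_add
    ((abs_add_le _ _).trans (add_le_add ((abs_add_le _ _).trans (add_le_add le_rfl ?_)) ?_)) ?_)) h7)
  all_goals linarith

theorem norm_gradCorr_le {x : Sp d} (hx : x ∈ K.space) (j : Fin (d + 1)) {ρ : ℝ}
    (hρ : ∀ i, ‖K.grad i‖ ≤ ρ) : ‖K.gradCorr C j x‖ ≤ C.gradBound * ρ := by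
  have hl := K.abs_lam_le_one hx
  have ρ0 : 0 ≤ ρ := (norm_nonneg _).trans (hρ 0)
  have h2 := norm_sum_smul_le hl hρ zero_le_one
  have h1 : |C.c₁ + 2 * C.c₂ * K.lam j x + 3 * C.c₃ * K.lam j x ^ 2| ≤
      |C.c₁| + 2 * |C.c₂| + 3 * |C.c₃| := by
    refine (abs_add_le _ _).trans (add_le_add ((abs_add_le _ _).trans (add_le_add le_rfl ?_)) ?_)
    · rw [abs_mul, abs_mul, abs_two]
      exact mul_le_of_le_one_right (by positivity) (hl j)
    · rw [abs_mul, abs_mul, abs_of_nonneg (by norm_num : (0 : ℝ) ≤ 3), abs_pow]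
      exact mul_le_of_le_one_right (by positivity) (pow_le_one₀ (abs_nonneg _) (hl j))
  rw [gradCorr, Correction.gradBound]
  refine (norm_add_le _ _).trans ?_
  rw [norm_smul, norm_smul, Real.norm_eq_abs, Real.norm_eq_abs, abs_mul, abs_two]
  push_cast at h2
  have h3 := mul_le_mul h1 (hρ j) (norm_nonneg _) (by positivity)
  have h4 := mul_le_mul_of_nonneg_left h2 (by positivity : 0 ≤ 2 * |C.κ|)
  linarith

theorem _root_.HeatDPG.Correction.bound_nonneg : 0 ≤ C.bound := by
  unfold Correction.bound; positivity

theorem _root_.HeatDPG.Correction.gradBound_nonneg : 0 ≤ C.gradBound := by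
  unfold Correction.gradBound; positivity

theorem abs_poly_fst_le (hd : 1 ≤ d) {μ : Weight d →ₗ[ℝ] ℝ} {R T X : ℝ} (h : K.IsBoundedMean μ R)
    (hT : K.ht ≤ T) (hX : K.hx ≤ X) {z : TS d} (hz : z ∈ K.carrier) :
    |(K.poly C (K.coeffs μ) z).fst| ≤ ((d + 1) * (5 * ((d + 1) * (d + 3)) +
      5 * ((d + 1) * (d + 3) + 1) * T) + (d + 1) * (5 * (1 + (d + 1) * (d + 2)) * X * C.bound)) * R := by
  have h0 := h.nonneg
  have ht := abs_tc_le (K := K) hz.1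
  have hx := K.hx_nonneg
  have hp := K.ht_pos
  have hb := C.bound_nonneg
  have h1 : ∀ i, |(K.coeffs μ).A i + (K.coeffs μ).B i * K.tc z.1| ≤
      5 * ((d + 1) * (d + 3)) * R + 5 * ((d + 1) * (d + 3) + 1) * R * T := fun i => by
    refine (abs_add_le _ _).trans (add_le_add (h.abs_A i) ?_)
    rw [abs_mul]
    exact mul_le_mul (h.abs_B i) (ht.trans hT) (abs_nonneg _) (by positivity)
  have hT0 : 0 ≤ T := hp.le.trans hT
  have h2 := abs_sum_mul_le h1 (K.abs_lam_le_one hz.2) (by positivity)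
  have h3 := abs_sum_mul_le (h.abs_β hd) (fun j => abs_corr_le C hz.2 j) (by positivity)
  rw [poly_fst]
  refine (abs_add_le _ _).trans ((add_le_add h2 h3).trans ?_)
  push_cast
  have h4 : ((d : ℝ) + 1) * (5 * (1 + (d + 1) * (d + 2)) * (K.hx * R) * C.bound) ≤
      (d + 1) * (5 * (1 + (d + 1) * (d + 2)) * (X * R) * C.bound) := by gcongr
  linarith

theorem norm_poly_snd_le (hd : 1 ≤ d) {μ : Weight d →ₗ[ℝ] ℝ} {R X : ℝ} (h : K.IsBoundedMean μ R)
    (hX : K.hx ≤ X) {z : TS d} (hz : z ∈ K.carrier) :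
    ‖(K.poly C (K.coeffs μ) z).snd‖ ≤ (5 + 60 * (1 + X) + 65 * X) * R := by
  have h0 := h.nonneg
  have ht := abs_tc_le (K := K) hz.1
  have hx := K.hx_nonneg
  have hp := K.ht_pos
  have h1 := h.norm_m
  have h2 : ‖K.tc z.1 • (K.coeffs μ).c‖ ≤ 60 * (1 + X) * R := by
    rw [norm_smul, Real.norm_eq_abs]
    refine (mul_le_mul_of_nonneg_right ht (norm_nonneg _)).trans (h.ht_mul_norm_c.trans ?_)
    gcongr
  have h3 : |(K.coeffs μ).s + (K.coeffs μ).s' * K.tc z.1| ≤ 65 * R := by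
    refine (abs_add_le _ _).trans ?_
    rw [abs_mul]
    nlinarith [h.abs_s hd, h.ht_mul_abs_s' hd, mul_le_mul_of_nonneg_left ht (abs_nonneg (K.coeffs μ).s')]
  have h4 : ‖((K.coeffs μ).s + (K.coeffs μ).s' * K.tc z.1) • (z.2 - K.center)‖ ≤ 65 * R * X := by
    rw [norm_smul, Real.norm_eq_abs]
    exact mul_le_mul h3 ((K.norm_sub_le_hx hz.2 K.center_mem).trans hX) (norm_nonneg _) (by positivity)
  rw [poly_snd]
  refine (norm_add_le _ _).trans ((add_le_add ((norm_add_le _ _).trans (add_le_add h1 h2)) h4).trans ?_)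
  linarith

theorem abs_astar_poly_fst_le (hd : 1 ≤ d) {μ : Weight d →ₗ[ℝ] ℝ} {R : ℝ} (h : K.IsBoundedMean μ R)
    {z : TS d} (hz : z ∈ K.carrier) :
    |(astarOp (K.poly C (K.coeffs μ)) z).fst| ≤
      ((d + 1) * (5 * ((d + 1) * (d + 3) + 1)) + d * 65) * R := by
  have h0 := h.nonneg
  have ht := abs_tc_le (K := K) hz.1
  have h3 : |(K.coeffs μ).s + (K.coeffs μ).s' * K.tc z.1| ≤ 65 * R := by
    refine (abs_add_le _ _).trans ?_
    rw [abs_mul]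
    nlinarith [h.abs_s hd, h.ht_mul_abs_s' hd, mul_le_mul_of_nonneg_left ht (abs_nonneg (K.coeffs μ).s')]
  have h2 := abs_sum_mul_le h.abs_B (K.abs_lam_le_one hz.2) (by positivity)
  have e : (astarOp (K.poly C (K.coeffs μ)) z).fst = -(∑ i, (K.coeffs μ).B i * K.lam i z.2 +
      d * ((K.coeffs μ).s + (K.coeffs μ).s' * K.tc z.1)) := by
    simp [astarOp, (K.hasGradAt_poly C _ z).dt_eq, divX_poly]
  rw [e, abs_neg]
  refine (abs_add_le _ _).trans ?_
  rw [abs_mul, Nat.abs_cast]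
  push_cast at h2
  nlinarith [mul_le_mul_of_nonneg_left h3 (Nat.cast_nonneg (α := ℝ) d)]

/-- Because `∑ ∇λ_i = 0`, each `A_i` may be replaced by `A_i - μ wE`, which is of order `h_x` like
`β_j`, and both compensate `γ / h_x`. No such gain is available for `t B_i`, and this is the source
of `h_t / h_x`. -/
theorem norm_gradX_poly_le (hd : 1 ≤ d) {μ : Weight d →ₗ[ℝ] ℝ} {R γ : ℝ} (h : K.IsBoundedMean μ R)
    (hx : 0 < K.hx) (hγ : 0 ≤ γ) (hg : ∀ i, ‖K.grad i‖ ≤ γ / K.hx) {z : TS d} (hz : z ∈ K.carrier) :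
    ‖gradX (fun z => (K.poly C (K.coeffs μ) z).fst) z‖ ≤
      ((d + 1) * (5 * ((d + 1) * (d + 2)) * γ) + (d + 1) * (5 * ((d + 1) * (d + 3) + 1) * γ) +
        (d + 1) * (5 * (1 + (d + 1) * (d + 2)) * (C.gradBound * γ))) * (1 + K.ht / K.hx) * R := by
  have h0 := h.nonneg
  have ht := abs_tc_le (K := K) hz.1
  have hp := K.ht_pos
  have hb := C.gradBound_nonneg
  have e : gradX (fun z => (K.poly C (K.coeffs μ) z).fst) z =
      ∑ i, ((K.coeffs μ).A i - μ wE) • K.grad i + K.tc z.1 • ∑ i, (K.coeffs μ).B i • K.grad i +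
        ∑ j, (K.coeffs μ).β j • K.gradCorr C j z.2 := by
    rw [(K.hasGradAt_poly C _ z).gradX_eq]
    congr 1
    simp only [sub_smul, Finset.sum_sub_distrib, ← Finset.smul_sum, sum_grad, smul_zero, sub_zero,
      add_smul, Finset.sum_add_distrib]
    rw [Finset.smul_sum]
    congr 1
    exact Finset.sum_congr rfl fun i _ => by rw [smul_smul, mul_comm]
  have h1 := norm_sum_smul_le h.abs_A_sub hg (by positivity)
  have h2 := norm_sum_smul_le h.abs_B hg (by positivity)
  have h3 := norm_sum_smul_le (h.abs_β hd) (fun j => norm_gradCorr_le C hz.2 j hg) (by positivity)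
  have h4 : ‖K.tc z.1 • ∑ i, (K.coeffs μ).B i • K.grad i‖ ≤
      K.ht * (((d + 1 : ℕ) : ℝ) * (5 * ((d + 1) * (d + 3) + 1) * R * (γ / K.hx))) := by
    rw [norm_smul, Real.norm_eq_abs]
    exact mul_le_mul ht h2 (norm_nonneg _) hp.le
  rw [e]
  refine (norm_add_le _ _).trans ((add_le_add ((norm_add_le _ _).trans (add_le_add h1 h4)) h3).trans ?_)
  push_cast
  set q := K.ht / K.hx with hq
  have hq0 : 0 ≤ q := by positivity
  have e1 : ((d : ℝ) + 1) * ((d + 1) * (d + 2) * (5 * K.hx * R) * (γ / K.hx)) =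
      (d + 1) * (5 * ((d + 1) * (d + 2)) * γ) * R := by field_simp
  have e2 : K.ht * (((d : ℝ) + 1) * (5 * ((d + 1) * (d + 3) + 1) * R * (γ / K.hx))) =
      (d + 1) * (5 * ((d + 1) * (d + 3) + 1) * γ) * q * R := by rw [hq]; field_simp
  have e3 : ((d : ℝ) + 1) * (5 * (1 + (d + 1) * (d + 2)) * (K.hx * R) * (C.gradBound * (γ / K.hx))) =
      (d + 1) * (5 * (1 + (d + 1) * (d + 2)) * (C.gradBound * γ)) * R := by field_simp
  rw [e1, e2, e3]
  have a1 : 0 ≤ ((d : ℝ) + 1) * (5 * ((d + 1) * (d + 2)) * γ) * q * R := by positivity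
  have a2 : 0 ≤ ((d : ℝ) + 1) * (5 * ((d + 1) * (d + 3) + 1) * γ) * R := by positivity
  have a3 : 0 ≤ ((d : ℝ) + 1) * (5 * (1 + (d + 1) * (d + 2)) * (C.gradBound * γ)) * q * R := by
    positivity
  linarith

/-- Pointwise bounds for the local operator. -/
theorem exists_poly_bound (hd : 1 ≤ d) (T X γ : ℝ) : ∃ B : ℝ, 0 ≤ B ∧ ∀ (K : Cell d)
    (μ : Weight d →ₗ[ℝ] ℝ) (R : ℝ), K.IsBoundedMean μ R → K.ht ≤ T → K.hx ≤ X → 0 < K.hx →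
    (∀ i, ‖K.grad i‖ ≤ γ / K.hx) → ∀ z ∈ K.carrier,
    ‖K.poly C (K.coeffs μ) z‖ ≤ B * (1 + K.ht / K.hx) * R ∧
      ‖astarOp (K.poly C (K.coeffs μ)) z‖ ≤ B * (1 + K.ht / K.hx) * R := by
  set B₁ : ℝ := ((d + 1) * (5 * ((d + 1) * (d + 3)) +
      5 * ((d + 1) * (d + 3) + 1) * T) + (d + 1) * (5 * (1 + (d + 1) * (d + 2)) * X * C.bound)) with h1
  set B₂ : ℝ := (5 + 60 * (1 + X) + 65 * X) with h2
  set B₃ : ℝ := ((d + 1) * (5 * ((d + 1) * (d + 3) + 1)) + d * 65) with h3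
  set B₄ : ℝ := ((d + 1) * (5 * ((d + 1) * (d + 2)) * γ) + (d + 1) * (5 * ((d + 1) * (d + 3) + 1) * γ) +
        (d + 1) * (5 * (1 + (d + 1) * (d + 2)) * (C.gradBound * γ))) with h4
  -- The numbers `T`, `X` and `γ` are arbitrary at this point and may be negative, hence the
  -- absolute values.
  refine ⟨|B₁| + |B₂| + |B₃| + |B₄|, by positivity, fun K μ R h hT hX hx hg z hz => ?_⟩
  have hR := h.nonneg
  have hp := K.ht_pos
  -- The sign of `γ` follows from the gradient bound, whose left side is a norm.
  have hγ : 0 ≤ γ := by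
    have := (norm_nonneg _).trans (hg 0)
    by_contra hn
    exact absurd this (not_le.2 (div_neg_of_neg_of_pos (not_le.1 hn) hx))
  set q := K.ht / K.hx with hq
  have hq0 : 0 ≤ q := by positivity
  have up : ∀ b : ℝ, b * R ≤ |b| * (1 + q) * R := fun b => by
    refine mul_le_mul_of_nonneg_right ?_ hR
    nlinarith [le_abs_self b, mul_nonneg (abs_nonneg b) hq0]
  have b1 := (abs_poly_fst_le C hd h hT hX hz).trans (up B₁)
  have b2 := (norm_poly_snd_le C hd h hX hz).trans (up B₂)
  have b3 := (abs_astar_poly_fst_le C hd h hz).trans (up B₃)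
  have b4 : ‖gradX (fun z => (K.poly C (K.coeffs μ) z).fst) z‖ ≤ |B₄| * (1 + q) * R :=
    (norm_gradX_poly_le C hd h hx hγ hg hz).trans
      (mul_le_mul_of_nonneg_right (mul_le_mul_of_nonneg_right (le_abs_self B₄) (by positivity)) hR)
  have n1 : ∀ b : ℝ, 0 ≤ |b| * (1 + q) * R := fun b => by positivity
  constructor
  · have := norm_val_le (K.poly C (K.coeffs μ) z)
    linarith [n1 B₃, n1 B₄]
  · have c1 := norm_val_le (astarOp (K.poly C (K.coeffs μ)) z)
    have c2 : ‖(astarOp (K.poly C (K.coeffs μ)) z).snd‖ ≤ ‖(K.poly C (K.coeffs μ) z).snd‖ +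
        ‖gradX (fun z => (K.poly C (K.coeffs μ) z).fst) z‖ := norm_sub_le _ _
    linarith [n1 B₁]

end Cell

end HeatDPG

end

noncomputable section

namespace HeatDPG

/-! ### Local polynomial fields are piecewise polynomials -/

variable {d : ℕ}

theorem affine_mem_polySpace (c : ℝ) (v : Sp d) : (fun x => c + ⟪v, x⟫) ∈ polySpace d 1 := by
  refine ⟨MvPolynomial.C c + ∑ i, MvPolynomial.C (v i) * MvPolynomial.X i, ?_, ?_⟩
  · refine (MvPolynomial.totalDegree_add _ _).trans (max_le (by simp) ?_)
    refine MvPolynomial.totalDegree_finsetSum_le fun i _ => ?_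
    refine (MvPolynomial.totalDegree_mul _ _).trans ?_
    simp
  · ext x
    simp [PiLp.inner_apply, mul_comm]

theorem exists_affine_of_mem_polySpace {f : Sp d → ℝ} (hf : f ∈ polySpace d 1) :
    ∃ (c : ℝ) (v : Sp d), ∀ x, f x = c + ⟪v, x⟫ := by
  obtain ⟨p, hp, rfl⟩ := hf
  have h : ∀ m ∈ p.support, ∃ (c : ℝ) (v : Sp d), ∀ x : Sp d,
      p.coeff m * (∏ i, (x i) ^ m i) = c + ⟪v, x⟫ := by
    intro m hm
    have h1 : (∑ i, m i) ≤ 1 := by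
      have := (MvPolynomial.le_totalDegree hm).trans hp
      rwa [Finsupp.sum_fintype _ _ fun _ => rfl] at this
    by_cases h0 : ∀ i, m i = 0
    · exact ⟨p.coeff m, 0, fun x => by simp [h0]⟩
    · push Not at h0
      obtain ⟨i, hi⟩ := h0
      have h2 := Finset.add_sum_erase Finset.univ (fun i => m i) (Finset.mem_univ i)
      have h3 : m i = 1 := by lia
      have h4 : ∀ j, j ≠ i → m j = 0 := fun j hj => by
        have := Finset.single_le_sum (f := fun i => m i) (fun _ _ => Nat.zero_le _)
          (Finset.mem_erase.2 ⟨hj, Finset.mem_univ j⟩)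
        lia
      refine ⟨0, EuclideanSpace.single i (p.coeff m), fun x => ?_⟩
      rw [Finset.prod_eq_single i (fun j _ hj => by rw [h4 j hj, pow_zero]) (by simp), h3,
        EuclideanSpace.inner_single_left]
      simp
  choose! c v hcv using h
  refine ⟨∑ m ∈ p.support, c m, ∑ m ∈ p.support, v m, fun x => ?_⟩
  change MvPolynomial.eval (fun i => x i) p = _
  rw [MvPolynomial.eval_eq', sum_inner, ← Finset.sum_add_distrib]
  exact Finset.sum_congr rfl fun m hm => hcv m hm x

theorem polySpace_mono {k l : ℕ} (h : k ≤ l) : polySpace d k ≤ polySpace d l := by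
  rintro _ ⟨p, hp, rfl⟩
  exact ⟨p, hp.trans h, rfl⟩

theorem const_mem_polySpace (c : ℝ) (k : ℕ) : (fun _ => c) ∈ polySpace d k :=
  ⟨MvPolynomial.C c, by simp, by simp⟩

theorem mul_mem_polySpace {k l : ℕ} {f g : Sp d → ℝ} (hf : f ∈ polySpace d k)
    (hg : g ∈ polySpace d l) : (fun x => f x * g x) ∈ polySpace d (k + l) := by
  obtain ⟨p, hp, rfl⟩ := hf
  obtain ⟨q, hq, rfl⟩ := hg
  exact ⟨p * q, (MvPolynomial.totalDegree_mul _ _).trans (add_le_add hp hq), by ext; simp⟩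

theorem tensor_mem {k : ℕ} {f : Sp d → ℝ} (hf : f ∈ polySpace d k) (hk : 1 ≤ k) (a b : ℝ) :
    (fun z : TS d => (a + b * z.1) * f z.2) ∈ tensorSpace d k := by
  refine Submodule.subset_span ⟨Polynomial.C a + Polynomial.C b * Polynomial.X, f, ?_, hf, ?_⟩
  · exact (Polynomial.natDegree_add_le _ _).trans (max_le (by simp)
      (Polynomial.natDegree_mul_le.trans (by simpa using hk)))
  · ext z
    simp

theorem tensorSpace_sum {ι : Type*} (s : Finset ι) {k : ℕ} {f : ι → TS d → ℝ}
    (h : ∀ i ∈ s, f i ∈ tensorSpace d k) : (fun z => ∑ i ∈ s, f i z) ∈ tensorSpace d k := by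
  have := Submodule.sum_mem _ h
  rwa [show ∑ i ∈ s, f i = fun z => ∑ i ∈ s, f i z from funext fun z => Finset.sum_apply _ _ _] at this

theorem tensorSpace_add {k : ℕ} {f g : TS d → ℝ} (hf : f ∈ tensorSpace d k)
    (hg : g ∈ tensorSpace d k) : (fun z => f z + g z) ∈ tensorSpace d k := Submodule.add_mem _ hf hg

namespace Cell

variable (K : Cell d) (C : Correction d)

theorem lam_mem_polySpace (i : Fin (d + 1)) : K.lam i ∈ polySpace d 1 := by
  rw [funext (K.lam_eq i)]
  exact affine_mem_polySpace _ _

theorem lam_pow_mem_polySpace (i : Fin (d + 1)) (n : ℕ) :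
    (fun x => K.lam i x ^ n) ∈ polySpace d n := by
  induction n with
  | zero => simpa using const_mem_polySpace 1 0
  | succ n ih => simpa only [pow_succ] using mul_mem_polySpace ih (K.lam_mem_polySpace i)

theorem one_le_testDeg : 1 ≤ testDeg d := by
  unfold testDeg
  split_ifs <;> norm_num

/-- The corrections alone require the degree `testDeg d`; the rest of the first component is affine
in space. -/
theorem corr_mem_polySpace (j : Fin (d + 1)) : K.corr C j ∈ polySpace d (testDeg d) := by
  have h2 : 2 ≤ testDeg d := by
    unfold testDeg
    split_ifs <;> norm_num
  have hs : (fun x => ∑ k, K.lam k x ^ 2) ∈ polySpace d (testDeg d) := by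
    have := Submodule.sum_mem (polySpace d (testDeg d)) (t := Finset.univ)
      fun k (_ : k ∈ Finset.univ) => polySpace_mono h2 (K.lam_pow_mem_polySpace k 2)
    rwa [show ∑ k, (fun x => K.lam k x ^ 2) = fun x => ∑ k, K.lam k x ^ 2 from
      funext fun z => Finset.sum_apply _ _ _] at this
  have h3 : (fun x => C.c₃ * K.lam j x ^ 3) ∈ polySpace d (testDeg d) := by
    by_cases hd : d = 1
    · exact Submodule.smul_mem _ C.c₃ (polySpace_mono (by simp [testDeg, hd])
        (K.lam_pow_mem_polySpace j 3))
    · rw [C.cubic hd]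
      simpa using const_mem_polySpace 0 (testDeg d)
  exact Submodule.add_mem _ (Submodule.add_mem _ (Submodule.add_mem _ (Submodule.add_mem _
    (const_mem_polySpace C.c₀ _) (Submodule.smul_mem _ C.c₁
      (polySpace_mono one_le_testDeg (K.lam_mem_polySpace j))))
    (Submodule.smul_mem _ C.c₂ (polySpace_mono h2 (K.lam_pow_mem_polySpace j 2)))) h3)
    (Submodule.smul_mem _ C.κ hs)

theorem poly_fst_mem (q : Coeffs d) :
    (fun z => (K.poly C q z).fst) ∈ tensorSpace d (testDeg d) := by
  simp only [poly_fst]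
  refine tensorSpace_add (tensorSpace_sum _ fun i _ => ?_) (tensorSpace_sum _ fun j _ => ?_)
  · convert tensor_mem (polySpace_mono one_le_testDeg (K.lam_mem_polySpace i)) one_le_testDeg
      (q.A i - q.B i * ((K.a + K.b) / 2)) (q.B i) using 2 with z
    rw [tc]
    ring
  · convert tensor_mem (K.corr_mem_polySpace C j) one_le_testDeg (q.β j) 0 using 2 with z
    ring

theorem poly_snd_mem (q : Coeffs d) (i : Fin d) :
    (fun z => (K.poly C q z).snd i) ∈ tensorSpace d 1 := by
  have h1 : (fun x : Sp d => x i - K.center i) ∈ polySpace d 1 := by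
    convert affine_mem_polySpace (-K.center i) (EuclideanSpace.single i 1) using 2 with x
    rw [EuclideanSpace.inner_single_left]
    simp
    ring
  have h2 := tensorSpace_add (tensor_mem (const_mem_polySpace (d := d) 1 1) le_rfl
    (q.m i - (K.a + K.b) / 2 * q.c i) (q.c i))
    (tensor_mem h1 le_rfl (q.s - q.s' * ((K.a + K.b) / 2)) q.s')
  convert h2 using 2 with z
  rw [poly_snd]
  simp [tc]
  ring

/-- Functions in `𝕋_1` in terms of barycentric coordinates. -/
theorem exists_lam_of_mem_tensorSpace {f : TS d → ℝ} (hf : f ∈ tensorSpace d 1) :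
    ∃ α β : Fin (d + 1) → ℝ, ∀ z, f z = ∑ i, (α i + β i * K.tc z.1) * K.lam i z.2 := by
  induction hf using Submodule.span_induction with
  | mem f hf =>
    obtain ⟨p, q, hp, hq, rfl⟩ := hf
    obtain ⟨c, v, hcv⟩ := exists_affine_of_mem_polySpace hq
    obtain ⟨a, b, rfl⟩ : ∃ a b, p = Polynomial.C a * Polynomial.X + Polynomial.C b :=
      ⟨_, _, Polynomial.eq_X_add_C_of_natDegree_le_one hp⟩
    refine ⟨fun i => (b + a * ((K.a + K.b) / 2)) * q (K.vert i), fun i => a * q (K.vert i),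
      fun z => ?_⟩
    have e : q z.2 = ∑ i, K.lam i z.2 * q (K.vert i) := by
      simp only [hcv, mul_add, Finset.sum_add_distrib, ← Finset.sum_mul, sum_lam, one_mul,
        ← real_inner_smul_right, ← inner_sum, sum_lam_smul_vert]
    simp only [Polynomial.eval_add, Polynomial.eval_mul, Polynomial.eval_C, Polynomial.eval_X]
    rw [e, Finset.mul_sum]
    exact Finset.sum_congr rfl fun i _ => by rw [tc]; ring
  | zero => exact ⟨0, 0, fun z => by simp⟩
  | add f g _ _ hf hg =>
    obtain ⟨α, β, h⟩ := hf
    obtain ⟨α', β', h'⟩ := hg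
    refine ⟨α + α', β + β', fun z => ?_⟩
    rw [Pi.add_apply, h, h', ← Finset.sum_add_distrib]
    exact Finset.sum_congr rfl fun i _ => by simp only [Pi.add_apply]; ring
  | smul c f _ hf =>
    obtain ⟨α, β, h⟩ := hf
    refine ⟨c • α, c • β, fun z => ?_⟩
    rw [Pi.smul_apply, h, smul_eq_mul, Finset.mul_sum]
    exact Finset.sum_congr rfl fun i _ => by simp only [Pi.smul_apply, smul_eq_mul]; ring

theorem exists_lam_of_mem_polySpace {f : Sp d → ℝ} (hf : f ∈ polySpace d 1) (x : Sp d) :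
    f x = ∑ i, f (K.vert i) * K.lam i x := by
  obtain ⟨c, v, hcv⟩ := exists_affine_of_mem_polySpace hf
  simp only [hcv, add_mul, Finset.sum_add_distrib, ← Finset.mul_sum, sum_lam, mul_one]
  simp only [mul_comm _ (K.lam _ _), ← real_inner_smul_right, ← inner_sum, sum_lam_smul_vert]

end Cell

/-- Functions in `𝕋_0` are constant. -/
theorem exists_const_of_mem_tensorSpace {f : TS d → ℝ} (hf : f ∈ tensorSpace d 0) :
    ∃ c, ∀ z, f z = c := by
  induction hf using Submodule.span_induction with
  | mem f hf =>
    obtain ⟨p, _, hp, ⟨q, hq, rfl⟩, rfl⟩ := hf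
    rw [Nat.le_zero] at hp hq
    rw [Polynomial.eq_C_of_natDegree_eq_zero hp, MvPolynomial.totalDegree_eq_zero_iff_eq_C.1 hq]
    exact ⟨_, fun z => by simp only [Polynomial.eval_C, MvPolynomial.eval_C]; rfl⟩
  | zero => exact ⟨0, fun z => rfl⟩
  | add f g _ _ hf hg =>
    obtain ⟨a, h⟩ := hf
    obtain ⟨b, h'⟩ := hg
    exact ⟨a + b, fun z => by rw [Pi.add_apply, h, h']⟩
  | smul c f _ hf =>
    obtain ⟨a, h⟩ := hf
    exact ⟨c * a, fun z => by rw [Pi.smul_apply, h, smul_eq_mul]⟩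

end HeatDPG

end

noncomputable section

namespace HeatDPG

/-! ### The Fortin operator for the broken test space -/

variable {d : ℕ} {T : ℝ} {Ω : Set (Sp d)} {𝒯 : Finset (Cell d)}

namespace IsMesh

variable (h : IsMesh T Ω 𝒯) (hT : 0 < T) (hΩ : IsLipschitzDomain Ω) (C : Correction d)

/-- Extension of smooth fields on a cell by zero. -/
def cellField (K : 𝒯) : SmoothField d →ₗ[ℝ] HA T Ω 𝒯 := Classical.choose (h.exists_cellField hT hΩ K.2)

theorem cellField_spec (K : 𝒯) (u : SmoothField d) :
    HA.field T Ω 𝒯 (h.cellField hT hΩ K u) =ᵐ[volume.restrict (cyl T Ω)]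
      K.1.openCell.indicator u.1 ∧
    HA.astar T Ω 𝒯 (h.cellField hT hΩ K u) =ᵐ[volume.restrict (cyl T Ω)]
      K.1.openCell.indicator (astarOp u.1) := Classical.choose_spec (h.exists_cellField hT hΩ K.2) u

/-- The Fortin operator on the broken space. -/
@[irreducible]
def fortin : HA T Ω 𝒯 →ₗ[ℝ] HA T Ω 𝒯 :=
  ∑ K : 𝒯, (h.cellField hT hΩ K).comp (Cell.localField C (h.openCell_subset hT hΩ K.2))

/-- The means of a broken test function on a cell. -/
def means (K : 𝒯) (w : HA T Ω 𝒯) : Weight d →ₗ[ℝ] ℝ :=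
  (Cell.wmean (h.openCell_subset hT hΩ K.2)).flip w

theorem fortin_apply (w : HA T Ω 𝒯) : h.fortin hT hΩ C w =
    ∑ K : 𝒯, h.cellField hT hΩ K (Cell.localField C (h.openCell_subset hT hΩ K.2) w) := by
  rw [fortin, LinearMap.sum_apply]
  rfl

theorem ae_sum_indicator (h : IsMesh T Ω 𝒯) {f : 𝒯 → L2Q T Ω} {u : 𝒯 → TS d → Val d}
    (hf : ∀ K, f K =ᵐ[volume.restrict (cyl T Ω)] K.1.openCell.indicator (u K)) (K : 𝒯) :
    ∀ᵐ z ∂volume.restrict (cyl T Ω), z ∈ K.1.openCell → (∑ K, f K : L2Q T Ω) z = u K z := by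
  have h1 : ∀ᵐ z ∂volume.restrict (cyl T Ω), ∀ K, f K z = K.1.openCell.indicator (u K) z :=
    ae_all_iff.2 hf
  filter_upwards [h1, Lp.coeFn_finsetSum Finset.univ f] with z hz hs hzK
  rw [hs, Finset.sum_apply, Finset.sum_eq_single K]
  · rw [hz, indicator_of_mem hzK]
  · intro K' _ hne
    rw [hz, indicator_of_notMem]
    exact disjoint_left.1 (h.nonoverlap K.1 K.2 K'.1 K'.2 fun h0 => hne (Subtype.ext h0.symm)) hzK
  · exact fun h0 => absurd (Finset.mem_univ K) h0

theorem field_fortin (K : 𝒯) (w : HA T Ω 𝒯) : ∀ᵐ z ∂volume.restrict (cyl T Ω), z ∈ K.1.openCell →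
    HA.field T Ω 𝒯 (h.fortin hT hΩ C w) z = K.1.poly C (K.1.coeffs (h.means hT hΩ K w)) z := by
  rw [fortin_apply, map_sum]
  exact h.ae_sum_indicator (fun K => (h.cellField_spec hT hΩ K _).1) K

theorem astar_fortin (K : 𝒯) (w : HA T Ω 𝒯) : ∀ᵐ z ∂volume.restrict (cyl T Ω), z ∈ K.1.openCell →
    HA.astar T Ω 𝒯 (h.fortin hT hΩ C w) z =
      astarOp (K.1.poly C (K.1.coeffs (h.means hT hΩ K w))) z := by
  rw [fortin_apply, map_sum]
  exact h.ae_sum_indicator (fun K => (h.cellField_spec hT hΩ K _).2) K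

theorem ae_openCell_of_imp (h : IsMesh T Ω 𝒯) (hT : 0 < T) (hΩ : IsLipschitzDomain Ω) {p : TS d → Prop} (K : 𝒯)
    (hp : ∀ᵐ z ∂volume.restrict (cyl T Ω), z ∈ K.1.openCell → p z) :
    ∀ᵐ z ∂volume.restrict K.1.openCell, p z := by
  filter_upwards [Cell.ae_openCell (h.openCell_subset hT hΩ K.2) hp,
    ae_restrict_mem K.1.isOpen_openCell.measurableSet] with z h1 h2
  exact h1 h2

/-- On `K` the image is the polynomial field with the coefficients of `w`, so preservation of a mean
becomes an algebraic identity for `coeffs`. -/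
theorem means_fortin (K : 𝒯) (w : HA T Ω 𝒯) (W : Weight d) :
    h.means hT hΩ K (h.fortin hT hΩ C w) W = K.1.pmean C W (K.1.coeffs (h.means hT hΩ K w)) := by
  refine Cell.mean_congr ?_
  filter_upwards [h.ae_openCell_of_imp hT hΩ K (h.field_fortin hT hΩ C K w),
    h.ae_openCell_of_imp hT hΩ K (h.astar_fortin hT hΩ C K w)] with z h1 h2
  simp only [Cell.dens, h1, h2]

/-- The weights that the Fortin operator preserves. -/
theorem means_sub_fortin_eq_zero {W : Weight d} (K : 𝒯) (w : HA T Ω 𝒯)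
    (hW : ∀ μ, K.1.pmean C W (K.1.coeffs μ) = μ W) :
    h.means hT hΩ K (w - h.fortin hT hΩ C w) W = 0 := by
  have h1 : h.means hT hΩ K (w - h.fortin hT hΩ C w) W =
      h.means hT hΩ K w W - h.means hT hΩ K (h.fortin hT hΩ C w) W := by
    rw [means, map_sub]
    rfl
  rw [h1, means_fortin, hW, sub_self]

theorem isPwTensor_fortin (w : HA T Ω 𝒯) :
    IsPwTensor T Ω 𝒯 (testDeg d) (fun z => (HA.field T Ω 𝒯 (h.fortin hT hΩ C w) z).fst) ∧
      ∀ i, IsPwTensor T Ω 𝒯 1 (fun z => (HA.field T Ω 𝒯 (h.fortin hT hΩ C w) z).snd i) := by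
  have hc : ∀ K : 𝒯, ∀ᵐ z ∂volume.restrict (cyl T Ω), z ∈ K.1.carrier → z ∈ K.1.openCell :=
    fun K => ae_restrict_of_ae (K.1.openCell_ae_eq.mem_iff.mono fun z hz => hz.2)
  constructor
  · intro K hK
    refine ⟨_, K.poly_fst_mem C (K.coeffs (h.means hT hΩ ⟨K, hK⟩ w)), ?_⟩
    filter_upwards [h.field_fortin hT hΩ C ⟨K, hK⟩ w, hc ⟨K, hK⟩] with z h1 h2 hz
    rw [h1 (h2 hz)]
  · intro i K hK
    refine ⟨_, K.poly_snd_mem C (K.coeffs (h.means hT hΩ ⟨K, hK⟩ w)) i, ?_⟩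
    filter_upwards [h.field_fortin hT hΩ C ⟨K, hK⟩ w, hc ⟨K, hK⟩] with z h1 h2 hz
    rw [h1 (h2 hz)]

/-! ### The norm of the Fortin operator -/

theorem norm_sq_prod_L2Q (w : WithLp 2 (L2Q T Ω × L2Q T Ω)) :
    ‖w‖ ^ 2 = ‖w.fst‖ ^ 2 + ‖w.snd‖ ^ 2 := WithLp.prod_norm_sq_eq_of_L2 w

theorem norm_sq_L2Q (f : L2Q T Ω) : ‖f‖ ^ 2 = ∫ z in cyl T Ω, ‖f z‖ ^ 2 := by
  rw [← real_inner_self_eq_norm_sq, L2.inner_def]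
  simp only [real_inner_self_eq_norm_sq]

theorem integrable_norm_sq (f g : L2Q T Ω) :
    Integrable (fun z => ‖f z‖ ^ 2 + ‖g z‖ ^ 2) (volume.restrict (cyl T Ω)) :=
  (Lp.memLp f).norm.integrable_sq.add (Lp.memLp g).norm.integrable_sq

theorem norm_sq_prod_eq_integral (w : WithLp 2 (L2Q T Ω × L2Q T Ω)) :
    ‖w‖ ^ 2 = ∫ z in cyl T Ω, (‖w.fst z‖ ^ 2 + ‖w.snd z‖ ^ 2) := by
  rw [norm_sq_prod_L2Q, norm_sq_L2Q, norm_sq_L2Q,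
    integral_add (Lp.memLp _).norm.integrable_sq (Lp.memLp _).norm.integrable_sq]

theorem norm_sq_HA (w : HA T Ω 𝒯) : ‖w‖ ^ 2 = ∫ z in cyl T Ω,
    (‖HA.field T Ω 𝒯 w z‖ ^ 2 + ‖HA.astar T Ω 𝒯 w z‖ ^ 2) := norm_sq_prod_eq_integral w.1

theorem norm_sq_HA_eq_sum (h : IsMesh T Ω 𝒯) (hT : 0 < T) (hΩ : IsLipschitzDomain Ω)
    (w : HA T Ω 𝒯) : ‖w‖ ^ 2 = ∑ K ∈ 𝒯, volume.real K.carrier *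
      K.mean fun z => ‖HA.field T Ω 𝒯 w z‖ ^ 2 + ‖HA.astar T Ω 𝒯 w z‖ ^ 2 := by
  refine (norm_sq_HA w).trans ((h.integral_cyl hT hΩ
    (integrable_norm_sq (HA.field T Ω 𝒯 w) (HA.astar T Ω 𝒯 w))).trans ?_)
  exact Finset.sum_congr rfl fun K _ => by
    rw [Cell.mean, mul_inv_cancel_left₀ K.volume_carrier_pos.ne']

theorem isBoundedMean (hd : 1 ≤ d) (K : 𝒯) (w : HA T Ω 𝒯) : K.1.IsBoundedMean (h.means hT hΩ K w)
    (K.1.rms (HA.field T Ω 𝒯 w) (HA.astar T Ω 𝒯 w)) where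
  nonneg := Real.sqrt_nonneg _
  le _ _ hM hW := Cell.abs_mean_dens_le hM hW
    (Cell.memLp_openCell (h.openCell_subset hT hΩ K.2) (HA.field T Ω 𝒯 w))
    (Cell.memLp_openCell (h.openCell_subset hT hΩ K.2) (HA.astar T Ω 𝒯 w))
  edge i k := K.1.wmean_wLam_sub hd K.2 (h.openCell_subset hT hΩ K.2) w i k

theorem hx_pos_and_grad_le (hd : 1 ≤ d) {γ : ℝ} (hs : ShapeRegular γ 𝒯) {K : Cell d} (hK : K ∈ 𝒯) :
    0 < K.hx ∧ ∀ i, ‖K.grad i‖ ≤ γ / K.hx := by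
  obtain ⟨c, r, hr, hb, hγ⟩ := hs K hK
  -- The centre of the ball and a boundary point of it in a coordinate direction lie in the simplex;
  -- such a direction exists because `d ≥ 1`.
  have h1 : r ≤ K.hx := by
    have hn : ‖EuclideanSpace.single (⟨0, hd⟩ : Fin d) (1 : ℝ)‖ = 1 := by simp
    have h2 := K.norm_sub_le_hx (hb (show c + r • EuclideanSpace.single (⟨0, hd⟩ : Fin d) (1 : ℝ) ∈ Metric.closedBall c r
      by simp [norm_smul, abs_of_pos hr])) (hb (Metric.mem_closedBall_self hr.le))
    rwa [add_sub_cancel_left, norm_smul, hn, mul_one, Real.norm_of_nonneg hr.le] at h2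
  have h3 : 0 < K.hx := hr.trans_le h1
  refine ⟨h3, fun i => (K.norm_grad_le hr hb i).trans ?_⟩
  rw [le_div_iff₀ h3, inv_mul_le_iff₀ hr, mul_comm]
  exact hγ

/-- Only the entries `1` and `h_t / h_x` of the maximum are used. Powers of `h_t` and `h_x` have
been bounded by `T` and the diameter of `Ω` and sit in the constant. -/
theorem le_meshFactor {K : Cell d} (hK : K ∈ 𝒯) : 1 + K.ht / K.hx ≤ 2 * meshFactor 𝒯 := by
  have h1 := le_ciSup (finite_range fun K : 𝒯 =>
    max (max 1 K.1.ht) (max K.1.hx (K.1.ht / K.1.hx))).bddAbove ⟨K, hK⟩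
  have h2 : 1 ≤ max (max 1 K.ht) (max K.hx (K.ht / K.hx)) := (le_max_left _ _).trans (le_max_left _ _)
  have h3 : K.ht / K.hx ≤ max (max 1 K.ht) (max K.hx (K.ht / K.hx)) :=
    (le_max_right _ _).trans (le_max_right _ _)
  rw [meshFactor]
  simp only at h1
  linarith

theorem one_le_meshFactor (h : IsMesh T Ω 𝒯) (hT : 0 < T) (hΩ : IsLipschitzDomain Ω) : 1 ≤ meshFactor 𝒯 := by
  obtain ⟨K, hK⟩ := h.nonempty hT hΩ
  have h1 := le_ciSup (finite_range fun K : 𝒯 =>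
    max (max 1 K.1.ht) (max K.1.hx (K.1.ht / K.1.hx))).bddAbove ⟨K, hK⟩
  exact ((le_max_left _ _).trans (le_max_left _ _)).trans h1

theorem mean_fortin_le (h : IsMesh T Ω 𝒯) (hT : 0 < T) (hΩ : IsLipschitzDomain Ω)
    (C : Correction d) {K : Cell d} (hK : K ∈ 𝒯) (w : HA T Ω 𝒯) {B : ℝ}
    (H : ∀ z ∈ K.carrier, ‖K.poly C (K.coeffs (h.means hT hΩ ⟨K, hK⟩ w)) z‖ ≤ B ∧
      ‖astarOp (K.poly C (K.coeffs (h.means hT hΩ ⟨K, hK⟩ w))) z‖ ≤ B) :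
    (K.mean fun z => ‖HA.field T Ω 𝒯 (h.fortin hT hΩ C w) z‖ ^ 2 +
      ‖HA.astar T Ω 𝒯 (h.fortin hT hΩ C w) z‖ ^ 2) ≤ 2 * B ^ 2 := by
  rw [← Cell.mean_const (K := K) (2 * B ^ 2)]
  have hf := Cell.memLp_openCell (h.openCell_subset hT hΩ hK) (HA.field T Ω 𝒯 (h.fortin hT hΩ C w))
  have ha := Cell.memLp_openCell (h.openCell_subset hT hΩ hK) (HA.astar T Ω 𝒯 (h.fortin hT hΩ C w))
  refine Cell.mean_mono (hf.norm.integrable_sq.add ha.norm.integrable_sq)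
    (integrableOn_const ((measure_mono K.openCell_subset).trans_lt
      K.isCompact_carrier.measure_lt_top).ne) ?_
  filter_upwards [h.ae_openCell_of_imp hT hΩ ⟨K, hK⟩ (h.field_fortin hT hΩ C ⟨K, hK⟩ w),
    h.ae_openCell_of_imp hT hΩ ⟨K, hK⟩ (h.astar_fortin hT hΩ C ⟨K, hK⟩ w),
    ae_restrict_mem K.isOpen_openCell.measurableSet] with z z1 z2 hz
  rw [z1, z2]
  obtain ⟨h6, h7⟩ := H z (K.openCell_subset hz)
  have h8 := pow_le_pow_left₀ (norm_nonneg _) h6 2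
  have h9 := pow_le_pow_left₀ (norm_nonneg _) h7 2
  linarith

theorem norm_sq_le_of_mean_le (h : IsMesh T Ω 𝒯) (hT : 0 < T) (hΩ : IsLipschitzDomain Ω)
    (v w : HA T Ω 𝒯) {c : ℝ} (H : ∀ K ∈ 𝒯,
      (K.mean fun z => ‖HA.field T Ω 𝒯 v z‖ ^ 2 + ‖HA.astar T Ω 𝒯 v z‖ ^ 2) ≤
        c * K.mean fun z => ‖HA.field T Ω 𝒯 w z‖ ^ 2 + ‖HA.astar T Ω 𝒯 w z‖ ^ 2) :
    ‖v‖ ^ 2 ≤ c * ‖w‖ ^ 2 := by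
  rw [norm_sq_HA_eq_sum h hT hΩ w, norm_sq_HA_eq_sum h hT hΩ v, Finset.mul_sum]
  refine Finset.sum_le_sum fun K hK => ?_
  rw [mul_left_comm]
  exact mul_le_mul_of_nonneg_left (H K hK) measureReal_nonneg

theorem _root_.HeatDPG.Cell.rms_sq (K : Cell d) (w a : TS d → Val d) :
    K.rms w a ^ 2 = K.mean fun z => ‖w z‖ ^ 2 + ‖a z‖ ^ 2 :=
  Real.sq_sqrt (mul_nonneg (inv_nonneg.2 measureReal_nonneg) (integral_nonneg fun z => by positivity))

end IsMesh

set_option maxHeartbeats 1000000 in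
theorem exists_fortin_poly_bound (hd : 1 ≤ d) (hT : 0 < T) (hΩ : IsLipschitzDomain Ω)
    (C : Correction d) (γ : ℝ) : ∃ B : ℝ, 0 ≤ B ∧ ∀ (𝒯 : Finset (Cell d)) (h : IsMesh T Ω 𝒯),
      ShapeRegular γ 𝒯 → ∀ (w : HA T Ω 𝒯) (K : Cell d) (hK : K ∈ 𝒯), ∀ z ∈ K.carrier,
      ‖K.poly C (K.coeffs (h.means hT hΩ ⟨K, hK⟩ w)) z‖ ≤
        2 * B * meshFactor 𝒯 * K.rms (HA.field T Ω 𝒯 w) (HA.astar T Ω 𝒯 w) ∧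
      ‖astarOp (K.poly C (K.coeffs (h.means hT hΩ ⟨K, hK⟩ w))) z‖ ≤
        2 * B * meshFactor 𝒯 * K.rms (HA.field T Ω 𝒯 w) (HA.astar T Ω 𝒯 w) := by
  obtain ⟨B, hB, H⟩ := Cell.exists_poly_bound C hd T (Metric.diam (closure Ω)) γ
  refine ⟨B, hB, fun 𝒯 h hs w K hK z hz => ?_⟩
  have h2 := IsMesh.hx_pos_and_grad_le hd hs hK
  have hb := h.isBoundedMean hT hΩ hd ⟨K, hK⟩ w
  have h4 := H K _ _ hb (h.ht_le hT hK) (h.hx_le hT hΩ hK) h2.1 h2.2 z hz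
  have h6 := mul_le_mul_of_nonneg_right (mul_le_mul_of_nonneg_left
    (IsMesh.le_meshFactor hK) hB) hb.nonneg
  rw [show B * (2 * meshFactor 𝒯) = 2 * B * meshFactor 𝒯 by ring] at h6
  exact ⟨h4.1.trans h6, h4.2.trans h6⟩

theorem le_mul_of_sq_le {x y b m : ℝ} (hy : 0 ≤ y) (hb : 0 ≤ b) (hm : 0 ≤ m)
    (h : x ^ 2 ≤ 2 * (2 * b * m) ^ 2 * y ^ 2) : x ≤ 4 * b * m * y := by
  have h7 : 0 ≤ 4 * b * m * y := by positivity
  refine abs_le_of_sq_le_sq' (h.trans ?_) h7 |>.2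
  nlinarith [sq_nonneg (b * m * y)]

set_option maxHeartbeats 1000000 in
theorem exists_fortin_bound (hd : 1 ≤ d) (hT : 0 < T) (hΩ : IsLipschitzDomain Ω) (C : Correction d)
    (γ : ℝ) : ∃ B : ℝ, 0 ≤ B ∧ ∀ (𝒯 : Finset (Cell d)) (h : IsMesh T Ω 𝒯), ShapeRegular γ 𝒯 →
      ∀ w : HA T Ω 𝒯, ‖h.fortin hT hΩ C w‖ ≤ B * meshFactor 𝒯 * ‖w‖ := by
  obtain ⟨B, hB, H⟩ := exists_fortin_poly_bound hd hT hΩ C γ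
  refine ⟨4 * B, by positivity, fun 𝒯 h hs w => ?_⟩
  refine le_mul_of_sq_le (norm_nonneg w) hB (zero_le_one.trans (h.one_le_meshFactor hT hΩ)) ?_
  refine h.norm_sq_le_of_mean_le hT hΩ (h.fortin hT hΩ C w) w fun K hK => ?_
  refine (h.mean_fortin_le hT hΩ C hK w (H 𝒯 h hs w K hK)).trans_eq ?_
  have e := K.rms_sq (HA.field T Ω 𝒯 w) (HA.astar T Ω 𝒯 w)
  generalize (K.mean fun z => ‖HA.field T Ω 𝒯 w z‖ ^ 2 + ‖HA.astar T Ω 𝒯 w z‖ ^ 2) = y at e ⊢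
  rw [← e]
  ring

end HeatDPG

end

noncomputable section

namespace HeatDPG

/-! ### The projection of the initial values -/

variable {d : ℕ} {T : ℝ} {Ω : Set (Sp d)} {𝒯 : Finset (Cell d)}

namespace Cell

variable (K : Cell d)

/-- The weight whose mean against `ξ` is the `i`-th coefficient of the projection of `ξ`. -/
def dual (i : Fin (d + 1)) (x : Sp d) : ℝ := (d + 1) * ((d + 2) * K.lam i x - 1)

theorem continuous_dual (i : Fin (d + 1)) : Continuous (K.dual i) := by
  have := K.continuous_lam i
  unfold dual
  fun_prop

theorem abs_dual_le {x : Sp d} (hx : x ∈ K.space) (i : Fin (d + 1)) :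
    |K.dual i x| ≤ (d + 1) * (d + 3) := by
  have h1 := K.lam_nonneg hx i
  have h2 := K.lam_le_one hx i
  have h3 : (0 : ℝ) ≤ d := Nat.cast_nonneg d
  rw [dual, abs_mul, abs_of_nonneg (by positivity : (0 : ℝ) ≤ d + 1)]
  refine mul_le_mul_of_nonneg_left (abs_le.2 ⟨?_, ?_⟩) (by positivity) <;> nlinarith

theorem memLp_space {f : Sp d → ℝ} (hK : interior K.space ⊆ Ω)
    (hf : MemLp f 2 (volume.restrict Ω)) : MemLp f 2 (volume.restrict K.space) := by
  rw [← Measure.restrict_congr_set K.interior_space_ae_eq]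
  exact hf.mono_measure (Measure.restrict_mono_set _ hK)

theorem integrableOn_mul_space {f ξ : Sp d → ℝ} (hf : Continuous f)
    (hξ : MemLp ξ 2 (volume.restrict K.space)) : IntegrableOn (fun x => f x * ξ x) K.space :=
  (hf.memLp_restrict K.isCompact_space subset_rfl : MemLp f 2 _).integrable_mul hξ

theorem ae_space (hK : interior K.space ⊆ Ω) {p : Sp d → Prop}
    (h : ∀ᵐ x ∂volume.restrict Ω, p x) : ∀ᵐ x ∂volume.restrict K.space, p x := by
  rw [← Measure.restrict_congr_set K.interior_space_ae_eq]
  exact ae_mono (Measure.restrict_mono_set _ hK) h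

/-- The weighted means of initial values. -/
def initialMean (hK : interior K.space ⊆ Ω) {f : Sp d → ℝ} (hf : Continuous f) : L2Om Ω →ₗ[ℝ] ℝ :=
  linearOfComb (fun ξ => K.smean fun x => f x * ξ x) fun c ξ η => by
    have i1 := K.integrableOn_mul_space hf (K.memLp_space hK (Lp.memLp ξ))
    have i2 := K.integrableOn_mul_space hf (K.memLp_space hK (Lp.memLp η))
    have e : ∫ x in K.space, f x * (c • ξ + η : L2Om Ω) x =
        ∫ x in K.space, (c * (f x * ξ x) + f x * η x) := by
      refine integral_congr_ae ?_
      filter_upwards [K.ae_space hK (coeFn_comb c ξ η)] with x hx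
      rw [hx, smul_eq_mul]
      ring
    simp only [smean]
    rw [e, integral_add (i1.const_mul c) i2, integral_const_mul, smul_eq_mul]
    ring

theorem smean_sq_le {f : Sp d → ℝ} (hf : MemLp f 2 (volume.restrict K.space)) :
    K.smean f ^ 2 ≤ K.smean fun z => f z ^ 2 := by
  have : IsFiniteMeasure (volume.restrict K.space) :=
    ⟨by simpa using K.isCompact_space.measure_lt_top⟩
  have i1 : IntegrableOn f K.space := hf.integrable (by norm_num)
  have i2 : IntegrableOn (fun z => f z ^ 2) K.space := hf.integrable_sq
  have i3 : IntegrableOn (fun z => 2 * K.smean f * f z) K.space := i1.const_mul _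
  have i4 : IntegrableOn (fun z => f z ^ 2 - 2 * K.smean f * f z) K.space := i2.sub i3
  have i5 : IntegrableOn (fun _ => K.smean f ^ 2) K.space := integrable_const _
  have h0 : 0 ≤ ∫ x in K.space, (f x ^ 2 - 2 * K.smean f * f x + K.smean f ^ 2) :=
    integral_nonneg fun x => by
      change 0 ≤ f x ^ 2 - 2 * K.smean f * f x + K.smean f ^ 2
      nlinarith [sq_nonneg (f x - K.smean f)]
  rw [integral_add i4 i5, integral_sub i2 i3,
    integral_const_mul, setIntegral_const, smul_eq_mul] at h0
  have hv := K.volume_space_pos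
  have e1 : ∫ x in K.space, f x = volume.real K.space * K.smean f := by
    rw [smean, mul_inv_cancel_left₀ hv.ne']
  have e2 : ∫ x in K.space, f x ^ 2 = volume.real K.space * K.smean fun z => f z ^ 2 := by
    rw [smean, mul_inv_cancel_left₀ hv.ne']
  rw [e1, e2] at h0
  have h1 : 0 ≤ volume.real K.space * ((K.smean fun z => f z ^ 2) - K.smean f ^ 2) := by
    linarith
  have := nonneg_of_mul_nonneg_right h1 hv
  linarith

/-- The local projection of initial values. -/
def proj (ξ : Sp d → ℝ) (x : Sp d) : ℝ := ∑ i, (K.smean fun x => K.dual i x * ξ x) * K.lam i x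

theorem abs_proj_le {ξ : Sp d → ℝ} (hξ : MemLp ξ 2 (volume.restrict K.space)) {x : Sp d}
    (hx : x ∈ K.space) :
    |K.proj ξ x| ≤ (d + 1) * ((d + 1) * (d + 3)) * √(K.smean fun x => ξ x ^ 2) := by
  have h1 : ∀ i, |K.smean fun x => K.dual i x * ξ x| ≤
      (d + 1) * (d + 3) * √(K.smean fun x => ξ x ^ 2) := fun i => by
    have hl : MemLp (fun x => K.dual i x * ξ x) 2 (volume.restrict K.space) :=
      hξ.of_le_mul ((K.continuous_dual i).aestronglyMeasurable.mul hξ.1)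
        (c := (d + 1) * (d + 3)) (by
        filter_upwards [ae_restrict_mem K.measurableSet_space] with x hx
        rw [norm_mul]
        exact mul_le_mul_of_nonneg_right (K.abs_dual_le hx i) (norm_nonneg _))
    have h2 := K.smean_sq_le hl
    have h3 : (K.smean fun x => (K.dual i x * ξ x) ^ 2) ≤
        ((d + 1) * (d + 3)) ^ 2 * K.smean fun x => ξ x ^ 2 := by
      rw [← smean_const_mul]
      refine mul_le_mul_of_nonneg_left (integral_mono_ae hl.integrable_sq
        (hξ.integrable_sq.const_mul _) ?_) (inv_nonneg.2 measureReal_nonneg)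
      filter_upwards [ae_restrict_mem K.measurableSet_space] with x hx
      have h4 := pow_le_pow_left₀ (abs_nonneg _) (K.abs_dual_le hx i) 2
      rw [sq_abs] at h4
      rw [mul_pow]
      exact mul_le_mul_of_nonneg_right h4 (sq_nonneg _)
    have h0 : 0 ≤ K.smean fun x => ξ x ^ 2 :=
      mul_nonneg (inv_nonneg.2 measureReal_nonneg) (integral_nonneg fun z => sq_nonneg _)
    refine abs_le_of_sq_le_sq ?_ (by positivity)
    rw [mul_pow, Real.sq_sqrt h0]
    exact h2.trans h3
  refine (abs_sum_mul_le h1 (K.abs_lam_le_one hx) (by positivity)).trans_eq ?_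
  push_cast
  ring

/-- The local projection preserves the moments of order one. -/
theorem smean_lam_mul_proj (hd : 1 ≤ d) {ξ : Sp d → ℝ} (hξ : MemLp ξ 2 (volume.restrict K.space))
    (k : Fin (d + 1)) :
    K.smean (fun x => K.lam k x * K.proj ξ x) = K.smean fun x => K.lam k x * ξ x := by
  have cl := K.continuous_lam
  have cd := K.continuous_dual
  set a : Fin (d + 1) → ℝ := fun i => K.smean fun x => K.dual i x * ξ x with ha
  have e : (fun x => K.lam k x * K.proj ξ x) = fun x => ∑ i, a i * (K.lam i x * K.lam k x) := by
    ext x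
    rw [proj, Finset.mul_sum]
    exact Finset.sum_congr rfl fun i _ => by ring
  rw [e, smean_sum _ fun k _ => by fun_prop]
  simp only [smean_const_mul, K.smean_lam_mul_lam hd]
  have i1 : ∀ {f : Sp d → ℝ}, Continuous f → IntegrableOn (fun x => f x * ξ x) K.space :=
    fun hf => K.integrableOn_mul_space hf hξ
  have e1 : ∀ i, a i * ((1 + if k = i then 1 else 0) / (((d : ℝ) + 1) * (d + 2))) =
      K.smean fun x => ((1 + if k = i then 1 else 0) / (((d : ℝ) + 1) * (d + 2))) *
        K.dual i x * ξ x := fun i => by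
    simp only [mul_assoc _ (K.dual i _), smean_const_mul, ha]
    ring
  -- The functions `dual i` are dual to the barycentric coordinates in the mean inner product:
  -- applying the Gram matrix to them returns `λ_k`.
  have e2 : ∀ x, ∑ i, ((1 + if k = i then 1 else 0) / (((d : ℝ) + 1) * (d + 2))) * K.dual i x * ξ x =
      K.lam k x * ξ x := fun x => by
    rw [← Finset.sum_mul]
    congr 1
    have e3 : ∀ i, ((1 + if k = i then 1 else 0) / (((d : ℝ) + 1) * (d + 2))) * K.dual i x =
        (K.lam i x - ((d : ℝ) + 2)⁻¹) + if k = i then K.lam i x - ((d : ℝ) + 2)⁻¹ else 0 := fun i => by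
      rw [dual]
      split_ifs <;> field_simp <;> ring
    simp only [e3]
    rw [Finset.sum_add_distrib, Finset.sum_ite_eq, Finset.sum_sub_distrib, sum_lam]
    simp only [Finset.mem_univ, if_true, Finset.sum_const, Finset.card_univ, Fintype.card_fin,
      nsmul_eq_mul]
    push_cast
    field_simp
    ring
  simp only [e1]
  simp only [smean]
  rw [← Finset.mul_sum, ← integral_finsetSum _ fun i _ => i1 (f := fun x => _ * K.dual i x) (continuous_const.mul (cd i))]
  simp only [e2]

theorem smean_poly_mul_sub_proj (hd : 1 ≤ d) {ξ : Sp d → ℝ}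
    (hξ : MemLp ξ 2 (volume.restrict K.space)) {θ : Sp d → ℝ} (hθ : θ ∈ polySpace d 1) :
    ∫ x in K.space, θ x * (ξ x - K.proj ξ x) = 0 := by
  have cl := K.continuous_lam
  have cp : Continuous (K.proj ξ) := by unfold proj; fun_prop
  have h1 : ∀ k, ∫ x in K.space, K.lam k x * (ξ x - K.proj ξ x) = 0 := fun k => by
    have h2 := K.smean_lam_mul_proj hd hξ k
    simp only [smean] at h2
    have h3 := mul_left_cancel₀ (inv_ne_zero K.volume_space_pos.ne') h2
    simp only [mul_sub]
    rw [integral_sub (K.integrableOn_mul_space (cl k) hξ)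
      (Continuous.integrableOn_of_isCompact (by fun_prop) K.isCompact_space), h3, sub_self]
  have e : ∀ x, θ x * (ξ x - K.proj ξ x) =
      ∑ k, θ (K.vert k) * (K.lam k x * (ξ x - K.proj ξ x)) := fun x => by
    rw [K.exists_lam_of_mem_polySpace hθ x, Finset.sum_mul]
    exact Finset.sum_congr rfl fun k _ => by ring
  simp only [e]
  rw [integral_finsetSum _ fun k _ => ?_]
  · simp only [integral_const_mul, h1, mul_zero, Finset.sum_const_zero]
  · refine Integrable.const_mul ?_ _
    exact K.integrableOn_mul_space (cl k) (hξ.sub (cp.memLp_restrict K.isCompact_space subset_rfl))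

end Cell

namespace IsMesh

variable (h : IsMesh T Ω 𝒯) (hT : 0 < T) (hΩ : IsLipschitzDomain Ω)

theorem memLp_indicator_lam (K : Cell d) (i : Fin (d + 1)) :
    MemLp ((interior K.space).indicator (K.lam i)) 2 (volume.restrict Ω) :=
  ((memLp_indicator_iff_restrict measurableSet_interior).2
    ((K.continuous_lam i).memLp_restrict K.isCompact_space interior_subset)).restrict _

theorem interior_subset_of_initial (h : IsMesh T Ω 𝒯) (hT : 0 < T) (hΩ : IsLipschitzDomain Ω)
    (K : initialCells 𝒯) : interior K.1.space ⊆ Ω :=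
  h.interior_space_subset hT hΩ (mem_initialCells.1 K.2).1

/-- The projection of the initial values to piecewise affine functions. -/
def initialProj : L2Om Ω →ₗ[ℝ] L2Om Ω :=
  ∑ K : initialCells 𝒯, ∑ i, (K.1.initialMean (h.interior_subset_of_initial hT hΩ K)
    (K.1.continuous_dual i)).smulRight (memLp_indicator_lam (Ω := Ω) K.1 i).toLp

theorem initialProj_apply (K : initialCells 𝒯) (ξ : L2Om Ω) :
    ∀ᵐ x ∂volume.restrict Ω, x ∈ interior K.1.space → h.initialProj hT hΩ ξ x = K.1.proj ξ x := by
  have e : h.initialProj hT hΩ ξ = ∑ K : initialCells 𝒯, ∑ i,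
      (K.1.smean fun x => K.1.dual i x * ξ x) • (memLp_indicator_lam (Ω := Ω) K.1 i).toLp := by
    simp only [initialProj, LinearMap.sum_apply, LinearMap.smulRight_apply]
    rfl
  have h1 : ∀ᵐ x ∂volume.restrict Ω, ∀ (K : initialCells 𝒯) i,
      ((memLp_indicator_lam (Ω := Ω) K.1 i).toLp : L2Om Ω) x =
        (interior K.1.space).indicator (K.1.lam i) x :=
    ae_all_iff.2 fun K => ae_all_iff.2 fun i => (memLp_indicator_lam K.1 i).coeFn_toLp
  have h2 : ∀ᵐ x ∂volume.restrict Ω, ∀ (K : initialCells 𝒯) i,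
      ((K.1.smean fun x => K.1.dual i x * ξ x) • (memLp_indicator_lam (Ω := Ω) K.1 i).toLp : L2Om Ω) x =
      (K.1.smean fun x => K.1.dual i x * ξ x) *
        ((memLp_indicator_lam (Ω := Ω) K.1 i).toLp : L2Om Ω) x :=
    ae_all_iff.2 fun K => ae_all_iff.2 fun i => Lp.coeFn_smul _ _
  have h3 : ∀ᵐ x ∂volume.restrict Ω, ∀ (K : initialCells 𝒯), (∑ i,
      (K.1.smean fun x => K.1.dual i x * ξ x) • (memLp_indicator_lam (Ω := Ω) K.1 i).toLp : L2Om Ω) x =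
      ∑ i, ((K.1.smean fun x => K.1.dual i x * ξ x) •
        (memLp_indicator_lam (Ω := Ω) K.1 i).toLp : L2Om Ω) x :=
    ae_all_iff.2 fun K => by
      filter_upwards [Lp.coeFn_finsetSum Finset.univ fun i =>
        ((K.1.smean fun x => K.1.dual i x * ξ x) •
          (memLp_indicator_lam (Ω := Ω) K.1 i).toLp : L2Om Ω)] with x hx
      rw [hx, Finset.sum_apply]
  rw [e]
  filter_upwards [h1, h2, h3, Lp.coeFn_finsetSum Finset.univ fun K : initialCells 𝒯 => (∑ i,
      (K.1.smean fun x => K.1.dual i x * ξ x) • (memLp_indicator_lam (Ω := Ω) K.1 i).toLp : L2Om Ω)]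
      with x h1 h2 h3 h4 hx
  rw [h4, Finset.sum_apply, Finset.sum_eq_single K]
  · rw [h3, Cell.proj]
    exact Finset.sum_congr rfl fun i _ => by rw [h2, h1, indicator_of_mem hx]
  · intro K' _ hne
    rw [h3]
    refine Finset.sum_eq_zero fun i _ => ?_
    rw [h2, h1, indicator_of_notMem, mul_zero]
    obtain ⟨a1, a2⟩ := mem_initialCells.1 K.2
    obtain ⟨b1, b2⟩ := mem_initialCells.1 K'.2
    exact disjoint_left.1 (h.disjoint_initial a1 b1 a2 b2 fun h0 => hne (Subtype.ext h0.symm)) hx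
  · exact fun h0 => absurd (Finset.mem_univ K) h0

theorem initialProj_ae_space (K : initialCells 𝒯) (ξ : L2Om Ω) :
    ∀ᵐ x ∂volume.restrict K.1.space, h.initialProj hT hΩ ξ x = K.1.proj ξ x := by
  have h1 := K.1.ae_space (h.interior_subset_of_initial hT hΩ K) (h.initialProj_apply hT hΩ K ξ)
  rw [← Measure.restrict_congr_set K.1.interior_space_ae_eq] at h1 ⊢
  filter_upwards [h1, ae_restrict_mem measurableSet_interior] with x h1 h2
  exact h1 h2

theorem integral_mul_sub_initialProj (hd : 1 ≤ d) {K : Cell d} (hK : K ∈ 𝒯) (h0 : K.a = 0)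
    (ξ : L2Om Ω) {θ : Sp d → ℝ} (hθ : θ ∈ polySpace d 1) :
    ∫ x in K.space, θ x * (ξ - h.initialProj hT hΩ ξ : L2Om Ω) x = 0 := by
  have hK' := mem_initialCells.2 ⟨hK, h0⟩
  have hs := h.interior_space_subset hT hΩ hK
  rw [← K.smean_poly_mul_sub_proj hd (K.memLp_space hs (Lp.memLp ξ)) hθ]
  refine integral_congr_ae ?_
  filter_upwards [h.initialProj_ae_space hT hΩ ⟨K, hK'⟩ ξ,
    K.ae_space hs (Lp.coeFn_sub ξ (h.initialProj hT hΩ ξ))] with x h1 h2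
  rw [h2, Pi.sub_apply, h1]

theorem initialProj_eq_zero {K : Cell d} (hK : K ∈ 𝒯) (h0 : K.a = 0) (ξ : L2Om Ω)
    (hξ : ∀ᵐ x ∂volume.restrict Ω, x ∈ K.space → ξ x = 0) :
    ∀ᵐ x ∂volume.restrict Ω, x ∈ K.space → h.initialProj hT hΩ ξ x = 0 := by
  have hK' := mem_initialCells.2 ⟨hK, h0⟩
  have hs := h.interior_space_subset hT hΩ hK
  have h1 : ∀ i, (K.smean fun x => K.dual i x * ξ x) = 0 := fun i => by
    rw [Cell.smean, integral_eq_zero_of_ae, mul_zero]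
    filter_upwards [K.ae_space hs hξ, ae_restrict_mem K.measurableSet_space] with x h1 h2
    rw [h1 h2, mul_zero, Pi.zero_apply]
  filter_upwards [h.initialProj_apply hT hΩ ⟨K, hK'⟩ ξ,
    ae_restrict_of_ae K.interior_space_ae_eq.mem_iff] with x h2 h3 hx
  rw [h2 (h3.2 hx), Cell.proj]
  exact Finset.sum_eq_zero fun i _ => by rw [h1, zero_mul]

theorem isPwPoly0_initialProj (ξ : L2Om Ω) : IsPwPoly0 Ω 𝒯 1 (h.initialProj hT hΩ ξ) := by
  intro K hK h0
  have hK' := mem_initialCells.2 ⟨hK, h0⟩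
  refine ⟨K.proj ξ, ?_, ?_⟩
  · have := Submodule.sum_mem (polySpace d 1) (t := Finset.univ) fun i (_ : i ∈ Finset.univ) =>
      Submodule.smul_mem _ (K.smean fun x => K.dual i x * ξ x) (K.lam_mem_polySpace i)
    convert this using 1
    ext x
    simp [Cell.proj]
  · filter_upwards [h.initialProj_apply hT hΩ ⟨K, hK'⟩ ξ,
      ae_restrict_of_ae K.interior_space_ae_eq.mem_iff] with x h2 h3 hx
    exact h2 (h3.2 hx)

theorem norm_initialProj_le (ξ : L2Om Ω) :
    ‖h.initialProj hT hΩ ξ‖ ≤ (d + 1) * ((d + 1) * (d + 3)) * ‖ξ‖ := by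
  have n1 : ∀ f : L2Om Ω, ‖f‖ ^ 2 = ∑ K ∈ initialCells 𝒯, ∫ x in K.space, f x ^ 2 := fun f => by
    rw [← real_inner_self_eq_norm_sq, L2.inner_def]
    simp only [real_inner_self_eq_norm_sq, Real.norm_eq_abs, sq_abs]
    rw [h.integral_initial hT hΩ (Lp.memLp f).integrable_sq]
    exact Finset.sum_congr rfl fun K _ => setIntegral_congr_set K.interior_space_ae_eq
  refine abs_le_of_sq_le_sq' ?_ (by positivity) |>.2
  rw [mul_pow, n1, n1, Finset.mul_sum]
  refine Finset.sum_le_sum fun K hK => ?_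
  have hs := h.interior_space_subset hT hΩ (mem_initialCells.1 hK).1
  have hv := K.volume_space_pos
  have hm := K.memLp_space hs (Lp.memLp ξ)
  have h0 : 0 ≤ K.smean fun x => ξ x ^ 2 :=
    mul_nonneg (inv_nonneg.2 measureReal_nonneg) (integral_nonneg fun z => sq_nonneg _)
  have h1 : ∫ x in K.space, h.initialProj hT hΩ ξ x ^ 2 ≤ ∫ x in K.space,
      ((d + 1) * ((d + 1) * (d + 3)) * √(K.smean fun x => ξ x ^ 2)) ^ 2 := by
    refine integral_mono_ae (K.memLp_space hs (Lp.memLp _)).integrable_sq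
      (integrableOn_const K.volume_space_ne_top) ?_
    filter_upwards [h.initialProj_ae_space hT hΩ ⟨K, hK⟩ ξ,
      ae_restrict_mem K.measurableSet_space] with x h2 h3
    rw [h2, ← sq_abs]
    exact pow_le_pow_left₀ (abs_nonneg _) (K.abs_proj_le hm h3) 2
  refine h1.trans_eq ?_
  rw [setIntegral_const, smul_eq_mul, mul_pow, Real.sq_sqrt h0, Cell.smean]
  field_simp

end IsMesh

end HeatDPG

end

noncomputable section

namespace HeatDPG

variable {d : ℕ} {T : ℝ} {Ω : Set (Sp d)} {𝒯 : Finset (Cell d)}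

/-! ### Uniqueness of weak derivatives -/

theorem ae_eq_of_forall_integral_mul_eq {S U : Set (TS d)} (hU : IsOpen U) (hUS : U ⊆ S)
    {f g : TS d → ℝ} (hf : MemLp f 2 (volume.restrict S)) (hg : MemLp g 2 (volume.restrict S))
    (H : ∀ φ : TS d → ℝ, ContDiff ℝ ∞ φ → HasCompactSupport φ → tsupport φ ⊆ U →
      ∫ z in S, f z * φ z = ∫ z in S, g z * φ z) : ∀ᵐ z ∂volume.restrict U, f z = g z := by
  have h1 : ∀ᵐ z, z ∈ U → f z - g z = 0 := by
    refine hU.ae_eq_zero_of_integral_contDiff_smul_eq_zero ?_ fun φ h1 h2 h3 => ?_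
    · have h2 : MemLp (f - g) 2 (volume.restrict U) :=
        (hf.sub hg).mono_measure (Measure.restrict_mono_set _ hUS)
      exact locallyIntegrableOn_of_locallyIntegrable_restrict (h2.locallyIntegrable (by norm_num))
    · have h1' : ContDiff ℝ ∞ φ := h1
      have c0 : MemLp φ 2 (volume.restrict S) := h1'.continuous.memLp_of_hasCompactSupport h2
      have h4 := H φ h1' h2 h3
      have e : ∫ z, φ z • (f z - g z) = ∫ z in S, (f z * φ z - g z * φ z) := by
        rw [setIntegral_eq_integral_of_forall_compl_eq_zero]
        · exact integral_congr_ae (ae_of_all _ fun z => by simp only [smul_eq_mul]; ring)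
        · intro z hz
          rw [image_eq_zero_of_notMem_tsupport fun h0 => hz (hUS (h3 h0))]
          ring
      have i1 : Integrable (fun z => f z * φ z) (volume.restrict S) := hf.integrable_mul c0
      have i2 : Integrable (fun z => g z * φ z) (volume.restrict S) := hg.integrable_mul c0
      rw [e, integral_sub i1 i2, h4, sub_self]
  filter_upwards [ae_restrict_of_ae h1, ae_restrict_mem hU.measurableSet] with z h1 h2
  exact sub_eq_zero.1 (h1 h2)

theorem integrable_smul_coord {S : Set (TS d)} {φ : TS d → ℝ} {g : TS d → Sp d}
    (hφ : ContDiff ℝ ∞ φ) (hc : HasCompactSupport φ) (hg : MemLp g 2 (volume.restrict S)) :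
    Integrable (fun z => φ z • g z) (volume.restrict S) :=
  memLp_one_iff_integrable.1
    (hg.smul (hφ.continuous.memLp_of_hasCompactSupport hc : MemLp φ 2 (volume.restrict S)))

theorem memLp_coord {α : Type*} [MeasurableSpace α] {μ : Measure α} {g : α → Sp d}
    (hg : MemLp g 2 μ) (i : Fin d) : MemLp (fun z => g z i) 2 μ :=
  (EuclideanSpace.proj (𝕜 := ℝ) i).comp_memLp' hg

/-- The broken adjoint vanishes where the field does. -/
theorem IsBrokenAstar.ae_eq_zero (h : IsMesh T Ω 𝒯) (hT : 0 < T) (hΩ : IsLipschitzDomain Ω)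
    {w a : L2Q T Ω} (H : IsBrokenAstar T Ω 𝒯 w a) (K : 𝒯)
    (hw : ∀ᵐ z ∂volume.restrict K.1.openCell, w z = 0) :
    ∀ᵐ z ∂volume.restrict K.1.openCell, a z = 0 := by
  have hS := h.openCell_subset hT hΩ K.2
  have hU := K.1.isOpen_openCell
  obtain ⟨h1, h2⟩ := H K.1 K.2
  have mw := Lp.memLp w
  have ma := Lp.memLp a
  have hw' : ∀ᵐ z ∂volume.restrict (cyl T Ω), z ∈ K.1.openCell → w z = 0 :=
    ae_restrict_of_ae ((ae_restrict_iff' hU.measurableSet).1 hw)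
  have e1 : ∀ᵐ z ∂volume.restrict K.1.openCell, -(a z).fst = 0 := by
    refine ae_eq_of_forall_integral_mul_eq hU hS (memLp_fst ma).neg MemLp.zero' fun φ a1 a2 a3 => ?_
    have h3 := h1 φ a1 a2 a3
    rw [integral_eq_zero_of_ae] at h3
    · simp only [zero_mul, integral_zero]
      exact neg_eq_zero.1 h3.symm
    · filter_upwards [hw'] with z hz
      by_cases hzU : z ∈ K.1.openCell
      · rw [hz hzU]; simp
      · obtain ⟨-, b1, b2⟩ := fderiv_eq_zero_of_notMem a3 hzU
        rw [b1, b2]; simp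
  have e2 : ∀ i, ∀ᵐ z ∂volume.restrict K.1.openCell, ((w z).snd - (a z).snd) i = 0 := fun i => by
    have mg : MemLp (fun z => (w z).snd - (a z).snd) 2 (volume.restrict (cyl T Ω)) :=
      (memLp_snd mw).sub (memLp_snd ma)
    refine ae_eq_of_forall_integral_mul_eq hU hS (memLp_coord mg i) MemLp.zero' fun φ a1 a2 a3 => ?_
    have h3 := h2 φ a1 a2 a3
    rw [integral_eq_zero_of_ae] at h3
    · have h4 := congrArg (fun v : Sp d => v i) (neg_eq_zero.1 h3.symm)
      simp only at h4
      rw [integral_coord (integrable_smul_coord a1 a2 mg)] at h4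
      simp only [zero_mul, integral_zero]
      refine Eq.trans (integral_congr_ae (ae_of_all _ fun z => ?_)) h4
      simp [mul_comm]
    · filter_upwards [hw'] with z hz
      by_cases hzU : z ∈ K.1.openCell
      · rw [hz hzU]; simp
      · rw [(fderiv_eq_zero_of_notMem a3 hzU).2.2]; simp
  filter_upwards [e1, ae_all_iff.2 e2, hw] with z z1 z2 z3
  refine WithLp.ofLp_injective 2 (Prod.ext (neg_eq_zero.1 z1) ?_)
  ext i
  have := z2 i
  rw [z3] at this
  simpa using this

theorem HA.isBrokenAstar (w : HA T Ω 𝒯) :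
    IsBrokenAstar T Ω 𝒯 (HA.field T Ω 𝒯 w) (HA.astar T Ω 𝒯 w) := w.2

/-! ### Locality and preserved means of the Fortin operator -/

namespace IsMesh

variable (h : IsMesh T Ω 𝒯) (hT : 0 < T) (hΩ : IsLipschitzDomain Ω) (C : Correction d)

/-- The Fortin operator is local. -/
theorem field_fortin_eq_zero {K : Cell d} (hK : K ∈ 𝒯) (w : HA T Ω 𝒯)
    (hw : ∀ᵐ z ∂volume.restrict (cyl T Ω), z ∈ K.carrier → HA.field T Ω 𝒯 w z = 0) :
    ∀ᵐ z ∂volume.restrict (cyl T Ω), z ∈ K.carrier → HA.field T Ω 𝒯 (h.fortin hT hΩ C w) z = 0 := by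
  have h1 : ∀ᵐ z ∂volume.restrict K.openCell, HA.field T Ω 𝒯 w z = 0 :=
    h.ae_openCell_of_imp hT hΩ ⟨K, hK⟩ (hw.mono fun z hz h0 => hz (K.openCell_subset h0))
  -- The weighted means also involve `A_h^* w`, so the vanishing of `w` on the cell must first be
  -- transferred to its weak derivatives.
  have h2 := IsBrokenAstar.ae_eq_zero h hT hΩ (HA.isBrokenAstar w) ⟨K, hK⟩ h1
  have h3 : h.means hT hΩ ⟨K, hK⟩ w = 0 := LinearMap.ext fun W => by
    refine (Cell.mean_congr (g := fun _ => 0) ?_).trans (Cell.mean_const 0)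
    filter_upwards [h1, h2] with z z1 z2
    simp [Cell.dens, z1, z2]
  -- The zero functional is the combination `(-1) • 0 + 0`, so linearity in the functional gives the
  -- claim.
  have h4 : K.poly C (K.coeffs 0) = 0 := by
    have := K.poly_coeffs_comb C (-1) 0 0
    simpa using this
  have h5 := h.field_fortin hT hΩ C ⟨K, hK⟩ w
  rw [h3, h4] at h5
  filter_upwards [h5, ae_restrict_of_ae K.openCell_ae_eq.mem_iff] with z h5 h6 hz
  exact h5 (h6.2 hz)

theorem integral_dens_eq_zero {K : Cell d} (hK : K ∈ 𝒯) {w : HA T Ω 𝒯} {W : Weight d}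
    (hW : h.means hT hΩ ⟨K, hK⟩ w W = 0) :
    ∫ z in K.openCell, Cell.dens W (HA.field T Ω 𝒯 w) (HA.astar T Ω 𝒯 w) z = 0 :=
  (mul_eq_zero.1 hW).resolve_left (inv_ne_zero K.volume_carrier_pos.ne')

/-- The Fortin operator preserves the means of the field. -/
theorem integral_inner_field_sub_fortin (hd : 1 ≤ d) {K : Cell d} (hK : K ∈ 𝒯) (w : HA T Ω 𝒯)
    (v : Val d) : ∫ z in K.carrier, ⟪v, HA.field T Ω 𝒯 (w - h.fortin hT hΩ C w) z⟫ = 0 := by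
  have hW : h.means hT hΩ ⟨K, hK⟩ (w - h.fortin hT hΩ C w) (v.fst • Cell.wE + Cell.wX v.snd) = 0 := by
    rw [map_add, map_smul, h.means_sub_fortin_eq_zero hT hΩ C ⟨K, hK⟩ w fun μ =>
        K.pmean_coeffs_wE C μ hd, h.means_sub_fortin_eq_zero hT hΩ C ⟨K, hK⟩ w fun μ =>
        K.pmean_coeffs_wX C μ hd _, smul_zero, add_zero]
  rw [← setIntegral_congr_set K.openCell_ae_eq]
  refine Eq.trans (integral_congr_ae (ae_of_all _ fun z => ?_)) (h.integral_dens_eq_zero hT hΩ hK hW)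
  simp [Cell.dens, Cell.wE, Cell.wX, WithLp.prod_inner_apply, mul_comm]

end IsMesh

/-! ### The Fortin operator -/

/-- The product of two linear maps as a linear map between Euclidean products. -/
def prodMapL2 {E F : Type*} [NormedAddCommGroup E] [NormedSpace ℝ E] [NormedAddCommGroup F]
    [NormedSpace ℝ F] (A : E →ₗ[ℝ] E) (B : F →ₗ[ℝ] F) : WithLp 2 (E × F) →ₗ[ℝ] WithLp 2 (E × F) :=
  linearOfComb (fun y => WithLp.toLp 2 (A y.fst, B y.snd)) fun c x y => by
    refine WithLp.ofLp_injective 2 (Prod.ext ?_ ?_) <;> simp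

theorem norm_prodMapL2_le {E F : Type*} [NormedAddCommGroup E] [NormedSpace ℝ E]
    [NormedAddCommGroup F] [NormedSpace ℝ F] {A : E →ₗ[ℝ] E} {B : F →ₗ[ℝ] F} {c : ℝ} (hc : 0 ≤ c)
    (hA : ∀ x, ‖A x‖ ≤ c * ‖x‖) (hB : ∀ x, ‖B x‖ ≤ c * ‖x‖) (y : WithLp 2 (E × F)) :
    ‖prodMapL2 A B y‖ ≤ c * ‖y‖ := by
  refine abs_le_of_sq_le_sq' ?_ (by positivity) |>.2
  rw [mul_pow, WithLp.prod_norm_sq_eq_of_L2, WithLp.prod_norm_sq_eq_of_L2]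
  have h1 := pow_le_pow_left₀ (norm_nonneg _) (hA y.fst) 2
  have h2 := pow_le_pow_left₀ (norm_nonneg _) (hB y.snd) 2
  rw [mul_pow] at h1 h2
  rw [mul_add]
  exact add_le_add h1 h2

end HeatDPG

end

noncomputable section

namespace HeatDPG

variable {d : ℕ} {T : ℝ} {Ω : Set (Sp d)} {𝒯 : Finset (Cell d)}

/-! ### Orthogonality: broken test functions with vanishing means -/

/-- All means that the Fortin operator preserves vanish. -/
structure IsMesh.HasZeroMeans (h : IsMesh T Ω 𝒯) (hT : 0 < T) (hΩ : IsLipschitzDomain Ω)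
    (u : HA T Ω 𝒯) : Prop where
  wE : ∀ K, h.means hT hΩ K u Cell.wE = 0
  wX : ∀ K v, h.means hT hΩ K u (Cell.wX v) = 0
  wD : ∀ (K : 𝒯) i, h.means hT hΩ K u (K.1.wD i) = 0
  wT : ∀ (K : 𝒯) i, h.means hT hΩ K u (K.1.wT i) = 0
  wG : ∀ (K : 𝒯) i, h.means hT hΩ K u (K.1.wG i) = 0

theorem IsMesh.hasZeroMeans_sub_fortin (h : IsMesh T Ω 𝒯) (hT : 0 < T) (hΩ : IsLipschitzDomain Ω)
    (hd : 1 ≤ d) (C : Correction d) (w : HA T Ω 𝒯) :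
    h.HasZeroMeans hT hΩ (w - h.fortin hT hΩ C w) where
  wE K := h.means_sub_fortin_eq_zero hT hΩ C K w fun μ => K.1.pmean_coeffs_wE C μ hd
  wX K v := h.means_sub_fortin_eq_zero hT hΩ C K w fun μ => K.1.pmean_coeffs_wX C μ hd v
  wD K i := h.means_sub_fortin_eq_zero hT hΩ C K w fun μ => K.1.pmean_coeffs_wD C μ hd i
  wT K i := h.means_sub_fortin_eq_zero hT hΩ C K w fun μ => K.1.pmean_coeffs_wT C μ hd i
  wG K i := h.means_sub_fortin_eq_zero hT hΩ C K w fun μ => K.1.pmean_coeffs_wG C μ hd i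

theorem integrable_inner_L2Q (f w : L2Q T Ω) : IntegrableOn (fun z => ⟪f z, w z⟫) (cyl T Ω) :=
  L2.integrable_inner (𝕜 := ℝ) f w

theorem IsMesh.inner_sub_inner_eq_zero (h : IsMesh T Ω 𝒯) (hT : 0 < T) (hΩ : IsLipschitzDomain Ω)
    {f w v a : L2Q T Ω} (H : ∀ K ∈ 𝒯, ∫ z in K.openCell, (⟪f z, w z⟫ - ⟪v z, a z⟫) = 0) :
    ⟪f, w⟫ - ⟪v, a⟫ = (0 : ℝ) := by
  have i1 := integrable_inner_L2Q f w
  have i2 := integrable_inner_L2Q v a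
  have i3 : IntegrableOn (fun z => ⟪f z, w z⟫ - ⟪v z, a z⟫) (cyl T Ω) := i1.sub i2
  rw [L2.inner_def, L2.inner_def, ← integral_sub i1 i2, h.integral_cyl hT hΩ i3]
  exact Finset.sum_eq_zero H

theorem IsMesh.inner_eq_zero (h : IsMesh T Ω 𝒯) (hT : 0 < T) (hΩ : IsLipschitzDomain Ω)
    {f w : L2Q T Ω} (H : ∀ K ∈ 𝒯, ∫ z in K.openCell, ⟪f z, w z⟫ = 0) : ⟪f, w⟫ = (0 : ℝ) := by
  rw [L2.inner_def, h.integral_cyl hT hΩ (integrable_inner_L2Q f w)]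
  exact Finset.sum_eq_zero H

namespace Cell

variable (K : Cell d)

/-- The weight of a constant direction for the mean of `∇_x e`. -/
def wGrad (v : Sp d) : Weight d := (0, 0, 0, ContinuousMap.const _ v)

/-- The identities `∑ ∇λ_j = 0` and `∑ (∇λ_j · v) p_j = v` write the constant field `v` as a
combination of the `x - p_j`. The facet conditions therefore already control the mean of `∇_x e`. -/
theorem wGrad_eq (v : Sp d) : wGrad v = -∑ j, ⟪K.grad j, v⟫ • K.wG j := by
  have e : ∀ x : Sp d, ∑ j, ⟪K.grad j, v⟫ • (x - K.vert j) = -v := fun x => by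
    have h1 : ∑ j, ⟪K.grad j, v⟫ = 0 := by rw [← sum_inner, sum_grad, inner_zero_left]
    have h2 := K.sum_lam_smul_sub (x + v) x
    have h3 := K.sum_lam_smul_sub x x
    simp only [lam_add, add_smul, Finset.sum_add_distrib] at h2
    rw [h3, sub_self, zero_add, add_sub_cancel_left] at h2
    conv_rhs => rw [← h2, ← Finset.sum_neg_distrib]
    exact Finset.sum_congr rfl fun j _ => by rw [← smul_neg, neg_sub]
  refine Prod.ext ?_ (Prod.ext ?_ (Prod.ext ?_ ?_))
  · ext z; simp [wGrad, wG, Prod.fst_sum]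
  · ext z; simp [wGrad, wG, Prod.fst_sum, Prod.snd_sum]
  · ext z; simp [wGrad, wG, Prod.fst_sum, Prod.snd_sum]
  · refine ContinuousMap.ext fun z => ?_
    have := e z.2
    simp only [wGrad, wG, Prod.snd_sum, Prod.snd_neg, Prod.smul_snd, ContinuousMap.neg_apply,
      ContinuousMap.sum_apply, ContinuousMap.smul_apply, ContinuousMap.coe_mk,
      ContinuousMap.const_apply]
    rw [this, neg_neg]

/-- A piecewise affine function in the space of tensor products of order one. -/
def bilin (α β : Fin (d + 1) → ℝ) (z : TS d) : ℝ := ∑ i, (α i + β i * K.tc z.1) * K.lam i z.2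

theorem contDiff_bilin (α β : Fin (d + 1) → ℝ) : ContDiff ℝ ∞ (K.bilin α β) := by
  have c1 := K.contDiff_tc
  have c2 := K.contDiff_lam_snd
  unfold bilin
  fun_prop

theorem hasGradAt_bilin (α β : Fin (d + 1) → ℝ) (z : TS d) : HasGradAt (K.bilin α β)
    (∑ i, β i * K.lam i z.2) (∑ i, (α i + β i * K.tc z.1) • K.grad i) z := by
  have h := HasGradAt.sum Finset.univ fun i _ =>
    ((HasGradAt.const (α i)).add ((HasGradAt.tc K z).const_mul (β i))).mul (HasGradAt.lam K i z)
  refine HasGradAt.congr h ?_ ?_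
  · simp [mul_comm]
  · simp

/-- The weight of the trace of a piecewise affine function. -/
def wBilin (α β : Fin (d + 1) → ℝ) : Weight d :=
  ∑ i, (β i • K.wT i + α i • (wX (K.grad i) + K.wD i))

/-- The right side is the density of the trace functional of `(v, 0)` with `v = bilin α β`: a basis
function `t λ_i` contributes `wT i`, and `λ_i` contributes `wX (∇λ_i) + wD i`. -/
theorem dens_wBilin (α β : Fin (d + 1) → ℝ) (w a : TS d → Val d) (z : TS d) :
    dens (K.wBilin α β) w a z = dt (K.bilin α β) z * (w z).fst +
      ⟪gradX (K.bilin α β) z, (w z).snd⟫ - K.bilin α β z * (a z).fst := by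
  rw [(K.hasGradAt_bilin α β z).dt_eq, (K.hasGradAt_bilin α β z).gradX_eq, sum_inner, dens, bilin]
  simp only [wBilin, wT, wX, wD, Prod.fst_sum, Prod.snd_sum, Prod.fst_add, Prod.snd_add,
    Prod.smul_fst, Prod.smul_snd, ContinuousMap.sum_apply, ContinuousMap.add_apply,
    ContinuousMap.smul_apply, ContinuousMap.coe_mk, ContinuousMap.const_apply,
    ContinuousMap.zero_apply, sum_inner, inner_add_left, real_inner_smul_left, smul_eq_mul,
    Finset.sum_mul, smul_zero, add_zero, zero_add, Finset.sum_const_zero, inner_zero_left]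
  rw [← Finset.sum_add_distrib, ← Finset.sum_add_distrib, ← Finset.sum_sub_distrib,
    ← Finset.sum_sub_distrib]
  exact Finset.sum_congr rfl fun i _ => by ring

theorem dens_wBilin_eq_inner {α β : Fin (d + 1) → ℝ} {w a v f : TS d → Val d} {z : TS d}
    (h1 : (v z).fst = K.bilin α β z) (h2 : (f z).fst = dt (K.bilin α β) z)
    (h3 : (f z).snd = gradX (K.bilin α β) z) (h4 : (v z).snd = 0) :
    dens (K.wBilin α β) w a z = ⟪f z, w z⟫ - ⟪v z, a z⟫ := by
  rw [K.dens_wBilin, WithLp.prod_inner_apply, WithLp.prod_inner_apply]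
  simp [h1, h2, h3, h4, mul_comm]

end Cell

/-! ### Piecewise constant fields -/

theorem ae_fst_eq_and_snd_eq {k : ℕ} (h : IsMesh T Ω 𝒯) (hT : 0 < T) (hΩ : IsLipschitzDomain Ω)
    {v : TS d → ℝ} (hv : IsPwTensor T Ω 𝒯 k v) {K : Cell d} (hK : K ∈ 𝒯) :
    ∃ f ∈ tensorSpace d k, ∀ᵐ z ∂volume.restrict K.openCell, v z = f z := by
  obtain ⟨f, hf, e⟩ := hv K hK
  exact ⟨f, hf, h.ae_openCell_of_imp hT hΩ ⟨K, hK⟩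
    (e.mono fun z hz h0 => hz (K.openCell_subset h0))⟩

theorem exists_ae_eq_const_of_mem_X0h (h : IsMesh T Ω 𝒯) (hT : 0 < T) (hΩ : IsLipschitzDomain Ω)
    {v : L2Q T Ω} (hv : v ∈ X0h T Ω 𝒯) {K : Cell d} (hK : K ∈ 𝒯) :
    ∃ c : Val d, ∀ᵐ z ∂volume.restrict K.openCell, v z = c := by
  have h1 : ∀ {u : TS d → ℝ}, IsPwTensor T Ω 𝒯 0 u →
      ∃ c, ∀ᵐ z ∂volume.restrict K.openCell, u z = c := fun hu => by
    obtain ⟨f, hf, e1⟩ := ae_fst_eq_and_snd_eq h hT hΩ hu hK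
    obtain ⟨c, hc⟩ := exists_const_of_mem_tensorSpace hf
    exact ⟨c, e1.mono fun z hz => hz.trans (hc z)⟩
  obtain ⟨c, hc⟩ := h1 hv.1
  choose b hb using fun i => h1 (hv.2 i)
  refine ⟨WithLp.toLp 2 (c, WithLp.toLp 2 b), ?_⟩
  filter_upwards [hc, ae_all_iff.2 hb] with z z1 z2
  refine WithLp.ofLp_injective 2 (Prod.ext z1 ?_)
  ext i
  exact z2 i

namespace Cell

variable (K : Cell d)

/-- The weight of the mean of the product of `A^* 𝐰` with a constant. -/
def wConst (c : Val d) : Weight d := wX c.snd - c.fst • (∑ i, K.wD i) - wGrad c.snd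

theorem dens_wConst (c : Val d) (w a : TS d → Val d) (z : TS d) :
    dens (K.wConst c) w a z = ⟪c, a z⟫ := by
  rw [wConst, K.sum_wD, WithLp.prod_inner_apply]
  simp [dens, wX, wGrad, wOne, inner_sub_right, mul_comm]
  ring

theorem map_wConst {μ : Weight d →ₗ[ℝ] ℝ} (hX : ∀ v, μ (wX v) = 0) (hD : ∀ i, μ (K.wD i) = 0)
    (hG : ∀ i, μ (K.wG i) = 0) (c : Val d) : μ (K.wConst c) = 0 := by
  simp only [wConst, K.wGrad_eq, map_sub, map_neg, map_sum, map_smul, hX, hD, hG, smul_zero,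
    Finset.sum_const_zero, sub_zero, neg_zero]

theorem map_wBilin {μ : Weight d →ₗ[ℝ] ℝ} (hX : ∀ v, μ (wX v) = 0) (hD : ∀ i, μ (K.wD i) = 0)
    (hT : ∀ i, μ (K.wT i) = 0) (α β : Fin (d + 1) → ℝ) : μ (K.wBilin α β) = 0 := by
  simp only [wBilin, map_add, map_sum, map_smul, hX, hD, hT, smul_zero, add_zero,
    Finset.sum_const_zero]

end Cell

theorem IsMesh.inner_X0h_astar_eq_zero (h : IsMesh T Ω 𝒯) (hT : 0 < T) (hΩ : IsLipschitzDomain Ω)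
    {u : HA T Ω 𝒯} (hu : h.HasZeroMeans hT hΩ u) {v : L2Q T Ω} (hv : v ∈ X0h T Ω 𝒯) :
    ⟪v, HA.astar T Ω 𝒯 u⟫ = (0 : ℝ) := by
  refine h.inner_eq_zero hT hΩ fun K hK => ?_
  obtain ⟨c, hc⟩ := exists_ae_eq_const_of_mem_X0h h hT hΩ hv hK
  refine Eq.trans (integral_congr_ae ?_) (h.integral_dens_eq_zero hT hΩ hK
    (K.map_wConst (hu.wX ⟨K, hK⟩) (hu.wD ⟨K, hK⟩) (hu.wG ⟨K, hK⟩) c))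
  filter_upwards [hc] with z hz
  exact (congrArg (fun v => ⟪v, _⟫) hz).trans (K.dens_wConst c _ _ z).symm

/-! ### Traces of piecewise affine functions -/

theorem isCompact_Icc_prod_closure (hΩ : IsLipschitzDomain Ω) : IsCompact (Icc 0 T ×ˢ closure Ω) :=
  isCompact_Icc.prod hΩ.isBounded.isCompact_closure

theorem _root_.Continuous.memLp_cyl {E : Type*} [NormedAddCommGroup E] [SecondCountableTopology E]
    (hΩ : IsLipschitzDomain Ω) {f : TS d → E} (hf : Continuous f) :
    MemLp f 2 (volume.restrict (cyl T Ω)) :=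
  hf.memLp_restrict (isCompact_Icc_prod_closure hΩ) (prod_mono Ioo_subset_Icc_self subset_closure)

theorem divX_smul_single {ψ : TS d → ℝ} (hψ : ContDiff ℝ ∞ ψ) (i : Fin d) (z : TS d) :
    divX (fun z => ψ z • EuclideanSpace.single i (1 : ℝ)) z =
      fderiv ℝ ψ z (0, EuclideanSpace.single i 1) := by
  have h1 : HasFDerivAt (fun z => ψ z • EuclideanSpace.single i (1 : ℝ)) _ z :=
    (hψ.differentiable (by simp) z).hasFDerivAt.smul_const _
  rw [divX, h1.fderiv]
  simp

/-- Where `v` agrees with a smooth function, its weak derivatives are classical by uniqueness. The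
lateral boundary formulation is tested with `ψ` times a unit vector for `ψ` with compact support in
`U`. -/
theorem IsU0.ae_eq_dt_and_gradX (hΩ : IsLipschitzDomain Ω) {v f : L2Q T Ω}
    (H : IsU0 T Ω v f) (h0 : ∀ᵐ z ∂volume.restrict (cyl T Ω), (v z).snd = 0) {U : Set (TS d)}
    (hU : IsOpen U) (hS : U ⊆ cyl T Ω) {φ : TS d → ℝ} (hφ : ContDiff ℝ ∞ φ)
    (hv : ∀ᵐ z ∂volume.restrict (cyl T Ω), z ∈ U → (v z).fst = φ z) :
    ∀ᵐ z ∂volume.restrict U, (f z).fst = dt φ z ∧ (f z).snd = gradX φ z := by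
  have mf := Lp.memLp f
  have e1 : ∀ᵐ z ∂volume.restrict U, (f z).fst = dt φ z := by
    refine ae_eq_of_forall_integral_mul_eq hU hS (memLp_fst mf) ((continuous_dt hφ).memLp_cyl hΩ)
      fun ψ a1 a2 a3 => ?_
    have h1 := H.1 ψ a1 a2 (a3.trans hS)
    have h2 := integral_mul_fderiv_eq hS hφ a1 a2 a3 (1, 0)
    refine neg_injective (h1.symm.trans (Eq.trans (integral_congr_ae ?_) h2))
    filter_upwards [h0, hv] with z z1 z2
    by_cases hz : z ∈ U
    · rw [z1, z2 hz, inner_zero_left, add_zero]; rfl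
    · obtain ⟨-, b1, b2⟩ := fderiv_eq_zero_of_notMem a3 hz
      rw [b1, b2, inner_zero_right, mul_zero, add_zero]
      change 0 = φ z * dt ψ z
      rw [b1, mul_zero]
  have e2 : ∀ i, ∀ᵐ z ∂volume.restrict U, (f z).snd i = gradX φ z i := fun i => by
    refine ae_eq_of_forall_integral_mul_eq hU hS (memLp_coord (memLp_snd mf) i)
      (memLp_coord ((continuous_gradX hφ).memLp_cyl hΩ) i) fun ψ a1 a2 a3 => ?_
    have h1 := H.2 (fun z => ψ z • EuclideanSpace.single i (1 : ℝ)) (a1.smul contDiff_const)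
    have h2 := integral_mul_fderiv_eq hS hφ a1 a2 a3 (0, EuclideanSpace.single i 1)
    have h3 : ∫ z in cyl T Ω, (v z).fst * divX (fun z => ψ z • EuclideanSpace.single i (1 : ℝ)) z =
        ∫ z in cyl T Ω, φ z * fderiv ℝ ψ z (0, EuclideanSpace.single i 1) := by
      refine integral_congr_ae ?_
      filter_upwards [hv] with z z2
      rw [divX_smul_single a1]
      by_cases hz : z ∈ U
      · rw [z2 hz]
      · have b : fderiv ℝ ψ z (0, EuclideanSpace.single i 1) = 0 :=
          congrArg (fun v : Sp d => v i) (fderiv_eq_zero_of_notMem a3 hz).2.2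
        rw [b, mul_zero, mul_zero]
    rw [h3, h2, neg_neg] at h1
    refine Eq.trans (integral_congr_ae ?_) h1
    filter_upwards [h0] with z z1
    rw [z1, sub_zero, real_inner_smul_right, EuclideanSpace.inner_single_right]
    simp [mul_comm]
  filter_upwards [e1, ae_all_iff.2 e2] with z z1 z2
  exact ⟨z1, by ext i; exact z2 i⟩

theorem IsMesh.inner_trace_eq_zero_of_isPwTensor (h : IsMesh T Ω 𝒯) (hT : 0 < T)
    (hΩ : IsLipschitzDomain Ω) {u : HA T Ω 𝒯} (hu : h.HasZeroMeans hT hΩ u) {v f : L2Q T Ω}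
    (H : IsU0 T Ω v f) (h0 : ∀ᵐ z ∂volume.restrict (cyl T Ω), (v z).snd = 0)
    (hv : IsPwTensor T Ω 𝒯 1 fun z => (v z).fst) :
    ⟪f, HA.field T Ω 𝒯 u⟫ - ⟪v, HA.astar T Ω 𝒯 u⟫ = (0 : ℝ) := by
  refine h.inner_sub_inner_eq_zero hT hΩ fun K hK => ?_
  have hS := h.openCell_subset hT hΩ hK
  obtain ⟨φ, hφ, e1⟩ := hv K hK
  obtain ⟨α, β, hαβ⟩ := K.exists_lam_of_mem_tensorSpace hφ
  obtain rfl : φ = K.bilin α β := funext hαβ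
  have e1' := e1.mono fun z hz (h0 : z ∈ K.openCell) => hz (K.openCell_subset h0)
  have e2 := H.ae_eq_dt_and_gradX hΩ h0 K.isOpen_openCell hS (K.contDiff_bilin α β) e1'
  refine Eq.trans (integral_congr_ae ?_)
    (h.integral_dens_eq_zero hT hΩ hK
    (K.map_wBilin (hu.wX ⟨K, hK⟩) (hu.wD ⟨K, hK⟩) (hu.wT ⟨K, hK⟩) α β))
  filter_upwards [h.ae_openCell_of_imp hT hΩ ⟨K, hK⟩ e1', e2, Cell.ae_openCell hS h0]
    with z z1 z2 z3
  exact (K.dens_wBilin_eq_inner z1 z2.1 z2.2 z3).symm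

end HeatDPG

end

noncomputable section

namespace HeatDPG

variable {d : ℕ} {T : ℝ} {Ω : Set (Sp d)} {𝒯 : Finset (Cell d)}

/-! ### Traces with constant normal components -/

theorem finite_allFacets (𝒯 : Finset (Cell d)) : (allFacets 𝒯).Finite := by
  have e : allFacets 𝒯 = ⋃ K ∈ 𝒯, K.facets := by
    ext f
    simp [allFacets]
  rw [e]
  exact 𝒯.finite_toSet.biUnion fun K _ => (finite_range _).union (toFinite _)

/-- Among the finitely many facets a maximal one containing the given facet is coarse. It contains
points at the two distinct times `a` and `b`, so it cannot be a facet at constant time. -/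
theorem exists_coarseLateral (hd : 1 ≤ d) {K : Cell d} (hK : K ∈ 𝒯) (i : Fin (d + 1)) :
    ∃ f ∈ coarseLateral 𝒯, K.lateralFacet i ⊆ f := by
  obtain ⟨g, hg, hm⟩ := (finite_allFacets 𝒯).exists_le_maximal
    (show K.lateralFacet i ∈ allFacets 𝒯 from ⟨K, hK, Or.inl ⟨i, rfl⟩⟩)
  refine ⟨g, ⟨?_, fun f hf hgf => hgf.antisymm (hm.2 hf hgf)⟩, hg⟩
  obtain ⟨K', hK', hf⟩ := hm.1
  refine ⟨K', hK', hf.resolve_right fun h0 => ?_⟩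
  have : Nontrivial (Fin (d + 1)) := Fin.nontrivial_iff_two_le.2 (by omega)
  obtain ⟨j, hj⟩ := exists_ne i
  have hp : K.simplex.points j ∈ K.spaceFacet i :=
    subset_convexHull ℝ _ ⟨j, hj, rfl⟩
  have h1 : (K.a, K.simplex.points j) ∈ g := hg ⟨left_mem_Icc.2 K.hab.le, hp⟩
  have h2 : (K.b, K.simplex.points j) ∈ g := hg ⟨right_mem_Icc.2 K.hab.le, hp⟩
  have hab := K.hab
  rcases h0 with rfl | rfl
  · exact hab.ne (h1.1.trans h2.1.symm)
  · exact hab.ne (h1.1.trans h2.1.symm)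

theorem Cell.integral_lateral_eq (K : Cell d) {i : Fin (d + 1)} {κ : ℝ}
    (hκ : ∀ φ : Sp d → ℝ, ContDiff ℝ 1 φ → ∫ x in K.spaceFacet i, φ x ∂μHE[d - 1] =
        κ * ∫ x in K.space, ((d : ℝ) * φ x + fderiv ℝ φ x (x - K.vert i))) {φ : TS d → ℝ}
    (hφ : ContDiff ℝ ∞ φ) :
    ∫ t in K.a..K.b, ∫ x in K.spaceFacet i, φ (t, x) ∂μHE[d - 1] =
      κ * ∫ z in K.carrier, (d * φ z + ⟪z.2 - K.vert i, gradX φ z⟫) := by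
  have h1 : ∀ t, ∫ x in K.spaceFacet i, φ (t, x) ∂μHE[d - 1] =
      κ * ∫ x in K.space, (d * φ (t, x) + ⟪x - K.vert i, gradX φ (t, x)⟫) := fun t => by
    rw [hκ (fun x => φ (t, x)) ((hφ.comp (contDiff_const.prodMk contDiff_id)).of_le (by simp))]
    simp only [fderiv_section hφ, inner_gradX]
  have cg := continuous_gradX hφ
  have cφ := hφ.continuous
  simp only [h1]
  rw [intervalIntegral.integral_const_mul, intervalIntegral.integral_of_le K.hab.le,
    ← integral_Icc_eq_integral_Ioc, carrier, Measure.volume_eq_prod, setIntegral_prod]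
  rw [← Measure.volume_eq_prod]
  exact Continuous.integrableOn_of_isCompact (by fun_prop) K.isCompact_carrier

/-- Constant normal traces are those of a combination of the fields `x - p_i`. -/
theorem HasConstNormalTraces.exists_coeffs (hd : 1 ≤ d) {τ : TS d → Sp d} {q : TS d → ℝ}
    (H : HasConstNormalTraces 𝒯 τ q) {K : Cell d} (hK : K ∈ 𝒯) :
    ∃ c : Fin (d + 1) → ℝ, ∀ φ : TS d → ℝ, ContDiff ℝ ∞ φ →
      ∫ z in K.carrier, (q z * φ z + ⟪τ z, gradX φ z⟫) =
        ∑ i, c i * ∫ z in K.carrier, (d * φ z + ⟪z.2 - K.vert i, gradX φ z⟫) := by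
  obtain ⟨P, hP⟩ := H
  choose f hf using fun i => exists_coarseLateral hd hK i
  choose ν hν using K.exists_isOuterNormal hd
  choose κ _ hκ using K.exists_integral_facet_eq hd
  -- Only the fact that the normal trace is constant on each lateral facet of this one cell
  -- survives; how the constants match across cells plays no role.
  refine ⟨fun i => ⟪P (f i), ν i⟫ * κ i, fun φ hφ => ?_⟩
  rw [hP K hK f ν (fun i => ⟨(hf i).1, (hf i).2, hν i⟩) φ hφ]
  exact Finset.sum_congr rfl fun i _ => by rw [K.integral_lateral_eq (hκ i) hφ, mul_assoc]

namespace Cell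

variable (K : Cell d)

/-- The weight of a trace with constant normal components. -/
def wNormal (c : Fin (d + 1) → ℝ) : Weight d := ∑ i, c i • ((d : ℝ) • wE + K.wG i)

theorem dens_wNormal (c : Fin (d + 1) → ℝ) (w a : TS d → Val d) (z : TS d) :
    dens (K.wNormal c) w a z = (∑ i, c i * d) * (w z).fst +
      ⟪∑ i, c i • (z.2 - K.vert i), (w z).snd - (a z).snd⟫ := by
  simp [dens, wNormal, wE, wG, Prod.fst_sum, Prod.snd_sum]

theorem map_wNormal {μ : Weight d →ₗ[ℝ] ℝ} (hE : μ wE = 0) (hG : ∀ i, μ (K.wG i) = 0)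
    (c : Fin (d + 1) → ℝ) : μ (K.wNormal c) = 0 := by
  simp only [wNormal, map_add, map_sum, map_smul, hE, hG, smul_zero, add_zero,
    Finset.sum_const_zero]

/-- The difference of `τ` and `∑ c_i (x - p_i)` annihilates all functions smooth up to the boundary,
that is, it has no normal trace. By density it annihilates the first component of `w` as well, which
avoids traces of `w` on facets. -/
theorem integral_normal_eq {S : Set (TS d)} (hS : K.openCell ⊆ S) {q : TS d → ℝ} {τ : TS d → Sp d}
    (hq : MemLp q 2 (volume.restrict K.openCell)) (hτ : MemLp τ 2 (volume.restrict K.openCell))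
    {c : Fin (d + 1) → ℝ} (H : ∀ φ : TS d → ℝ, ContDiff ℝ ∞ φ →
      ∫ z in K.carrier, (q z * φ z + ⟪τ z, gradX φ z⟫) =
        ∑ i, c i * ∫ z in K.carrier, (d * φ z + ⟪z.2 - K.vert i, gradX φ z⟫))
    {w a : TS d → Val d} (hw : MemLp w 2 (volume.restrict K.openCell))
    (ha : MemLp a 2 (volume.restrict K.openCell))
    (hwa : HasWeakGradX S K.openCell (fun z => (w z).fst) fun z => (w z).snd - (a z).snd) :
    ∫ z in K.openCell, (q z * (w z).fst + ⟪τ z, (w z).snd - (a z).snd⟫) =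
      ∫ z in K.openCell, dens (K.wNormal c) w a z := by
  have m1 : MemLp (fun _ : TS d => ∑ i, c i * (d : ℝ)) 2 (volume.restrict K.openCell) :=
    continuous_const.memLp_restrict K.isCompact_carrier K.openCell_subset
  have m2 : MemLp (fun z : TS d => ∑ i, c i • (z.2 - K.vert i)) 2 (volume.restrict K.openCell) :=
    Continuous.memLp_restrict (by fun_prop) K.isCompact_carrier K.openCell_subset
  have key : ∀ {e : TS d → ℝ} {g : TS d → Sp d}, MemLp e 2 (volume.restrict K.openCell) →
      MemLp g 2 (volume.restrict K.openCell) →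
      ∫ z in K.openCell, ((q z - ∑ i, c i * (d : ℝ)) * e z +
        ⟪τ z - ∑ i, c i • (z.2 - K.vert i), g z⟫) =
      (∫ z in K.openCell, (q z * e z + ⟪τ z, g z⟫)) -
        ∫ z in K.openCell, ((∑ i, c i * (d : ℝ)) * e z + ⟪∑ i, c i • (z.2 - K.vert i), g z⟫) := by
    intro e g he hg
    have i1 : IntegrableOn (fun z => q z * e z + ⟪τ z, g z⟫) K.openCell :=
      (hq.integrable_mul he).add (integrable_inner_of_memLp hτ hg)
    have i2 : IntegrableOn (fun z => (∑ i, c i * (d : ℝ)) * e z +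
        ⟪∑ i, c i • (z.2 - K.vert i), g z⟫) K.openCell :=
      (m1.integrable_mul he).add (integrable_inner_of_memLp m2 hg)
    rw [← integral_sub i1 i2]
    refine integral_congr_ae (ae_of_all _ fun z => ?_)
    simp only [inner_sub_left]
    ring
  have mg := (memLp_snd hw).sub (memLp_snd ha)
  have h0 := K.integral_eq_zero_of_contDiff hS (memLp_fst hw) mg hwa
    (q := fun z => q z - ∑ i, c i * (d : ℝ)) (τ := fun z => τ z - ∑ i, c i • (z.2 - K.vert i))
    (hq.sub m1) (hτ.sub m2) fun φ hφ => ?_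
  · have h1 := (key (memLp_fst hw) mg).symm.trans h0
    refine (sub_eq_zero.1 h1).trans (integral_congr_ae (ae_of_all _ fun z => ?_))
    exact (K.dens_wNormal c w a z).symm
  · have cφ := hφ.continuous
    have cg := continuous_gradX hφ
    rw [key (cφ.memLp_restrict K.isCompact_carrier K.openCell_subset)
      (cg.memLp_restrict K.isCompact_carrier K.openCell_subset),
      setIntegral_congr_set K.openCell_ae_eq, setIntegral_congr_set K.openCell_ae_eq, H φ hφ,
      sub_eq_zero]
    simp only [← integral_const_mul]
    rw [← integral_finsetSum _ fun i _ => ?_]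
    · refine integral_congr_ae (ae_of_all _ fun z => ?_)
      simp only [sum_inner, Finset.sum_mul, real_inner_smul_left, ← Finset.sum_add_distrib]
      exact Finset.sum_congr rfl fun i _ => by ring
    · exact Continuous.integrableOn_of_isCompact (by fun_prop) K.isCompact_carrier

end Cell

/-- For `v = 0` the weak gradient vanishes, so the second component of `A (0, τ)` is `τ`. -/
theorem IsU0.snd_eq_snd (hΩ : IsLipschitzDomain Ω) {v f : L2Q T Ω} (H : IsU0 T Ω v f)
    (h0 : ∀ᵐ z ∂volume.restrict (cyl T Ω), (v z).fst = 0) :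
    ∀ᵐ z ∂volume.restrict (cyl T Ω), (f z).snd = (v z).snd := by
  have mf := Lp.memLp f
  have mv := Lp.memLp v
  have e : ∀ i, ∀ᵐ z ∂volume.restrict (cyl T Ω), (f z).snd i = (v z).snd i := fun i => by
    have m1 := memLp_coord (memLp_snd mf) i
    have m2 := memLp_coord (memLp_snd mv) i
    refine ae_eq_of_forall_integral_mul_eq (isOpen_cyl hΩ) subset_rfl m1 m2 fun ψ a1 a2 a3 => ?_
    have h1 := H.2 (fun z => ψ z • EuclideanSpace.single i (1 : ℝ)) (a1.smul contDiff_const)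
    have c0 : MemLp ψ 2 (volume.restrict (cyl T Ω)) := a1.continuous.memLp_of_hasCompactSupport a2
    have i1 : Integrable (fun z => (f z).snd i * ψ z) (volume.restrict (cyl T Ω)) :=
      m1.integrable_mul c0
    have i2 : Integrable (fun z => (v z).snd i * ψ z) (volume.restrict (cyl T Ω)) :=
      m2.integrable_mul c0
    rw [integral_eq_zero_of_ae (f := fun z => (v z).fst * _)
      (by filter_upwards [h0] with z hz; rw [hz, zero_mul]; rfl), neg_zero] at h1
    rw [← sub_eq_zero, ← integral_sub i1 i2]
    refine Eq.trans (integral_congr_ae (ae_of_all _ fun z => ?_)) h1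
    simp only [real_inner_smul_right, EuclideanSpace.inner_single_right]
    simp
    ring
  filter_upwards [ae_all_iff.2 e] with z hz
  ext i
  exact hz i

theorem inner_sub_inner_val {f v w a : Val d} (h1 : f.snd = v.snd) (h2 : v.fst = 0) :
    ⟪f, w⟫ - ⟪v, a⟫ = f.fst * w.fst + ⟪v.snd, w.snd - a.snd⟫ := by
  rw [WithLp.prod_inner_apply, WithLp.prod_inner_apply, inner_sub_right]
  simp [h1, h2, mul_comm]
  ring

theorem IsMesh.inner_trace_eq_zero_of_hasConstNormalTraces (h : IsMesh T Ω 𝒯) (hT : 0 < T)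
    (hΩ : IsLipschitzDomain Ω) (hd : 1 ≤ d) {u : HA T Ω 𝒯} (hu : h.HasZeroMeans hT hΩ u)
    {v f : L2Q T Ω} (H : IsU0 T Ω v f) (h0 : ∀ᵐ z ∂volume.restrict (cyl T Ω), (v z).fst = 0)
    (hv : HasConstNormalTraces 𝒯 (fun z => (v z).snd) fun z => (f z).fst) :
    ⟪f, HA.field T Ω 𝒯 u⟫ - ⟪v, HA.astar T Ω 𝒯 u⟫ = (0 : ℝ) := by
  refine h.inner_sub_inner_eq_zero hT hΩ fun K hK => ?_
  have hS := h.openCell_subset hT hΩ hK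
  obtain ⟨c, hc⟩ := hv.exists_coeffs hd hK
  have e := K.integral_normal_eq hS (memLp_fst (Cell.memLp_openCell hS f))
    (memLp_snd (Cell.memLp_openCell hS v)) hc (Cell.memLp_openCell hS (HA.field T Ω 𝒯 u))
    (Cell.memLp_openCell hS (HA.astar T Ω 𝒯 u)) (HA.isBrokenAstar u K hK).2
  refine Eq.trans (integral_congr_ae ?_) (e.trans (h.integral_dens_eq_zero hT hΩ hK
    (K.map_wNormal (hu.wE ⟨K, hK⟩) (hu.wG ⟨K, hK⟩) c)))
  filter_upwards [Cell.ae_openCell hS (H.snd_eq_snd hΩ h0), Cell.ae_openCell hS h0] with z z1 z2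
  exact inner_sub_inner_val z1 z2

/-! ### Initial traces -/

/-- The pairing of the continuous representative with `η` is continuous in time and vanishes almost
everywhere near `0`, hence also at `0`. The initial value is never compared with `v` directly. -/
theorem IsInitialTrace.inner_eq_zero {v : L2Q T Ω} {g η : L2Om Ω}
    (H : IsInitialTrace T Ω v g) {δ : ℝ} (hδ : 0 < δ) (hδT : δ ≤ T)
    (h0 : ∀ᵐ t ∂volume.restrict (Ioo 0 δ), ∫ x in Ω, (v (t, x)).fst * η x = 0) :
    ⟪g, η⟫ = (0 : ℝ) := by
  obtain ⟨u, hu, rfl, hv⟩ := H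
  have h1 : EqOn (fun t => ⟪u t, η⟫) (fun _ => (0 : ℝ)) (Icc 0 δ) := by
    refine Measure.eqOn_Icc_of_ae_eq volume hδ.ne ?_
      ((hu.mono (Icc_subset_Icc_right hδT)).inner continuousOn_const) continuousOn_const
    rw [← Measure.restrict_congr_set Ioo_ae_eq_Icc]
    filter_upwards [h0, ae_mono (Measure.restrict_mono_set _ (Ioo_subset_Ioo_right hδT)) hv]
      with t t1 t2
    rw [L2.inner_def]
    refine Eq.trans (integral_congr_ae ?_) t1
    filter_upwards [t2] with x hx
    rw [hx]
    simp [mul_comm]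
  exact h1 (left_mem_Icc.2 hδ.le)

theorem ae_ae_of_ae_cyl {p : TS d → Prop} (h : ∀ᵐ z ∂volume.restrict (cyl T Ω), p z) :
    ∀ᵐ t ∂volume.restrict (Ioo 0 T), ∀ᵐ x ∂volume.restrict Ω, p (t, x) := by
  rw [cyl, Measure.volume_eq_prod, ← Measure.prod_restrict] at h
  exact Measure.ae_ae_of_ae_prod h

theorem IsInitialTrace.inner_eq_zero_of_fst_eq_zero (hT : 0 < T) {v : L2Q T Ω} {g : L2Om Ω}
    (H : IsInitialTrace T Ω v g) (h0 : ∀ᵐ z ∂volume.restrict (cyl T Ω), (v z).fst = 0)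
    (η : L2Om Ω) : ⟪g, η⟫ = (0 : ℝ) := by
  refine H.inner_eq_zero hT le_rfl ?_
  filter_upwards [ae_ae_of_ae_cyl h0] with t ht
  refine integral_eq_zero_of_ae ?_
  filter_upwards [ht] with x hx
  rw [hx, zero_mul]
  rfl

theorem section_mem_polySpace {f : TS d → ℝ} (hf : f ∈ tensorSpace d 1) (t : ℝ) :
    (fun x => f (t, x)) ∈ polySpace d 1 := by
  induction hf using Submodule.span_induction with
  | mem f hf =>
    obtain ⟨p, q, -, hq, rfl⟩ := hf
    exact Submodule.smul_mem _ (p.eval t) hq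
  | zero => exact Submodule.zero_mem _
  | add f g _ _ hf hg => exact Submodule.add_mem _ hf hg
  | smul c f _ hf => exact Submodule.smul_mem _ c hf

/-- Up to time `δ` the initial cells form the only layer of the mesh, so their simplices describe
every time slice. -/
theorem exists_pos_le_initial (𝒯 : Finset (Cell d)) (hT : 0 < T) :
    ∃ δ > 0, δ ≤ T ∧ ∀ K ∈ IsMesh.initialCells 𝒯, δ ≤ K.b := by
  have h1 : ∀ s : Finset (Cell d), (∀ K ∈ s, 0 < K.b) → ∃ δ > 0, δ ≤ T ∧ ∀ K ∈ s, δ ≤ K.b := by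
    intro s hs
    classical
    induction s using Finset.induction_on with
    | empty => exact ⟨T, hT, le_rfl, by simp⟩
    | insert K s _ ih =>
      obtain ⟨δ, h1, h2, h3⟩ := ih fun K hK => hs K (Finset.mem_insert_of_mem hK)
      refine ⟨min δ K.b, lt_min h1 (hs K (Finset.mem_insert_self K s)), (min_le_left _ _).trans h2,
        fun K' hK' => ?_⟩
      rcases Finset.mem_insert.1 hK' with rfl | hK'
      · exact min_le_right _ _
      · exact (min_le_left _ _).trans (h3 K' hK')
  exact h1 _ fun K hK => by
    obtain ⟨-, h0⟩ := IsMesh.mem_initialCells.1 hK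
    exact h0 ▸ K.hab

/-- For times below `δ` the slice of `v` is affine on every initial simplex and thus orthogonal to
`η`. -/
theorem IsMesh.inner_initialTrace_eq_zero (h : IsMesh T Ω 𝒯) (hT : 0 < T)
    (hΩ : IsLipschitzDomain Ω) {v : L2Q T Ω} {g η : L2Om Ω} (H : IsInitialTrace T Ω v g)
    (hv : IsPwTensor T Ω 𝒯 1 fun z => (v z).fst)
    (hη : ∀ K ∈ 𝒯, K.a = 0 → ∀ θ ∈ polySpace d 1, ∫ x in K.space, θ x * η x = 0) :
    ⟪g, η⟫ = (0 : ℝ) := by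
  obtain ⟨δ, h1, h2, h3⟩ := exists_pos_le_initial 𝒯 hT
  refine H.inner_eq_zero h1 h2 ?_
  have h4 : ∀ᵐ t ∂volume.restrict (Ioo 0 T), ∀ K : IsMesh.initialCells 𝒯, ∃ θ ∈ polySpace d 1,
      ∀ᵐ x ∂volume.restrict Ω, (t, x) ∈ K.1.carrier → (v (t, x)).fst = θ x := by
    refine ae_all_iff.2 fun K => ?_
    obtain ⟨f, hf, e⟩ := hv K.1 (IsMesh.mem_initialCells.1 K.2).1
    filter_upwards [ae_ae_of_ae_cyl e] with t ht
    exact ⟨_, section_mem_polySpace hf t, ht⟩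
  filter_upwards [ae_mono (Measure.restrict_mono_set _ (Ioo_subset_Ioo_right h2)) h4,
    ae_restrict_mem measurableSet_Ioo] with t t1 t2
  -- Splitting the integral over the simplices needs integrability of the slice; without it the
  -- integral is `0` by convention, which is the value wanted.
  by_cases hi : IntegrableOn (fun x => (v (t, x)).fst * η x) Ω
  · rw [h.integral_initial hT hΩ hi]
    refine Finset.sum_eq_zero fun K hK => ?_
    obtain ⟨hK', h0⟩ := IsMesh.mem_initialCells.1 hK
    obtain ⟨θ, hθ, e⟩ := t1 ⟨K, hK⟩
    rw [setIntegral_congr_set K.interior_space_ae_eq, ← hη K hK' h0 θ hθ]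
    refine integral_congr_ae ?_
    filter_upwards [K.ae_space (h.interior_space_subset hT hΩ hK') e,
      ae_restrict_mem K.measurableSet_space] with x x1 x2
    rw [x1 ⟨⟨h0.le.trans t2.1.le, t2.2.le.trans (h3 K hK)⟩, x2⟩]
  · exact integral_undef hi

end HeatDPG

end

noncomputable section

namespace HeatDPG

/-! ### Residual minimization with a Fortin operator -/

section Abstract

variable {E : Type*} [NormedAddCommGroup E] [InnerProductSpace ℝ E]

/-- The Riesz representative of a functional in the completion. -/
def riesz (f : StrongDual ℝ E) : UniformSpace.Completion E :=
  (InnerProductSpace.toDual ℝ (UniformSpace.Completion E)).symm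
    (f.extend (UniformSpace.Completion.toComplL : E →L[ℝ] UniformSpace.Completion E))

/-- Completeness of the space is not assumed, so the representative lives in the completion. Testing
with elements of the dense original space suffices throughout. -/
theorem inner_riesz (f : StrongDual ℝ E) (x : E) :
    ⟪riesz f, (x : UniformSpace.Completion E)⟫ = f x := by
  rw [riesz, InnerProductSpace.toDual_symm_apply]
  exact ContinuousLinearMap.extend_eq f UniformSpace.Completion.denseRange_coe
    (UniformSpace.Completion.isUniformInducing_coe E) x

theorem riesz_comb (c : ℝ) (f g : StrongDual ℝ E) : riesz (c • f + g) = c • riesz f + riesz g := by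
  refine ext_inner_right ℝ fun y => ?_
  refine UniformSpace.Completion.induction_on y (isClosed_eq (by fun_prop) (by fun_prop)) fun x => ?_
  simp [inner_riesz, inner_add_left, real_inner_smul_left]

theorem norm_riesz (f : StrongDual ℝ E) : ‖riesz f‖ = ‖f‖ := by
  refine le_antisymm ?_ (f.opNorm_le_bound (norm_nonneg _) fun x => ?_)
  · rw [riesz, LinearIsometryEquiv.norm_map]
    have h := ContinuousLinearMap.opNorm_extend_le f (N := 1)
      (e := (UniformSpace.Completion.toComplL : E →L[ℝ] UniformSpace.Completion E))
      UniformSpace.Completion.denseRange_coe (fun x => by simp)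
    simpa using h
  · rw [← inner_riesz, ← UniformSpace.Completion.norm_coe x]
    exact abs_real_inner_le_norm _ _

/-- Dual norms of inner product spaces are again induced by an inner product, which makes residual
minimization a quadratic problem. -/
theorem norm_sq_comb (c : ℝ) (f g : StrongDual ℝ E) :
    ‖c • f + g‖ ^ 2 = c ^ 2 * ‖f‖ ^ 2 + 2 * c * ⟪riesz f, riesz g⟫ + ‖g‖ ^ 2 := by
  rw [← norm_riesz, ← norm_riesz f, ← norm_riesz g, riesz_comb, norm_add_sq_real, norm_smul,
    mul_pow, Real.norm_eq_abs, sq_abs, real_inner_smul_left]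
  ring

/-- A minimal residual is orthogonal to the trial space. -/
theorem norm_sq_comb_of_minimal {e r : StrongDual ℝ E} (H : ∀ c : ℝ, ‖e‖ ≤ ‖c • r + e‖) (c : ℝ) :
    ‖c • r + e‖ ^ 2 = c ^ 2 * ‖r‖ ^ 2 + ‖e‖ ^ 2 := by
  suffices h : ⟪riesz r, riesz e⟫ = (0 : ℝ) by rw [norm_sq_comb, h]; ring
  have h1 : ∀ c : ℝ, 0 ≤ c ^ 2 * ‖r‖ ^ 2 + 2 * c * ⟪riesz r, riesz e⟫ := fun c => by
    have h2 := pow_le_pow_left₀ (norm_nonneg _) (H c) 2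
    rw [norm_sq_comb] at h2
    linarith
  set s : ℝ := ⟪riesz r, riesz e⟫
  rcases eq_or_ne ‖r‖ 0 with h0 | h0
  -- If `r = 0` only the linear term remains, and `c = -s` makes it `-2 s ^ 2`.
  · have h2 := h1 (-s)
    rw [h0] at h2
    nlinarith
  -- This is the minimizer of the quadratic in `c`, where its value is `-s ^ 2 / ‖r‖ ^ 2`.
  · have h2 := h1 (-(s / ‖r‖ ^ 2))
    have h3 : (-(s / ‖r‖ ^ 2)) ^ 2 * ‖r‖ ^ 2 + 2 * -(s / ‖r‖ ^ 2) * s = -(s ^ 2 / ‖r‖ ^ 2) := by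
      field_simp
      ring
    rw [h3] at h2
    have h4 : s ^ 2 / ‖r‖ ^ 2 = 0 := le_antisymm (by linarith) (by positivity)
    have h5 := (div_eq_zero_iff.1 h4).resolve_right (pow_ne_zero 2 h0)
    exact pow_eq_zero_iff two_ne_zero |>.1 h5

/-- A functional that does not distinguish `y` from `P y` is determined on the discrete space, so
its full dual norm is controlled by the discrete one. -/
theorem norm_le_of_fortin {P : E →L[ℝ] E} {V : Submodule ℝ E} (hV : ∀ y, P y ∈ V)
    {r : StrongDual ℝ E} (hr : ∀ y, r (y - P y) = 0) : ‖r‖ ≤ ‖P‖ * ‖r.comp V.subtypeL‖ := by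
  refine r.opNorm_le_bound (by positivity) fun y => ?_
  have h1 : r y = r.comp V.subtypeL ⟨P y, hV y⟩ := by
    rw [← sub_eq_zero, ← hr y, map_sub]
    rfl
  rw [h1]
  refine ((r.comp V.subtypeL).le_opNorm _).trans ?_
  have h2 : ‖(⟨P y, hV y⟩ : V)‖ ≤ ‖P‖ * ‖y‖ := P.le_opNorm y
  calc _ ≤ ‖r.comp V.subtypeL‖ * (‖P‖ * ‖y‖) := 
      mul_le_mul_of_nonneg_left h2 (ContinuousLinearMap.opNorm_nonneg _)
    _ = _ := by ring

theorem norm_comp_subtypeL_le (V : Submodule ℝ E) (r : StrongDual ℝ E) :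
    ‖r.comp V.subtypeL‖ ≤ ‖r‖ :=
  (r.comp V.subtypeL).opNorm_le_bound (norm_nonneg _) fun _ => r.le_opNorm _

/-- Taking the whole space as the discrete one gives `‖r‖ ≤ ‖P‖ ‖r‖`, and `‖r‖` can be cancelled. -/
theorem one_le_norm_of_fortin {P : E →L[ℝ] E} {r : StrongDual ℝ E} (h0 : r ≠ 0)
    (hr : ∀ y, r (y - P y) = 0) : 1 ≤ ‖P‖ := by
  have h1 : ‖r‖ ≤ ‖P‖ * ‖r‖ := (norm_le_of_fortin (V := ⊤) (fun _ => Submodule.mem_top) hr).trans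
    (mul_le_mul_of_nonneg_left (norm_comp_subtypeL_le _ r) (norm_nonneg _))
  exact le_of_mul_le_mul_right (by rwa [one_mul]) (norm_pos_iff.2 h0)

/-- Quasi-optimality of residual minimization with the norm of the Fortin operator as constant. -/
theorem norm_le_of_minimal_of_fortin {P : E →L[ℝ] E} {V : Submodule ℝ E} (hV : ∀ y, P y ∈ V)
    (hP : 1 ≤ ‖P‖) {e r : StrongDual ℝ E} (hr : ∀ y, r (y - P y) = 0)
    (H : ∀ c : ℝ, ‖e.comp V.subtypeL‖ ≤ ‖(c • r + e).comp V.subtypeL‖) : ‖e‖ ≤ ‖P‖ * ‖r + e‖ := by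
  -- On the discrete space `r` and `e` are orthogonal by minimality, so `c r` is bounded by `c r +
  -- e` there. Passing to the full norm of `r` costs `‖P‖`, while restriction does not increase the
  -- norm of `c r + e`.
  have h1 : ∀ c : ℝ, c ^ 2 * ‖r‖ ^ 2 ≤ ‖P‖ ^ 2 * ‖c • r + e‖ ^ 2 := fun c => by
    have h2 := pow_le_pow_left₀ (norm_nonneg _) (norm_le_of_fortin hV hr) 2
    have h3 := norm_sq_comb_of_minimal (e := e.comp V.subtypeL) (r := r.comp V.subtypeL) H c
    have h4 := pow_le_pow_left₀ (ContinuousLinearMap.opNorm_nonneg _)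
      (norm_comp_subtypeL_le V (c • r + e)) 2
    have h5 : c ^ 2 * ‖r.comp V.subtypeL‖ ^ 2 ≤ ‖c • r + e‖ ^ 2 := by
      refine le_trans ?_ h4
      refine le_trans ?_ h3.ge
      exact le_add_of_nonneg_right (sq_nonneg _)
    rw [mul_pow] at h2
    calc _ ≤ c ^ 2 * (‖P‖ ^ 2 * ‖r.comp V.subtypeL‖ ^ 2) := mul_le_mul_of_nonneg_left h2 (sq_nonneg _)
      _ = ‖P‖ ^ 2 * (c ^ 2 * ‖r.comp V.subtypeL‖ ^ 2) := by ring
      _ ≤ _ := mul_le_mul_of_nonneg_left h5 (sq_nonneg _)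
  refine abs_le_of_sq_le_sq' ?_ (by positivity) |>.2
  rw [mul_pow]
  rcases eq_or_ne ‖r‖ 0 with h0 | h0
  · rw [norm_eq_zero.1 h0, zero_add]
    nlinarith [sq_nonneg ‖e‖, one_le_pow₀ hP (n := 2)]
  · rcases eq_or_ne ‖e‖ 0 with h0' | h0'
    · rw [h0', zero_pow two_ne_zero]
      positivity
    -- For this `c` the vector `c r + e` has norm `‖e‖ / ‖r‖` times that of `r + e`, and `c r` has
    -- norm `‖e‖ / ‖r‖` times that of `e`. The bound on the component in the direction of `r`
    -- thereby becomes one on `e`, with the same constant.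
    · have h2 := h1 (‖e‖ ^ 2 / ‖r‖ ^ 2)
      rw [norm_sq_comb] at h2
      have h3 := norm_sq_comb 1 r e
      rw [one_smul] at h3
      rw [h3]
      have e1 : (‖e‖ ^ 2 / ‖r‖ ^ 2) ^ 2 * ‖r‖ ^ 2 = ‖e‖ ^ 2 / ‖r‖ ^ 2 * ‖e‖ ^ 2 := by
        field_simp
      have e2 : ‖P‖ ^ 2 * ((‖e‖ ^ 2 / ‖r‖ ^ 2) ^ 2 * ‖r‖ ^ 2 + 2 * (‖e‖ ^ 2 / ‖r‖ ^ 2) *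
          ⟪riesz r, riesz e⟫ + ‖e‖ ^ 2) = ‖e‖ ^ 2 / ‖r‖ ^ 2 *
            (‖P‖ ^ 2 * (1 ^ 2 * ‖r‖ ^ 2 + 2 * 1 * ⟪riesz r, riesz e⟫ + ‖e‖ ^ 2)) := by
        field_simp
        ring
      rw [e2, e1] at h2
      exact le_of_mul_le_mul_left h2 (by positivity)

end Abstract

variable {d : ℕ} {T : ℝ} {Ω : Set (Sp d)} {𝒯 : Finset (Cell d)}

/-! ### Linearity of the trial spaces -/

theorem traceFunctional_comb (c : ℝ) (v v' f f' : L2Q T Ω) (g g' : L2Om Ω) :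
    traceFunctional T Ω 𝒯 (c • v + v') (c • f + f') (c • g + g') =
      c • traceFunctional T Ω 𝒯 v f g + traceFunctional T Ω 𝒯 v' f' g' := by
  refine ContinuousLinearMap.ext fun y => ?_
  simp only [traceFunctional, add_apply, sub_apply,
    smul_apply, ContinuousLinearMap.comp_apply, innerSL_apply_apply,
    inner_add_left, real_inner_smul_left, smul_eq_mul]
  ring

theorem bform_comb (c : ℝ) (x x' : XAmb T Ω 𝒯) :
    bform T Ω 𝒯 (c • x + x') = c • bform T Ω 𝒯 x + bform T Ω 𝒯 x' := by
  refine ContinuousLinearMap.ext fun y => ?_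
  have e1 : (c • x + x').fst = c • x.fst + x'.fst := rfl
  have e2 : (c • x + x').snd = c • x.snd + x'.snd := rfl
  simp only [bform, e1, e2, add_apply, smul_apply,
    ContinuousLinearMap.comp_apply, innerSL_apply_apply, inner_add_left, real_inner_smul_left,
    smul_eq_mul]
  ring

theorem IsU0.comb (hΩ : IsLipschitzDomain Ω) (c : ℝ) {v f v' f' : L2Q T Ω} (H : IsU0 T Ω v f)
    (H' : IsU0 T Ω v' f') : IsU0 T Ω (c • v + v') (c • f + f') := by
  have ev := coeFn_comb c v v'
  have ef := coeFn_comb c f f'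
  refine ⟨H.1.of_comb c H'.1 (Lp.memLp _) (Lp.memLp _) (memLp_fst (Lp.memLp _))
    (memLp_fst (Lp.memLp _)) ev (ef.mono fun z hz => ?_), fun χ hχ => ?_⟩
  · rw [hz]
    simp
  · have mχ : MemLp χ 2 (volume.restrict (cyl T Ω)) := hχ.continuous.memLp_cyl hΩ
    have md : MemLp (divX χ) 2 (volume.restrict (cyl T Ω)) := (continuous_divX hχ).memLp_cyl hΩ
    have i1 : ∀ f v : L2Q T Ω, Integrable (fun z => ⟪(f z).snd - (v z).snd, χ z⟫)
        (volume.restrict (cyl T Ω)) := fun f v =>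
      integrable_inner_of_memLp ((memLp_snd (Lp.memLp f)).sub (memLp_snd (Lp.memLp v))) mχ
    have i2 : ∀ v : L2Q T Ω, Integrable (fun z => (v z).fst * divX χ z)
        (volume.restrict (cyl T Ω)) := fun v => (memLp_fst (Lp.memLp v)).integrable_mul md
    have e1 : ∫ z in cyl T Ω, ⟪((c • f + f' : L2Q T Ω) z).snd - ((c • v + v' : L2Q T Ω) z).snd, χ z⟫ =
        ∫ z in cyl T Ω, (c * ⟪(f z).snd - (v z).snd, χ z⟫ + ⟪(f' z).snd - (v' z).snd, χ z⟫) := by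
      refine integral_congr_ae ?_
      filter_upwards [ev, ef] with z h1 h2
      simp only [h1, h2, WithLp.add_snd, WithLp.smul_snd, inner_sub_left, inner_add_left,
        real_inner_smul_left]
      ring
    have e2 : ∫ z in cyl T Ω, ((c • v + v' : L2Q T Ω) z).fst * divX χ z =
        ∫ z in cyl T Ω, (c * ((v z).fst * divX χ z) + (v' z).fst * divX χ z) := by
      refine integral_congr_ae ?_
      filter_upwards [ev] with z h1
      simp only [h1, WithLp.add_fst, WithLp.smul_fst, smul_eq_mul]
      ring
    rw [e1, e2, integral_add ((i1 f v).const_mul c) (i1 f' v'),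
      integral_add ((i2 v).const_mul c) (i2 v'), integral_const_mul, integral_const_mul,
      H.2 χ hχ, H'.2 χ hχ]
    ring

theorem IsInitialTrace.comb (c : ℝ) {v v' : L2Q T Ω} {g g' : L2Om Ω}
    (H : IsInitialTrace T Ω v g) (H' : IsInitialTrace T Ω v' g') :
    IsInitialTrace T Ω (c • v + v') (c • g + g') := by
  obtain ⟨u, hu, rfl, hv⟩ := H
  obtain ⟨u', hu', rfl, hv'⟩ := H'
  refine ⟨fun t => c • u t + u' t, (hu.const_smul c).add hu', rfl, ?_⟩
  filter_upwards [hv, hv', ae_ae_of_ae_cyl (coeFn_comb c v v')] with t h1 h2 h3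
  filter_upwards [h1, h2, h3, coeFn_comb c (u t) (u' t)] with x h1 h2 h3 h4
  rw [h4, h1, h2, h3]
  simp

end HeatDPG

end

noncomputable section

namespace HeatDPG

variable {d : ℕ} {T : ℝ} {Ω : Set (Sp d)} {𝒯 : Finset (Cell d)}

theorem Gam_comb (hΩ : IsLipschitzDomain Ω) (c : ℝ) {t t' : StrongDual ℝ (Y T Ω 𝒯)}
    (ht : t ∈ Gam T Ω 𝒯) (ht' : t' ∈ Gam T Ω 𝒯) : c • t + t' ∈ Gam T Ω 𝒯 := by
  obtain ⟨v, f, g, h1, h2, rfl⟩ := ht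
  obtain ⟨v', f', g', h1', h2', rfl⟩ := ht'
  exact ⟨_, _, _, h1.comb hΩ c h1', h2.comb c h2', (traceFunctional_comb c v v' f f' g g').symm⟩

theorem GamH1_comb (hΩ : IsLipschitzDomain Ω) (c : ℝ) {t t' : StrongDual ℝ (Y T Ω 𝒯)}
    (ht : t ∈ GamH1 T Ω 𝒯) (ht' : t' ∈ GamH1 T Ω 𝒯) : c • t + t' ∈ GamH1 T Ω 𝒯 := by
  obtain ⟨v, f, g, h1, h2, h3, h4, rfl⟩ := ht
  obtain ⟨v', f', g', h1', h2', h3', h4', rfl⟩ := ht'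
  refine ⟨_, _, _, h1.comb hΩ c h1', h2.comb c h2', ?_, h4.of_comb c h4' ?_,
    (traceFunctional_comb c v v' f f' g g').symm⟩
  · filter_upwards [h3, h3', coeFn_comb c v v'] with z z1 z2 z3
    rw [z3, WithLp.add_snd, WithLp.smul_snd, z1, z2, smul_zero, add_zero]
  · filter_upwards [coeFn_comb c v v'] with z z3
    rw [z3]
    simp

theorem HasConstNormalTraces.comb (c : ℝ) {τ τ' σ : TS d → Sp d} {q q' p : TS d → ℝ}
    (H : HasConstNormalTraces 𝒯 τ q) (H' : HasConstNormalTraces 𝒯 τ' q')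
    (hτ : ∀ K ∈ 𝒯, MemLp τ 2 (volume.restrict K.openCell))
    (hτ' : ∀ K ∈ 𝒯, MemLp τ' 2 (volume.restrict K.openCell))
    (hq : ∀ K ∈ 𝒯, MemLp q 2 (volume.restrict K.openCell))
    (hq' : ∀ K ∈ 𝒯, MemLp q' 2 (volume.restrict K.openCell))
    (hσ : ∀ K ∈ 𝒯, ∀ᵐ z ∂volume.restrict K.openCell, σ z = c • τ z + τ' z)
    (hp : ∀ K ∈ 𝒯, ∀ᵐ z ∂volume.restrict K.openCell, p z = c * q z + q' z) :
    HasConstNormalTraces 𝒯 σ p := by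
  obtain ⟨P, hP⟩ := H
  obtain ⟨P', hP'⟩ := H'
  refine ⟨fun f => c • P f + P' f, fun K hK f ν hf φ hφ => ?_⟩
  have h1 := hP K hK f ν hf φ hφ
  have h2 := hP' K hK f ν hf φ hφ
  rw [← setIntegral_congr_set K.openCell_ae_eq] at h1 h2 ⊢
  have mφ : MemLp φ 2 (volume.restrict K.openCell) :=
    hφ.continuous.memLp_restrict K.isCompact_carrier K.openCell_subset
  have mg : MemLp (gradX φ) 2 (volume.restrict K.openCell) :=
    (continuous_gradX hφ).memLp_restrict K.isCompact_carrier K.openCell_subset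
  have i1 : IntegrableOn (fun z => q z * φ z + ⟪τ z, gradX φ z⟫) K.openCell :=
    ((hq K hK).integrable_mul mφ).add (integrable_inner_of_memLp (hτ K hK) mg)
  have i2 : IntegrableOn (fun z => q' z * φ z + ⟪τ' z, gradX φ z⟫) K.openCell :=
    ((hq' K hK).integrable_mul mφ).add (integrable_inner_of_memLp (hτ' K hK) mg)
  have e : ∫ z in K.openCell, (p z * φ z + ⟪σ z, gradX φ z⟫) = ∫ z in K.openCell,
      (c * (q z * φ z + ⟪τ z, gradX φ z⟫) + (q' z * φ z + ⟪τ' z, gradX φ z⟫)) := by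
    refine integral_congr_ae ?_
    filter_upwards [hσ K hK, hp K hK] with z z1 z2
    rw [z1, z2, inner_add_left, real_inner_smul_left]
    ring
  rw [e, integral_add (i1.const_mul c) i2, integral_const_mul, h1, h2, Finset.mul_sum,
    ← Finset.sum_add_distrib]
  exact Finset.sum_congr rfl fun i _ => by rw [inner_add_left, real_inner_smul_left]; ring

theorem GamDiv_comb (h : IsMesh T Ω 𝒯) (hT : 0 < T) (hΩ : IsLipschitzDomain Ω) (c : ℝ)
    {t t' : StrongDual ℝ (Y T Ω 𝒯)} (ht : t ∈ GamDiv T Ω 𝒯) (ht' : t' ∈ GamDiv T Ω 𝒯) :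
    c • t + t' ∈ GamDiv T Ω 𝒯 := by
  obtain ⟨v, f, g, h1, h2, h3, h4, rfl⟩ := ht
  obtain ⟨v', f', g', h1', h2', h3', h4', rfl⟩ := ht'
  have hS := fun K (hK : K ∈ 𝒯) => h.openCell_subset hT hΩ hK
  refine ⟨_, _, _, h1.comb hΩ c h1', h2.comb c h2', ?_, h4.comb c h4'
    (fun K hK => memLp_snd (Cell.memLp_openCell (hS K hK) v))
    (fun K hK => memLp_snd (Cell.memLp_openCell (hS K hK) v'))
    (fun K hK => memLp_fst (Cell.memLp_openCell (hS K hK) f))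
    (fun K hK => memLp_fst (Cell.memLp_openCell (hS K hK) f')) (fun K hK => ?_) (fun K hK => ?_),
    (traceFunctional_comb c v v' f f' g g').symm⟩
  · filter_upwards [h3, h3', coeFn_comb c v v'] with z z1 z2 z3
    rw [z3, WithLp.add_fst, WithLp.smul_fst, z1, z2, smul_zero, add_zero]
  · filter_upwards [Cell.ae_openCell (hS K hK) (coeFn_comb c v v')] with z z1
    rw [z1]
    simp
  · filter_upwards [Cell.ae_openCell (hS K hK) (coeFn_comb c f f')] with z z1
    rw [z1]
    simp

theorem X_comb (hΩ : IsLipschitzDomain Ω) (c : ℝ) {x x' : XAmb T Ω 𝒯} (hx : x ∈ X T Ω 𝒯)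
    (hx' : x' ∈ X T Ω 𝒯) : c • x + x' ∈ X T Ω 𝒯 := Gam_comb hΩ c hx hx'

theorem Xh_subset_X (hΩ : IsLipschitzDomain Ω) : Xh T Ω 𝒯 ⊆ X T Ω 𝒯 := by
  rintro x ⟨-, t, ⟨v, f, g, h1, h2, -, -, h3⟩, t', ⟨v', f', g', h1', h2', -, -, h3'⟩, hx⟩
  have := Gam_comb hΩ 1 (t := t) (t' := t') ⟨v, f, g, h1, h2, h3⟩ ⟨v', f', g', h1', h2', h3'⟩
  rw [one_smul, ← hx] at this
  exact this

theorem X0h_comb (c : ℝ) {v v' : L2Q T Ω} (h : v ∈ X0h T Ω 𝒯) (h' : v' ∈ X0h T Ω 𝒯) :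
    c • v + v' ∈ X0h T Ω 𝒯 := by
  have ev := coeFn_comb c v v'
  refine ⟨h.1.of_comb c h'.1 (ev.mono fun z hz => ?_),
    fun i => (h.2 i).of_comb c (h'.2 i) (ev.mono fun z hz => ?_)⟩
  · rw [hz]
    simp
  · rw [hz]
    simp

theorem smul_add_comb {E : Type*} [NormedAddCommGroup E] [NormedSpace ℝ E] (c : ℝ)
    {x x' y t s t' s' : StrongDual ℝ E} (h : y = c • x + x') (e : x = t + s) (e' : x' = t' + s') :
    y = (c • t + t') + (c • s + s') := by
  rw [h, e, e']
  module

theorem XAmb.fst_comb (c : ℝ) (x x' : XAmb T Ω 𝒯) : (c • x + x').fst = c • x.fst + x'.fst := rfl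

theorem XAmb.snd_comb (c : ℝ) (x x' : XAmb T Ω 𝒯) : (c • x + x').snd = c • x.snd + x'.snd := rfl

theorem mem_Xh {x : XAmb T Ω 𝒯} {t s : StrongDual ℝ (Y T Ω 𝒯)} (h1 : x.fst ∈ X0h T Ω 𝒯)
    (h2 : t ∈ GamH1 T Ω 𝒯) (h3 : s ∈ GamDiv T Ω 𝒯) (h4 : x.snd = t + s) : x ∈ Xh T Ω 𝒯 :=
  ⟨h1, t, h2, s, h3, h4⟩

set_option maxHeartbeats 1000000 in
theorem Xh_comb (h : IsMesh T Ω 𝒯) (hT : 0 < T) (hΩ : IsLipschitzDomain Ω) (c : ℝ)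
    {x x' : XAmb T Ω 𝒯} (hx : x ∈ Xh T Ω 𝒯) (hx' : x' ∈ Xh T Ω 𝒯) : c • x + x' ∈ Xh T Ω 𝒯 := by
  obtain ⟨h1, t, ht, s, hs, e⟩ := hx
  obtain ⟨h1', t', ht', s', hs', e'⟩ := hx'
  have a1 : (c • x + x').fst ∈ X0h T Ω 𝒯 := by
    rw [XAmb.fst_comb]
    exact X0h_comb c h1 h1'
  have a2 := GamH1_comb hΩ c ht ht'
  have a3 := GamDiv_comb h hT hΩ c hs hs'
  have a4 := smul_add_comb c (XAmb.snd_comb c x x') e e'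
  exact mem_Xh a1 a2 a3 a4

/-! ### The stability constants -/

theorem norm_innerSL_comp_add_le {H E : Type*} [NormedAddCommGroup H] [InnerProductSpace ℝ H]
    [NormedAddCommGroup E] [NormedSpace ℝ E] (A : E →L[ℝ] H) (x : WithLp 2 (H × StrongDual ℝ E)) :
    ‖(innerSL ℝ x.fst).comp A + x.snd‖ ≤ (‖A‖ + 1) * ‖x‖ := by
  have h1 : ‖(innerSL ℝ x.fst).comp A‖ ≤ ‖x.fst‖ * ‖A‖ := by
    rw [← innerSL_apply_norm ℝ x.fst]
    exact ContinuousLinearMap.opNorm_comp_le _ _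
  have h2 : ‖x.fst‖ ≤ ‖x‖ := WithLp.norm_fst_le _ x
  have h3 : ‖x.snd‖ ≤ ‖x‖ := WithLp.norm_snd_le _ x
  have h4 := mul_le_mul_of_nonneg_right h2 (norm_nonneg A)
  refine (norm_add_le _ _).trans ?_
  linarith

theorem norm_bform_le (x : XAmb T Ω 𝒯) :
    ‖bform T Ω 𝒯 x‖ ≤ (‖Y.astar T Ω 𝒯‖ + 1) * ‖x‖ :=
  norm_innerSL_comp_add_le (Y.astar T Ω 𝒯) x

section Quotients

variable {E F : Type*} [NormedAddCommGroup E] [NormedAddCommGroup F] (s : Set E) (f : E → F)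

theorem sInf_norm_div_mul_le {x : E} (hx : x ∈ s) :
    sInf {r | ∃ x ∈ s, x ≠ 0 ∧ r = ‖f x‖ / ‖x‖} * ‖x‖ ≤ ‖f x‖ := by
  rcases eq_or_ne x 0 with rfl | h0
  · rw [norm_zero, mul_zero]
    exact norm_nonneg _
  · rw [← le_div_iff₀ (norm_pos_iff.2 h0)]
    refine csInf_le ⟨0, ?_⟩ ⟨x, hx, h0, rfl⟩
    rintro _ ⟨y, -, -, rfl⟩
    positivity

theorem norm_le_sSup_norm_div_mul {c : ℝ} (hc : ∀ x, ‖f x‖ ≤ c * ‖x‖) {x : E} (hx : x ∈ s) :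
    ‖f x‖ ≤ sSup {r | ∃ x ∈ s, x ≠ 0 ∧ r = ‖f x‖ / ‖x‖} * ‖x‖ := by
  rcases eq_or_ne x 0 with rfl | h0
  · refine (hc _).trans ?_
    rw [norm_zero, mul_zero, mul_zero]
  · rw [← div_le_iff₀ (norm_pos_iff.2 h0)]
    refine le_csSup ⟨c, ?_⟩ ⟨x, hx, h0, rfl⟩
    rintro _ ⟨y, -, hy, rfl⟩
    rw [div_le_iff₀ (norm_pos_iff.2 hy)]
    exact hc y

end Quotients

theorem infSupConst_mul_norm_le {x : XAmb T Ω 𝒯} (hx : x ∈ X T Ω 𝒯) :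
    infSupConst T Ω 𝒯 * ‖x‖ ≤ ‖bform T Ω 𝒯 x‖ :=
  sInf_norm_div_mul_le (X T Ω 𝒯) (bform T Ω 𝒯) hx

theorem norm_bform_le_contConst {x : XAmb T Ω 𝒯} (hx : x ∈ X T Ω 𝒯) :
    ‖bform T Ω 𝒯 x‖ ≤ contConst T Ω 𝒯 * ‖x‖ :=
  norm_le_sSup_norm_div_mul (X T Ω 𝒯) (bform T Ω 𝒯) (fun x => norm_bform_le (𝒯 := 𝒯) x) hx

end HeatDPG

end

noncomputable section

namespace HeatDPG

/-! ### The main estimates for the practical scheme -/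

/-- The abstract estimate is applied to `e = b (x - xh)` and the discrete residual `r = b (xh - z)`,
whose sum is `b (x - z)`. -/
theorem norm_sub_le_of_minimal_of_fortin {E W : Type*} [NormedAddCommGroup E]
    [InnerProductSpace ℝ E] [AddCommGroup W] [Module ℝ W] (b : W → StrongDual ℝ E)
    (hb : ∀ (c : ℝ) x x', b (c • x + x') = c • b x + b x') {S : Set W}
    (hS : ∀ (c : ℝ) x x', x ∈ S → x' ∈ S → c • x + x' ∈ S) {P : E →L[ℝ] E} {V : Submodule ℝ E}
    (hV : ∀ y, P y ∈ V) (hP : 1 ≤ ‖P‖) (hr : ∀ x ∈ S, ∀ y, b x (y - P y) = 0) {x xh z : W}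
    (hxh : xh ∈ S) (hz : z ∈ S)
    (H : ∀ z ∈ S, ‖(b xh - b x).comp V.subtypeL‖ ≤ ‖(b z - b x).comp V.subtypeL‖) :
    ‖b (x - xh)‖ ≤ ‖P‖ * ‖b (x - z)‖ := by
  have hsub : ∀ x x', b (x - x') = b x - b x' := fun x x' => by
    rw [show x - x' = (-1 : ℝ) • x' + x by module, hb]
    module
  have hd : xh - z ∈ S := by
    rw [show xh - z = (-1 : ℝ) • z + xh by module]
    exact hS _ _ _ hz hxh
  have e1 : b (x - z) = b (xh - z) + b (x - xh) := by
    rw [hsub, hsub, hsub]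
    abel
  rw [e1]
  refine norm_le_of_minimal_of_fortin hV hP (hr _ hd) fun c => ?_
  -- The competitor `xh - c (xh - z)` has the residual `-(c r + e)`, so minimality over the whole
  -- trial space is used only along this line.
  have h1 := H _ (hS (-c) _ _ hd hxh)
  have e2 : b (x - xh) = -(b xh - b x) := by
    rw [hsub]
    abel
  have e3 : c • b (xh - z) + b (x - xh) = -(b (-c • (xh - z) + xh) - b x) := by
    rw [hb, hsub x]
    module
  rw [e3, e2, ContinuousLinearMap.neg_comp, ContinuousLinearMap.neg_comp, 
    ContinuousLinearMap.opNorm_neg, ContinuousLinearMap.opNorm_neg]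
  exact h1

/-! ### Vanishing of the form on test functions with zero means, and the constant initial value -/

variable {d : ℕ} {T : ℝ} {Ω : Set (Sp d)} {𝒯 : Finset (Cell d)}

theorem bform_apply (x : XAmb T Ω 𝒯) (y : Y T Ω 𝒯) :
    bform T Ω 𝒯 x y = ⟪x.fst, HA.astar T Ω 𝒯 y.fst⟫ + x.snd y := rfl

theorem traceFunctional_apply (v f : L2Q T Ω) (g : L2Om Ω) (y : Y T Ω 𝒯) :
    traceFunctional T Ω 𝒯 v f g y =
      ⟪f, HA.field T Ω 𝒯 y.fst⟫ - ⟪v, HA.astar T Ω 𝒯 y.fst⟫ + ⟪g, y.snd⟫ := rfl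

namespace IsMesh

variable (h : IsMesh T Ω 𝒯) (hT : 0 < T) (hΩ : IsLipschitzDomain Ω)

theorem GamH1_apply_eq_zero {y : Y T Ω 𝒯} (hu : h.HasZeroMeans hT hΩ y.fst)
    (hη : ∀ K ∈ 𝒯, K.a = 0 → ∀ θ ∈ polySpace d 1, ∫ x in K.space, θ x * y.snd x = 0)
    {t : StrongDual ℝ (Y T Ω 𝒯)} (ht : t ∈ GamH1 T Ω 𝒯) : t y = 0 := by
  obtain ⟨v, f, g, h1, h2, h3, h4, rfl⟩ := ht
  rw [traceFunctional_apply, h.inner_trace_eq_zero_of_isPwTensor hT hΩ hu h1 h3 h4,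
    h.inner_initialTrace_eq_zero hT hΩ h2 h4 hη, add_zero]

theorem GamDiv_apply_eq_zero (hd : 1 ≤ d) {y : Y T Ω 𝒯} (hu : h.HasZeroMeans hT hΩ y.fst)
    {t : StrongDual ℝ (Y T Ω 𝒯)} (ht : t ∈ GamDiv T Ω 𝒯) : t y = 0 := by
  obtain ⟨v, f, g, h1, h2, h3, h4, rfl⟩ := ht
  rw [traceFunctional_apply, h.inner_trace_eq_zero_of_hasConstNormalTraces hT hΩ hd hu h1 h3 h4,
    h2.inner_eq_zero_of_fst_eq_zero hT h3 y.snd, add_zero]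

theorem bform_eq_zero (hd : 1 ≤ d) {y : Y T Ω 𝒯} (hu : h.HasZeroMeans hT hΩ y.fst)
    (hη : ∀ K ∈ 𝒯, K.a = 0 → ∀ θ ∈ polySpace d 1, ∫ x in K.space, θ x * y.snd x = 0)
    {x : XAmb T Ω 𝒯} (hx : x ∈ Xh T Ω 𝒯) : bform T Ω 𝒯 x y = 0 := by
  obtain ⟨h0, t, ht, s, hs, e⟩ := hx
  have e1 : x.snd y = 0 := by
    rw [e]
    exact (congrArg₂ (· + ·) (h.GamH1_apply_eq_zero hT hΩ hu hη ht)
      (h.GamDiv_apply_eq_zero hT hΩ hd hu hs)).trans (add_zero 0)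
  rw [bform_apply, e1, add_zero]
  exact h.inner_X0h_astar_eq_zero hT hΩ hu h0

/-- The constant initial value. -/
def oneL2 (hΩ : IsLipschitzDomain Ω) : L2Om Ω :=
  indicatorConstLp 2 (μ := volume.restrict Ω) MeasurableSet.univ
    (by rw [Measure.restrict_apply_univ]; exact hΩ.isBounded.measure_lt_top.ne) 1

theorem oneL2_ae (hΩ : IsLipschitzDomain Ω) : ∀ᵐ x ∂volume.restrict Ω, oneL2 hΩ x = 1 := by
  filter_upwards [indicatorConstLp_coeFn (p := 2) (μ := volume.restrict Ω) (hs := MeasurableSet.univ)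
    (hμs := by rw [Measure.restrict_apply_univ]; exact hΩ.isBounded.measure_lt_top.ne)
    (c := (1 : ℝ))] with x hx
  rw [oneL2, hx, indicator_of_mem (mem_univ x)]

theorem inner_oneL2 (hΩ : IsLipschitzDomain Ω) (η : L2Om Ω) : ⟪oneL2 hΩ, η⟫ = ∫ x in Ω, η x := by
  rw [L2.inner_def]
  refine integral_congr_ae ?_
  filter_upwards [oneL2_ae hΩ] with x hx
  rw [hx]
  simp

theorem oneL2_ne_zero (hΩ : IsLipschitzDomain Ω) : oneL2 hΩ ≠ 0 := by
  intro h0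
  have h1 := inner_oneL2 hΩ (oneL2 hΩ)
  rw [integral_congr_ae (oneL2_ae hΩ), h0, inner_zero_left, setIntegral_const, smul_eq_mul,
    mul_one] at h1
  have h2 : 0 < volume.real Ω := ENNReal.toReal_pos
    (hΩ.isOpen.measure_pos volume hΩ.isConnected.nonempty).ne' hΩ.isBounded.measure_lt_top.ne
  exact h2.ne h1

theorem inner_oneL2_eq_zero (h : IsMesh T Ω 𝒯) (hT : 0 < T) (hΩ : IsLipschitzDomain Ω) {η : L2Om Ω}
    (hη : ∀ K ∈ 𝒯, K.a = 0 → ∀ θ ∈ polySpace d 1, ∫ x in K.space, θ x * η x = 0) :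
    ⟪oneL2 hΩ, η⟫ = (0 : ℝ) := by
  have hf : IsFiniteMeasure (volume.restrict Ω) :=
    ⟨by rw [Measure.restrict_apply_univ]; exact hΩ.isBounded.measure_lt_top⟩
  rw [inner_oneL2, h.integral_initial hT hΩ ((Lp.memLp η).integrable (by norm_num))]
  refine Finset.sum_eq_zero fun K hK => ?_
  obtain ⟨hK, h0⟩ := mem_initialCells.1 hK
  rw [setIntegral_congr_set K.interior_space_ae_eq,
    ← hη K hK h0 (fun _ => 1) ⟨1, by simp, by ext; simp⟩]
  simp

end IsMesh

end HeatDPG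

end

noncomputable section

namespace HeatDPG

variable {d : ℕ} {T : ℝ} {Ω : Set (Sp d)} {𝒯 : Finset (Cell d)}

/-! ### The Fortin operator on the full test space -/

namespace IsMesh

variable (h : IsMesh T Ω 𝒯) (hT : 0 < T) (hΩ : IsLipschitzDomain Ω) (C : Correction d)

/-- The Fortin operator on `Y` as a linear map. -/
def fortinY : Y T Ω 𝒯 →ₗ[ℝ] Y T Ω 𝒯 := prodMapL2 (h.fortin hT hΩ C) (h.initialProj hT hΩ)

theorem fortinY_toLp (w : HA T Ω 𝒯) (ξ : L2Om Ω) : h.fortinY hT hΩ C (WithLp.toLp 2 (w, ξ)) =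
    WithLp.toLp 2 (h.fortin hT hΩ C w, h.initialProj hT hΩ ξ) := rfl

theorem fortinY_mem (y : Y T Ω 𝒯) : h.fortinY hT hΩ C y ∈ Yh T Ω 𝒯 :=
  ⟨(h.isPwTensor_fortin hT hΩ C y.fst).1, (h.isPwTensor_fortin hT hΩ C y.fst).2,
    h.isPwPoly0_initialProj hT hΩ y.snd⟩

theorem sub_fortinY_fst (y : Y T Ω 𝒯) :
    (y - h.fortinY hT hΩ C y).fst = y.fst - h.fortin hT hΩ C y.fst := rfl

theorem sub_fortinY_snd (y : Y T Ω 𝒯) :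
    (y - h.fortinY hT hΩ C y).snd = y.snd - h.initialProj hT hΩ y.snd := rfl

theorem bform_sub_fortinY (hd : 1 ≤ d) {x : XAmb T Ω 𝒯} (hx : x ∈ Xh T Ω 𝒯) (y : Y T Ω 𝒯) :
    bform T Ω 𝒯 x (y - h.fortinY hT hΩ C y) = 0 := by
  refine h.bform_eq_zero hT hΩ hd ?_ ?_ hx
  · rw [sub_fortinY_fst]
    exact h.hasZeroMeans_sub_fortin hT hΩ hd C y.fst
  · rw [sub_fortinY_snd]
    exact fun K hK h0 θ hθ => h.integral_mul_sub_initialProj hT hΩ hd hK h0 y.snd hθ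

theorem norm_fortinY_le {B : ℝ} (hB : 0 ≤ B)
    (H : ∀ w, ‖h.fortin hT hΩ C w‖ ≤ B * meshFactor 𝒯 * ‖w‖) (y : Y T Ω 𝒯) :
    ‖h.fortinY hT hΩ C y‖ ≤ (B + (d + 1) * ((d + 1) * (d + 3))) * meshFactor 𝒯 * ‖y‖ := by
  have h1 := h.one_le_meshFactor hT hΩ
  have h2 : (0 : ℝ) ≤ (d + 1) * ((d + 1) * (d + 3)) := by positivity
  have h3 : 0 ≤ meshFactor 𝒯 := zero_le_one.trans h1
  refine norm_prodMapL2_le (by positivity) (fun w => (H w).trans ?_)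
    (fun ξ => (h.norm_initialProj_le hT hΩ ξ).trans ?_) y
  · refine mul_le_mul_of_nonneg_right ?_ (norm_nonneg _)
    exact mul_le_mul_of_nonneg_right (by linarith) h3
  · refine mul_le_mul_of_nonneg_right ?_ (norm_nonneg _)
    nlinarith

/-- The functional of integration of the initial value. -/
def initialMass (hΩ : IsLipschitzDomain Ω) : StrongDual ℝ (Y T Ω 𝒯) :=
  (innerSL ℝ (oneL2 hΩ)).comp (Y.init T Ω 𝒯)

theorem initialMass_ne_zero (hΩ : IsLipschitzDomain Ω) : initialMass (T := T) (𝒯 := 𝒯) hΩ ≠ 0 := by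
  intro h0
  have h1 : initialMass (T := T) (𝒯 := 𝒯) hΩ (WithLp.toLp 2 (0, oneL2 hΩ)) = 0 := by rw [h0]; rfl
  have h2 : ⟪oneL2 hΩ, oneL2 hΩ⟫ = (0 : ℝ) := h1
  exact oneL2_ne_zero hΩ (inner_self_eq_zero.1 h2)

/-- Constants are affine, so the initial projection preserves the integral over `Ω`; this is a
nonzero functional that does not distinguish `y` from its image. -/
theorem one_le_norm {P : Y T Ω 𝒯 →L[ℝ] Y T Ω 𝒯} (hP : ∀ y, P y = h.fortinY hT hΩ C y)
    (hd : 1 ≤ d) : 1 ≤ ‖P‖ := by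
  refine one_le_norm_of_fortin (initialMass_ne_zero hΩ) fun y => ?_
  rw [hP]
  exact h.inner_oneL2_eq_zero hT hΩ (η := y.snd - h.initialProj hT hΩ y.snd)
    fun K hK h0 θ hθ => h.integral_mul_sub_initialProj hT hΩ hd hK h0 y.snd hθ

set_option maxHeartbeats 2000000 in
theorem norm_bform_sub_le {P : Y T Ω 𝒯 →L[ℝ] Y T Ω 𝒯} (hP : ∀ y, P y = h.fortinY hT hΩ C y)
    (hd : 1 ≤ d) {F : StrongDual ℝ (Y T Ω 𝒯)} {x : XAmb T Ω 𝒯}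
    (hx : ∀ y, bform T Ω 𝒯 x y = F y) {xh : XAmb T Ω 𝒯} (hxh : IsPracticalDPG T Ω 𝒯 F xh)
    {z : XAmb T Ω 𝒯} (hz : z ∈ Xh T Ω 𝒯) :
    ‖bform T Ω 𝒯 (x - xh)‖ ≤ ‖P‖ * ‖bform T Ω 𝒯 (x - z)‖ := by
  obtain rfl : bform T Ω 𝒯 x = F := ContinuousLinearMap.ext hx
  have hV : ∀ y, P y ∈ Yh T Ω 𝒯 := fun y => by
    rw [hP]
    exact h.fortinY_mem hT hΩ C y
  have hr : ∀ x ∈ Xh T Ω 𝒯, ∀ y, bform T Ω 𝒯 x (y - P y) = 0 := fun x hx y => by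
    rw [hP]
    exact h.bform_sub_fortinY hT hΩ C hd hx y
  have hS : ∀ (c : ℝ) x x', x ∈ Xh T Ω 𝒯 → x' ∈ Xh T Ω 𝒯 → c • x + x' ∈ Xh T Ω 𝒯 :=
    fun c x x' h1 h2 => Xh_comb h hT hΩ c h1 h2
  exact norm_sub_le_of_minimal_of_fortin (E := Y T Ω 𝒯) (W := XAmb T Ω 𝒯) (bform T Ω 𝒯) bform_comb
    (S := Xh T Ω 𝒯) hS (P := P) (V := Yh T Ω 𝒯) hV (h.one_le_norm hT hΩ C hP hd) hr hxh.1 hz hxh.2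

end IsMesh

theorem sub_eq_neg_one_smul_add {M : Type*} [AddCommGroup M] [Module ℝ M] (x y : M) :
    x - y = (-1 : ℝ) • y + x := by module

theorem sub_mem_X (hΩ : IsLipschitzDomain Ω) {x x' : XAmb T Ω 𝒯} (hx : x ∈ X T Ω 𝒯)
    (hx' : x' ∈ X T Ω 𝒯) : x - x' ∈ X T Ω 𝒯 := by
  rw [sub_eq_neg_one_smul_add]
  exact X_comb hΩ (-1) hx' hx

theorem infSupConst_mul_norm_sub_le (hΩ : IsLipschitzDomain Ω) {x xh z : XAmb T Ω 𝒯}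
    (hx : x ∈ X T Ω 𝒯) (hxh : xh ∈ X T Ω 𝒯) (hz : z ∈ X T Ω 𝒯) {p : ℝ} (hp : 0 ≤ p)
    (H : ‖bform T Ω 𝒯 (x - xh)‖ ≤ p * ‖bform T Ω 𝒯 (x - z)‖) :
    infSupConst T Ω 𝒯 * ‖x - xh‖ ≤ contConst T Ω 𝒯 * p * ‖x - z‖ := by
  have h1 := infSupConst_mul_norm_le (sub_mem_X hΩ hx hxh)
  have h2 := norm_bform_le_contConst (sub_mem_X hΩ hx hz)
  refine (h1.trans H).trans ((mul_le_mul_of_nonneg_left h2 hp).trans_eq ?_)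
  ring

end HeatDPG

end

set_option maxHeartbeats 4000000 in
open HeatDPG in
theorem mainTheorem2 (d : ℕ) (hd : 1 ≤ d) (T : ℝ) (hT : 0 < T) (Ω : Set (Sp d))
    (hΩ : IsLipschitzDomain Ω) (γ : ℝ) :
    ∃ C : ℝ, ∀ 𝒯 : Finset (Cell d), IsMesh T Ω 𝒯 → ShapeRegular γ 𝒯 →
      ∃ (P : Y T Ω 𝒯 →L[ℝ] Y T Ω 𝒯) (P₀ : HA T Ω 𝒯 →ₗ[ℝ] HA T Ω 𝒯)
        (P₁ : L2Om Ω →ₗ[ℝ] L2Om Ω),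
        (∀ y, P y ∈ Yh T Ω 𝒯) ∧
        (∀ x ∈ Xh T Ω 𝒯, ∀ y, bform T Ω 𝒯 x (y - P y) = 0) ∧
        ‖P‖ ≤ C * meshFactor 𝒯 ∧
        (∀ w ξ, P (WithLp.toLp 2 (w, ξ)) = WithLp.toLp 2 (P₀ w, P₁ ξ)) ∧
        (∀ w, ∀ K ∈ 𝒯, ∀ v₀ : Val d,
          ∫ z in K.carrier, ⟪v₀, HA.field T Ω 𝒯 (w - P₀ w) z⟫ = 0) ∧
        (∀ ξ, ∀ K ∈ 𝒯, K.a = 0 → ∀ θ ∈ polySpace d 1,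
          ∫ x in K.space, θ x * (ξ - P₁ ξ : L2Om Ω) x = 0) ∧
        (∀ w, ∀ K ∈ 𝒯,
          (∀ᵐ z ∂volume.restrict (cyl T Ω), z ∈ K.carrier → HA.field T Ω 𝒯 w z = 0) →
          ∀ᵐ z ∂volume.restrict (cyl T Ω), z ∈ K.carrier → HA.field T Ω 𝒯 (P₀ w) z = 0) ∧
        (∀ ξ, ∀ K ∈ 𝒯, K.a = 0 →
          (∀ᵐ x ∂volume.restrict Ω, x ∈ K.space → ξ x = 0) →
          ∀ᵐ x ∂volume.restrict Ω, x ∈ K.space → P₁ ξ x = 0) ∧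
        (∀ F : StrongDual ℝ (Y T Ω 𝒯), ∀ x ∈ X T Ω 𝒯, (∀ y, bform T Ω 𝒯 x y = F y) →
          ∀ xh, IsPracticalDPG T Ω 𝒯 F xh → ∀ z ∈ Xh T Ω 𝒯,
            ‖bform T Ω 𝒯 (x - xh)‖ ≤ ‖P‖ * ‖bform T Ω 𝒯 (x - z)‖ ∧
            infSupConst T Ω 𝒯 * ‖x - xh‖ ≤ contConst T Ω 𝒯 * ‖P‖ * ‖x - z‖) := by
  obtain ⟨C⟩ := exists_correction hd
  obtain ⟨B, hB, HB⟩ := exists_fortin_bound hd hT hΩ C γ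
  -- The number `B` is fixed before the mesh is chosen, and the second summand bounds the initial
  -- projection. The correction coefficients behind `B` depend on `d` only.
  refine ⟨B + (d + 1) * ((d + 1) * (d + 3)), fun 𝒯 h hs => ?_⟩
  have hbound := h.norm_fortinY_le hT hΩ C hB (HB 𝒯 h hs)
  obtain ⟨P, hP, hn⟩ : ∃ P : Y T Ω 𝒯 →L[ℝ] Y T Ω 𝒯, (∀ y, P y = h.fortinY hT hΩ C y) ∧
      ‖P‖ ≤ (B + (d + 1) * ((d + 1) * (d + 3))) * meshFactor 𝒯 := by
    have h1 := h.one_le_meshFactor hT hΩ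
    exact ⟨(h.fortinY hT hΩ C).mkContinuous _ hbound, fun y => rfl,
      LinearMap.mkContinuous_norm_le _ (by positivity) _⟩
  refine ⟨P, h.fortin hT hΩ C, h.initialProj hT hΩ, fun y => ?_, fun x hx y => ?_, hn,
    fun w ξ => ?_, fun w K hK v => h.integral_inner_field_sub_fortin hT hΩ C hd hK w v,
    fun ξ K hK h0 θ hθ => h.integral_mul_sub_initialProj hT hΩ hd hK h0 ξ hθ,
    fun w K hK hw => h.field_fortin_eq_zero hT hΩ C hK w hw,
    fun ξ K hK h0 hξ => h.initialProj_eq_zero hT hΩ hK h0 ξ hξ,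
    fun F x hx hF xh hxh z hz => ?_⟩
  · rw [hP]
    exact h.fortinY_mem hT hΩ C y
  · rw [hP]
    exact h.bform_sub_fortinY hT hΩ C hd hx y
  · rw [hP]
    exact h.fortinY_toLp hT hΩ C w ξ
  · have h1 := h.norm_bform_sub_le hT hΩ C hP hd hF hxh hz
    exact ⟨h1, infSupConst_mul_norm_sub_le hΩ hx (Xh_subset_X hΩ hxh.1) (Xh_subset_X hΩ hz)
      (ContinuousLinearMap.opNorm_nonneg P) h1⟩
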